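/- Let $k$ be a field of characteristic different from $2$ that contains a primitive 7th root of unity $\zeta_7$. Let $a,b,c\in k(x)$, let $s\in k[x]$ be a polynomial of degree 6 with distinct roots (in an algebraic closure of $k$), and let $\lambda\in k$ be such that $\lambda$ has a 7th root in $k$ and $$a^2-b^2s=\lambda c^7 .$$ Let $C$ be the genus 2 curve $y^2=s(x)$ with function field $k(C)=k(x,y)$, put $\varphi=a+by$ and $\varphi'=a-by$ in $k(C)$, and let $w$ be any root of $Z^7-\varphi$. 1. If $\varphi$ is not a 7th power in $k(C)$, then $k(x,y,w)/k(x)$ is a Galois extension whose group is the dihedral group $D_7$ of order 14. 2. If $\varphi\neq 0$ and the divisors $\mathrm{div}(\varphi)$ and $\mathrm{div}(\varphi')$ on $C$ are relatively prime (have disjoint supports), then $k(x,y,w)/k(x,y)$ is unramified. If moreover $\varphi$ is not a 7th power in $k(C)$, then the projective nonsingular model $X$ of $k(x,y,w)$ is a geometrically integral curve with the following properties, which also hold after every extension of the base field $k$ (the statements on fixed points are meant for points over an algebraically closed field containing $k$): (i) $X$ has genus 8. (ii) Every element $\rho\in D_7$ of order 7 acts on $X$ without fixed points; $X/\langle\rho\rangle=C$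 has genus 2, and $X\to C$ is unramified. (iii) Every involution $\tau\in D_7$ has exactly 6 fixed points on $X$, one above each of the six roots of $s(x)=0$. The quotient $Y=X/\langle\tau\rangle$ has genus 3, and the quotients for different involutions are isomorphic. (iv) Let $Y=X/\langle\tau\rangle$ with quotient map $h:X\to Y$, and let $\rho\in D_7$ have order 7. The correspondence of $Y$ given by $X\to Y\times Y$, $P\mapsto (h(P),h(\rho P))$, induces an endomorphism $T$ of $\mathrm{Jac}(Y)$ with $T^3+T^2-2T-1=0$, the equation of $\zeta_7+\zeta_7^{-1}$. -/

import Mathlib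

open scoped TensorProduct

noncomputable section

/-! Algebraic function fields of one variable, treated as projective nonsingular curves: the closed
points of the nonsingular projective model of `F / k` are the discrete valuation rings of `F`
that contain `k`. -/

/-- A place of `F / k`, i.e. a closed point of the nonsingular projective model of `F / k`:
a discrete valuation ring of the field `F` containing `k`. -/
structure Place (k F : Type*) [Field k] [Field F] [Algebra k F] where
  /-- the local ring of the point -/
  ring : ValuationSubring F
  algebraMap_mem : ∀ c : k, algebraMap k F c ∈ ring
  isDVR : IsDiscreteValuationRing ring

namespace Place

variable {k E F : Type*} [Field k] [Field E] [Field F] [Algebra k E] [Algebra k F]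

instance (P : Place k F) : IsDiscreteValuationRing P.ring := P.isDVR

instance (P : Place k F) : Algebra k P.ring :=
  ((algebraMap k F).codRestrict P.ring P.algebraMap_mem).toAlgebra

/-- The residue field of a place. -/
abbrev Residue (P : Place k F) : Type _ := IsLocalRing.ResidueField P.ring

/-- The degree of a place over the base field. -/
def deg (P : Place k F) : ℕ := Module.finrank k P.Residue

/-- The order of vanishing of `f` at `P` (negative at a pole), with the convention `ord 0 = 0`. -/
def ord (P : Place k F) (f : F) : ℤ :=
  -WithZero.log ((IsDiscreteValuationRing.maximalIdeal P.ring).valuation F f)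

theorem ord_mul (P : Place k F) {f g : F} (hf : f ≠ 0) (hg : g ≠ 0) :
    P.ord (f * g) = P.ord f + P.ord g := by
  have h1 : (IsDiscreteValuationRing.maximalIdeal P.ring).valuation F f ≠ 0 := by simpa using hf
  have h2 : (IsDiscreteValuationRing.maximalIdeal P.ring).valuation F g ≠ 0 := by simpa using hg
  simp only [ord, map_mul, WithZero.log_mul h1 h2]
  ring

theorem ord_one (P : Place k F) : P.ord 1 = 0 := by simp [ord]

theorem ord_inv (P : Place k F) (f : F) : P.ord f⁻¹ = -P.ord f := by
  simp [ord, WithZero.log_inv]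

theorem exists_ord_eq_one (P : Place k F) : ∃ f : F, P.ord f = 1 := by
  obtain ⟨f, hf⟩ := (IsDiscreteValuationRing.maximalIdeal P.ring).valuation_exists_uniformizer F
  exact ⟨f, by simp [ord, hf]⟩

/-- A uniformizer at `P`. -/
def uniformizer (P : Place k F) : F := P.exists_ord_eq_one.choose

/-- `Q` lies over `P` with respect to the embedding `i` of function fields: the covering of curves
given by `i` maps the point `Q` to the point `P`. -/
def LiesOver (i : E →ₐ[k] F) (Q : Place k F) (P : Place k E) : Prop :=
  Q.ring.comap (i : E →+* F) = P.ring

theorem LiesOver.mem_iff {i : E →ₐ[k] F} {Q : Place k F} {P : Place k E} (h : Q.LiesOver i P)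
    (f : E) : i f ∈ Q.ring ↔ f ∈ P.ring := by
  rw [← h]; rfl

/-- The map of local rings at `Q` over `P`. -/
def LiesOver.ringHom {i : E →ₐ[k] F} {Q : Place k F} {P : Place k E} (h : Q.LiesOver i P) :
    P.ring →+* Q.ring :=
  ((i : E →+* F).comp P.ring.subtype).codRestrict Q.ring fun f => (h.mem_iff f).2 f.2

instance LiesOver.isLocalHom {i : E →ₐ[k] F} {Q : Place k F} {P : Place k E}
    (h : Q.LiesOver i P) : IsLocalHom h.ringHom := by
  constructor
  intro f hf
  have hf0 : (f : E) ≠ 0 := by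
    rintro h0
    have : f = 0 := Subtype.ext h0
    rw [this, map_zero] at hf
    exact not_isUnit_zero hf
  obtain ⟨g, hg⟩ := hf.exists_right_inv
  have hg' : i f * (g : F) = 1 := congrArg Subtype.val hg
  have hinv : i ((f : E)⁻¹) = (g : F) := by
    rw [map_inv₀]; exact inv_eq_of_mul_eq_one_right hg'
  have hm : (f : E)⁻¹ ∈ P.ring := (h.mem_iff _).1 (by rw [hinv]; exact g.2)
  exact IsUnit.of_mul_eq_one ⟨(f : E)⁻¹, hm⟩ (Subtype.ext (mul_inv_cancel₀ hf0))

/-- The extension of residue fields at `Q` over `P`. -/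
def LiesOver.residueMap {i : E →ₐ[k] F} {Q : Place k F} {P : Place k E} (h : Q.LiesOver i P) :
    P.Residue →+* Q.Residue :=
  IsLocalRing.ResidueField.map h.ringHom

open Classical in
/-- The ramification index `e(Q/P)` (and `0` if `Q` does not lie over `P`). -/
def ramificationIdx (i : E →ₐ[k] F) (Q : Place k F) (P : Place k E) : ℕ :=
  if Q.LiesOver i P then (Q.ord (i P.uniformizer)).toNat else 0

open Classical in
/-- The residue degree `f(Q/P)` (and `0` if `Q` does not lie over `P`). -/
def inertiaDeg (i : E →ₐ[k] F) (Q : Place k F) (P : Place k E) : ℕ :=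
  if h : Q.LiesOver i P then
    letI := h.residueMap.toAlgebra
    Module.finrank P.Residue Q.Residue
  else 0

end Place

/-- The extension of function fields `i : E → F` (i.e. the corresponding covering of curves) is
unramified: at each point the ramification index is `1` and the residue field extension is
separable. -/
def IsUnramifiedExt {k E F : Type*} [Field k] [Field E] [Field F] [Algebra k E] [Algebra k F]
    (i : E →ₐ[k] F) : Prop :=
  ∀ (Q : Place k F) (P : Place k E) (h : Q.LiesOver i P),
    Q.ramificationIdx i P = 1 ∧
      (letI := h.residueMap.toAlgebra
       Algebra.IsSeparable P.Residue Q.Residue)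

section Genus

variable (k F : Type*) [Field k] [Field F] [Algebra k F]

/-- Repartitions (adeles) of `F / k`: families of elements of `F` indexed by the places, that are
regular at all but finitely many places. -/
def repartitions : Submodule k (Place k F → F) where
  carrier := {r | {P : Place k F | r P ∉ P.ring}.Finite}
  zero_mem' := by simp [ZeroMemClass.zero_mem]
  add_mem' := by
    intro r r' hr hr'
    refine (hr.union hr').subset fun P hP => ?_
    by_contra hc
    simp only [Set.mem_union, Set.mem_ofPred_eq, not_or, not_not] at hc
    exact hP (P.ring.add_mem _ _ hc.1 hc.2)
  smul_mem' := by
    intro c r hr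
    refine hr.subset fun P hP hc => hP ?_
    rw [Pi.smul_apply, Algebra.smul_def]
    exact P.ring.mul_mem _ _ (P.algebraMap_mem c) hc

/-- Families that are regular at every place. -/
def regularRepartitions : Submodule k (Place k F → F) where
  carrier := {r | ∀ P : Place k F, r P ∈ P.ring}
  zero_mem' := fun P => P.ring.zero_mem
  add_mem' := fun hr hr' P => P.ring.add_mem _ _ (hr P) (hr' P)
  smul_mem' := by
    intro c r hr P
    rw [Pi.smul_apply, Algebra.smul_def]
    exact P.ring.mul_mem _ _ (P.algebraMap_mem c) (hr P)

/-- The constant (diagonal) families. -/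
def diagonalRepartitions : Submodule k (Place k F → F) :=
  LinearMap.range (LinearMap.pi fun _ : Place k F => (LinearMap.id : F →ₗ[k] F))

/-- The genus of the nonsingular projective model of `F / k`: the dimension over `k` of
`H¹(𝒪) = A / (A(0) + F)`, where `A` is the space of repartitions. -/
def curveGenus : ℕ :=
  Module.finrank k (repartitions k F ⧸
    (regularRepartitions k F ⊔ diagonalRepartitions k F).comap (repartitions k F).subtype)

end Genus

section Divisors

variable (k F : Type*) [Field k] [Field F] [Algebra k F]

/-- Divisors on the curve with function field `F / k`. -/
abbrev CurveDivisor : Type _ := Place k F →₀ ℤ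

/-- The degree of a divisor. -/
def CurveDivisor.degree : CurveDivisor k F →+ ℤ :=
  Finsupp.liftAddHom fun P => zmultiplesHom ℤ (P.deg : ℤ)

/-- The group of principal divisors. -/
def principalDivisors : AddSubgroup (CurveDivisor k F) where
  carrier := {D | ∃ f : F, f ≠ 0 ∧ ∀ P : Place k F, D P = P.ord f}
  zero_mem' := ⟨1, one_ne_zero, fun P => by simp [Place.ord_one]⟩
  add_mem' := by
    rintro D D' ⟨f, hf, hD⟩ ⟨g, hg, hD'⟩
    exact ⟨f * g, mul_ne_zero hf hg, fun P => by
      rw [Finsupp.add_apply, hD, hD', P.ord_mul hf hg]⟩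
  neg_mem' := by
    rintro D ⟨f, hf, hD⟩
    exact ⟨f⁻¹, inv_ne_zero hf, fun P => by rw [Finsupp.neg_apply, hD, P.ord_inv]⟩

/-- The divisor class group. -/
abbrev CurvePic : Type _ := CurveDivisor k F ⧸ principalDivisors k F

/-- The group of divisor classes of degree zero. For `k` algebraically closed this is the group
of points of the Jacobian of the curve. -/
def CurvePicZero : AddSubgroup (CurvePic k F) :=
  (CurveDivisor.degree k F).ker.map (QuotientAddGroup.mk' (principalDivisors k F))

variable {k F} {E : Type*} [Field E] [Algebra k E]

/-- The pull-back of divisors along the covering of curves given by `i`: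
`P ↦ ∑_{Q | P} e(Q/P) Q`. -/
def divisorPullback (i : E →ₐ[k] F) : CurveDivisor k E →+ CurveDivisor k F :=
  Finsupp.liftAddHom fun P =>
    zmultiplesHom (CurveDivisor k F)
      (∑ᶠ Q : Place k F, Finsupp.single Q (Q.ramificationIdx i P : ℤ))

/-- The push-forward of divisors along the covering of curves given by `i`:
`Q ↦ f(Q/P) P`, where `P` is the place below `Q`. -/
def divisorPushforward (i : E →ₐ[k] F) : CurveDivisor k F →+ CurveDivisor k E :=
  Finsupp.liftAddHom fun Q =>
    zmultiplesHom (CurveDivisor k E)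
      (∑ᶠ P : Place k E, Finsupp.single P (Q.inertiaDeg i P : ℤ))

/-- Two coverings `X → Y`, given by embeddings `i`, `j` of the function field `E` of `Y` into the
function field `F` of `X`, define a correspondence `X → Y × Y` of `Y`; this is its action
`j_* ∘ i^*` on divisors. -/
def divisorCorrespondence (i j : E →ₐ[k] F) : CurveDivisor k E →+ CurveDivisor k E :=
  (divisorPushforward j).comp (divisorPullback i)

/-- `T` is the endomorphism of the group of divisor classes of degree zero that is induced by the
correspondence given by `i` and `j`. -/
def IsInducedByCorrespondence (i j : E →ₐ[k] F) (T : AddMonoid.End (CurvePicZero k E)) : Prop :=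
  ∀ (D : CurveDivisor k E) (C : CurvePicZero k E), CurveDivisor.degree k E D = 0 →
    (C : CurvePic k E) = QuotientAddGroup.mk' (principalDivisors k E) D →
    ((T C : CurvePicZero k E) : CurvePic k E) =
      QuotientAddGroup.mk' (principalDivisors k E) (divisorCorrespondence i j D)

end Divisors

section Automorphisms

variable {k F : Type*} [Field k] [Field F] [Algebra k F]

/-- The point `Q` is fixed by the automorphism of the curve given by `σ`. -/
def Place.IsFixedBy (σ : F ≃ₐ[k] F) (Q : Place k F) : Prop :=
  Q.ring.comap (σ : F →+* F) = Q.ring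

/-- The function field of the quotient of the curve by the cyclic group generated by `σ`. -/
abbrev quotientField (σ : F ≃ₐ[k] F) : IntermediateField k F :=
  IntermediateField.fixedField (Subgroup.zpowers σ)

end Automorphisms

section BaseChange

variable {k F : Type*} [Field k] [Field F] [Algebra k F]
  (k₁ F₁ : Type*) [Field k₁] [Algebra k k₁] [Field F₁] [Algebra k₁ F₁]
  [Algebra (k₁ ⊗[k] F) F₁] [IsScalarTower k₁ (k₁ ⊗[k] F) F₁] [IsFractionRing (k₁ ⊗[k] F) F₁]

/-- The automorphism induced by `σ` on the function field `F₁ = Frac (k₁ ⊗ F)` of the curve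
obtained by extending the base field from `k` to `k₁`. -/
def baseChangeAut (σ : F ≃ₐ[k] F) : F₁ ≃ₐ[k₁] F₁ :=
  IsFractionRing.algEquivOfAlgEquiv
    (Algebra.TensorProduct.congr (AlgEquiv.refl : k₁ ≃ₐ[k₁] k₁) σ)

end BaseChange

end

/-!
The curves are treated through their function fields `k(x) ⊆ K = k(C) ⊆ L = k(X)`, and all points
are places.

*Genus.* The places of such a field are covered by two "affine" sets, the finite places and the
places at infinity. By strong approximation the genus of a function field is its dimension modulo the
functions regular on the first set plus the functions regular on the second (`Place.curveGenus_eq_finrank`).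
The same recipe gives `h⁰` and `h¹` of a divisor, and adding a point changes `h⁰ - h¹` by its degree
(`Place.isFredholmPair_divisor`). This is computed directly for the projective line and then for
`C`, since `K = k(x) ⊕ k(x) y` compatibly with regularity (`IsSextic.isFredholmPair`). If `div φ` is
prime to the divisor of its conjugate, the equation `φ φ' = n ^ 7` makes `div φ = 7 D` with `D` of
degree `0`. As `char k ≠ 7`, regularity of `∑ fᵢ wⁱ` can be tested on the eigenvectors `fᵢ wⁱ` of
`ρ`, and `fᵢ wⁱ` is regular iff `fᵢ` is a section of `i D` (`IsHeptic.forall_mem_iff`). For `i ≠ 0`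
a nonzero global section of `i D` would make `φ` a seventh power (the constant that comes up is a
seventh power because its square is a norm), so `h⁰ = 0` and `h¹ = 1`
(`IsRadicand.finrank_quotient`); hence `X` has genus `2 + 6 · 1 = 8`. An involution `τ`
interchanges the eigenspaces of `i` and `7 - i`, and the fixed field is `k(x) ⊕ K³`; hence `Y` has
genus `0 + 3 · 1 = 3` (`IsHeptic.curveGenus_fixed_eq`).

*Ramification and fixed points.* At each place, `w` times a function on `C` is a unit, and an
element of order `7` multiplies it by a nontrivial root of unity. So it cannot act trivially on the
residue field, and `X → C` is unramified. A fixed point of `τ` lies above a zero of `y`, because a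
regular function that `τ` changes by a sign vanishes at the fixed points of `τ`. Conversely the
stabilizer of a point above a root of `s` has order `e f`, where `e` is even, so the point is fixed
by some involution, and the seven involutions are conjugate
(`IsDihedralData.existsUnique_fixed`).

*The correspondence.* On divisors, pulling back a push-forward along a Galois covering is the sum of
the conjugates (`divisorPullback_divisorPushforward`). A computation in the group ring of `D₇` then
identifies `T ^ 3 + T ^ 2 - 2 T - 1` with the pull-back of the push-forward along
`Y → X / D₇ = ℙ¹` (`dihedral_correspondence`), and this kills the classes of degree `0`, because a
divisor of degree `0` on `ℙ¹` is principal (`RatFunc.mem_principalDivisors`).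

*Extension of constants.* Over an extension field `k₁` the function `φ` is still not a seventh power:
otherwise `D` would become principal and have `h¹ = 2`, but sections over `k` that span modulo one
element do so over `k₁` (`IsConstantExtension.not_pow`). Hence the equations of `X` define a field
over `k₁`, into which `k₁ ⊗ L` embeds (`IsHeptic.exists_tensorProduct_embedding`), and its fraction
field carries the same dihedral data (`IsDihedralData.exists_baseChange`). All statements over `k₁`
are then instances of the statements over `k`.
-/

noncomputable section

set_option linter.unusedSectionVars false

section

/-! ### Places and valuations -/

namespace Place

variable {k E F : Type*} [Field k] [Field E] [Field F] [Algebra k E] [Algebra k F]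

theorem ext' {P Q : Place k F} (h : P.ring = Q.ring) : P = Q := by
  cases P; cases Q; cases h; rfl

/-- The normalized valuation of `F` attached to the place `P`. -/
def val (P : Place k F) : Valuation F (WithZero (Multiplicative ℤ)) :=
  (IsDiscreteValuationRing.maximalIdeal P.ring).valuation F

theorem ord_def (P : Place k F) (f : F) : P.ord f = -WithZero.log (P.val f) := rfl

theorem val_le_one_iff (P : Place k F) (f : F) : P.val f ≤ 1 ↔ f ∈ P.ring := by
  constructor
  · intro h
    obtain ⟨a, b, hb⟩ :=
      (IsDiscreteValuationRing.maximalIdeal P.ring).exists_primeCompl_mul_eq_of_integer f h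
    have hu : IsUnit (b : P.ring) := by
      by_contra hb'
      exact b.2 ((IsLocalRing.mem_maximalIdeal _).2 hb')
    obtain ⟨c, hc⟩ := hu.exists_right_inv
    have hc' : ((b : P.ring) : F) * (c : F) = 1 := congrArg Subtype.val hc
    have : f = ((a * c : P.ring) : F) := by
      have hb2 : f * ((b : P.ring) : F) = (a : F) := hb
      calc f = f * (((b : P.ring) : F) * (c : F)) := by rw [hc', mul_one]
        _ = (a : F) * c := by rw [← mul_assoc, hb2]
    rw [this]
    exact (a * c).2
  · intro h
    exact (IsDiscreteValuationRing.maximalIdeal P.ring).valuation_le_one (⟨f, h⟩ : P.ring)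

theorem val_eq_exp (P : Place k F) {f : F} (hf : f ≠ 0) : P.val f = WithZero.exp (-P.ord f) := by
  have : P.val f ≠ 0 := by simpa using hf
  rw [ord_def, neg_neg, WithZero.exp_log this]

theorem mem_ring_iff (P : Place k F) {f : F} (hf : f ≠ 0) : f ∈ P.ring ↔ 0 ≤ P.ord f := by
  rw [← val_le_one_iff, P.val_eq_exp hf, ← WithZero.exp_zero, WithZero.exp_le_exp]
  omega

theorem val_lt_one_iff (P : Place k F) (f : P.ring) :
    P.val f < 1 ↔ f ∈ IsLocalRing.maximalIdeal P.ring :=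
  (IsDiscreteValuationRing.maximalIdeal P.ring).valuation_lt_one_iff_mem f

theorem mem_maximalIdeal_iff (P : Place k F) (f : P.ring) (hf : (f : F) ≠ 0) :
    f ∈ IsLocalRing.maximalIdeal P.ring ↔ 0 < P.ord f := by
  rw [← val_lt_one_iff, P.val_eq_exp hf, ← WithZero.exp_zero, WithZero.exp_lt_exp]
  omega

theorem ord_zero (P : Place k F) : P.ord 0 = 0 := by simp [ord]

theorem ord_pow (P : Place k F) (f : F) (n : ℕ) : P.ord (f ^ n) = n * P.ord f := by
  simp [ord, WithZero.log_pow]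

theorem ord_zpow (P : Place k F) (f : F) (n : ℤ) : P.ord (f ^ n) = n * P.ord f := by
  simp [ord, WithZero.log_zpow]

theorem ord_div (P : Place k F) {f g : F} (hf : f ≠ 0) (hg : g ≠ 0) :
    P.ord (f / g) = P.ord f - P.ord g := by
  rw [div_eq_mul_inv, P.ord_mul hf (inv_ne_zero hg), ord_inv]; ring

theorem ord_uniformizer (P : Place k F) : P.ord P.uniformizer = 1 :=
  P.exists_ord_eq_one.choose_spec

theorem uniformizer_ne_zero (P : Place k F) : P.uniformizer ≠ 0 := by
  intro h
  have := P.ord_uniformizer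
  rw [h, ord_zero] at this
  exact zero_ne_one this

theorem ord_algebraMap (P : Place k F) (c : k) : P.ord (algebraMap k F c) = 0 := by
  by_cases hc : c = 0
  · simp [hc, ord_zero]
  · have h0 : algebraMap k F c ≠ 0 := by simpa using hc
    have h1 := (P.mem_ring_iff h0).1 (P.algebraMap_mem c)
    have h2 : algebraMap k F c⁻¹ ≠ 0 := by simpa using hc
    have h3 := (P.mem_ring_iff h2).1 (P.algebraMap_mem c⁻¹)
    rw [map_inv₀, ord_inv] at h3
    omega

/-- Elements integral over a subring of a valuation ring lie in it. -/
theorem mem_of_isIntegral {A : Type*} [CommRing A] [Algebra A F] (V : ValuationSubring F)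
    (h : ∀ a : A, algebraMap A F a ∈ V) {f : F} (hf : IsIntegral A f) : f ∈ V := by
  let g : A →+* V := (algebraMap A F).codRestrict V h
  have hfV : IsIntegral V f := by
    obtain ⟨p, hp, hp'⟩ := hf
    refine ⟨p.map g, hp.map g, ?_⟩
    rw [Polynomial.eval₂_map]
    exact hp'
  obtain ⟨v, hv⟩ := IsIntegrallyClosed.isIntegral_iff.1 hfV
  rw [← hv]
  exact v.2

theorem ring_ne_top (P : Place k F) : P.ring ≠ ⊤ := by
  intro h
  obtain ⟨f, hf⟩ := P.exists_ord_eq_one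
  have hf0 : f ≠ 0 := by rintro rfl; rw [ord_zero] at hf; exact zero_ne_one hf
  have : f⁻¹ ∈ P.ring := by rw [h]; exact ValuationSubring.mem_top _
  rw [P.mem_ring_iff (inv_ne_zero hf0), ord_inv, hf] at this
  omega

end Place

/-- Two valuations with the same valuation ring and values in `ℤ`, both normalized, are equal. -/
theorem Valuation.eq_of_normalized {F : Type*} [Field F]
    {v w : Valuation F (WithZero (Multiplicative ℤ))} (h : ∀ f, v f ≤ 1 ↔ w f ≤ 1)
    (hv : ∃ f, v f = WithZero.exp (-1)) (hw : ∃ f, w f = WithZero.exp (-1)) : v = w := by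
  have hle : ∀ f g : F, v f ≤ v g ↔ w f ≤ w g := by
    intro f g
    by_cases hg : g = 0
    · simp [hg]
    · have h1 : v f ≤ v g ↔ v (f / g) ≤ 1 := by
        rw [map_div₀, div_le_one₀]
        exact zero_lt_iff.2 (by simpa using hg)
      have h2 : w f ≤ w g ↔ w (f / g) ≤ 1 := by
        rw [map_div₀, div_le_one₀]
        exact zero_lt_iff.2 (by simpa using hg)
      rw [h1, h2, h]
  obtain ⟨π, hπ⟩ := hv
  obtain ⟨ϖ, hϖ⟩ := hw
  have hπ0 : π ≠ 0 := by rintro rfl; rw [map_zero] at hπ; exact WithZero.exp_ne_zero hπ.symm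
  have key : ∀ (u : Valuation F (WithZero (Multiplicative ℤ))) (f : F), f ≠ 0 → u f < 1 →
      u f ≤ WithZero.exp (-1) := by
    intro u f hf hu
    have : u f ≠ 0 := by simpa using hf
    rw [← WithZero.exp_log this] at hu ⊢
    rw [← WithZero.exp_zero, WithZero.exp_lt_exp] at hu
    rw [WithZero.exp_le_exp]
    omega
  have hlt : ∀ f : F, v f < 1 ↔ w f < 1 := by
    intro f
    have := hle 1 f
    simp only [map_one] at this
    rw [← not_le, ← not_le, this]
  have hϖ0 : ϖ ≠ 0 := by rintro rfl; rw [map_zero] at hϖ; exact WithZero.exp_ne_zero hϖ.symm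
  have e1 : w π = WithZero.exp (-1) := by
    apply le_antisymm
    · apply key w π hπ0
      rw [← hlt, hπ, ← WithZero.exp_zero, WithZero.exp_lt_exp]; omega
    · rw [← hϖ, ← hle, hπ]
      apply key v ϖ hϖ0
      rw [hlt, hϖ, ← WithZero.exp_zero, WithZero.exp_lt_exp]; omega
  ext f
  by_cases hf : f = 0
  · simp [hf]
  have hvf : v f ≠ 0 := by simpa using hf
  set m := WithZero.log (v f) with hm
  have hvm : v f = WithZero.exp m := (WithZero.exp_log hvf).symm
  have hone : ∀ n : ℤ, WithZero.exp (-1 : ℤ) ^ n = WithZero.exp (-n) := by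
    intro n
    rw [← WithZero.exp_zsmul]; simp
  have h1 : v f = v (π ^ (-m)) := by rw [map_zpow₀, hπ, hone, hvm]; simp
  have h2 : w f = w (π ^ (-m)) :=
    le_antisymm ((hle _ _).1 h1.le) ((hle _ _).1 h1.ge)
  rw [h1, h2, map_zpow₀, map_zpow₀, hπ, e1]

open IsDedekindDomain in
/-- A nontrivial valuation ring that contains a Dedekind domain with fraction field `F` is the
localization at a maximal ideal. -/
theorem ValuationSubring.eq_valuationSubring_of_le {R F : Type*} [CommRing R] [IsDedekindDomain R]
    [Field F] [Algebra R F] [IsFractionRing R F] (V : ValuationSubring F) (hV : V ≠ ⊤)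
    (h : ∀ r, algebraMap R F r ∈ V) :
    ∃ v : HeightOneSpectrum R, V = (v.valuation F).valuationSubring ∧
      ∀ r : R, r ∈ v.asIdeal ↔ V.valuation (algebraMap R F r) < 1 := by
  let g : R →+* V := (algebraMap R F).codRestrict V h
  let q : Ideal R := (IsLocalRing.maximalIdeal V).comap g
  have hq : ∀ r : R, r ∈ q ↔ V.valuation (algebraMap R F r) < 1 := fun r =>
    ValuationSubring.valuation_lt_one_iff V (g r)
  have hqp : q.IsPrime := inferInstance
  have hunit : ∀ r, r ∉ q → (algebraMap R F r)⁻¹ ∈ V := by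
    intro r hr
    have hu : IsUnit (g r) := by
      by_contra hc
      exact hr ((IsLocalRing.mem_maximalIdeal _).2 hc)
    obtain ⟨c, hc⟩ := hu.exists_right_inv
    have : algebraMap R F r * (c : F) = 1 := congrArg Subtype.val hc
    rw [inv_eq_of_mul_eq_one_right this]
    exact c.2
  have hq0 : q ≠ ⊥ := by
    intro hbot
    apply hV
    ext f
    simp only [ValuationSubring.mem_top, iff_true]
    obtain ⟨a, b, hb, rfl⟩ := IsFractionRing.div_surjective (A := R) f
    rw [div_eq_mul_inv]
    refine V.mul_mem _ _ (h a) (hunit b ?_)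
    rw [hbot, Ideal.mem_bot]
    exact nonZeroDivisors.ne_zero hb
  refine ⟨⟨q, hqp, hq0⟩, ?_, hq⟩
  rw [← HeightOneSpectrum.valuationSubringAtPrime_eq_valuationSubring]
  symm
  apply ValuationSubring.eq_of_le_of_ne_top _ _ hV
  rintro x ⟨a, s, hs, rfl⟩
  exact V.mul_mem _ _ (h a) (hunit s hs)

namespace Place

open IsDedekindDomain

variable {k E F : Type*} [Field k] [Field E] [Field F] [Algebra k E] [Algebra k F]

section Dedekind

variable {R : Type*} [CommRing R] [IsDedekindDomain R] [Algebra R F] [IsFractionRing R F]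

/-- The maximal ideal of the Dedekind domain `R` at which a place containing `R` is centered. -/
def center (Q : Place k F) (h : ∀ r : R, algebraMap R F r ∈ Q.ring) : HeightOneSpectrum R :=
  (ValuationSubring.eq_valuationSubring_of_le Q.ring Q.ring_ne_top h).choose

theorem val_eq_center (Q : Place k F) (h : ∀ r : R, algebraMap R F r ∈ Q.ring) :
    Q.val = (Q.center h).valuation F := by
  have h1 := (ValuationSubring.eq_valuationSubring_of_le Q.ring Q.ring_ne_top h).choose_spec.1
  refine Valuation.eq_of_normalized (fun f => ?_)
    ((IsDiscreteValuationRing.maximalIdeal Q.ring).valuation_exists_uniformizer F)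
    ((Q.center h).valuation_exists_uniformizer F)
  rw [val_le_one_iff, h1]
  rfl

theorem mem_center_iff (Q : Place k F) (h : ∀ r : R, algebraMap R F r ∈ Q.ring) (r : R) :
    r ∈ (Q.center h).asIdeal ↔ Q.val (algebraMap R F r) < 1 := by
  rw [val_eq_center Q h, HeightOneSpectrum.valuation_lt_one_iff_mem]

/-- The place given by a maximal ideal of a Dedekind domain with fraction field `F`. -/
def ofPrime (v : HeightOneSpectrum R) (hk : ∀ c : k, v.valuation F (algebraMap k F c) ≤ 1) :
    Place k F where
  ring := (v.valuation F).valuationSubring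
  algebraMap_mem := hk
  isDVR := by
    rw [← HeightOneSpectrum.valuationSubringAtPrime_eq_valuationSubring]
    exact IsLocalization.AtPrime.isDiscreteValuationRing_of_dedekind_domain R v.ne_bot _

theorem ofPrime_mem (v : HeightOneSpectrum R) (hk : ∀ c : k, v.valuation F (algebraMap k F c) ≤ 1)
    (r : R) : algebraMap R F r ∈ (ofPrime v hk).ring := v.valuation_le_one r

theorem val_ofPrime (v : HeightOneSpectrum R)
    (hk : ∀ c : k, v.valuation F (algebraMap k F c) ≤ 1) :
    (ofPrime v hk).val = v.valuation F := by
  refine Valuation.eq_of_normalized (fun f => ?_)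
    ((IsDiscreteValuationRing.maximalIdeal (ofPrime v hk).ring).valuation_exists_uniformizer F)
    (v.valuation_exists_uniformizer F)
  rw [val_le_one_iff]
  rfl

theorem center_ofPrime (v : HeightOneSpectrum R)
    (hk : ∀ c : k, v.valuation F (algebraMap k F c) ≤ 1) :
    (ofPrime v hk).center (ofPrime_mem v hk) = v := by
  ext r
  rw [mem_center_iff, val_ofPrime, HeightOneSpectrum.valuation_lt_one_iff_mem]

theorem ofPrime_center (Q : Place k F) (h : ∀ r : R, algebraMap R F r ∈ Q.ring)
    (hk : ∀ c : k, (Q.center h).valuation F (algebraMap k F c) ≤ 1) :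
    ofPrime (Q.center h) hk = Q := by
  apply ext'
  ext f
  rw [← val_le_one_iff, ← val_le_one_iff, val_ofPrime, val_eq_center Q h]

end Dedekind

end Place

end

section

/-! ### Strong approximation and restriction of places -/

open IsDedekindDomain

/-- Strong approximation in the fraction field of a Dedekind domain. -/
theorem IsDedekindDomain.exists_approx {R F : Type*} [CommRing R] [IsDedekindDomain R] [Field F]
    [Algebra R F] [IsFractionRing R F] (T : Finset (HeightOneSpectrum R))
    (f : HeightOneSpectrum R → F) (N : ℕ) :
    ∃ g : F, (∀ v ∈ T, v.valuation F (g - f v) ≤ WithZero.exp (-(N : ℤ))) ∧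
      ∀ v ∉ T, v.valuation F g ≤ 1 := by
  classical
  -- clear the denominators of the `f v` by `d`, then apply the Chinese remainder theorem to the
  -- numerators, with `0` prescribed at the zeros of `d` outside `T`
  obtain ⟨⟨d, hd⟩, hdf⟩ :=
    IsLocalization.exist_integer_multiples_of_finset (nonZeroDivisors R) (T.image f)
  have hd0 : d ≠ 0 := nonZeroDivisors.ne_zero hd
  have hdF : algebraMap R F d ≠ 0 := by simpa using hd0
  have hfin : {v : HeightOneSpectrum R | v.asIdeal ∣ Ideal.span {d}}.Finite :=
    Ideal.finite_factors (by simpa using hd0)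
  set T' : Finset (HeightOneSpectrum R) := T ∪ hfin.toFinset with hT'
  have hord : ∀ v : HeightOneSpectrum R, ∃ m : ℕ,
      WithZero.exp (-(m : ℤ)) ≤ v.valuation F (algebraMap R F d) := by
    intro v
    rw [v.valuation_of_algebraMap, v.intValuation_if_neg hd0]
    exact ⟨_, le_rfl⟩
  choose m hm using hord
  have hx : ∀ v : T', ∃ x : R, ((v : HeightOneSpectrum R) ∈ T →
      algebraMap R F x = algebraMap R F d * f v) ∧ ((v : HeightOneSpectrum R) ∉ T → x = 0) := by
    intro v
    by_cases hv : (v : HeightOneSpectrum R) ∈ T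
    · obtain ⟨x, hx⟩ := hdf (f v) (Finset.mem_image_of_mem _ hv)
      refine ⟨x, fun _ => ?_, fun h => absurd hv h⟩
      rw [hx]
      exact Algebra.smul_def _ _
    · exact ⟨0, fun h => absurd h hv, fun _ => rfl⟩
  choose x hx1 hx2 using hx
  obtain ⟨b, hb⟩ := IsDedekindDomain.exists_forall_sub_mem_ideal (s := T')
    (fun v : HeightOneSpectrum R => v.asIdeal) (fun v => N + m v)
    (fun v _ => v.prime) (fun v _ w _ hvw h => hvw (HeightOneSpectrum.ext h)) x
  have hval : ∀ v (hv : v ∈ T'), v.valuation F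
      ((algebraMap R F b - algebraMap R F (x ⟨v, hv⟩)) / algebraMap R F d) ≤
        WithZero.exp (-(N : ℤ)) := by
    intro v hv
    rw [map_div₀, ← map_sub, v.valuation_of_algebraMap]
    have h1 := (v.intValuation_le_pow_iff_mem _ _).2 (hb v hv)
    have hpos : (0 : WithZero (Multiplicative ℤ)) < v.valuation F (algebraMap R F d) :=
      zero_lt_iff.2 (by simpa using hd0)
    rw [div_le_iff₀ hpos]
    refine h1.trans (le_trans ?_ (mul_le_mul_right (hm v) _))
    rw [← WithZero.exp_add, WithZero.exp_le_exp]
    push_cast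
    omega
  refine ⟨algebraMap R F b / algebraMap R F d, fun v hv => ?_, fun v hv => ?_⟩
  · have := hval v (Finset.mem_union_left _ hv)
    rwa [hx1 ⟨v, _⟩ hv, sub_div, mul_div_cancel_left₀ _ hdF] at this
  · by_cases hv' : v ∈ T'
    · have := hval v hv'
      rw [hx2 ⟨v, hv'⟩ hv, map_zero, sub_zero] at this
      refine this.trans ?_
      rw [← WithZero.exp_zero, WithZero.exp_le_exp]
      omega
    · have hdv : v.valuation F (algebraMap R F d) = 1 := by
        rw [v.valuation_eq_one_iff_notMem]
        intro hmem
        apply hv'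
        rw [hT', Finset.mem_union]
        right
        rw [Set.Finite.mem_toFinset]
        exact Ideal.dvd_span_singleton.2 hmem
      rw [map_div₀, hdv, div_one]
      exact v.valuation_le_one b

namespace Place

variable {k E F : Type*} [Field k] [Field E] [Field F] [Algebra k E] [Algebra k F]

/-- Strong approximation for the places that contain a Dedekind domain `R`. -/
theorem exists_approx (R : Type*) [CommRing R] [IsDedekindDomain R] [Algebra R F]
    [IsFractionRing R F] {T : Set (Place k F)} (hT : T.Finite)
    (hR : ∀ Q ∈ T, ∀ r, algebraMap R F r ∈ Q.ring) (f : Place k F → F) (N : ℕ) :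
    ∃ g : F, (∀ Q ∈ T, Q.val (g - f Q) ≤ WithZero.exp (-(N : ℤ))) ∧
      ∀ Q : Place k F, (∀ r, algebraMap R F r ∈ Q.ring) → Q ∉ T → g ∈ Q.ring := by
  classical
  have hinj : ∀ (Q Q' : Place k F) (h : ∀ r, algebraMap R F r ∈ Q.ring)
      (h' : ∀ r, algebraMap R F r ∈ Q'.ring), Q.center h = Q'.center h' → Q = Q' := by
    intro Q Q' h h' hc
    apply ext'
    ext z
    rw [← val_le_one_iff, ← val_le_one_iff, val_eq_center Q h, val_eq_center Q' h', hc]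
  have : ∃ f' : HeightOneSpectrum R → F, ∀ Q (h : Q ∈ T), f' (Q.center (hR Q h)) = f Q := by
    refine ⟨fun v => if h : ∃ Q, ∃ hQ : Q ∈ T, Q.center (hR Q hQ) = v then f h.choose else 0, ?_⟩
    intro Q hQ
    have h : ∃ Q', ∃ hQ' : Q' ∈ T, Q'.center (hR Q' hQ') = Q.center (hR Q hQ) := ⟨Q, hQ, rfl⟩
    simp only [dif_pos h]
    obtain ⟨h1, h2⟩ := h.choose_spec
    rw [hinj _ _ _ _ h2]
  obtain ⟨f', hf'⟩ := this
  obtain ⟨g, hg1, hg2⟩ := IsDedekindDomain.exists_approx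
    (hT.toFinset.attach.image fun Q => Q.1.center (hR Q.1 (hT.mem_toFinset.1 Q.2))) f' N
  refine ⟨g, fun Q hQ => ?_, fun Q h hQ => ?_⟩
  · rw [val_eq_center Q (hR Q hQ), ← hf' Q hQ]
    apply hg1
    rw [Finset.mem_image]
    exact ⟨⟨Q, hT.mem_toFinset.2 hQ⟩, Finset.mem_attach _ _, rfl⟩
  · rw [← val_le_one_iff, val_eq_center Q h]
    apply hg2
    rw [Finset.mem_image]
    rintro ⟨⟨Q', hQ'⟩, -, hc⟩
    exact hQ (hinj _ _ _ _ hc ▸ hT.mem_toFinset.1 hQ')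

section Tower

theorem LiesOver.ord_eq {i : E →ₐ[k] F} {Q : Place k F} {P : Place k E} (h : Q.LiesOver i P)
    (f : E) : Q.ord (i f) = Q.ramificationIdx i P * P.ord f := by
  have hu : P.uniformizer ∈ P.ring :=
    (P.mem_ring_iff P.uniformizer_ne_zero).2 (by rw [ord_uniformizer]; omega)
  have h0 : i P.uniformizer ≠ 0 := by
    simpa using P.uniformizer_ne_zero
  have hpos : 0 ≤ Q.ord (i P.uniformizer) := (Q.mem_ring_iff h0).1 ((h.mem_iff _).2 hu)
  have he : (Q.ramificationIdx i P : ℤ) = Q.ord (i P.uniformizer) := by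
    rw [ramificationIdx, if_pos h, Int.toNat_of_nonneg hpos]
  rw [he]
  by_cases hf : f = 0
  · simp [hf, ord_zero]
  have hz : P.uniformizer ^ P.ord f ≠ 0 := zpow_ne_zero _ P.uniformizer_ne_zero
  have hunit : P.ord (f / P.uniformizer ^ P.ord f) = 0 := by
    rw [P.ord_div hf hz, ord_zpow, ord_uniformizer]; ring
  have key : ∀ g : E, g ≠ 0 → P.ord g = 0 → Q.ord (i g) = 0 := by
    intro g hg hg0
    have hig : i g ≠ 0 := by simpa using hg
    have h1 := (Q.mem_ring_iff hig).1 ((h.mem_iff _).2 ((P.mem_ring_iff hg).2 hg0.ge))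
    have h2 : 0 ≤ Q.ord (i g⁻¹) := by
      refine (Q.mem_ring_iff (by simpa using hg)).1 ((h.mem_iff _).2
        ((P.mem_ring_iff (inv_ne_zero hg)).2 ?_))
      rw [ord_inv, hg0]; simp
    rw [map_inv₀, ord_inv] at h2
    omega
  have := key _ (div_ne_zero hf hz) hunit
  rw [map_div₀, Q.ord_div (by simpa using hf)
    (by rw [Ne, map_eq_zero]; exact hz), map_zpow₀, ord_zpow] at this
  linarith

theorem LiesOver.ramificationIdx_pos {i : E →ₐ[k] F} {Q : Place k F} {P : Place k E}
    (h : Q.LiesOver i P) : 0 < Q.ramificationIdx i P := by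
  rcases Nat.eq_zero_or_pos (Q.ramificationIdx i P) with h0 | h0
  · have h1 := h.ord_eq P.uniformizer⁻¹
    rw [h0] at h1
    have h2 : i P.uniformizer⁻¹ ∈ Q.ring := by
      refine (Q.mem_ring_iff (by simpa using P.uniformizer_ne_zero)).2 ?_
      rw [h1]; simp
    rw [h.mem_iff, P.mem_ring_iff (inv_ne_zero P.uniformizer_ne_zero), ord_inv,
      ord_uniformizer] at h2
    omega
  · exact h0

theorem LiesOver.unique {i : E →ₐ[k] F} {Q : Place k F} {P P' : Place k E}
    (h : Q.LiesOver i P) (h' : Q.LiesOver i P') : P = P' :=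
  ext' (h.symm.trans h')

end Tower

end Place

/-- The valuation ring of a nontrivial valuation with values in `ℤ` is discrete. -/
theorem Valuation.isDiscreteValuationRing_of_ne_top {E : Type*} [Field E]
    (v : Valuation E (WithZero (Multiplicative ℤ))) (hv : v.valuationSubring ≠ ⊤) :
    IsDiscreteValuationRing v.valuationSubring := by
  have h1 : IsCyclic (WithZero (Multiplicative ℤ))ˣ :=
    isCyclic_of_surjective (WithZero.unitsWithZeroEquiv (α := Multiplicative ℤ)).symm
      (WithZero.unitsWithZeroEquiv (α := Multiplicative ℤ)).symm.surjective
  have h2 : IsCyclic (MonoidWithZeroHom.valueGroup (.ofClass v)) := inferInstance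
  have h3 : Nontrivial (MonoidWithZeroHom.valueGroup (.ofClass v)) := by
    rw [Subgroup.nontrivial_iff_exists_ne_one]
    obtain ⟨f, hf⟩ : ∃ f, f ∉ v.valuationSubring := by
      by_contra! h
      exact hv (ValuationSubring.ext _ _ fun x => ⟨fun _ => trivial, fun _ => h x⟩)
    rw [Valuation.mem_valuationSubring_iff, not_le] at hf
    have hf0 : v f ≠ 0 := (zero_lt_one.trans hf).ne'
    refine ⟨Units.mk0 (v f) hf0, MonoidWithZeroHom.mem_valueGroup _ ⟨f, rfl⟩, fun h => ?_⟩
    have : v f = 1 := congrArg Units.val h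
    exact hf.ne' this
  exact Valuation.valuationSubring_isDiscreteValuationRing v

/-- The restriction of a discrete valuation ring to a subfield is trivial or discrete. -/
theorem ValuationSubring.isDiscreteValuationRing_comap {k E F : Type*} [Field k] [Field E]
    [Field F] [Algebra k F] (Q : Place k F) (i : E →+* F) (h : Q.ring.comap i ≠ ⊤) :
    IsDiscreteValuationRing (Q.ring.comap i) := by
  have hv : Q.ring.comap i = (Q.val.comap i).valuationSubring := by
    ext f
    exact (Q.val_le_one_iff (i f)).symm
  rw [hv] at h ⊢
  exact Valuation.isDiscreteValuationRing_of_ne_top _ h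

namespace Place

variable {k E F : Type*} [Field k] [Field E] [Field F] [Algebra k E] [Algebra k F]

theorem comap_ne_top {i : E →ₐ[k] F} (hi : (i : E →+* F).IsIntegral) (Q : Place k F) :
    Q.ring.comap (i : E →+* F) ≠ ⊤ := by
  intro h
  apply Q.ring_ne_top
  ext f
  simp only [ValuationSubring.mem_top, iff_true]
  let _ := (i : E →+* F).toAlgebra
  refine mem_of_isIntegral (A := E) Q.ring (fun e => ?_) (hi f)
  have : e ∈ Q.ring.comap (i : E →+* F) := by rw [h]; trivial
  exact this

/-- The image of a point under the covering of curves given by the algebraic extension `i`. -/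
def below (i : E →ₐ[k] F) (hi : (i : E →+* F).IsIntegral) (Q : Place k F) : Place k E where
  ring := Q.ring.comap (i : E →+* F)
  algebraMap_mem c := by
    change i (algebraMap k E c) ∈ Q.ring
    rw [AlgHom.commutes]
    exact Q.algebraMap_mem c
  isDVR := ValuationSubring.isDiscreteValuationRing_comap Q _ (comap_ne_top hi Q)

theorem liesOver_below (i : E →ₐ[k] F) (hi : (i : E →+* F).IsIntegral) (Q : Place k F) :
    Q.LiesOver i (Q.below i hi) := rfl

theorem krullDimLE (P : Place k F) : Ring.KrullDimLE 1 P.ring :=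
  Ring.KrullDimLE.mk₁' fun _ h0 _ => Ideal.IsPrime.isMaximal ‹_› h0

/-- A place is a maximal proper subring. -/
theorem eq_of_le {P P' : Place k F} (h : ∀ f, f ∈ P.ring → f ∈ P'.ring) : P = P' := by
  have := P.krullDimLE
  exact ext' (ValuationSubring.eq_of_le_of_ne_top _ h P'.ring_ne_top)

theorem liesOver_of_le {i : E →ₐ[k] F} (hi : (i : E →+* F).IsIntegral) {Q : Place k F}
    {P : Place k E} (h : ∀ f, f ∈ P.ring → i f ∈ Q.ring) : Q.LiesOver i P := by
  have : P = Q.below i hi := eq_of_le h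
  rw [this]
  rfl

end Place

end

section

open IsDedekindDomain

/-! ### The points above a given point and the fundamental identity -/


namespace Place

variable {k E F : Type*} [Field k] [Field E] [Field F] [Algebra k E] [Algebra k F]

section Fundamental

variable [Algebra E F] [IsScalarTower k E F] [FiniteDimensional E F]

theorem isIntegral_toAlgHom :
    ((IsScalarTower.toAlgHom k E F : E →ₐ[k] F) : E →+* F).IsIntegral :=
  fun f => Algebra.IsIntegral.isIntegral (R := E) f

theorem liesOver_iff_integralClosure (Q : Place k F) (P : Place k E) :
    Q.LiesOver (IsScalarTower.toAlgHom k E F) P ↔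
      ∀ b : integralClosure P.ring F, algebraMap _ F b ∈ Q.ring := by
  constructor
  · intro h b
    exact mem_of_isIntegral (A := P.ring) Q.ring (fun a => (h.mem_iff _).2 a.2) b.2
  · intro h
    refine liesOver_of_le isIntegral_toAlgHom fun f hf => ?_
    exact h ⟨algebraMap P.ring F ⟨f, hf⟩, isIntegral_algebraMap⟩

variable [Algebra.IsSeparable E F]

theorem isDedekindDomain_integralClosure (P : Place k E) :
    IsDedekindDomain (integralClosure P.ring F) :=
  integralClosure.isDedekindDomain P.ring E F

theorem isFractionRing_integralClosure (P : Place k E) :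
    IsFractionRing (integralClosure P.ring F) F :=
  integralClosure.isFractionRing_of_finite_extension E F

theorem finite_integralClosure (P : Place k E) :
    Module.Finite P.ring (integralClosure P.ring F) :=
  IsIntegralClosure.finite P.ring E F (integralClosure P.ring F)

theorem faithfulSMul_integralClosure (P : Place k E) :
    FaithfulSMul P.ring (integralClosure P.ring F) := by
  rw [faithfulSMul_iff_algebraMap_injective]
  intro a b hab
  have h : algebraMap E F a = algebraMap E F b := congrArg Subtype.val hab
  exact Subtype.ext ((algebraMap E F).injective h)

theorem isTorsionFree_integralClosure (P : Place k E) :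
    Module.IsTorsionFree P.ring (integralClosure P.ring F) := by
  have := faithfulSMul_integralClosure (F := F) P
  exact FaithfulSMul.to_isTorsionFree _ _

/-- The place above `P` given by a maximal ideal of the integral closure of its local ring. -/
def above (P : Place k E) [IsDedekindDomain (integralClosure P.ring F)]
    [IsFractionRing (integralClosure P.ring F) F]
    (v : HeightOneSpectrum (integralClosure P.ring F)) : Place k F :=
  ofPrime v fun c => by
    have : algebraMap k F c = algebraMap (integralClosure P.ring F) F
        ⟨algebraMap P.ring F ⟨algebraMap k E c, P.algebraMap_mem c⟩, isIntegral_algebraMap⟩ := by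
      rw [IsScalarTower.algebraMap_apply k E F]; rfl
    rw [this]
    exact v.valuation_le_one _

theorem above_liesOver (P : Place k E) [IsDedekindDomain (integralClosure P.ring F)]
    [IsFractionRing (integralClosure P.ring F) F]
    (v : HeightOneSpectrum (integralClosure P.ring F)) :
    (above P v).LiesOver (IsScalarTower.toAlgHom k E F) P :=
  (liesOver_iff_integralClosure _ _).2 (ofPrime_mem v _)

/-- The points above `P` are the maximal ideals of the integral closure of its local ring. -/
def equivPrimesOver (P : Place k E) [IsDedekindDomain (integralClosure P.ring F)]
    [IsFractionRing (integralClosure P.ring F) F] :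
    {Q : Place k F // Q.LiesOver (IsScalarTower.toAlgHom k E F) P} ≃
      (IsLocalRing.maximalIdeal P.ring).primesOver (integralClosure P.ring F) where
  toFun Q := ⟨(Q.1.center ((liesOver_iff_integralClosure _ _).1 Q.2)).asIdeal,
    (Q.1.center ((liesOver_iff_integralClosure _ _).1 Q.2)).isPrime, ⟨by
      ext a
      rw [Ideal.under_def, Ideal.mem_comap, mem_center_iff, ← P.val_lt_one_iff]
      have h2 : algebraMap (integralClosure P.ring F) F (algebraMap P.ring _ a) =
        IsScalarTower.toAlgHom k E F (a : E) := rfl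
      rw [h2]
      by_cases ha : (a : E) = 0
      · rw [ha]; simp
      · have ha' : IsScalarTower.toAlgHom k E F (a : E) ≠ 0 := by simpa using ha
        rw [P.val_eq_exp ha, Q.1.val_eq_exp ha', Q.2.ord_eq, ← WithZero.exp_zero,
          WithZero.exp_lt_exp, WithZero.exp_lt_exp]
        have := Q.2.ramificationIdx_pos
        have h3 : (0 : ℤ) < (Q.1.ramificationIdx (IsScalarTower.toAlgHom k E F) P : ℤ) := by
          exact_mod_cast this
        constructor
        · intro h; have : 0 < P.ord (a : E) := by omega
          have := mul_pos h3 this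
          omega
        · intro h
          have : 0 < (Q.1.ramificationIdx (IsScalarTower.toAlgHom k E F) P : ℤ) * P.ord a := by
            omega
          have := pos_of_mul_pos_right this h3.le
          omega⟩⟩
  invFun q := ⟨above P ⟨q.1, q.2.1, by
    rintro h0
    have h1 := q.2.2.over
    have := faithfulSMul_integralClosure (F := F) P
    rw [h0, Ideal.under_bot] at h1
    exact (IsDiscreteValuationRing.maximalIdeal P.ring).ne_bot h1⟩, above_liesOver P _⟩
  left_inv Q := by
    apply Subtype.ext
    have hB := (liesOver_iff_integralClosure _ _).1 Q.2
    apply ext'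
    ext f
    change f ∈ ((Q.1.center hB).valuation F).valuationSubring ↔ _
    rw [Valuation.mem_valuationSubring_iff, ← val_eq_center, val_le_one_iff]
  right_inv q := by
    apply Subtype.ext
    exact congrArg HeightOneSpectrum.asIdeal (center_ofPrime _ _)

theorem finite_liesOver (P : Place k E) :
    {Q : Place k F | Q.LiesOver (IsScalarTower.toAlgHom k E F) P}.Finite := by
  have := isDedekindDomain_integralClosure (F := F) P
  have := isFractionRing_integralClosure (F := F) P
  have := finite_integralClosure (F := F) P
  have : Finite ((IsLocalRing.maximalIdeal P.ring).primesOver (integralClosure P.ring F)) :=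
    Algebra.QuasiFinite.finite_primesOver _
  exact Set.finite_coe_iff.1 (Finite.of_equiv _ (equivPrimesOver (F := F) P).symm)

theorem exists_liesOver (P : Place k E) :
    ∃ Q : Place k F, Q.LiesOver (IsScalarTower.toAlgHom k E F) P := by
  have := isDedekindDomain_integralClosure (F := F) P
  have := isFractionRing_integralClosure (F := F) P
  have := faithfulSMul_integralClosure (F := F) P
  obtain ⟨q⟩ : Nonempty ((IsLocalRing.maximalIdeal P.ring).primesOver (integralClosure P.ring F)) :=
    inferInstance
  exact ⟨_, ((equivPrimesOver (F := F) P).symm q).2⟩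

/-- The ramification index of places agrees with that of maximal ideals. -/
theorem ramificationIdx_eq_ideal (P : Place k E) [IsDedekindDomain (integralClosure P.ring F)]
    [IsFractionRing (integralClosure P.ring F) F]
    (Q : {Q : Place k F // Q.LiesOver (IsScalarTower.toAlgHom k E F) P}) :
    (equivPrimesOver P Q).1.ramificationIdx P.ring =
      Q.1.ramificationIdx (IsScalarTower.toAlgHom k E F) P := by
  have hp := (equivPrimesOver P Q).2.1
  have hl := (equivPrimesOver P Q).2.2
  set v := Q.1.center ((liesOver_iff_integralClosure _ _).1 Q.2) with hv
  have := isTorsionFree_integralClosure (F := F) P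
  have hvl : v.asIdeal.LiesOver (IsDiscreteValuationRing.maximalIdeal P.ring).asIdeal := hl
  have h1 := HeightOneSpectrum.valuation_liesOver F
    (IsDiscreteValuationRing.maximalIdeal P.ring) v P.uniformizer
  have h2 : v.asIdeal = (equivPrimesOver P Q).1 := rfl
  rw [← h2, ← Ideal.ramificationIdx'_eq_ramificationIdx
    (IsDiscreteValuationRing.maximalIdeal P.ring).asIdeal v.asIdeal
    (IsDiscreteValuationRing.maximalIdeal P.ring).ne_bot]
  rw [← val_eq_center] at h1
  have h3 : (IsDiscreteValuationRing.maximalIdeal P.ring).valuation E P.uniformizer =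
    WithZero.exp (-1) := by
    have := P.val_eq_exp P.uniformizer_ne_zero
    rwa [ord_uniformizer] at this
  have h4 := Q.1.val_eq_exp (f := algebraMap E F P.uniformizer)
    (by simpa using P.uniformizer_ne_zero)
  have h5 := Q.2.ord_eq P.uniformizer
  rw [ord_uniformizer, mul_one] at h5
  change Q.1.ord (algebraMap E F P.uniformizer) = _ at h5
  rw [h3, h4, h5, ← WithZero.exp_nsmul, WithZero.exp_inj] at h1
  simp only [nsmul_eq_mul, mul_neg, mul_one, neg_inj] at h1
  exact_mod_cast h1

/-- The residue degree of places agrees with that of maximal ideals. -/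
theorem inertiaDeg_eq_ideal (P : Place k E) [IsDedekindDomain (integralClosure P.ring F)]
    [IsFractionRing (integralClosure P.ring F) F]
    (Q : {Q : Place k F // Q.LiesOver (IsScalarTower.toAlgHom k E F) P}) :
    (equivPrimesOver P Q).1.inertiaDeg P.ring =
      Q.1.inertiaDeg (IsScalarTower.toAlgHom k E F) P := by
  have hp := (equivPrimesOver P Q).2.1
  have hl := (equivPrimesOver P Q).2.2
  have hB := (liesOver_iff_integralClosure _ _).1 Q.2
  set v := Q.1.center hB with hv
  have hm : (equivPrimesOver P Q).1.IsMaximal := v.isMaximal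
  rw [Ideal.inertiaDeg_eq_of_isMaximal (IsLocalRing.maximalIdeal P.ring) _, inertiaDeg,
    dif_pos Q.2]
  let g : integralClosure P.ring F →+* Q.1.ring :=
    (algebraMap (integralClosure P.ring F) F).codRestrict Q.1.ring hB
  have hg : ∀ b, b ∈ (equivPrimesOver P Q).1 ↔ IsLocalRing.residue Q.1.ring (g b) = 0 := by
    intro b
    rw [IsLocalRing.residue_eq_zero_iff, ← Q.1.val_lt_one_iff]
    exact mem_center_iff Q.1 hB b
  -- the residue field of `Q` is the quotient of the integral closure by the corresponding ideal
  let φ : (integralClosure P.ring F ⧸ (equivPrimesOver P Q).1) →+* Q.1.Residue :=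
    Ideal.Quotient.lift _ ((IsLocalRing.residue Q.1.ring).comp g) fun b hb => (hg b).1 hb
  have hφ : Function.Bijective φ := by
    constructor
    · refine (RingHom.injective_iff_ker_eq_bot φ).2 (eq_bot_iff.2 fun a ha => ?_)
      obtain ⟨b, rfl⟩ := Ideal.Quotient.mk_surjective a
      exact Ideal.Quotient.eq_zero_iff_mem.2 ((hg b).2 ha)
    · intro z
      obtain ⟨z, rfl⟩ := IsLocalRing.residue_surjective z
      have hz : v.valuation F (z : F) ≤ 1 := by
        rw [← val_eq_center, val_le_one_iff]; exact z.2
      obtain ⟨b, hb⟩ := v.exists_valuation_sub_lt_of_integer hz 1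
      refine ⟨Ideal.Quotient.mk _ b, ?_⟩
      change IsLocalRing.residue Q.1.ring (g b) = _
      rw [← sub_eq_zero, ← map_sub, IsLocalRing.residue_eq_zero_iff, ← Q.1.val_lt_one_iff,
        val_eq_center Q.1 hB]
      exact hb
  let _ := Q.2.residueMap.toAlgebra
  refine Algebra.finrank_eq_of_equiv_equiv (RingEquiv.refl (P.ring ⧸ IsLocalRing.maximalIdeal P.ring))
    (RingEquiv.ofBijective φ hφ) ?_
  ext a
  rfl

/-- The fundamental identity `∑ e f = n`. -/
theorem sum_ramificationIdx_mul_inertiaDeg (P : Place k E) (S : Finset (Place k F))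
    (hS : ∀ Q, Q ∈ S ↔ Q.LiesOver (IsScalarTower.toAlgHom k E F) P) :
    ∑ Q ∈ S, Q.ramificationIdx (IsScalarTower.toAlgHom k E F) P *
      Q.inertiaDeg (IsScalarTower.toAlgHom k E F) P = Module.finrank E F := by
  have := isDedekindDomain_integralClosure (F := F) P
  have := isFractionRing_integralClosure (F := F) P
  have := finite_integralClosure (F := F) P
  have : Finite ((IsLocalRing.maximalIdeal P.ring).primesOver (integralClosure P.ring F)) :=
    Algebra.QuasiFinite.finite_primesOver _
  have := Fintype.ofFinite ((IsLocalRing.maximalIdeal P.ring).primesOver (integralClosure P.ring F))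
  have := isTorsionFree_integralClosure (F := F) P
  have : Fintype {Q : Place k F // Q.LiesOver (IsScalarTower.toAlgHom k E F) P} :=
    Fintype.ofEquiv _ (equivPrimesOver (F := F) P).symm
  rw [← IsIntegralClosure.rank P.ring E F (integralClosure P.ring F),
    ← Ideal.sum_ramification_inertia_eq_finrank (IsLocalRing.maximalIdeal P.ring),
    ← (equivPrimesOver (F := F) P).sum_comp, ← Finset.sum_subtype S hS (fun Q =>
      Q.ramificationIdx (IsScalarTower.toAlgHom k E F) P *
      Q.inertiaDeg (IsScalarTower.toAlgHom k E F) P) |>.symm]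
  refine Finset.sum_congr rfl fun Q _ => ?_
  rw [ramificationIdx_eq_ideal, inertiaDeg_eq_ideal]

end Fundamental

end Place

end

section

/-! ### Galois action on points -/


open IsDedekindDomain

namespace Place

variable {k E F H : Type*} [Field k] [Field E] [Field F] [Field H] [Algebra k E] [Algebra k F]
  [Algebra k H]

theorem LiesOver.comp {i : E →ₐ[k] F} {j : F →ₐ[k] H} {S : Place k H} {Q : Place k F}
    {P : Place k E} (h : S.LiesOver j Q) (h' : Q.LiesOver i P) : S.LiesOver (j.comp i) P := by
  unfold LiesOver at *
  rw [← h', ← h]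
  rfl

theorem ramificationIdx_comp {i : E →ₐ[k] F} {j : F →ₐ[k] H} {S : Place k H} {Q : Place k F}
    {P : Place k E} (h : S.LiesOver j Q) (h' : Q.LiesOver i P) :
    S.ramificationIdx (j.comp i) P = S.ramificationIdx j Q * Q.ramificationIdx i P := by
  have h1 := (h.comp h').ord_eq P.uniformizer
  rw [AlgHom.comp_apply, h.ord_eq, h'.ord_eq, ord_uniformizer, mul_one, mul_one] at h1
  exact_mod_cast h1.symm

theorem inertiaDeg_comp {i : E →ₐ[k] F} {j : F →ₐ[k] H} {S : Place k H} {Q : Place k F}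
    {P : Place k E} (h : S.LiesOver j Q) (h' : Q.LiesOver i P) :
    S.inertiaDeg (j.comp i) P = S.inertiaDeg j Q * Q.inertiaDeg i P := by
  rw [inertiaDeg, inertiaDeg, inertiaDeg, dif_pos (h.comp h'), dif_pos h, dif_pos h']
  let _ := h.residueMap.toAlgebra
  let _ := h'.residueMap.toAlgebra
  let _ := (h.comp h').residueMap.toAlgebra
  have : IsScalarTower P.Residue Q.Residue S.Residue := by
    refine IsScalarTower.of_algebraMap_eq fun a => ?_
    obtain ⟨a, rfl⟩ := IsLocalRing.residue_surjective a
    rfl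
  rw [mul_comm]
  exact (Module.finrank_mul_finrank P.Residue Q.Residue S.Residue).symm

theorem LiesOver.deg_eq {i : E →ₐ[k] F} {Q : Place k F} {P : Place k E} (h : Q.LiesOver i P) :
    Q.deg = Q.inertiaDeg i P * P.deg := by
  rw [inertiaDeg, dif_pos h, deg, deg]
  let _ := h.residueMap.toAlgebra
  have : IsScalarTower k P.Residue Q.Residue := by
    refine IsScalarTower.of_algebraMap_eq fun a => ?_
    change IsLocalRing.residue Q.ring (algebraMap k Q.ring a) =
      IsLocalRing.residue Q.ring (h.ringHom (algebraMap k P.ring a))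
    congr 1
    apply Subtype.ext
    exact (i.commutes a).symm
  rw [mul_comm]
  exact (Module.finrank_mul_finrank k P.Residue Q.Residue).symm

/-- The action of an automorphism on points: the image of `Q` under the automorphism of the curve
that corresponds to the automorphism `σ` of its function field. -/
def comapAut (σ : F ≃ₐ[k] F) (Q : Place k F) : Place k F :=
  Q.below σ.toAlgHom fun f => by
    rw [← σ.apply_symm_apply f]
    exact RingHom.isIntegralElem_map _

theorem mem_comapAut (σ : F ≃ₐ[k] F) (Q : Place k F) (f : F) :
    f ∈ (Q.comapAut σ).ring ↔ σ f ∈ Q.ring := Iff.rfl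

theorem comapAut_liesOver (σ : F ≃ₐ[k] F) (Q : Place k F) :
    Q.LiesOver σ.toAlgHom (Q.comapAut σ) := rfl

theorem comapAut_mul (σ τ : F ≃ₐ[k] F) (Q : Place k F) :
    Q.comapAut (σ * τ) = (Q.comapAut σ).comapAut τ :=
  ext' (ValuationSubring.ext _ _ fun f => by simp [mem_comapAut])

theorem comapAut_one (Q : Place k F) : Q.comapAut 1 = Q :=
  ext' (ValuationSubring.ext _ _ fun f => by simp [mem_comapAut])

theorem isFixedBy_iff (σ : F ≃ₐ[k] F) (Q : Place k F) :
    Q.IsFixedBy σ ↔ Q.comapAut σ = Q :=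
  ⟨fun h => ext' h, fun h => congrArg Place.ring h⟩

theorem ramificationIdx_aut (σ : F ≃ₐ[k] F) (Q : Place k F) :
    Q.ramificationIdx σ.toAlgHom (Q.comapAut σ) = 1 := by
  have h := (Q.comapAut_liesOver σ).ord_eq (σ.symm Q.uniformizer)
  have h2 : σ.toAlgHom (σ.symm Q.uniformizer) = Q.uniformizer := σ.apply_symm_apply _
  rw [h2, ord_uniformizer] at h
  have : (Q.ramificationIdx σ.toAlgHom (Q.comapAut σ) : ℤ) ∣ 1 := ⟨_, h⟩
  exact_mod_cast Int.eq_one_of_dvd_one (by positivity) this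

theorem ord_comapAut (σ : F ≃ₐ[k] F) (Q : Place k F) (f : F) :
    (Q.comapAut σ).ord f = Q.ord (σ f) := by
  have h := (Q.comapAut_liesOver σ).ord_eq f
  rw [ramificationIdx_aut, Nat.cast_one, one_mul] at h
  exact h.symm

theorem inertiaDeg_aut (σ : F ≃ₐ[k] F) (Q : Place k F) :
    Q.inertiaDeg σ.toAlgHom (Q.comapAut σ) = 1 := by
  rw [inertiaDeg, dif_pos (Q.comapAut_liesOver σ)]
  let _ := (Q.comapAut_liesOver σ).residueMap.toAlgebra
  have hs : Function.Surjective (algebraMap (Q.comapAut σ).Residue Q.Residue) := by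
    intro z
    obtain ⟨z, rfl⟩ := IsLocalRing.residue_surjective z
    refine ⟨IsLocalRing.residue _ ⟨σ.symm z, ?_⟩, ?_⟩
    · rw [mem_comapAut, AlgEquiv.apply_symm_apply]; exact z.2
    · change IsLocalRing.residue Q.ring ((Q.comapAut_liesOver σ).ringHom _) = _
      congr 1
      apply Subtype.ext
      exact σ.apply_symm_apply _
  have e := AlgEquiv.ofBijective (Algebra.ofId (Q.comapAut σ).Residue Q.Residue)
    ⟨(algebraMap (Q.comapAut σ).Residue Q.Residue).injective, hs⟩
  rw [← e.toLinearEquiv.finrank_eq, Module.finrank_self]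

section Galois

variable [Algebra E F] [IsScalarTower k E F] [FiniteDimensional E F]

theorem restrictScalars_mul (σ τ : F ≃ₐ[E] F) :
    (σ * τ).restrictScalars k = σ.restrictScalars k * τ.restrictScalars k := rfl

theorem LiesOver.comapAut {P : Place k E} {Q : Place k F}
    (h : Q.LiesOver (IsScalarTower.toAlgHom k E F) P) (σ : F ≃ₐ[E] F) :
    (Q.comapAut (σ.restrictScalars k)).LiesOver (IsScalarTower.toAlgHom k E F) P := by
  rw [← h.unique h]
  refine liesOver_of_le isIntegral_toAlgHom fun f hf => ?_
  rw [mem_comapAut]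
  have : (σ.restrictScalars k) (IsScalarTower.toAlgHom k E F f) =
    IsScalarTower.toAlgHom k E F f := σ.commutes f
  rw [this, h.mem_iff]
  exact hf

theorem toAlgHom_comp_aut (σ : F ≃ₐ[E] F) :
    (σ.restrictScalars k).toAlgHom.comp (IsScalarTower.toAlgHom k E F) =
      IsScalarTower.toAlgHom k E F := by
  ext e
  exact σ.commutes e

theorem ramificationIdx_comapAut {P : Place k E} {Q : Place k F}
    (h : Q.LiesOver (IsScalarTower.toAlgHom k E F) P) (σ : F ≃ₐ[E] F) :
    (Q.comapAut (σ.restrictScalars k)).ramificationIdx (IsScalarTower.toAlgHom k E F) P =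
      Q.ramificationIdx (IsScalarTower.toAlgHom k E F) P := by
  have := ramificationIdx_comp (Q.comapAut_liesOver (σ.restrictScalars k)) (h.comapAut σ)
  rw [ramificationIdx_aut, one_mul, toAlgHom_comp_aut] at this
  exact this.symm

theorem inertiaDeg_comapAut {P : Place k E} {Q : Place k F}
    (h : Q.LiesOver (IsScalarTower.toAlgHom k E F) P) (σ : F ≃ₐ[E] F) :
    (Q.comapAut (σ.restrictScalars k)).inertiaDeg (IsScalarTower.toAlgHom k E F) P =
      Q.inertiaDeg (IsScalarTower.toAlgHom k E F) P := by
  have := inertiaDeg_comp (Q.comapAut_liesOver (σ.restrictScalars k)) (h.comapAut σ)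
  rw [inertiaDeg_aut, one_mul, toAlgHom_comp_aut] at this
  exact this.symm

theorem ord_finset_prod {ι : Type*} (Q : Place k F) (s : Finset ι) (f : ι → F)
    (hf : ∀ i ∈ s, f i ≠ 0) : Q.ord (∏ i ∈ s, f i) = ∑ i ∈ s, Q.ord (f i) := by
  classical
  induction s using Finset.induction_on with
  | empty => simp [ord_one]
  | insert a s ha ih =>
    rw [Finset.prod_insert ha, Finset.sum_insert ha, Q.ord_mul (hf a (Finset.mem_insert_self _ _))
      (Finset.prod_ne_zero_iff.2 fun i hi => hf i (Finset.mem_insert_of_mem hi)),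
      ih fun i hi => hf i (Finset.mem_insert_of_mem hi)]

variable [IsGalois E F]

/-- The Galois group acts transitively on the points above `P`: otherwise there is a function
that vanishes at `Q'` and at no conjugate of `Q`, and its norm has a zero at `P` and no zero
at `P`. -/
theorem exists_comapAut_eq {P : Place k E} {Q Q' : Place k F}
    (h : Q.LiesOver (IsScalarTower.toAlgHom k E F) P)
    (h' : Q'.LiesOver (IsScalarTower.toAlgHom k E F) P) :
    ∃ σ : F ≃ₐ[E] F, Q.comapAut (σ.restrictScalars k) = Q' := by
  classical
  by_contra! hne
  have := isDedekindDomain_integralClosure (F := F) P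
  have := isFractionRing_integralClosure (F := F) P
  obtain ⟨f, hf, -⟩ := exists_approx (integralClosure P.ring F) (finite_liesOver (F := F) P)
    (fun R hR => (liesOver_iff_integralClosure R P).1 hR) (fun R => if R = Q' then 0 else 1) 1
  have hlt : WithZero.exp (-((1 : ℕ) : ℤ)) < (1 : WithZero (Multiplicative ℤ)) := by
    rw [← WithZero.exp_zero, WithZero.exp_lt_exp]; norm_num
  have hone : ∀ R : Place k F, R.LiesOver (IsScalarTower.toAlgHom k E F) P → R ≠ Q' →
      f ≠ 0 ∧ R.ord f = 0 := by
    intro R hR hRQ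
    have h1 := (hf R hR).trans_lt hlt
    rw [if_neg hRQ] at h1
    have h2 : R.val f = 1 := by
      have := R.val.map_one_add_of_lt h1
      rwa [add_sub_cancel] at this
    have hf0 : f ≠ 0 := by rintro rfl; simp at h2
    refine ⟨hf0, ?_⟩
    rw [ord_def, h2]; simp
  have hQ := hone Q h fun hQ => hne 1 (by rw [← hQ]; exact comapAut_one Q)
  have hf0 := hQ.1
  have hpos : 0 < Q'.ord f := by
    have h1 := (hf Q' h').trans_lt hlt
    rw [if_pos rfl, sub_zero, Q'.val_eq_exp hf0, ← WithZero.exp_zero, WithZero.exp_lt_exp] at h1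
    omega
  -- `ord_R N(f)` is the sum of the orders of `f` at the conjugates of `R`
  have hnorm : ∀ R : Place k F, R.ord (IsScalarTower.toAlgHom k E F (Algebra.norm E f)) =
      ∑ σ : F ≃ₐ[E] F, (R.comapAut (σ.restrictScalars k)).ord f := by
    intro R
    have h1 : IsScalarTower.toAlgHom k E F (Algebra.norm E f) = ∏ σ : F ≃ₐ[E] F, σ f :=
      Algebra.norm_eq_prod_automorphisms E f
    rw [h1, ord_finset_prod _ _ _ fun σ _ => by simpa using hf0]
    exact Finset.sum_congr rfl fun σ _ => (ord_comapAut (σ.restrictScalars k) R f).symm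
  have h1 := hnorm Q
  rw [Finset.sum_eq_zero fun σ _ => (hone _ (h.comapAut σ) (hne σ)).2, h.ord_eq] at h1
  have h2 := hnorm Q'
  have h3 : (Q.ramificationIdx (IsScalarTower.toAlgHom k E F) P : ℤ) ≠ 0 := by
    have := h.ramificationIdx_pos
    exact_mod_cast this.ne'
  have h4 : P.ord (Algebra.norm E f) = 0 := (mul_eq_zero.1 h1).resolve_left h3
  rw [h'.ord_eq, h4, mul_zero] at h2
  have h5 : 0 < ∑ σ : F ≃ₐ[E] F, (Q'.comapAut (σ.restrictScalars k)).ord f := by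
    refine Finset.sum_pos' (fun σ _ => ?_) ⟨1, Finset.mem_univ _, ?_⟩
    · by_cases hc : Q'.comapAut (σ.restrictScalars k) = Q'
      · rw [hc]; exact hpos.le
      · rw [(hone _ (h'.comapAut σ) hc).2]
    · have : Q'.comapAut ((1 : F ≃ₐ[E] F).restrictScalars k) = Q' := comapAut_one Q'
      rw [this]; exact hpos
  omega

open Classical in
/-- The elements of the Galois group that map `Q` to a given point of its orbit are `e f` in
number. -/
theorem card_comapAut_eq {P : Place k E} {Q Q' : Place k F}
    (h : Q.LiesOver (IsScalarTower.toAlgHom k E F) P)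
    (h' : Q'.LiesOver (IsScalarTower.toAlgHom k E F) P) :
    (Finset.univ.filter fun σ : F ≃ₐ[E] F => Q.comapAut (σ.restrictScalars k) = Q').card =
      Q.ramificationIdx (IsScalarTower.toAlgHom k E F) P *
        Q.inertiaDeg (IsScalarTower.toAlgHom k E F) P := by
  set N : Place k F → ℕ := fun R =>
    (Finset.univ.filter fun σ : F ≃ₐ[E] F => Q.comapAut (σ.restrictScalars k) = R).card with hN
  have hmul : ∀ (σ τ : F ≃ₐ[E] F), Q.comapAut ((σ * τ).restrictScalars k) =
      (Q.comapAut (σ.restrictScalars k)).comapAut (τ.restrictScalars k) := fun σ τ => by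
    rw [restrictScalars_mul, comapAut_mul]
  -- the number is the same for all points of the orbit, and the numbers add up to `[F : E] = r e f`
  have hconst : ∀ R, R.LiesOver (IsScalarTower.toAlgHom k E F) P → N R = N Q' := by
    intro R hR
    obtain ⟨τ, hτ⟩ := exists_comapAut_eq hR h'
    have hinj : ∀ R', R'.comapAut (τ.restrictScalars k) = Q' → R' = R := by
      intro R' hR'
      have h1 : (τ.restrictScalars k) * (τ⁻¹.restrictScalars k) = 1 := by
        rw [← restrictScalars_mul, mul_inv_cancel]; rfl
      rw [← comapAut_one R', ← comapAut_one R, ← h1, comapAut_mul, comapAut_mul, hR', hτ]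
    refine Finset.card_equiv (Equiv.mulRight τ) fun σ => ?_
    rw [Finset.mem_filter, Finset.mem_filter, Equiv.coe_mulRight, hmul]
    simp only [Finset.mem_univ, true_and]
    exact ⟨fun h => by rw [h, hτ], fun h => hinj _ h⟩
  set S := (finite_liesOver (F := F) P).toFinset with hS
  have hS' : ∀ R, R ∈ S ↔ R.LiesOver (IsScalarTower.toAlgHom k E F) P := fun R =>
    (finite_liesOver (F := F) P).mem_toFinset
  have h1 : ∑ R ∈ S, N R = Fintype.card (F ≃ₐ[E] F) := by
    rw [← Finset.card_univ]
    exact (Finset.card_eq_sum_card_fiberwise fun σ _ => by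
      rw [Finset.mem_coe, hS']
      exact h.comapAut σ).symm
  have h2 := sum_ramificationIdx_mul_inertiaDeg (F := F) P S hS'
  rw [Finset.sum_congr rfl fun R hR => hconst R ((hS' R).1 hR), Finset.sum_const] at h1
  have hef : ∀ R ∈ S, R.ramificationIdx (IsScalarTower.toAlgHom k E F) P *
      R.inertiaDeg (IsScalarTower.toAlgHom k E F) P =
      Q.ramificationIdx (IsScalarTower.toAlgHom k E F) P *
        Q.inertiaDeg (IsScalarTower.toAlgHom k E F) P := by
    intro R hR
    obtain ⟨τ, rfl⟩ := exists_comapAut_eq h ((hS' R).1 hR)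
    rw [ramificationIdx_comapAut h, inertiaDeg_comapAut h]
  rw [Finset.sum_congr rfl hef, Finset.sum_const, ← IsGalois.card_aut_eq_finrank,
    Nat.card_eq_fintype_card, ← h1] at h2
  have hcard : 0 < S.card := Finset.card_pos.2 ⟨Q, (hS' Q).2 h⟩
  simp only [smul_eq_mul] at h2
  exact (Nat.eq_of_mul_eq_mul_left hcard h2).symm

end Galois

end Place

end

section

/-! ### Pull-back and push-forward of divisors -/


open IsDedekindDomain Place

theorem AddMonoid.End.cubic_apply {G : Type*} [AddCommGroup G] (T : AddMonoid.End G) (c : G) :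
    (T ^ 3 + T ^ 2 - 2 * T - 1 : AddMonoid.End G) c = T (T (T c)) + T (T c) - (T c + T c) - c := by
  rw [two_mul]
  rfl

section Divisors

variable {k E F H : Type*} [Field k] [Field E] [Field F] [Field H] [Algebra k E] [Algebra k F]
  [Algebra k H]

/-- The coefficient of the pull-back at `Q` is `e` times the coefficient at the point below `Q`. The
finiteness of the fibres excludes the junk value of the `finsum` in the definition. -/
theorem divisorPullback_apply {i : E →ₐ[k] F} (hfin : ∀ P, {Q : Place k F | Q.LiesOver i P}.Finite)
    (D : CurveDivisor k E) {Q : Place k F} {P : Place k E} (h : Q.LiesOver i P) :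
    divisorPullback i D Q = Q.ramificationIdx i P * D P := by
  classical
  have hsum : ∀ P' : Place k E,
      (∑ᶠ Q : Place k F, Finsupp.single Q (Q.ramificationIdx i P' : ℤ)) Q =
        (Q.ramificationIdx i P' : ℤ) := by
    intro P'
    have hsupp : (Function.support fun Q : Place k F =>
        Finsupp.single Q (Q.ramificationIdx i P' : ℤ)) ⊆ ((hfin P').toFinset : Set _) := by
      intro R hR
      rw [Set.Finite.coe_toFinset]
      by_contra hc
      apply hR
      simp only [Set.mem_ofPred_eq] at hc
      simp [ramificationIdx, if_neg hc]
    rw [finsum_eq_sum_of_support_subset _ hsupp, Finsupp.finsetSum_apply]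
    by_cases hQ : Q ∈ (hfin P').toFinset
    · rw [Finset.sum_eq_single_of_mem Q hQ]
      · simp
      · intro R _ hR
        rw [Finsupp.single_apply, if_neg hR]
    · rw [Finset.sum_eq_zero]
      · rw [Set.Finite.mem_toFinset] at hQ
        simp only [Set.mem_ofPred_eq] at hQ
        simp [ramificationIdx, if_neg hQ]
      · intro R hR
        rw [Finsupp.single_apply, if_neg]
        rintro rfl
        exact hQ hR
  induction D using Finsupp.induction_linear with
  | zero => simp
  | add D D' h1 h2 => rw [map_add, Finsupp.add_apply, h1, h2, Finsupp.add_apply, mul_add]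
  | single P' n =>
    rw [divisorPullback, Finsupp.liftAddHom_apply_single, zmultiplesHom_apply, Finsupp.smul_apply,
      hsum, smul_eq_mul, mul_comm]
    by_cases hP : P' = P
    · subst hP; simp
    · rw [Finsupp.single_apply, if_neg hP, ramificationIdx, if_neg]
      · simp
      · intro hc
        exact hP (hc.unique h)

theorem divisorPushforward_single {i : E →ₐ[k] F} {Q : Place k F} {P : Place k E}
    (h : Q.LiesOver i P) (n : ℤ) :
    divisorPushforward i (Finsupp.single Q n) = Finsupp.single P (n * Q.inertiaDeg i P) := by
  rw [divisorPushforward, Finsupp.liftAddHom_apply_single, zmultiplesHom_apply,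
    finsum_eq_single _ P]
  · rw [Finsupp.smul_single, smul_eq_mul]
  · intro P' hP'
    rw [inertiaDeg, dif_neg]
    · simp
    · intro hc
      exact hP' (hc.unique h)

theorem divisorPushforward_comp {i : E →ₐ[k] F} (j : F →ₐ[k] H)
    (hi : (i : E →+* F).IsIntegral) (hj : (j : F →+* H).IsIntegral) (D : CurveDivisor k H) :
    divisorPushforward (j.comp i) D = divisorPushforward i (divisorPushforward j D) := by
  induction D using Finsupp.induction_linear with
  | zero => simp
  | add D D' h1 h2 => simp only [map_add, h1, h2]
  | single S n =>
    rw [divisorPushforward_single (S.liesOver_below j hj),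
      divisorPushforward_single ((S.below j hj).liesOver_below i hi),
      divisorPushforward_single ((S.liesOver_below j hj).comp ((S.below j hj).liesOver_below i hi)),
      inertiaDeg_comp (S.liesOver_below j hj) ((S.below j hj).liesOver_below i hi)]
    push_cast
    rw [mul_assoc]

theorem divisorPushforward_aut (σ : F ≃ₐ[k] F) (Q : Place k F) (n : ℤ) :
    divisorPushforward σ.toAlgHom (Finsupp.single Q n) = Finsupp.single (Q.comapAut σ) n := by
  rw [divisorPushforward_single (Q.comapAut_liesOver σ), inertiaDeg_aut]
  simp

theorem comapAut_symm_comapAut (σ : F ≃ₐ[k] F) (Q : Place k F) :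
    (Q.comapAut σ).comapAut σ⁻¹ = Q := by
  rw [← comapAut_mul, mul_inv_cancel, comapAut_one]

theorem divisorPushforward_aut_apply (σ : F ≃ₐ[k] F) (D : CurveDivisor k F) (Q : Place k F) :
    divisorPushforward σ.toAlgHom D Q = D (Q.comapAut σ⁻¹) := by
  classical
  induction D using Finsupp.induction_linear with
  | zero => simp
  | add D D' h1 h2 => rw [map_add, Finsupp.add_apply, h1, h2, Finsupp.add_apply]
  | single Q' n =>
    rw [divisorPushforward_aut, Finsupp.single_apply, Finsupp.single_apply]
    congr 1
    rw [eq_iff_iff]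
    constructor
    · rintro rfl; rw [comapAut_symm_comapAut]
    · rintro rfl
      have := comapAut_symm_comapAut σ⁻¹ Q
      rwa [inv_inv] at this

theorem degree_single (Q : Place k F) (n : ℤ) :
    CurveDivisor.degree k F (Finsupp.single Q n) = n * Q.deg := by
  rw [CurveDivisor.degree, Finsupp.liftAddHom_apply_single, zmultiplesHom_apply, smul_eq_mul]

theorem degree_divisorPushforward {i : E →ₐ[k] F} (hi : (i : E →+* F).IsIntegral)
    (D : CurveDivisor k F) :
    CurveDivisor.degree k E (divisorPushforward i D) = CurveDivisor.degree k F D := by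
  induction D using Finsupp.induction_linear with
  | zero => simp
  | add D D' h1 h2 => simp only [map_add, h1, h2]
  | single S n =>
    rw [divisorPushforward_single (S.liesOver_below i hi), degree_single, degree_single,
      (S.liesOver_below i hi).deg_eq]
    push_cast
    ring

theorem divisorPullback_mem_principal {i : E →ₐ[k] F} (hi : (i : E →+* F).IsIntegral)
    (hfin : ∀ P, {Q : Place k F | Q.LiesOver i P}.Finite) {D : CurveDivisor k E}
    (hD : D ∈ principalDivisors k E) : divisorPullback i D ∈ principalDivisors k F := by
  obtain ⟨f, hf, hDf⟩ := hD
  refine ⟨i f, by simpa using hf, fun Q => ?_⟩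
  rw [divisorPullback_apply hfin D (Q.liesOver_below i hi), hDf, (Q.liesOver_below i hi).ord_eq]

theorem divisorPushforward_aut_mem_principal (σ : F ≃ₐ[k] F) {D : CurveDivisor k F}
    (hD : D ∈ principalDivisors k F) :
    divisorPushforward σ.toAlgHom D ∈ principalDivisors k F := by
  obtain ⟨f, hf, hDf⟩ := hD
  refine ⟨σ⁻¹ f, by simpa using hf, fun Q => ?_⟩
  rw [divisorPushforward_aut_apply, hDf, ord_comapAut]

section Tower

variable [Algebra E F] [IsScalarTower k E F] [FiniteDimensional E F] [Algebra.IsSeparable E F]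

local notation "ι" => (IsScalarTower.toAlgHom k E F)

theorem divisorPullback_apply' (D : CurveDivisor k E) {Q : Place k F} {P : Place k E}
    (h : Q.LiesOver ι P) : divisorPullback ι D Q = Q.ramificationIdx ι P * D P :=
  divisorPullback_apply finite_liesOver D h

theorem divisorPullback_single (P : Place k E) (n : ℤ) :
    divisorPullback ι (Finsupp.single P n) =
      ∑ Q ∈ (finite_liesOver (F := F) P).toFinset, Finsupp.single Q (n * Q.ramificationIdx ι P) := by
  classical
  ext Q
  rw [divisorPullback_apply' _ (Q.liesOver_below ι isIntegral_toAlgHom), Finsupp.finsetSum_apply]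
  by_cases hQ : Q.LiesOver ι P
  · have hQP : Q.below ι isIntegral_toAlgHom = P := (Q.liesOver_below ι _).unique hQ
    rw [hQP, Finset.sum_eq_single_of_mem Q ((finite_liesOver P).mem_toFinset.2 hQ)]
    · simp [mul_comm]
    · intro R _ hR
      rw [Finsupp.single_apply, if_neg hR]
  · rw [Finset.sum_eq_zero, Finsupp.single_apply, if_neg, mul_zero]
    · rintro rfl
      exact hQ (Q.liesOver_below ι isIntegral_toAlgHom)
    · intro R hR
      rw [Finsupp.single_apply, if_neg]
      rintro rfl
      exact hQ ((finite_liesOver P).mem_toFinset.1 hR)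

/-- Going up and down multiplies a divisor by the degree of the covering, as `∑ e f = n`. -/
theorem divisorPushforward_divisorPullback (D : CurveDivisor k E) :
    divisorPushforward ι (divisorPullback ι D) = Module.finrank E F • D := by
  induction D using Finsupp.induction_linear with
  | zero => simp
  | add D D' h1 h2 => simp only [map_add, h1, h2, smul_add]
  | single P n =>
    rw [divisorPullback_single, map_sum]
    rw [Finset.sum_congr rfl fun Q hQ =>
      divisorPushforward_single ((finite_liesOver P).mem_toFinset.1 hQ) _]
    rw [← Finsupp.single_finsetSum, Finsupp.smul_single]
    congr 1
    rw [← sum_ramificationIdx_mul_inertiaDeg (F := F) P _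
      (fun Q => (finite_liesOver (F := F) P).mem_toFinset), nsmul_eq_mul]
    push_cast
    rw [Finset.sum_mul]
    refine Finset.sum_congr rfl fun Q _ => by ring

theorem degree_divisorPullback (D : CurveDivisor k E) :
    CurveDivisor.degree k F (divisorPullback ι D) =
      Module.finrank E F * CurveDivisor.degree k E D := by
  rw [← degree_divisorPushforward (i := ι) isIntegral_toAlgHom, divisorPushforward_divisorPullback,
    map_nsmul, nsmul_eq_mul]

theorem divisorPullback_comp {i : E →ₐ[k] F} {j : F →ₐ[k] H}
    (hi : (i : E →+* F).IsIntegral) (hj : (j : F →+* H).IsIntegral)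
    (hfi : ∀ P, {Q : Place k F | Q.LiesOver i P}.Finite)
    (hfj : ∀ P, {Q : Place k H | Q.LiesOver j P}.Finite)
    (hfij : ∀ P, {Q : Place k H | Q.LiesOver (j.comp i) P}.Finite) (D : CurveDivisor k E) :
    divisorPullback (j.comp i) D = divisorPullback j (divisorPullback i D) := by
  ext S
  have h1 := S.liesOver_below j hj
  have h2 := (S.below j hj).liesOver_below i hi
  rw [divisorPullback_apply hfij _ (h1.comp h2), divisorPullback_apply hfj _ h1,
    divisorPullback_apply hfi _ h2, ramificationIdx_comp h1 h2]
  push_cast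
  ring

variable [IsGalois E F]

/-- Going down and up a Galois covering is the sum of the conjugates. -/
theorem divisorPullback_divisorPushforward (D : CurveDivisor k F) :
    divisorPullback ι (divisorPushforward ι D) =
      ∑ σ : F ≃ₐ[E] F, divisorPushforward (σ.restrictScalars k).toAlgHom D := by
  classical
  induction D using Finsupp.induction_linear with
  | zero => simp
  | add D D' h1 h2 => simp only [map_add, h1, h2, Finset.sum_add_distrib]
  | single Q n =>
    have hQ := Q.liesOver_below ι isIntegral_toAlgHom
    set P := Q.below ι isIntegral_toAlgHom with hP
    rw [divisorPushforward_single hQ]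
    ext R
    have hR := R.liesOver_below ι isIntegral_toAlgHom
    rw [divisorPullback_apply' _ hR, Finset.sum_congr rfl fun σ _ => divisorPushforward_aut _ _ _,
      Finsupp.finsetSum_apply]
    simp only [Finsupp.single_apply]
    by_cases hRP : R.LiesOver ι P
    · rw [hRP.unique hR, if_pos rfl, ← Finset.sum_filter, Finset.sum_const,
        card_comapAut_eq hQ hRP, nsmul_eq_mul]
      obtain ⟨σ, rfl⟩ := exists_comapAut_eq hQ hRP
      rw [← hRP.unique hR, ramificationIdx_comapAut hQ]
      push_cast
      ring
    · rw [if_neg, Finset.sum_eq_zero, mul_zero]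
      · intro σ _
        rw [if_neg]
        rintro rfl
        exact hRP (hQ.comapAut σ)
      · intro hc
        apply hRP
        rw [hc]
        exact hR

/-- The push-forward of the divisor of `f` is the divisor of the norm of `f`. -/
theorem divisorPushforward_mem_principal {D : CurveDivisor k F}
    (hD : D ∈ principalDivisors k F) : divisorPushforward ι D ∈ principalDivisors k E := by
  obtain ⟨f, hf, hDf⟩ := hD
  refine ⟨Algebra.norm E f, by rwa [Ne, Algebra.norm_eq_zero_iff], fun P => ?_⟩
  obtain ⟨Q, hQ⟩ := exists_liesOver (F := F) P
  have h1 := DFunLike.congr_fun (divisorPullback_divisorPushforward (E := E) D) Q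
  rw [divisorPullback_apply' _ hQ, Finsupp.finsetSum_apply] at h1
  have h2 : Q.ord (ι (Algebra.norm E f)) = ∑ σ : F ≃ₐ[E] F, Q.ord (σ f) := by
    have h3 : ι (Algebra.norm E f) = ∏ σ : F ≃ₐ[E] F, σ f :=
      Algebra.norm_eq_prod_automorphisms E f
    rw [h3, ord_finset_prod _ _ _ fun σ _ => by simpa using hf]
  rw [hQ.ord_eq] at h2
  have := hQ.ramificationIdx_pos
  refine mul_left_cancel₀ (a := (Q.ramificationIdx ι P : ℤ)) (by exact_mod_cast this.ne') ?_
  rw [h1, h2, ← Equiv.sum_comp (Equiv.inv (F ≃ₐ[E] F))]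
  refine Finset.sum_congr rfl fun σ _ => ?_
  rw [divisorPushforward_aut_apply, hDf, ord_comapAut]
  rfl

end Tower

/-! ### Correspondences on curves with a dihedral group -/

/-- The computation with the group ring of the dihedral group of order `14`, for the action on
divisors: `T ^ 3 + T ^ 2 - 2 T - 1` is the action of the fibres of the map to the quotient by the
whole group. -/
theorem dihedral_correspondence {A B : Type*} [AddCommGroup A] [AddCommGroup B]
    (hB : ∀ b : B, (2 : ℤ) • b = 0 → b = 0) (push : A →+ B) (pull : B →+ A) (r t : A →+ A)
    (c : B →+ B) (h1 : ∀ a, pull (push a) = a + t a) (h2 : ∀ b, push (pull b) = (2 : ℤ) • b)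
    (h3 : ∀ a, push (t a) = push a) (h4 : ∀ b, t (pull b) = pull b)
    (h5 : ∀ a, r (t (r a)) = t a) (h6 : ∀ a, r (r (r (r (r (r (r a)))))) = a)
    (h7 : ∀ a, pull (c (push a)) = ∑ j ∈ Finset.range 7, r^[j] (a + t a)) (b : B) :
    push (r (pull (push (r (pull (push (r (pull b)))))))) +
      push (r (pull (push (r (pull b))))) - (2 : ℤ) • push (r (pull b)) - b = c b := by
  have key : ∀ a, push (r (pull (push (r a)))) = push (r (r a)) + push (t a) := by
    intro a
    rw [h1, map_add, h5, map_add]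
  have e2 : push (r (pull (push (r (pull b))))) = push (r (r (pull b))) + (2 : ℤ) • b := by
    rw [key, h4, h2]
  have e3 : push (r (pull (push (r (r (pull b)))))) =
      push (r (r (r (pull b)))) + push (r (pull b)) := by
    rw [key, h3]
  -- `t r^j = r^(7-j)` on elements invariant under `t`
  have i1 : t (r (pull b)) = r (r (r (r (r (r (pull b)))))) := by
    rw [← h6 (t (r (pull b))), h5, h4]
  have i2 : t (r (r (pull b))) = r (r (r (r (r (pull b))))) := by
    rw [← h6 (t (r (r (pull b)))), h5, h5, h4]
  have i3 : t (r (r (r (pull b)))) = r (r (r (r (pull b)))) := by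
    rw [← h6 (t (r (r (r (pull b))))), h5, h5, h5, h4]
  have j1 := h3 (r (pull b))
  have j2 := h3 (r (r (pull b)))
  have j3 := h3 (r (r (r (pull b))))
  rw [i1] at j1
  rw [i2] at j2
  rw [i3] at j3
  -- `r ^ j` and `r ^ (7 - j)` of an element invariant under `t` have the same image under `push`
  have h8 := congrArg push (h7 (pull b))
  rw [h2, h2, h4] at h8
  simp only [Finset.sum_range_succ, Finset.sum_range_zero, Function.iterate_succ,
    Function.iterate_zero, Function.comp_apply, id, map_add, zero_add, map_zsmul] at h8
  rw [j1, j2, j3, h2] at h8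
  have h9 : c b = b + push (r (pull b)) + push (r (r (pull b))) + push (r (r (r (pull b)))) := by
    rw [← sub_eq_zero]
    apply hB
    apply hB
    rw [smul_sub, smul_sub, h8]
    module
  rw [e2, map_add, map_add, map_add, e3, map_zsmul, map_zsmul, map_zsmul, h9]
  module

/-- Three curves `X → Y → Z`, where `X → Z` is Galois with dihedral group of order `14` generated
by `ρ` and `τ`, `Y = X / ⟨τ⟩`, and every divisor of degree `0` on `Z` is principal. The
correspondence on `Y` defined by `ρ` satisfies the equation of `ζ₇ + ζ₇⁻¹`. -/
theorem exists_endomorphism_of_dihedral [Algebra E F] [Algebra F H] [Algebra E H]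
    [IsScalarTower k E F] [IsScalarTower k F H] [IsScalarTower k E H] [IsScalarTower E F H]
    [FiniteDimensional E H] [FiniteDimensional F H]
    [IsGalois E H] [IsGalois F H] (ρ τ : H ≃ₐ[E] H)
    (hFH : Module.finrank F H = 2)
    (hτF : ∀ f : F, τ (algebraMap F H f) = algebraMap F H f)
    (hρ : ρ ^ 7 = 1) (hρτ : ρ * τ * ρ = τ)
    (hbij : ∀ g : (H ≃ₐ[E] H) → CurveDivisor k H, ∑ σ, g σ =
      ∑ j ∈ Finset.range 7, (g (ρ ^ j) + g (τ * ρ ^ j)))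
    (hF : ∀ g : (H ≃ₐ[F] H) → CurveDivisor k H, ∃ τ' : H ≃ₐ[F] H, (∀ h, τ' h = τ h) ∧
      ∑ σ, g σ = g 1 + g τ')
    (hE : ∀ D : CurveDivisor k E, CurveDivisor.degree k E D = 0 → D ∈ principalDivisors k E) :
    ∃ T : AddMonoid.End (CurvePicZero k F),
      IsInducedByCorrespondence (IsScalarTower.toAlgHom k F H)
        ((ρ.restrictScalars k).toAlgHom.comp (IsScalarTower.toAlgHom k F H)) T ∧
      T ^ 3 + T ^ 2 - 2 * T - 1 = 0 := by
  have hfdE : FiniteDimensional E F := FiniteDimensional.left E F H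
  have hsepE : Algebra.IsSeparable E F := Algebra.isSeparable_tower_bot_of_isSeparable E F H
  let i := IsScalarTower.toAlgHom k F H
  let m := IsScalarTower.toAlgHom k E F
  have hi : (i : F →+* H).IsIntegral := isIntegral_toAlgHom
  have hm : (m : E →+* F).IsIntegral := isIntegral_toAlgHom
  have haut : ∀ σ : H ≃ₐ[k] H, (σ.toAlgHom : H →+* H).IsIntegral := fun σ f => by
    rw [← σ.apply_symm_apply f]
    exact RingHom.isIntegralElem_map _
  let j := (ρ.restrictScalars k).toAlgHom.comp i
  have hmi : i.comp m = IsScalarTower.toAlgHom k E H := by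
    ext e
    exact (IsScalarTower.algebraMap_apply E F H e).symm
  let push := divisorPushforward i
  let pull := divisorPullback i
  let r := divisorPushforward (ρ.restrictScalars k).toAlgHom
  let t := divisorPushforward (τ.restrictScalars k).toAlgHom
  have hmul : ∀ (σ σ' : H ≃ₐ[E] H) (D : CurveDivisor k H),
      divisorPushforward ((σ * σ').restrictScalars k).toAlgHom D =
      divisorPushforward (σ'.restrictScalars k).toAlgHom
        (divisorPushforward (σ.restrictScalars k).toAlgHom D) := by
    intro σ σ' D
    have h : ((σ * σ').restrictScalars k).toAlgHom =
        (σ.restrictScalars k).toAlgHom.comp (σ'.restrictScalars k).toAlgHom :=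
      AlgHom.ext fun _ => rfl
    rw [h]
    exact divisorPushforward_comp _ (haut _) (haut _) D
  have hone : ∀ D : CurveDivisor k H,
      divisorPushforward ((1 : H ≃ₐ[E] H).restrictScalars k).toAlgHom D = D := by
    intro D
    ext Q
    have h1 : (1 : H ≃ₐ[E] H).restrictScalars k = (1 : H ≃ₐ[k] H) := rfl
    rw [h1, divisorPushforward_aut_apply, inv_one, comapAut_one]
  have hpow : ∀ (n : ℕ) (D : CurveDivisor k H),
      divisorPushforward ((ρ ^ n).restrictScalars k).toAlgHom D = r^[n] D := by
    intro n
    induction n with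
    | zero => intro D; rw [pow_zero, hone]; rfl
    | succ n ih => intro D; rw [pow_succ, hmul, ih, Function.iterate_succ_apply']
  let Tdiv : CurveDivisor k F →+ CurveDivisor k F := divisorCorrespondence i j
  have hT : ∀ D, Tdiv D = push (r (pull D)) := fun D =>
    divisorPushforward_comp _ hi (haut _) _
  -- `c` factors through the divisors on `Z`, so it kills the classes of degree `0`
  let c : CurveDivisor k F →+ CurveDivisor k F := (divisorPullback m).comp (divisorPushforward m)
  have hc0 : ∀ D, CurveDivisor.degree k F D = 0 → c D ∈ principalDivisors k F := by
    intro D hD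
    refine divisorPullback_mem_principal hm finite_liesOver (hE _ ?_)
    rw [degree_divisorPushforward hm, hD]
  have hTprin : ∀ D ∈ principalDivisors k F, Tdiv D ∈ principalDivisors k F := by
    intro D hD
    rw [hT]
    exact divisorPushforward_mem_principal (divisorPushforward_aut_mem_principal _
      (divisorPullback_mem_principal hi finite_liesOver hD))
  have hTdeg : ∀ D, CurveDivisor.degree k F D = 0 → CurveDivisor.degree k F (Tdiv D) = 0 := by
    intro D hD
    rw [hT, degree_divisorPushforward hi, degree_divisorPushforward (haut _),
      degree_divisorPullback, hD, mul_zero]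
  have hτi : (τ.restrictScalars k).toAlgHom.comp i = i := by
    ext f
    exact hτF f
  have heq : ∀ D, Tdiv (Tdiv (Tdiv D)) + Tdiv (Tdiv D) - (2 : ℤ) • Tdiv D - D = c D := by
    intro D
    simp only [hT]
    refine dihedral_correspondence (fun b hb => ?_) push pull r t c ?_ ?_ ?_ ?_ ?_ ?_ ?_ D
    · exact (smul_eq_zero.1 hb).resolve_left (by norm_num)
    · intro a
      change divisorPullback _ (divisorPushforward _ a) = _
      rw [divisorPullback_divisorPushforward]
      obtain ⟨τ', h1, h2⟩ := hF fun σ => divisorPushforward (σ.restrictScalars k).toAlgHom a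
      rw [h2]
      have h3 : τ'.restrictScalars k = τ.restrictScalars k := by ext h; exact h1 h
      rw [h3]
      exact congrArg₂ (· + ·) (hone a) rfl
    · intro b
      have := divisorPushforward_divisorPullback (k := k) (E := F) (F := H) b
      rw [hFH] at this
      rw [← Nat.cast_smul_eq_nsmul ℤ] at this
      exact this
    · intro a
      have := divisorPushforward_comp (i := i) (τ.restrictScalars k).toAlgHom hi (haut _) a
      rw [hτi] at this
      exact this.symm
    · intro b
      ext Q
      change divisorPushforward _ (divisorPullback _ b) Q = divisorPullback _ b Q
      rw [divisorPushforward_aut_apply]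
      have h1 := Q.liesOver_below i hi
      have h2 : (Q.comapAut (τ.restrictScalars k)⁻¹).LiesOver i (Q.below i hi) := by
        refine liesOver_of_le hi fun f hf => ?_
        rw [mem_comapAut]
        have h3 : (τ.restrictScalars k)⁻¹ (i f) = i f := by
          have : τ (i f) = i f := hτF f
          exact (AlgEquiv.symm_apply_eq τ).2 this.symm
        rw [h3]
        exact hf
      rw [divisorPullback_apply' _ h1, divisorPullback_apply' _ h2]
      congr 2
      have h4 := ramificationIdx_comp (Q.comapAut_liesOver (τ.restrictScalars k)⁻¹) h2
      rw [ramificationIdx_aut, one_mul] at h4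
      rw [← h4]
      congr 1
      ext f
      have : τ (i f) = i f := hτF f
      exact (AlgEquiv.symm_apply_eq τ).2 this.symm
    · intro a
      change r (t (r a)) = t a
      have h1 := congrArg (fun σ : H ≃ₐ[E] H =>
        divisorPushforward (σ.restrictScalars k).toAlgHom a) hρτ
      simp only [hmul] at h1
      exact h1
    · intro a
      have := hpow 7 a
      rw [hρ, hone] at this
      exact this.symm
    · intro a
      have h1 := divisorPullback_comp (i := m) (j := i) hm hi finite_liesOver finite_liesOver
        (by rw [hmi]; exact finite_liesOver) (divisorPushforward m (push a))
      change divisorPullback i (divisorPullback m (divisorPushforward m (push a))) = _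
      rw [← h1, ← divisorPushforward_comp i hm hi, hmi, divisorPullback_divisorPushforward, hbij]
      refine Finset.sum_congr rfl fun n _ => ?_
      rw [hmul, hpow, hpow, ← iterate_map_add]
  let q := QuotientAddGroup.mk' (principalDivisors k F)
  -- `T` respects principal divisors and degree `0`, hence acts on classes
  let Tpic : CurvePic k F →+ CurvePic k F :=
    QuotientAddGroup.map _ _ Tdiv fun D hD => hTprin D hD
  have hTpic : ∀ D, Tpic (q D) = q (Tdiv D) := fun D => rfl
  have hmem : ∀ C : CurvePicZero k F, Tpic C ∈ CurvePicZero k F := by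
    rintro ⟨C, D, hD, rfl⟩
    exact ⟨Tdiv D, hTdeg D hD, rfl⟩
  let T : AddMonoid.End (CurvePicZero k F) :=
    (Tpic.comp (CurvePicZero k F).subtype).codRestrict _ hmem
  have hTval : ∀ C, ((T C : CurvePicZero k F) : CurvePic k F) = Tpic C := fun C => rfl
  refine ⟨T, ?_, ?_⟩
  · intro D C _ hC
    rw [hTval, hC]
    rfl
  · ext C
    refine (congrArg Subtype.val (AddMonoid.End.cubic_apply T C)).trans ?_
    obtain ⟨D, hD, hDC⟩ := C.2
    have h1 : c D ∈ principalDivisors k F := hc0 D hD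
    have h2 : q (c D) = 0 := (QuotientAddGroup.eq_zero_iff _).2 h1
    have h3 : (2 : ℤ) • Tdiv D = Tdiv D + Tdiv D := two_zsmul _
    rw [← heq, h3, map_sub, map_sub, map_add, map_add, ← hTpic, ← hTpic, ← hTpic] at h2
    change Tpic (Tpic (Tpic (C : CurvePic k F))) + Tpic (Tpic (C : CurvePic k F)) -
      (Tpic (C : CurvePic k F) + Tpic (C : CurvePic k F)) - (C : CurvePic k F) = 0
    rw [← hDC]
    exact h2

end Divisors

end

section

open IsDedekindDomain Polynomial

/-! ### The projective line -/

namespace Place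

variable (k : Type*) [Field k]

open Classical in
/-- The point at infinity of the projective line. -/
def infty : Place k (RatFunc k) where
  ring := (RatFunc.inftyValuation k).valuationSubring
  algebraMap_mem c := by
    rw [Valuation.mem_valuationSubring_iff, RatFunc.algebraMap_eq_C]
    by_cases hc : c = 0
    · simp [hc]
    · rw [RatFunc.inftyValuation.C k hc]
  isDVR := by
    refine Valuation.isDiscreteValuationRing_of_ne_top _ fun h => ?_
    have h1 : (RatFunc.X : RatFunc k) ∈ (RatFunc.inftyValuation k).valuationSubring := by
      rw [h]; exact ValuationSubring.mem_top _
    rw [Valuation.mem_valuationSubring_iff, RatFunc.inftyValuation.X, ← WithZero.exp_zero,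
      WithZero.exp_le_exp] at h1
    omega

variable {k}

open Classical in
theorem val_infty : (infty k).val = RatFunc.inftyValuation k := by
  refine Valuation.eq_of_normalized (fun f => ?_)
    ((IsDiscreteValuationRing.maximalIdeal (infty k).ring).valuation_exists_uniformizer _)
    ⟨1 / RatFunc.X, RatFunc.inftyValuation.X_inv k⟩
  rw [val_le_one_iff]
  rfl

theorem ord_infty {f : RatFunc k} (hf : f ≠ 0) : (infty k).ord f = -f.intDegree := by
  classical
  rw [ord_def, val_infty, RatFunc.inftyValuation_apply, RatFunc.inftyValuation_of_nonzero k hf,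
    WithZero.log_exp]

theorem X_notMem_infty : (RatFunc.X : RatFunc k) ∉ (infty k).ring := by
  rw [mem_ring_iff _ RatFunc.X_ne_zero, ord_infty RatFunc.X_ne_zero, RatFunc.intDegree_X]
  omega

/-- A place at which `x` has a pole is the point at infinity. -/
theorem eq_infty {P : Place k (RatFunc k)} (h : (RatFunc.X : RatFunc k) ∉ P.ring) :
    P = infty k := by
  classical
  have hv : Valuation.IsTrivialOn k P.val := ⟨fun c hc => by
    have h0 : algebraMap k (RatFunc k) c ≠ 0 := by simpa using hc
    have := P.val_eq_exp h0
    rw [ord_algebraMap] at this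
    simpa using this⟩
  have h1 := RatFunc.valuation_isEquiv_inftyValuation_of_one_lt_valuation_X (v := P.val)
    (lt_of_not_ge fun h' => h ((P.val_le_one_iff _).1 h'))
  apply ext'
  ext f
  rw [← val_le_one_iff, ← val_le_one_iff, val_infty]
  exact h1.le_one_iff_le_one

theorem algebraMap_polynomial_mem {F : Type*} [Field F] [Algebra k F] (P : Place k F) {x : F}
    (hx : x ∈ P.ring) (p : k[X]) : aeval x p ∈ P.ring := by
  rw [aeval_eq_sum_range]
  refine sum_mem fun i _ => ?_
  rw [Algebra.smul_def]
  exact P.ring.mul_mem _ _ (P.algebraMap_mem _) (pow_mem hx i)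

theorem polynomial_mem {P : Place k (RatFunc k)} (h : (RatFunc.X : RatFunc k) ∈ P.ring)
    (p : k[X]) : algebraMap k[X] (RatFunc k) p ∈ P.ring := by
  have h1 := P.algebraMap_polynomial_mem h p
  rwa [← RatFunc.algebraMap_X, aeval_algebraMap_apply, aeval_X_left_apply] at h1

theorem valuation_algebraMap_le (v : HeightOneSpectrum k[X]) (c : k) :
    v.valuation (RatFunc k) (algebraMap k (RatFunc k) c) ≤ 1 := by
  rw [IsScalarTower.algebraMap_apply k k[X] (RatFunc k)]
  exact v.valuation_le_one _

/-- A place at which `x` has no pole comes from a maximal ideal of `k[x]`. -/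
theorem exists_ofPrime {P : Place k (RatFunc k)} (h : (RatFunc.X : RatFunc k) ∈ P.ring) :
    ∃ v : HeightOneSpectrum k[X], P = ofPrime v (valuation_algebraMap_le v) :=
  ⟨P.center (polynomial_mem h), (ofPrime_center _ (polynomial_mem h) _).symm⟩

/-- A rational function without poles in the affine line is a polynomial. -/
theorem exists_polynomial {f : RatFunc k}
    (h : ∀ P : Place k (RatFunc k), RatFunc.X ∈ P.ring → f ∈ P.ring) :
    ∃ p : k[X], algebraMap k[X] (RatFunc k) p = f := by
  refine HeightOneSpectrum.mem_integers_of_valuation_le_one (R := k[X]) (RatFunc k) f fun v => ?_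
  have h1 := h (ofPrime v (valuation_algebraMap_le v)) (by
    have := ofPrime_mem v (valuation_algebraMap_le v) X
    rwa [RatFunc.algebraMap_X] at this)
  rwa [← val_le_one_iff, val_ofPrime] at h1

theorem algebraMap_residue {F : Type*} [Field F] [Algebra k F] (P : Place k F) (c : k) :
    algebraMap k P.Residue c = IsLocalRing.residue P.ring (algebraMap k P.ring c) := rfl

theorem deg_eq_one_of_surjective {F : Type*} [Field F] [Algebra k F] (P : Place k F)
    (h : ∀ f : P.ring, ∃ c : k, f - algebraMap k P.ring c ∈ IsLocalRing.maximalIdeal P.ring) :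
    P.deg = 1 := by
  have : Function.Bijective (algebraMap k P.Residue) := by
    refine ⟨(algebraMap k P.Residue).injective, fun z => ?_⟩
    obtain ⟨f, rfl⟩ := IsLocalRing.residue_surjective z
    obtain ⟨c, hc⟩ := h f
    refine ⟨c, ?_⟩
    rw [algebraMap_residue]
    rw [← IsLocalRing.residue_eq_zero_iff, map_sub, sub_eq_zero] at hc
    exact hc.symm
  have e := LinearEquiv.ofBijective (Algebra.linearMap k P.Residue) this
  rw [deg, ← e.finrank_eq, Module.finrank_self]

theorem deg_infty : (infty k).deg = 1 := by
  refine deg_eq_one_of_surjective _ fun f => ?_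
  by_cases hf : (f : RatFunc k) = 0
  · refine ⟨0, ?_⟩
    have : f = 0 := Subtype.ext hf
    simp [this]
  have h1 := (mem_ring_iff _ hf).1 f.2
  rw [ord_infty hf] at h1
  rcases h1.lt_or_eq with h2 | h2
  · refine ⟨0, ?_⟩
    rw [map_zero, sub_zero, mem_maximalIdeal_iff _ _ hf, ord_infty hf]
    omega
  · let g : RatFunc k := f
    have hd : g.num.natDegree = g.denom.natDegree := by
      have : g.intDegree = 0 := by change (f : RatFunc k).intDegree = 0; omega
      rw [RatFunc.intDegree] at this
      omega
    refine ⟨g.num.leadingCoeff, ?_⟩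
    have hmon := RatFunc.monic_denom g
    have hd0 : algebraMap k[X] (RatFunc k) g.denom ≠ 0 := by simpa using g.denom_ne_zero
    have hval : ((f - algebraMap k (infty k).ring g.num.leadingCoeff : (infty k).ring) : RatFunc k) =
        algebraMap k[X] (RatFunc k) (g.num - C g.num.leadingCoeff * g.denom) /
          algebraMap k[X] (RatFunc k) g.denom := by
      rw [map_sub, sub_div, RatFunc.num_div_denom, map_mul, mul_div_assoc, div_self hd0, mul_one]
      rfl
    by_cases h0 : ((f - algebraMap k (infty k).ring g.num.leadingCoeff : (infty k).ring) :
        RatFunc k) = 0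
    · have : f - algebraMap k (infty k).ring g.num.leadingCoeff = 0 := Subtype.ext h0
      rw [this]; exact zero_mem _
    rw [mem_maximalIdeal_iff _ _ h0, hval]
    have hn0 : g.num - C g.num.leadingCoeff * g.denom ≠ 0 := by
      intro h; rw [hval, h, map_zero, zero_div] at h0; exact h0 rfl
    have hn0' : algebraMap k[X] (RatFunc k) (g.num - C g.num.leadingCoeff * g.denom) ≠ 0 := by
      simpa only [ne_eq, FaithfulSMul.algebraMap_eq_zero_iff] using hn0
    have hlc : g.num.leadingCoeff ≠ 0 := by
      rw [leadingCoeff_ne_zero]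
      exact RatFunc.num_ne_zero hf
    rw [ord_div _ hn0' hd0, ord_infty hn0', ord_infty hd0, RatFunc.intDegree_polynomial,
      RatFunc.intDegree_polynomial]
    have hlt : (g.num - C g.num.leadingCoeff * g.denom).degree < g.num.degree := by
      refine degree_sub_lt_left ?_ (RatFunc.num_ne_zero hf) ?_
      · rw [degree_C_mul hlc, degree_eq_natDegree (RatFunc.num_ne_zero hf),
          degree_eq_natDegree g.denom_ne_zero, hd]
      · rw [leadingCoeff_mul, leadingCoeff_C, hmon.leadingCoeff, mul_one]
    have := natDegree_lt_natDegree hn0 hlt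
    omega

/-- The degree of the point given by an irreducible polynomial is the degree of the polynomial. -/
theorem deg_ofPrime (v : HeightOneSpectrum k[X]) (p : k[X]) (hp : v.asIdeal = Ideal.span {p}) :
    (ofPrime v (valuation_algebraMap_le v)).deg = p.natDegree := by
  set P := ofPrime v (valuation_algebraMap_le v) with hP
  have hmem : ∀ q : k[X], algebraMap k[X] (RatFunc k) q ∈ P.ring := ofPrime_mem v _
  let g : k[X] →ₐ[k] P.ring :=
    { (algebraMap k[X] (RatFunc k)).codRestrict P.ring hmem with
      commutes' := fun c => Subtype.ext
        ((IsScalarTower.algebraMap_apply k k[X] (RatFunc k) c).symm) }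
  let r : k[X] →ₐ[k] P.Residue :=
    { (IsLocalRing.residue P.ring).comp (g : k[X] →+* P.ring) with
      commutes' := fun c => congrArg (IsLocalRing.residue P.ring) (g.commutes c) }
  have hr0 : ∀ q, r q = 0 ↔ q ∈ v.asIdeal := by
    intro q
    change IsLocalRing.residue P.ring (g q) = 0 ↔ _
    have hv : P.val = v.valuation (RatFunc k) := val_ofPrime v _
    rw [IsLocalRing.residue_eq_zero_iff, ← val_lt_one_iff, hv]
    exact v.valuation_lt_one_iff_mem q
  have hsurj : Function.Surjective r := by
    intro z
    obtain ⟨f, rfl⟩ := IsLocalRing.residue_surjective z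
    obtain ⟨a, b, hab⟩ := v.exists_primeCompl_mul_eq_of_integer (K := RatFunc k) f.1 f.2
    have hb : r b ≠ 0 := fun h => b.2 ((hr0 b).1 h)
    have hfb : f * g b = g a := Subtype.ext hab
    have hmax : v.asIdeal.IsMaximal := v.isPrime.isMaximal v.ne_bot
    obtain ⟨b', hb'⟩ := hmax.exists_inv b.2
    obtain ⟨m, hm, hm'⟩ := hb'
    refine ⟨a * b', ?_⟩
    have h1 : r b' * r b = 1 := by
      have := congrArg r hm'
      rw [map_add, map_mul, map_one, (hr0 m).2 hm, add_zero] at this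
      exact this
    have h2 : IsLocalRing.residue P.ring f * r b = r a :=
      congrArg (IsLocalRing.residue P.ring) hfb
    rw [map_mul, ← h2, mul_assoc, mul_comm (r b), h1, mul_one]
  have hker : RingHom.ker r = Ideal.span {p} := by
    ext q
    rw [RingHom.mem_ker, hr0, hp]
  have e := (Ideal.quotientKerAlgEquivOfSurjective hsurj).toLinearEquiv
  have hp0 : p ≠ 0 := by
    rintro rfl
    exact v.ne_bot (by rw [hp]; simp)
  rw [deg, ← e.finrank_eq, ← (Ideal.quotientEquivAlgOfEq k hker.symm).toLinearEquiv.finrank_eq]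
  exact finrank_quotient_span_eq_natDegree

theorem deg_pos (P : Place k (RatFunc k)) : 0 < P.deg := by
  by_cases h : (RatFunc.X : RatFunc k) ∈ P.ring
  · obtain ⟨v, rfl⟩ := exists_ofPrime h
    obtain ⟨p, hp⟩ := (IsPrincipalIdealRing.principal v.asIdeal).principal
    have hp : v.asIdeal = Ideal.span {p} := hp
    rw [deg_ofPrime v p hp]
    refine Nat.pos_of_ne_zero fun h0 => ?_
    rw [natDegree_eq_zero] at h0
    obtain ⟨c, rfl⟩ := h0
    by_cases hc : c = 0
    · exact v.ne_bot (by rw [hp, hc]; simp)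
    · exact v.isPrime.ne_top (by
        rw [hp, Ideal.span_singleton_eq_top]
        exact isUnit_C.2 (IsUnit.mk0 c hc))
  · rw [eq_infty h, deg_infty]; exact one_pos

end Place

open Place in
/-- The divisor class group of degree zero of the projective line is trivial. -/
theorem RatFunc.mem_principalDivisors {k : Type*} [Field k] (D : CurveDivisor k (RatFunc k))
    (hD : CurveDivisor.degree k (RatFunc k) D = 0) : D ∈ principalDivisors k (RatFunc k) := by
  -- every point `P` is equivalent to `deg P` times the point at infinity
  have key : ∀ P : Place k (RatFunc k),
      Finsupp.single P 1 - (P.deg : ℤ) • Finsupp.single (infty k) 1 ∈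
        principalDivisors k (RatFunc k) := by
    intro P
    by_cases h : (RatFunc.X : RatFunc k) ∈ P.ring
    · obtain ⟨v, rfl⟩ := exists_ofPrime h
      obtain ⟨p, hp⟩ := (IsPrincipalIdealRing.principal v.asIdeal).principal
      have hp : v.asIdeal = Ideal.span {p} := hp
      have hp0 : p ≠ 0 := by
        rintro rfl
        exact v.ne_bot (by rw [hp]; simp)
      have hp0' : algebraMap k[X] (RatFunc k) p ≠ 0 := by simpa using hp0
      refine ⟨algebraMap k[X] (RatFunc k) p, hp0', fun Q => ?_⟩
      rw [deg_ofPrime v p hp]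
      by_cases hQ : (RatFunc.X : RatFunc k) ∈ Q.ring
      · obtain ⟨u, rfl⟩ := exists_ofPrime hQ
        have h1 : ofPrime u (valuation_algebraMap_le u) ≠ infty k := by
          intro h; rw [h] at hQ; exact X_notMem_infty hQ
        rw [Finsupp.sub_apply, Finsupp.smul_apply, Finsupp.single_eq_of_ne h1, smul_zero, sub_zero]
        by_cases huv : u = v
        · subst huv
          rw [Finsupp.single_eq_same, ord_def, val_ofPrime, u.valuation_of_algebraMap,
            u.intValuation_singleton hp0 hp, WithZero.log_exp]
          rfl
        · rw [Finsupp.single_eq_of_ne, ord_def, val_ofPrime]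
          · have : u.valuation (RatFunc k) (algebraMap k[X] (RatFunc k) p) = 1 := by
              refine le_antisymm (u.valuation_le_one p) (not_lt.1 fun hlt => huv ?_)
              rw [u.valuation_lt_one_iff_mem] at hlt
              have hle : v.asIdeal ≤ u.asIdeal := by
                rw [hp, Ideal.span_singleton_le_iff_mem]; exact hlt
              have hmax : v.asIdeal.IsMaximal := v.isPrime.isMaximal v.ne_bot
              exact HeightOneSpectrum.ext (hmax.eq_of_le u.isPrime.ne_top hle).symm
            rw [this, WithZero.log_one, neg_zero]
          · intro h
            apply huv
            have := congrArg Place.val h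
            rw [val_ofPrime, val_ofPrime] at this
            ext q
            rw [← u.valuation_lt_one_iff_mem (K := RatFunc k), this, v.valuation_lt_one_iff_mem]
      · rw [eq_infty hQ, Finsupp.sub_apply, Finsupp.smul_apply, Finsupp.single_eq_same,
          Finsupp.single_eq_of_ne, ord_infty hp0', RatFunc.intDegree_polynomial]
        · simp
        · intro h'; rw [← h'] at h; exact X_notMem_infty h
    · rw [eq_infty h, deg_infty]
      simp [zero_mem]
  have h1 : D = D.sum fun P n => n • (Finsupp.single P (1 : ℤ) -
      (P.deg : ℤ) • Finsupp.single (infty k) (1 : ℤ)) := by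
    have h2 : (D.sum fun P n => n • (P.deg : ℤ)) = 0 := by
      rw [← hD]
      rw [CurveDivisor.degree, Finsupp.liftAddHom_apply]
      exact Finset.sum_congr rfl fun P _ => rfl
    have h3 : (D.sum fun P n => n • (Finsupp.single P (1 : ℤ) -
      (P.deg : ℤ) • Finsupp.single (infty k) (1 : ℤ))) =
        (D.sum fun P n => n • Finsupp.single P (1 : ℤ)) -
          (D.sum fun P n => n • (P.deg : ℤ)) • Finsupp.single (infty k) (1 : ℤ) := by
      simp only [Finsupp.sum, smul_sub, Finset.sum_sub_distrib, Finset.sum_smul, smul_assoc]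
    rw [h3, h2, zero_smul, sub_zero]
    conv_lhs => rw [← Finsupp.sum_single D]
    simp
  rw [h1]
  exact sum_mem fun P _ => AddSubgroup.zsmul_mem _ (key P) _

end

section

open IsDedekindDomain Polynomial Module

/-! ### The cohomology of a divisor on a curve covered by two affine sets -/

/-- Two subspaces with finite dimensional intersection and finite codimensional sum; the index is
the difference of the two dimensions. -/
structure IsFredholmPair {k V : Type*} [Field k] [AddCommGroup V] [Module k V]
    (I J : Submodule k V) (n : ℤ) : Prop where
  finite_inf : Module.Finite k ↥(I ⊓ J)
  finite_quotient : Module.Finite k (V ⧸ (I ⊔ J))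
  index_eq : (finrank k ↥(I ⊓ J) : ℤ) - finrank k (V ⧸ (I ⊔ J)) = n

theorem IsFredholmPair.symm {k V : Type*} [Field k] [AddCommGroup V] [Module k V]
    {I J : Submodule k V} {n : ℤ} (h : IsFredholmPair I J n) : IsFredholmPair J I n := by
  obtain ⟨h1, h2, h3⟩ := h
  rw [inf_comm] at h1
  rw [sup_comm] at h2
  refine ⟨h1, h2, ?_⟩
  rw [← h3, inf_comm, sup_comm]

/-- Enlarging one of the subspaces by a finite dimension `d` raises the index by `d`. -/
theorem isFredholmPair_iff_add {k V W : Type*} [Field k] [AddCommGroup V] [Module k V]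
    [AddCommGroup W] [Module k W] [Module.Finite k W] {I I' J : Submodule k V} (hI : I ≤ I')
    (f : I' →ₗ[k] W) (hf : Function.Surjective f) (hker : ∀ x : I', f x = 0 ↔ (x : V) ∈ I) (n : ℤ) :
    IsFredholmPair I J n ↔ IsFredholmPair I' J (n + finrank k W) := by
  let α : ↥(I' ⊓ J) →ₗ[k] W := f ∘ₗ Submodule.inclusion inf_le_left
  have hα : ∀ x : ↥(I' ⊓ J), α x = 0 ↔ (x : V) ∈ I := fun x => hker _
  let eα : LinearMap.ker α ≃ₗ[k] ↥(I ⊓ J) :=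
    { toFun := fun x => ⟨x.1.1, (hα x.1).1 x.2, x.1.2.2⟩
      invFun := fun x => ⟨⟨x.1, hI x.2.1, x.2.2⟩, (hα _).2 x.2.1⟩
      map_add' := fun _ _ => rfl
      map_smul' := fun _ _ => rfl
      left_inv := fun _ => rfl
      right_inv := fun _ => rfl }
  have hle : I ⊔ J ≤ I' ⊔ J := sup_le_sup_right hI J
  let β : (V ⧸ (I ⊔ J)) →ₗ[k] V ⧸ (I' ⊔ J) := Submodule.factor hle
  have hβs : Function.Surjective β := Submodule.factor_surjective hle
  have hβ : ∀ v : V, β (Submodule.mkQ _ v) = 0 ↔ v ∈ I' ⊔ J := by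
    intro v
    change Submodule.mkQ (I' ⊔ J) v = 0 ↔ _
    rw [← LinearMap.mem_ker, Submodule.ker_mkQ]
  let γ : I' →ₗ[k] LinearMap.ker β :=
    LinearMap.codRestrict _ ((I ⊔ J).mkQ ∘ₗ I'.subtype)
      fun x => (hβ x).2 (Submodule.mem_sup_left x.2)
  have hγs : Function.Surjective γ := by
    rintro ⟨z, hz⟩
    obtain ⟨v, rfl⟩ := Submodule.mkQ_surjective _ z
    obtain ⟨x, hx, j, hj, rfl⟩ := Submodule.mem_sup.1 ((hβ v).1 hz)
    refine ⟨⟨x, hx⟩, Subtype.ext ?_⟩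
    change (I ⊔ J).mkQ x = (I ⊔ J).mkQ (x + j)
    rw [map_add, left_eq_add, ← LinearMap.mem_ker, Submodule.ker_mkQ]
    exact Submodule.mem_sup_right hj
  let δ : I' →ₗ[k] W ⧸ LinearMap.range α := (LinearMap.range α).mkQ ∘ₗ f
  have hδs : Function.Surjective δ := (Submodule.mkQ_surjective _).comp hf
  have hkk : LinearMap.ker γ = LinearMap.ker δ := by
    ext x
    have h1 : x ∈ LinearMap.ker γ ↔ (x : V) ∈ I ⊔ J := by
      rw [LinearMap.mem_ker, ← Submodule.coe_eq_zero]
      change (I ⊔ J).mkQ x = 0 ↔ _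
      rw [← LinearMap.mem_ker, Submodule.ker_mkQ]
    have h2 : x ∈ LinearMap.ker δ ↔ f x ∈ LinearMap.range α := by
      rw [LinearMap.mem_ker]
      change (LinearMap.range α).mkQ (f x) = 0 ↔ _
      rw [← LinearMap.mem_ker, Submodule.ker_mkQ]
    rw [h1, h2]
    constructor
    · intro h
      obtain ⟨a, ha, j, hj, haj⟩ := Submodule.mem_sup.1 h
      have hj' : j ∈ I' := by
        have : j = x - a := by rw [← haj]; abel
        rw [this]; exact I'.sub_mem x.2 (hI ha)
      refine ⟨⟨j, hj', hj⟩, ?_⟩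
      have : x = ⟨a, hI ha⟩ + ⟨j, hj'⟩ := Subtype.ext haj.symm
      rw [this, map_add, (hker ⟨a, hI ha⟩).2 ha, zero_add]
      rfl
    · rintro ⟨z, hz⟩
      have h3 : f (x - ⟨z, z.2.1⟩) = 0 := by
        rw [map_sub, sub_eq_zero]; exact hz.symm
      have h4 := (hker _).1 h3
      have : (x : V) = (x - z) + z := by abel
      rw [this]
      exact Submodule.add_mem_sup h4 z.2.2
  -- with `α : I' ⊓ J → W` and `β : V / (I + J) → V / (I' + J)`, there is an exact sequence
  -- `0 → I ⊓ J → I' ⊓ J → W → V / (I + J) → V / (I' + J) → 0`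
  let e : LinearMap.ker β ≃ₗ[k] W ⧸ LinearMap.range α :=
    (γ.quotKerEquivOfSurjective hγs).symm.trans
      ((Submodule.quotEquivOfEq _ _ hkk).trans (δ.quotKerEquivOfSurjective hδs))
  have hB : Module.Finite k (LinearMap.ker β) := Module.Finite.equiv e.symm
  have hBr : finrank k (LinearMap.ker β) + finrank k (LinearMap.range α) = finrank k W := by
    rw [e.finrank_eq, Submodule.finrank_quotient_add_finrank]
  have hfin1 : Module.Finite k ↥(I ⊓ J) ↔ Module.Finite k ↥(I' ⊓ J) := by
    constructor
    · intro h
      have : Module.Finite k (LinearMap.ker α) := Module.Finite.equiv eα.symm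
      have : Module.Finite k (↥(I' ⊓ J) ⧸ LinearMap.ker α) :=
        Module.Finite.equiv α.quotKerEquivRange.symm
      exact Module.Finite.of_submodule_quotient (LinearMap.ker α)
    · intro h
      exact Module.Finite.equiv eα
  have hfin2 : Module.Finite k (V ⧸ (I ⊔ J)) ↔ Module.Finite k (V ⧸ (I' ⊔ J)) := by
    constructor
    · intro h
      exact Module.Finite.of_surjective β hβs
    · intro h
      have : Module.Finite k ((V ⧸ (I ⊔ J)) ⧸ LinearMap.ker β) :=
        Module.Finite.equiv (β.quotKerEquivOfSurjective hβs).symm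
      exact Module.Finite.of_submodule_quotient (LinearMap.ker β)
  have key : Module.Finite k ↥(I ⊓ J) → Module.Finite k (V ⧸ (I ⊔ J)) →
      (finrank k ↥(I' ⊓ J) : ℤ) - finrank k (V ⧸ (I' ⊔ J)) =
        finrank k ↥(I ⊓ J) - finrank k (V ⧸ (I ⊔ J)) + finrank k W := by
    intro h1 h2
    have := hfin1.1 h1
    have h3 := α.finrank_range_add_finrank_ker
    have h4 := β.finrank_range_add_finrank_ker
    rw [eα.finrank_eq] at h3
    rw [LinearMap.range_eq_top.2 hβs, finrank_top] at h4
    omega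
  constructor
  · rintro ⟨h1, h2, h3⟩
    exact ⟨hfin1.1 h1, hfin2.1 h2, by rw [key h1 h2, h3]⟩
  · rintro ⟨h1, h2, h3⟩
    refine ⟨hfin1.2 h1, hfin2.2 h2, ?_⟩
    rw [key (hfin1.2 h1) (hfin2.2 h2)] at h3
    omega

namespace Place

variable {k E F : Type*} [Field k] [Field E] [Field F] [Algebra k E] [Algebra k F]

/-- The functions `f` with `ord_P f ≥ -D(P)` at all places `P` in `S`. -/
def sectionsOn (S : Set (Place k F)) (D : Place k F → ℤ) : Submodule k F where
  carrier := {f | ∀ P ∈ S, P.val f ≤ WithZero.exp (D P)}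
  zero_mem' P _ := by rw [map_zero]; exact zero_le
  add_mem' hf hg P hP := (P.val.map_add _ _).trans (max_le (hf P hP) (hg P hP))
  smul_mem' c f hf P hP := by
    rw [Algebra.smul_def, map_mul]
    calc _ ≤ 1 * P.val f := mul_le_mul_left ((P.val_le_one_iff _).2 (P.algebraMap_mem c)) _
      _ ≤ _ := by rw [one_mul]; exact hf P hP

theorem mem_sectionsOn {S : Set (Place k F)} {D : Place k F → ℤ} {f : F} :
    f ∈ sectionsOn S D ↔ ∀ P ∈ S, P.val f ≤ WithZero.exp (D P) := Iff.rfl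

theorem mem_sectionsOn_zero {S : Set (Place k F)} {f : F} :
    f ∈ sectionsOn S 0 ↔ ∀ P ∈ S, f ∈ P.ring := by
  simp only [mem_sectionsOn, Pi.zero_apply, WithZero.exp_zero, val_le_one_iff]

/-- The set `S` of places behaves like the set of closed points of an affine curve: functions have
finitely many poles in `S`, and strong approximation holds. -/
structure IsAffineSet (S : Set (Place k F)) : Prop where
  finite_poles : ∀ f : F, {P ∈ S | f ∉ P.ring}.Finite
  approx : ∀ T : Set (Place k F), T.Finite → T ⊆ S → ∀ (f : Place k F → F) (N : ℕ),
    ∃ g : F, (∀ P ∈ T, P.val (g - f P) ≤ WithZero.exp (-(N : ℤ))) ∧ ∀ P ∈ S, P ∉ T → g ∈ P.ring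

/-- The places that contain a Dedekind domain with fraction field `F` form an affine set. -/
theorem isAffineSet_of_isDedekindDomain (R : Type*) [CommRing R] [IsDedekindDomain R] [Algebra R F]
    [IsFractionRing R F] (S : Set (Place k F))
    (hS : ∀ P, P ∈ S ↔ ∀ r, algebraMap R F r ∈ P.ring) : IsAffineSet S where
  finite_poles f := by
    have h1 := HeightOneSpectrum.Support.finite R f
    have h2 : Set.Finite ((fun P : {P // P ∈ S} => P.1.center ((hS P.1).1 P.2)) ⁻¹'
        HeightOneSpectrum.Support R f) := by
      refine h1.preimage ?_
      rintro ⟨Q, hQ⟩ - ⟨Q', hQ'⟩ - hc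
      apply Subtype.ext
      apply ext'
      ext z
      change z ∈ Q.ring ↔ z ∈ Q'.ring
      rw [← val_le_one_iff, ← val_le_one_iff, val_eq_center Q ((hS Q).1 hQ),
        val_eq_center Q' ((hS Q').1 hQ')]
      rw [show Q.center ((hS Q).1 hQ) = Q'.center ((hS Q').1 hQ') from hc]
    refine (h2.image Subtype.val).subset ?_
    rintro P ⟨hP, hf⟩
    refine ⟨⟨P, hP⟩, ?_, rfl⟩
    change 1 < (P.center ((hS P).1 hP)).valuation F f
    rw [← val_eq_center]
    exact lt_of_not_ge fun h => hf ((P.val_le_one_iff f).1 h)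
  approx T hT hTS f N := by
    obtain ⟨g, h1, h2⟩ := exists_approx R hT (fun Q hQ => (hS Q).1 (hTS hQ)) f N
    exact ⟨g, h1, fun P hP => h2 P ((hS P).1 hP)⟩

/-- The genus in terms of a covering by two affine sets. -/
theorem curveGenus_eq {S : Set (Place k F)} (hS : IsAffineSet S) (hS' : IsAffineSet Sᶜ)
    (hfin : Sᶜ.Finite) :
    curveGenus k F = finrank k (F ⧸ (sectionsOn S 0 ⊔ sectionsOn Sᶜ 0)) := by
  classical
  -- a class in `H¹` is represented by a function placed at the points outside `S`
  let c : F →ₗ[k] repartitions k F :=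
    { toFun := fun f => ⟨fun P => if P ∈ S then 0 else f, hfin.subset fun P hP hPS => by
        simp only [Set.mem_ofPred_eq, if_pos hPS] at hP
        exact hP P.ring.zero_mem⟩
      map_add' := fun f g => by
        ext P
        by_cases h : P ∈ S <;> simp [h]
      map_smul' := fun r f => by
        ext P
        by_cases h : P ∈ S <;> simp [h] }
  have hc : ∀ f P, (c f : Place k F → F) P = if P ∈ S then 0 else f := fun _ _ => rfl
  let U := (regularRepartitions k F ⊔ diagonalRepartitions k F).comap (repartitions k F).subtype
  let q : F →ₗ[k] repartitions k F ⧸ U := U.mkQ ∘ₗ c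
  have hsurj : Function.Surjective q := by
    intro z
    obtain ⟨r, rfl⟩ := U.mkQ_surjective z
    have hT : {P ∈ S | r.1 P ∉ P.ring}.Finite := Set.Finite.subset r.2 fun P hP => hP.2
    obtain ⟨g1, h1, h1'⟩ := hS.approx _ hT (fun P hP => hP.1) r.1 0
    obtain ⟨g2, h2, -⟩ := hS'.approx _ hfin subset_rfl (fun P => r.1 P - g1) 0
    refine ⟨g2, ?_⟩
    rw [eq_comm, ← sub_eq_zero]
    change U.mkQ r - U.mkQ (c g2) = 0
    rw [← map_sub, ← LinearMap.mem_ker, Submodule.ker_mkQ]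
    change r.1 - (c g2).1 ∈ regularRepartitions k F ⊔ diagonalRepartitions k F
    refine Submodule.mem_sup.2 ⟨fun P => r.1 P - (c g2).1 P - g1, fun P => ?_, fun _ => g1,
      ⟨g1, rfl⟩, ?_⟩
    · change r.1 P - (c g2).1 P - g1 ∈ P.ring
      rw [hc]
      by_cases hP : P ∈ S
      · rw [if_pos hP, sub_zero]
        by_cases hr : r.1 P ∈ P.ring
        · exact sub_mem hr (h1' P hP fun h => h.2 hr)
        · have := h1 P ⟨hP, hr⟩
          rw [Nat.cast_zero, neg_zero, WithZero.exp_zero, val_le_one_iff] at this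
          rw [← neg_sub]
          exact neg_mem this
      · rw [if_neg hP]
        have := h2 P hP
        rw [Nat.cast_zero, neg_zero, WithZero.exp_zero, val_le_one_iff] at this
        have h3 : r.1 P - g2 - g1 = -(g2 - (r.1 P - g1)) := by ring
        rw [h3]
        exact neg_mem this
    · funext P
      simp
  have hker : LinearMap.ker q = sectionsOn S 0 ⊔ sectionsOn Sᶜ 0 := by
    ext f
    rw [LinearMap.mem_ker]
    change U.mkQ (c f) = 0 ↔ _
    rw [← LinearMap.mem_ker, Submodule.ker_mkQ]
    change (c f).1 ∈ regularRepartitions k F ⊔ diagonalRepartitions k F ↔ _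
    rw [Submodule.mem_sup, Submodule.mem_sup]
    constructor
    · rintro ⟨r, hr, _, ⟨g, rfl⟩, hrg⟩
      have h3 : ∀ P, r P + g = if P ∈ S then 0 else f := fun P => congrFun hrg P
      refine ⟨g, mem_sectionsOn_zero.2 fun P hP => ?_, f - g,
        mem_sectionsOn_zero.2 fun P hP => ?_, by ring⟩
      · have := h3 P
        rw [if_pos hP] at this
        rw [← neg_eq_of_add_eq_zero_right this]
        exact neg_mem (hr P)
      · have := h3 P
        rw [if_neg hP] at this
        rw [← this, add_sub_cancel_right]
        exact hr P
    · rintro ⟨g, hg, g', hg', rfl⟩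
      refine ⟨fun P => if P ∈ S then -g else g', fun P => ?_, fun _ => g, ⟨g, rfl⟩, ?_⟩
      · by_cases hP : P ∈ S
        · simp only [if_pos hP]
          exact neg_mem (mem_sectionsOn_zero.1 hg P hP)
        · simp only [if_neg hP]
          exact mem_sectionsOn_zero.1 hg' P hP
      · funext P
        rw [Pi.add_apply, hc]
        by_cases hP : P ∈ S
        · simp only [if_pos hP, neg_add_cancel]
        · simp only [if_neg hP, add_comm]
  rw [curveGenus, ← hker]
  exact (q.quotKerEquivOfSurjective hsurj).finrank_eq.symm

theorem exists_finsupp_bound (D : Place k F →₀ ℤ) : ∃ N : ℕ, ∀ P, -(N : ℤ) ≤ D P := by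
  refine ⟨∑ P ∈ D.support, (D P).natAbs, fun P => ?_⟩
  by_cases hP : P ∈ D.support
  · have := Finset.single_le_sum (f := fun P => (D P).natAbs) (s := D.support)
      (fun _ _ => Nat.zero_le _) hP
    omega
  · rw [Finsupp.notMem_support_iff.1 hP]
    omega

/-- Adding a point `P` of `S` to the divisor enlarges the sections on `S` by the residue field of `P`:
the leading coefficient at `P` can be prescribed by strong approximation. -/
theorem isFredholmPair_add_single_of_mem {S : Set (Place k F)} (hS : IsAffineSet S)
    {D D' : CurveDivisor k F} {P : Place k F} (hD' : D' = D + Finsupp.single P 1) (hP : P ∈ S)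
    [Module.Finite k P.Residue] (J : Submodule k F) (n : ℤ) :
    IsFredholmPair (sectionsOn S D) J n ↔
      IsFredholmPair (sectionsOn S D') J (n + P.deg) := by
  classical
  have hDP : D' P = D P + 1 := by simp [hD']
  have hDQ : ∀ Q, Q ≠ P → D' Q = D Q := fun Q hQ => by
    simp [hD', Finsupp.single_eq_of_ne hQ]
  have hle : sectionsOn S D ≤ sectionsOn S D' := by
    intro f hf Q hQ
    refine (hf Q hQ).trans (WithZero.exp_le_exp.2 ?_)
    by_cases h : Q = P
    · rw [h, hDP]; omega
    · rw [hDQ Q h]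
  set u := P.uniformizer ^ (D P + 1) with hu
  have hu0 : u ≠ 0 := zpow_ne_zero _ P.uniformizer_ne_zero
  have hvu : P.val u = WithZero.exp (-(D P + 1)) := by
    rw [val_eq_exp _ hu0, hu, ord_zpow, ord_uniformizer, mul_one]
  have hmem : ∀ f ∈ sectionsOn S D', f * u ∈ P.ring := by
    intro f hf
    have := hf P hP
    rw [hDP] at this
    rw [← val_le_one_iff, map_mul, hvu]
    calc _ ≤ WithZero.exp (D P + 1) * WithZero.exp (-(D P + 1)) := mul_le_mul_left this _
      _ = 1 := by rw [← WithZero.exp_add]; simp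
  let m : sectionsOn S D' →ₗ[k] P.Residue :=
    { toFun := fun f => IsLocalRing.residue P.ring ⟨f * u, hmem f f.2⟩
      map_add' := fun f g => by
        rw [← map_add]
        congr 1
        exact Subtype.ext (add_mul _ _ _)
      map_smul' := fun c f => by
        rw [RingHom.id_apply, Algebra.smul_def, algebraMap_residue, ← map_mul]
        congr 1
        refine Subtype.ext ?_
        change (c • (f : F)) * u = algebraMap k F c * (f * u)
        rw [Algebra.smul_def, mul_assoc] }
  have hm : ∀ f, m f = IsLocalRing.residue P.ring ⟨f * u, hmem f f.2⟩ := fun _ => rfl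
  have hker : ∀ f, m f = 0 ↔ (f : F) ∈ sectionsOn S D := by
    intro f
    have h1 : m f = 0 ↔ P.val f ≤ WithZero.exp (D P) := by
      rw [hm, IsLocalRing.residue_eq_zero_iff, ← val_lt_one_iff]
      by_cases hf : (f : F) = 0
      · simp [hf]
      · change P.val (f * u) < 1 ↔ _
        rw [map_mul, hvu, val_eq_exp _ hf, ← WithZero.exp_add, ← WithZero.exp_zero,
          WithZero.exp_lt_exp, WithZero.exp_le_exp]
        omega
    rw [h1]
    refine ⟨fun h Q hQ => ?_, fun h => h P hP⟩
    by_cases hQP : Q = P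
    · rw [hQP]; exact h
    · have := f.2 Q hQ
      rwa [hDQ Q hQP] at this
  refine isFredholmPair_iff_add hle m ?_ hker n
  intro z
  obtain ⟨a, rfl⟩ := IsLocalRing.residue_surjective z
  -- surjectivity: approximate `a / u` at `P`, and `0` at the other points of the support of `D`
  obtain ⟨N, hN⟩ := exists_finsupp_bound D
  obtain ⟨g, h1, h2⟩ := hS.approx ({P} ∪ {Q | Q ∈ S ∧ Q ∈ D.support})
    ((Set.finite_singleton P).union ((Finset.finite_toSet D.support).subset fun Q hQ => hQ.2))
    (by rintro Q (rfl | hQ); exacts [hP, hQ.1]) (fun Q => if Q = P then a * u⁻¹ else 0) N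
  have hgP : P.val (g - a * u⁻¹) ≤ WithZero.exp (D P) := by
    have := h1 P (Or.inl rfl)
    rw [if_pos rfl] at this
    exact this.trans (WithZero.exp_le_exp.2 (hN P))
  have hau : P.val (a * u⁻¹) ≤ WithZero.exp (D P + 1) := by
    rw [map_mul, map_inv₀, hvu, ← WithZero.exp_neg, neg_neg]
    calc _ ≤ 1 * WithZero.exp (D P + 1) := mul_le_mul_left ((P.val_le_one_iff _).2 a.2) _
      _ = _ := one_mul _
  have hg : g ∈ sectionsOn S D' := by
    intro Q hQ
    by_cases hQP : Q = P
    · rw [hQP, hDP]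
      have : g = (g - a * u⁻¹) + a * u⁻¹ := by ring
      rw [this]
      refine (P.val.map_add _ _).trans (max_le (hgP.trans (WithZero.exp_le_exp.2 ?_)) hau)
      omega
    · rw [hDQ Q hQP]
      by_cases hs : Q ∈ D.support
      · have := h1 Q (Or.inr ⟨hQ, hs⟩)
        rw [if_neg hQP, sub_zero] at this
        exact this.trans (WithZero.exp_le_exp.2 (hN Q))
      · rw [Finsupp.notMem_support_iff.1 hs, WithZero.exp_zero, val_le_one_iff]
        refine h2 Q hQ ?_
        rintro (h | h)
        exacts [hQP h, hs h.2]
  refine ⟨⟨g, hg⟩, ?_⟩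
  rw [hm, ← sub_eq_zero, ← map_sub, IsLocalRing.residue_eq_zero_iff, ← val_lt_one_iff]
  change P.val (g * u - a) < 1
  have : g * u - a = (g - a * u⁻¹) * u := by field_simp
  rw [this, map_mul, hvu]
  calc _ ≤ WithZero.exp (D P) * WithZero.exp (-(D P + 1)) := mul_le_mul_left hgP _
    _ < 1 := by
      rw [← WithZero.exp_add, ← WithZero.exp_zero, WithZero.exp_lt_exp]; omega

theorem sectionsOn_congr {S : Set (Place k F)} {D D' : Place k F → ℤ} (h : ∀ P ∈ S, D P = D' P) :
    sectionsOn S D = sectionsOn S D' := by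
  ext f
  rw [mem_sectionsOn, mem_sectionsOn]
  exact forall₂_congr fun P hP => by rw [h P hP]

theorem isFredholmPair_add_single {S : Set (Place k F)} (hS : IsAffineSet S)
    (hS' : IsAffineSet Sᶜ) {D D' : CurveDivisor k F} {P : Place k F}
    (hD' : D' = D + Finsupp.single P 1) [Module.Finite k P.Residue] (n : ℤ) :
    IsFredholmPair (sectionsOn S D) (sectionsOn Sᶜ D) n ↔
      IsFredholmPair (sectionsOn S D') (sectionsOn Sᶜ D') (n + P.deg) := by
  have hQ : ∀ Q, Q ≠ P → D Q = D' Q := fun Q hQ => by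
    simp [hD', Finsupp.single_eq_of_ne hQ]
  by_cases hP : P ∈ S
  · rw [← sectionsOn_congr (S := Sᶜ) (D := D) fun Q h => hQ Q fun h' => h (h' ▸ hP)]
    exact isFredholmPair_add_single_of_mem hS hD' hP _ n
  · rw [← sectionsOn_congr (S := S) (D := D) fun Q h => hQ Q fun h' => hP (h' ▸ h)]
    have := isFredholmPair_add_single_of_mem hS' hD' (P := P) hP (sectionsOn S D) n
    exact ⟨fun h => (this.1 h.symm).symm, fun h => (this.2 h.symm).symm⟩

/-- Riemann's part of the Riemann-Roch theorem: the Euler characteristic of a divisor is that of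
the structure sheaf plus the degree. -/
theorem isFredholmPair_divisor {S : Set (Place k F)} (hS : IsAffineSet S) (hS' : IsAffineSet Sᶜ)
    (hres : ∀ P : Place k F, Module.Finite k P.Residue) {n : ℤ}
    (h0 : IsFredholmPair (sectionsOn S 0) (sectionsOn Sᶜ 0) n) (D : CurveDivisor k F) :
    IsFredholmPair (sectionsOn S D) (sectionsOn Sᶜ D) (n + CurveDivisor.degree k F D) := by
  induction D using Finsupp.induction with
  | zero => simpa using h0
  | single_add P m D _ _ ih =>
    have key : ∀ (m : ℤ) (D' : CurveDivisor k F), D' = Finsupp.single P m + D →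
        IsFredholmPair (sectionsOn S D') (sectionsOn Sᶜ D') (n + CurveDivisor.degree k F D') := by
      have step : ∀ (m : ℤ) (D₁ D₂ : CurveDivisor k F), D₁ = Finsupp.single P m + D →
          D₂ = Finsupp.single P (m + 1) + D →
          (IsFredholmPair (sectionsOn S D₁) (sectionsOn Sᶜ D₁) (n + CurveDivisor.degree k F D₁) ↔
          IsFredholmPair (sectionsOn S D₂) (sectionsOn Sᶜ D₂)
            (n + CurveDivisor.degree k F D₂)) := by
        intro m D₁ D₂ h₁ h₂
        have h3 : D₂ = D₁ + Finsupp.single P 1 := by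
          rw [h₁, h₂, Finsupp.single_add]; abel
        rw [isFredholmPair_add_single hS hS' h3, h3, map_add, degree_single, one_mul, add_assoc]
      intro m
      induction m using Int.induction_on with
      | zero =>
        rintro D' rfl
        rw [Finsupp.single_zero, zero_add]
        exact ih
      | succ i hi => exact fun D' h => (step _ _ _ rfl h).1 (hi _ rfl)
      | pred i hi => exact fun D' h => (step _ _ _ h rfl).2 (hi _ (by simp))
    exact key m _ rfl

/-- Multiplication by a function `φ` identifies the sections of `D` with those of `D - div φ`. -/
theorem isFredholmPair_mul {S : Set (Place k F)} {D D' : Place k F → ℤ} {φ : F} (hφ : φ ≠ 0)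
    (hD : ∀ P, D' P = D P - P.ord φ) {n : ℤ}
    (h : IsFredholmPair (sectionsOn S D) (sectionsOn Sᶜ D) n) :
    IsFredholmPair (sectionsOn S D') (sectionsOn Sᶜ D') n := by
  let e : F ≃ₗ[k] F := LinearEquiv.ofLinearMap (LinearMap.mulLeft k φ) (LinearMap.mulLeft k φ⁻¹)
    (by ext; simp [hφ]) (by ext; simp [hφ])
  have he : ∀ S : Set (Place k F), (sectionsOn S D).map (e : F →ₗ[k] F) = sectionsOn S D' := by
    intro S
    ext f
    rw [Submodule.mem_map_equiv]
    change (∀ P ∈ S, P.val (φ⁻¹ * f) ≤ _) ↔ _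
    refine forall₂_congr fun P _ => ?_
    by_cases hf : f = 0
    · simp [hf]
    · rw [val_eq_exp _ (mul_ne_zero (inv_ne_zero hφ) hf), val_eq_exp _ hf,
        P.ord_mul (inv_ne_zero hφ) hf, P.ord_inv, hD, WithZero.exp_le_exp, WithZero.exp_le_exp]
      omega
  obtain ⟨h1, h2, h3⟩ := h
  let e1 : ↥(sectionsOn S D ⊓ sectionsOn Sᶜ D) ≃ₗ[k] ↥(sectionsOn S D' ⊓ sectionsOn Sᶜ D') :=
    (e.submoduleMap _).trans (LinearEquiv.ofEq _ _ (by
      rw [← he, ← he, Submodule.map_inf _ e.injective]))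
  let e2 : (F ⧸ (sectionsOn S D ⊔ sectionsOn Sᶜ D)) ≃ₗ[k]
      F ⧸ (sectionsOn S D' ⊔ sectionsOn Sᶜ D') :=
    Submodule.Quotient.equiv _ _ e (by rw [← he, ← he, Submodule.map_sup])
  exact ⟨Module.Finite.equiv e1, Module.Finite.equiv e2, by
    rw [← h3, e1.finrank_eq, e2.finrank_eq]⟩

theorem IsFredholmPair.index_unique {V : Type*} [AddCommGroup V] [Module k V]
    {I J : Submodule k V} {m n : ℤ} (h : IsFredholmPair I J m) (h' : IsFredholmPair I J n) :
    m = n := h.index_eq.symm.trans h'.index_eq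

end Place

end

section

open IsDedekindDomain Polynomial Module

/-! ### Coverings of the projective line and the genus -/

/-- If `F = V₀ × V ^ ι` compatibly with pairs of subspaces, the dimensions of the quotients add. -/
theorem finrank_quotient_sup_of_prod {k V₀ V F ι : Type*} [Field k] [AddCommGroup V₀] [Module k V₀]
    [AddCommGroup V] [Module k V] [AddCommGroup F] [Module k F] [Fintype ι]
    (Φ : (V₀ × (ι → V)) ≃ₗ[k] F) (A₀ B₀ : Submodule k V₀) (A B : ι → Submodule k V)
    (A' B' : Submodule k F) (hA : ∀ v f, Φ (v, f) ∈ A' ↔ v ∈ A₀ ∧ ∀ i, f i ∈ A i)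
    (hB : ∀ v f, Φ (v, f) ∈ B' ↔ v ∈ B₀ ∧ ∀ i, f i ∈ B i)
    [Module.Finite k (V₀ ⧸ (A₀ ⊔ B₀))] [∀ i, Module.Finite k (V ⧸ (A i ⊔ B i))] :
    Module.Finite k (F ⧸ (A' ⊔ B')) ∧ finrank k (F ⧸ (A' ⊔ B')) =
      finrank k (V₀ ⧸ (A₀ ⊔ B₀)) + ∑ i, finrank k (V ⧸ (A i ⊔ B i)) := by
  let q : F →ₗ[k] (V₀ ⧸ (A₀ ⊔ B₀)) × (∀ i, V ⧸ (A i ⊔ B i)) :=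
    (LinearMap.prodMap (A₀ ⊔ B₀).mkQ
      (LinearMap.pi fun i => (A i ⊔ B i).mkQ ∘ₗ LinearMap.proj i)) ∘ₗ (Φ.symm : F →ₗ[k] _)
  have hq : ∀ v f, q (Φ (v, f)) = ((A₀ ⊔ B₀).mkQ v, fun i => (A i ⊔ B i).mkQ (f i)) := by
    intro v f
    change LinearMap.prodMap _ _ (Φ.symm (Φ (v, f))) = _
    rw [LinearEquiv.symm_apply_apply]
    rfl
  have hqs : Function.Surjective q := by
    rintro ⟨z, g⟩
    obtain ⟨v, rfl⟩ := Submodule.mkQ_surjective _ z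
    choose f hf using fun i => Submodule.mkQ_surjective _ (g i)
    exact ⟨Φ (v, f), by rw [hq]; exact Prod.ext rfl (funext hf)⟩
  have hker : LinearMap.ker q = A' ⊔ B' := by
    ext z
    obtain ⟨⟨v, f⟩, rfl⟩ := Φ.surjective z
    rw [LinearMap.mem_ker, hq]
    have h1 : ((A₀ ⊔ B₀).mkQ v, fun i => (A i ⊔ B i).mkQ (f i)) =
        (0 : (V₀ ⧸ (A₀ ⊔ B₀)) × (∀ i, V ⧸ (A i ⊔ B i))) ↔
          v ∈ A₀ ⊔ B₀ ∧ ∀ i, f i ∈ A i ⊔ B i := by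
      rw [Prod.ext_iff, funext_iff]
      refine and_congr ?_ (forall_congr' fun i => ?_)
      · change (A₀ ⊔ B₀).mkQ v = 0 ↔ _
        rw [← LinearMap.mem_ker, Submodule.ker_mkQ]
      · change (A i ⊔ B i).mkQ (f i) = 0 ↔ _
        rw [← LinearMap.mem_ker, Submodule.ker_mkQ]
    rw [h1]
    constructor
    · rintro ⟨h, hf⟩
      obtain ⟨a, ha, b, hb, hab⟩ := Submodule.mem_sup.1 h
      choose c hc d hd hcd using fun i => Submodule.mem_sup.1 (hf i)
      refine Submodule.mem_sup.2 ⟨Φ (a, c), (hA _ _).2 ⟨ha, hc⟩, Φ (b, d), (hB _ _).2 ⟨hb, hd⟩, ?_⟩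
      rw [← map_add]
      exact congrArg Φ (Prod.ext hab (funext hcd))
    · intro h
      obtain ⟨a, ha, b, hb, hab⟩ := Submodule.mem_sup.1 h
      obtain ⟨⟨a0, a1⟩, rfl⟩ := Φ.surjective a
      obtain ⟨⟨b0, b1⟩, rfl⟩ := Φ.surjective b
      rw [← map_add] at hab
      have h2 := Φ.injective hab
      rw [hA] at ha
      rw [hB] at hb
      have h3 : a0 + b0 = v := congrArg Prod.fst h2
      have h4 : a1 + b1 = f := congrArg Prod.snd h2
      rw [← h3, ← h4]
      exact ⟨Submodule.add_mem_sup ha.1 hb.1, fun i => Submodule.add_mem_sup (ha.2 i) (hb.2 i)⟩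
  have e := (Submodule.quotEquivOfEq _ _ hker.symm).trans (q.quotKerEquivOfSurjective hqs)
  refine ⟨Module.Finite.equiv e.symm, ?_⟩
  rw [e.finrank_eq, finrank_prod, finrank_pi_fintype]

namespace Place

/-- The places that do not lie over the point at infinity. -/
def finitePlaces (k F : Type*) [Field k] [Field F] [Algebra k F] [Algebra (RatFunc k) F] :
    Set (Place k F) :=
  {Q | algebraMap (RatFunc k) F RatFunc.X ∈ Q.ring}

variable {k F : Type*} [Field k] [Field F] [Algebra k F] [Algebra (RatFunc k) F]
  [IsScalarTower k (RatFunc k) F]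

theorem polynomial_mem_of_mem_finitePlaces {Q : Place k F} (h : Q ∈ finitePlaces k F) (p : k[X]) :
    algebraMap (RatFunc k) F (algebraMap k[X] (RatFunc k) p) ∈ Q.ring := by
  have h1 := Q.algebraMap_polynomial_mem h p
  rwa [aeval_algebraMap_apply, ← RatFunc.algebraMap_X, aeval_algebraMap_apply,
    aeval_X_left_apply] at h1

theorem LiesOver.mem_finitePlaces_iff {Q : Place k F} {P : Place k (RatFunc k)}
    (h : Q.LiesOver (IsScalarTower.toAlgHom k (RatFunc k) F) P) :
    Q ∈ finitePlaces k F ↔ (RatFunc.X : RatFunc k) ∈ P.ring := h.mem_iff _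

variable [FiniteDimensional (RatFunc k) F]

theorem notMem_finitePlaces_iff {Q : Place k F} :
    Q ∉ finitePlaces k F ↔ Q.LiesOver (IsScalarTower.toAlgHom k (RatFunc k) F) (infty k) := by
  constructor
  · intro h
    have h1 := Q.liesOver_below (IsScalarTower.toAlgHom k (RatFunc k) F) isIntegral_toAlgHom
    rw [h1.mem_finitePlaces_iff] at h
    rwa [eq_infty h] at h1
  · intro h
    rw [h.mem_finitePlaces_iff]
    exact X_notMem_infty

variable [Algebra.IsSeparable (RatFunc k) F]

/-- The finite places are the maximal ideals of the integral closure of `k[x]`. -/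
theorem isAffineSet_finitePlaces : IsAffineSet (finitePlaces k F) := by
  let _ : Algebra k[X] F :=
    ((algebraMap (RatFunc k) F).comp (algebraMap k[X] (RatFunc k))).toAlgebra
  have : IsScalarTower k[X] (RatFunc k) F := .of_algebraMap_eq fun _ => rfl
  have := integralClosure.isDedekindDomain k[X] (RatFunc k) F
  have := integralClosure.isFractionRing_of_finite_extension (A := k[X]) (RatFunc k) F
  refine isAffineSet_of_isDedekindDomain (integralClosure k[X] F) _ fun P => ⟨fun h r => ?_,
    fun h => ?_⟩
  · exact mem_of_isIntegral (A := k[X]) P.ring (polynomial_mem_of_mem_finitePlaces h) r.2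
  · have := h ⟨algebraMap k[X] F X, isIntegral_algebraMap⟩
    change algebraMap (RatFunc k) F RatFunc.X ∈ P.ring
    rw [← RatFunc.algebraMap_X]
    exact this

/-- The places at infinity are the maximal ideals of the integral closure of the local ring at
infinity. -/
theorem isAffineSet_finitePlaces_compl : IsAffineSet (finitePlaces k F)ᶜ := by
  have := isDedekindDomain_integralClosure (F := F) (infty k)
  have := isFractionRing_integralClosure (F := F) (infty k)
  refine isAffineSet_of_isDedekindDomain (integralClosure (infty k).ring F) _ fun P => ?_
  rw [Set.mem_compl_iff, notMem_finitePlaces_iff, liesOver_iff_integralClosure]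

theorem finite_finitePlaces_compl : (finitePlaces k F)ᶜ.Finite := by
  refine (finite_liesOver (F := F) (infty k)).subset fun Q hQ => ?_
  exact notMem_finitePlaces_iff.1 hQ

theorem inertiaDeg_pos {E : Type*} [Field E] [Algebra k E] [Algebra E F] [IsScalarTower k E F]
    [FiniteDimensional E F] [Algebra.IsSeparable E F] {Q : Place k F} {P : Place k E}
    (h : Q.LiesOver (IsScalarTower.toAlgHom k E F) P) :
    0 < Q.inertiaDeg (IsScalarTower.toAlgHom k E F) P := by
  have := isDedekindDomain_integralClosure (F := F) P
  have := isFractionRing_integralClosure (F := F) P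
  have := finite_integralClosure (F := F) P
  rw [← inertiaDeg_eq_ideal P ⟨Q, h⟩]
  have := (equivPrimesOver P ⟨Q, h⟩).2.1
  exact Ideal.inertiaDeg_pos _ _

theorem finite_residue (Q : Place k F) : Module.Finite k Q.Residue := by
  have h := Q.liesOver_below (IsScalarTower.toAlgHom k (RatFunc k) F) isIntegral_toAlgHom
  refine Module.finite_of_finrank_pos ?_
  change 0 < Q.deg
  rw [h.deg_eq]
  exact Nat.mul_pos (inertiaDeg_pos h) (deg_pos _)

/-- The genus is the dimension of `H¹` for the covering by the finite places and the places at
infinity. -/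
theorem curveGenus_eq_finrank : curveGenus k F =
    finrank k (F ⧸ (sectionsOn (finitePlaces k F) 0 ⊔ sectionsOn (finitePlaces k F)ᶜ 0)) :=
  curveGenus_eq isAffineSet_finitePlaces isAffineSet_finitePlaces_compl finite_finitePlaces_compl

/-- A nonzero function has finitely many zeros and poles. -/
theorem exists_divisor {f : F} (hf : f ≠ 0) :
    ∃ D : CurveDivisor k F, ∀ P : Place k F, D P = P.ord f := by
  have hfin : ∀ g : F, {P : Place k F | g ∉ P.ring}.Finite := by
    intro g
    refine (((isAffineSet_finitePlaces (k := k) (F := F)).finite_poles g).union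
      ((isAffineSet_finitePlaces_compl (k := k) (F := F)).finite_poles g)).subset fun P hP => ?_
    by_cases h : P ∈ finitePlaces k F
    · exact Or.inl ⟨h, hP⟩
    · exact Or.inr ⟨h, hP⟩
  refine ⟨Finsupp.ofSupportFinite (fun P => P.ord f) (((hfin f).union (hfin f⁻¹)).subset ?_),
    fun P => rfl⟩
  intro P hP
  by_contra h
  rw [Set.mem_union, not_or] at h
  have h1 := (P.mem_ring_iff hf).1 (not_not.1 h.1)
  have h2 := (P.mem_ring_iff (inv_ne_zero hf)).1 (not_not.1 h.2)
  rw [ord_inv] at h2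
  exact hP (by change P.ord f = 0; omega)

theorem mem_sectionsOn_finitePlaces_iff {f : RatFunc k} :
    f ∈ sectionsOn (finitePlaces k (RatFunc k)) 0 ↔
      ∃ p : k[X], algebraMap k[X] (RatFunc k) p = f := by
  rw [mem_sectionsOn_zero]
  constructor
  · exact fun h => exists_polynomial h
  · rintro ⟨p, rfl⟩ P hP
    exact polynomial_mem hP p

theorem notMem_finitePlaces_ratFunc {P : Place k (RatFunc k)} :
    P ∉ finitePlaces k (RatFunc k) ↔ P = infty k := by
  constructor
  · exact fun h => eq_infty h
  · rintro rfl
    exact X_notMem_infty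

/-- The two standard affine lines cover the projective line, which has arithmetic genus `0`. -/
theorem isFredholmPair_ratFunc :
    IsFredholmPair (sectionsOn (finitePlaces k (RatFunc k)) 0)
      (sectionsOn (finitePlaces k (RatFunc k))ᶜ 0) 1 ∧
    sectionsOn (finitePlaces k (RatFunc k)) 0 ⊔ sectionsOn (finitePlaces k (RatFunc k))ᶜ 0 = ⊤ := by
  have hinf : ∀ f : RatFunc k, f ∈ sectionsOn (finitePlaces k (RatFunc k))ᶜ 0 ↔
      f ∈ (infty k).ring := by
    intro f
    rw [mem_sectionsOn_zero]
    exact ⟨fun h => h _ (notMem_finitePlaces_ratFunc.2 rfl),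
      fun h P hP => by rwa [notMem_finitePlaces_ratFunc.1 hP]⟩
  have htop : sectionsOn (finitePlaces k (RatFunc k)) 0 ⊔
      sectionsOn (finitePlaces k (RatFunc k))ᶜ 0 = ⊤ := by
    rw [eq_top_iff]
    intro f _
    have hmon := RatFunc.monic_denom f
    have hd0 : algebraMap k[X] (RatFunc k) f.denom ≠ 0 := by simpa using f.denom_ne_zero
    -- division with remainder: a polynomial plus a function without a pole at infinity
    refine Submodule.mem_sup.2 ⟨algebraMap k[X] (RatFunc k) (f.num /ₘ f.denom),
      mem_sectionsOn_finitePlaces_iff.2 ⟨_, rfl⟩,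
      algebraMap k[X] (RatFunc k) (f.num %ₘ f.denom) / algebraMap k[X] (RatFunc k) f.denom,
      (hinf _).2 ?_, ?_⟩
    · by_cases h0 : f.num %ₘ f.denom = 0
      · rw [h0, map_zero, zero_div]; exact zero_mem _
      · have h0' : algebraMap k[X] (RatFunc k) (f.num %ₘ f.denom) ≠ 0 := by simpa using h0
        rw [mem_ring_iff _ (div_ne_zero h0' hd0), ord_div _ h0' hd0, ord_infty h0', ord_infty hd0,
          RatFunc.intDegree_polynomial, RatFunc.intDegree_polynomial]
        have := natDegree_lt_natDegree h0 (degree_modByMonic_lt f.num hmon)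
        omega
    · conv_rhs => rw [← RatFunc.num_div_denom f]
      rw [eq_div_iff hd0, add_mul, div_mul_cancel₀ _ hd0, ← map_mul, ← map_add]
      congr 1
      rw [add_comm, mul_comm]
      exact modByMonic_add_div f.num f.denom
  have hbot : sectionsOn (finitePlaces k (RatFunc k)) 0 ⊓
      sectionsOn (finitePlaces k (RatFunc k))ᶜ 0 =
        LinearMap.range (Algebra.linearMap k (RatFunc k)) := by
    ext f
    rw [Submodule.mem_inf, mem_sectionsOn_finitePlaces_iff, hinf]
    constructor
    · rintro ⟨⟨p, rfl⟩, h⟩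
      by_cases hp : p = 0
      · exact ⟨0, by simp [hp]⟩
      · have hp' : algebraMap k[X] (RatFunc k) p ≠ 0 := by simpa using hp
        rw [mem_ring_iff _ hp', ord_infty hp', RatFunc.intDegree_polynomial] at h
        have h1 : p.natDegree = 0 := by omega
        obtain ⟨c, rfl⟩ := natDegree_eq_zero.1 h1
        exact ⟨c, by rw [Algebra.linearMap_apply, IsScalarTower.algebraMap_apply k k[X] (RatFunc k)]
                     rfl⟩
    · rintro ⟨c, rfl⟩
      refine ⟨⟨C c, ?_⟩, (infty k).algebraMap_mem c⟩
      rw [Algebra.linearMap_apply, IsScalarTower.algebraMap_apply k k[X] (RatFunc k)]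
      rfl
  let e : k ≃ₗ[k] LinearMap.range (Algebra.linearMap k (RatFunc k)) :=
    LinearEquiv.ofInjective (Algebra.linearMap k (RatFunc k)) (algebraMap k (RatFunc k)).injective
  refine ⟨⟨?_, ?_, ?_⟩, htop⟩
  · rw [hbot]
    exact Module.Finite.equiv e
  · rw [htop]
    infer_instance
  · rw [htop, hbot, ← e.finrank_eq, finrank_self,
      finrank_zero_of_subsingleton]
    rfl

/-- Regularity can be tested after pulling back to a finite covering. -/
theorem forall_mem_iff_of_tower {E F : Type*} [Field E] [Field F] [Algebra k E] [Algebra k F]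
    [Algebra E F] [IsScalarTower k E F] [FiniteDimensional E F] [Algebra.IsSeparable E F]
    {S : Set (Place k E)} {S' : Set (Place k F)}
    (hS : ∀ Q P, Q.LiesOver (IsScalarTower.toAlgHom k E F) P → (Q ∈ S' ↔ P ∈ S)) (f : E) :
    (∀ Q ∈ S', algebraMap E F f ∈ Q.ring) ↔ ∀ P ∈ S, f ∈ P.ring := by
  constructor
  · intro h P hP
    obtain ⟨Q, hQ⟩ := exists_liesOver (F := F) P
    exact (hQ.mem_iff f).1 (h Q ((hS Q P hQ).2 hP))
  · intro h Q hQ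
    have h1 := Q.liesOver_below (IsScalarTower.toAlgHom k E F) isIntegral_toAlgHom
    exact (h1.mem_iff f).2 (h _ ((hS _ _ h1).1 hQ))

end Place

end

section

open IsDedekindDomain Polynomial Module

/-! ### Radical extensions and the genus 2 curve -/

section Radical

variable {E K : Type*} [Field E] [Field K] [Algebra E K] {z : K} {n : ℕ} {a : E}

theorem isIntegral_of_pow_eq (hn : 0 < n) (hz : z ^ n = algebraMap E K a) : IsIntegral E z :=
  ⟨X ^ n - C a, monic_X_pow_sub_C a hn.ne', by simp [hz]⟩

/-- The powers `z ^ i` with `i < n` span `E(z)` when `z ^ n` is in `E`. -/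
theorem exists_sum_of_pow_eq (hn : 0 < n) (hz : z ^ n = algebraMap E K a)
    (htop : IntermediateField.adjoin E {z} = ⊤) (f : K) :
    ∃ c : ℕ → E, f = ∑ i ∈ Finset.range n, algebraMap E K (c i) * z ^ i := by
  have hf : f ∈ Algebra.adjoin E {z} := by
    rw [← IntermediateField.adjoin_simple_toSubalgebra_of_isAlgebraic
      (isIntegral_of_pow_eq hn hz).isAlgebraic, htop]
    trivial
  rw [Algebra.adjoin_singleton_eq_range_aeval] at hf
  obtain ⟨p, rfl⟩ := hf
  have hmon : (X ^ n - C a : E[X]).Monic := monic_X_pow_sub_C a hn.ne'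
  have h0 : aeval z (X ^ n - C a : E[X]) = 0 := by simp [hz]
  refine ⟨(p %ₘ (X ^ n - C a)).coeff, ?_⟩
  have h1 : aeval z p = aeval z (p %ₘ (X ^ n - C a)) := by
    conv_lhs => rw [← modByMonic_add_div p (X ^ n - C a)]
    rw [map_add, map_mul, h0, zero_mul, add_zero]
  have hdeg : (p %ₘ (X ^ n - C a)).natDegree < n := by
    have := natDegree_modByMonic_lt p hmon (fun h => by
      have := congrArg natDegree h
      rw [natDegree_X_pow_sub_C, natDegree_one] at this
      omega)
    rwa [natDegree_X_pow_sub_C] at this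
  change aeval z p = _
  rw [h1, aeval_eq_sum_range' hdeg]
  exact Finset.sum_congr rfl fun i _ => Algebra.smul_def _ _

theorem minpoly_of_pow_eq (hn : 0 < n) (hz : z ^ n = algebraMap E K a)
    (hirr : Irreducible (X ^ n - C a : E[X])) : minpoly E z = X ^ n - C a :=
  (minpoly.eq_of_irreducible_of_monic hirr (by simp [hz]) (monic_X_pow_sub_C a hn.ne')).symm

theorem finiteDimensional_of_pow_eq (hn : 0 < n) (hz : z ^ n = algebraMap E K a)
    (htop : IntermediateField.adjoin E {z} = ⊤) : FiniteDimensional E K := by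
  have := IntermediateField.adjoin.finiteDimensional (isIntegral_of_pow_eq hn hz)
  rw [htop] at this
  exact Module.Finite.equiv IntermediateField.topEquiv.toLinearEquiv

theorem isSeparable_of_pow_eq (hn : (n : E) ≠ 0) (ha : a ≠ 0) (hz : z ^ n = algebraMap E K a)
    (htop : IntermediateField.adjoin E {z} = ⊤) : Algebra.IsSeparable E K := by
  have h1 : IsSeparable E z := by
    refine (separable_X_pow_sub_C a hn ha).of_dvd ?_
    exact minpoly.dvd _ _ (by simp [hz])
  have h2 := (IntermediateField.isSeparable_adjoin_simple_iff_isSeparable E K).2 h1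
  rw [htop] at h2
  exact Algebra.IsSeparable.of_algHom _ _ (IntermediateField.topEquiv (F := E) (E := K)).symm.toAlgHom

theorem finrank_of_pow_eq (hn : 0 < n) (hz : z ^ n = algebraMap E K a)
    (htop : IntermediateField.adjoin E {z} = ⊤)
    (hirr : Irreducible (X ^ n - C a : E[X])) : finrank E K = n := by
  have := IntermediateField.adjoin.finrank (isIntegral_of_pow_eq hn hz)
  rwa [htop, IntermediateField.finrank_top', minpoly_of_pow_eq hn hz hirr,
    natDegree_X_pow_sub_C] at this

/-- The powers `z ^ i` with `i < n` are linearly independent when `X ^ n - a` is irreducible. -/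
theorem eq_zero_of_sum_eq_zero (hn : 0 < n) (hz : z ^ n = algebraMap E K a)
    (hirr : Irreducible (X ^ n - C a : E[X])) (c : ℕ → E)
    (hc : ∑ i ∈ Finset.range n, algebraMap E K (c i) * z ^ i = 0) : ∀ i < n, c i = 0 := by
  set p : E[X] := ∑ i ∈ Finset.range n, C (c i) * X ^ i with hp
  have h1 : aeval z p = 0 := by
    rw [← hc, hp, map_sum]
    exact Finset.sum_congr rfl fun i _ => by simp
  have h2 : p = 0 := by
    by_contra h
    have h3 := minpoly.degree_le_of_ne_zero E z h h1
    rw [minpoly_of_pow_eq hn hz hirr, degree_X_pow_sub_C hn] at h3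
    have h4 : p.degree < n := by
      rw [hp]
      refine (degree_sum_le _ _).trans_lt ((Finset.sup_lt_iff (WithBot.bot_lt_coe n)).2 ?_)
      intro i hi
      exact (degree_C_mul_X_pow_le i (c i)).trans_lt (by
        exact WithBot.coe_lt_coe.2 (Finset.mem_range.1 hi))
    exact absurd h3 (not_le.2 h4)
  intro i hi
  have h5 := congrArg (fun q => coeff q i) h2
  simpa [hp, coeff_X_pow, hi] using h5

/-- A homomorphism on `E` extends to `E(z)` as soon as there is an image for `z`. -/
theorem exists_ringHom_of_pow_eq (hn : 0 < n) (hz : z ^ n = algebraMap E K a)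
    (htop : IntermediateField.adjoin E {z} = ⊤) (hirr : Irreducible (X ^ n - C a : E[X]))
    {M : Type*} [Field M] (i : E →+* M) {z' : M} (hz' : z' ^ n = i a) :
    ∃ g : K →+* M, (∀ e, g (algebraMap E K e) = i e) ∧ g z = z' := by
  have hmin := minpoly_of_pow_eq hn hz hirr
  let r : AdjoinRoot (minpoly E z) →+* M := AdjoinRoot.lift i z' (by
    rw [hmin, eval₂_sub, eval₂_X_pow, eval₂_C, hz', sub_self])
  let e₁ := IntermediateField.adjoinRootEquivAdjoin E (isIntegral_of_pow_eq hn hz)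
  let e₂ : K ≃ₐ[E] IntermediateField.adjoin E {z} :=
    IntermediateField.topEquiv.symm.trans (IntermediateField.equivOfEq htop.symm)
  let g : K ≃ₐ[E] AdjoinRoot (minpoly E z) := e₂.trans e₁.symm
  refine ⟨r.comp (g : K →+* AdjoinRoot (minpoly E z)), fun e => ?_, ?_⟩
  · change r (g (algebraMap E K e)) = _
    rw [g.commutes]
    exact AdjoinRoot.lift_of _
  · have h1 : g z = AdjoinRoot.root _ := by
      change e₁.symm (e₂ z) = _
      rw [AlgEquiv.symm_apply_eq, IntermediateField.adjoinRootEquivAdjoin_apply_root]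
      rfl
    change r (g z) = _
    rw [h1]
    exact AdjoinRoot.lift_root _

end Radical

section Rational

variable {k : Type*} [Field k]

/-- If `v ^ 2 s` is a polynomial and `s` is squarefree, then `v` is a polynomial. -/
theorem RatFunc.exists_polynomial_of_sq_mul {s p : k[X]} (hs : Squarefree s) {v : RatFunc k}
    (h : v ^ 2 * algebraMap k[X] (RatFunc k) s = algebraMap k[X] (RatFunc k) p) :
    ∃ q : k[X], algebraMap k[X] (RatFunc k) q = v := by
  have hd0 : algebraMap k[X] (RatFunc k) v.denom ≠ 0 := by simpa using v.denom_ne_zero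
  have h1 : v.num ^ 2 * s = p * v.denom ^ 2 := by
    apply IsFractionRing.injective k[X] (RatFunc k)
    have h0 : algebraMap k[X] (RatFunc k) v.num = v * algebraMap k[X] (RatFunc k) v.denom := by
      rw [eq_comm, ← eq_div_iff hd0, RatFunc.num_div_denom]
    rw [map_mul, map_mul, map_pow, map_pow, ← h, h0]
    ring
  have h2 : v.denom ^ 2 ∣ s :=
    (v.isCoprime_num_denom.symm.pow (m := 2) (n := 2)).dvd_of_dvd_mul_left
      ⟨p, by rw [h1, mul_comm]⟩
  have h3 : IsUnit v.denom := hs _ (by rwa [← sq])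
  obtain ⟨c, hc⟩ := h3.exists_right_inv
  refine ⟨v.num * c, ?_⟩
  conv_rhs => rw [← RatFunc.num_div_denom v]
  rw [eq_div_iff hd0, ← map_mul, mul_assoc, mul_comm c, hc, mul_one]

theorem RatFunc.sq_ne_of_separable {s : k[X]} (hs : s.Separable) (hdeg : s.natDegree ≠ 0)
    (v : RatFunc k) : v ^ 2 ≠ algebraMap k[X] (RatFunc k) s := by
  intro h
  obtain ⟨q, rfl⟩ := RatFunc.exists_polynomial_of_sq_mul (s := 1) (p := s) (v := v)
    squarefree_one (by rw [map_one, mul_one, h])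
  rw [← map_pow] at h
  have h1 := IsFractionRing.injective k[X] (RatFunc k) h
  have h2 : IsUnit q := hs.squarefree q ⟨1, by rw [← h1]; ring⟩
  have h3 := natDegree_eq_zero_of_isUnit h2
  rw [← h1, natDegree_pow, h3] at hdeg
  exact hdeg rfl

end Rational

/-- `K` is the function field `k(x, y)` of the curve `y ^ 2 = s(x)` of genus `2`, where `s` is a
separable polynomial of degree `6`. -/
structure IsSextic {k K : Type*} [Field k] [Field K] [Algebra (RatFunc k) K] (s : k[X])
    (y : K) : Prop where
  two_ne : (2 : k) ≠ 0
  natDegree_eq : s.natDegree = 6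
  separable : s.Separable
  sq_eq : y ^ 2 = algebraMap (RatFunc k) K (algebraMap k[X] (RatFunc k) s)
  adjoin_eq_top : IntermediateField.adjoin (RatFunc k) {y} = ⊤

namespace IsSextic

variable {k K : Type*} [Field k] [Field K] [Algebra (RatFunc k) K] {s : k[X]} {y : K}

theorem ne_zero (h : IsSextic s y) : s ≠ 0 := h.separable.ne_zero

theorem algebraMap_ne_zero (h : IsSextic s y) : algebraMap k[X] (RatFunc k) s ≠ 0 := by
  simpa using h.ne_zero

theorem two_ne_zero' (h : IsSextic s y) {F : Type*} [Field F] [Algebra k F] : (2 : F) ≠ 0 := by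
  have := (algebraMap k F).injective.ne h.two_ne
  rwa [map_ofNat, map_zero] at this

theorem y_ne_zero (h : IsSextic s y) : y ≠ 0 := by
  rintro rfl
  have := h.sq_eq
  rw [zero_pow two_ne_zero, eq_comm, map_eq_zero] at this
  exact h.algebraMap_ne_zero this

theorem irreducible (h : IsSextic s y) :
    Irreducible (X ^ 2 - C (algebraMap k[X] (RatFunc k) s) : (RatFunc k)[X]) :=
  X_pow_sub_C_irreducible_of_prime Nat.prime_two
    (RatFunc.sq_ne_of_separable h.separable (by rw [h.natDegree_eq]; omega))

theorem finiteDimensional (h : IsSextic s y) : FiniteDimensional (RatFunc k) K :=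
  finiteDimensional_of_pow_eq two_pos h.sq_eq h.adjoin_eq_top

theorem isSeparable (h : IsSextic s y) : Algebra.IsSeparable (RatFunc k) K :=
  isSeparable_of_pow_eq (n := 2) (by exact_mod_cast h.two_ne_zero') h.algebraMap_ne_zero h.sq_eq
    h.adjoin_eq_top

theorem exists_eq (h : IsSextic s y) (f : K) :
    ∃ u v : RatFunc k, f = algebraMap (RatFunc k) K u + algebraMap (RatFunc k) K v * y := by
  obtain ⟨c, hc⟩ := exists_sum_of_pow_eq (n := 2) (by omega) h.sq_eq h.adjoin_eq_top f
  refine ⟨c 0, c 1, ?_⟩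
  rw [hc, Finset.sum_range_succ, Finset.sum_range_one, pow_zero, mul_one, pow_one]

theorem eq_zero (h : IsSextic s y) {u v : RatFunc k}
    (huv : algebraMap (RatFunc k) K u + algebraMap (RatFunc k) K v * y = 0) : u = 0 ∧ v = 0 := by
  have := eq_zero_of_sum_eq_zero (n := 2) (by omega) h.sq_eq h.irreducible
    (fun i => if i = 0 then u else v) (by
      rw [Finset.sum_range_succ, Finset.sum_range_one, pow_zero, mul_one, pow_one]
      exact huv)
  exact ⟨this 0 (by omega), this 1 (by omega)⟩

/-- The hyperelliptic involution. -/
theorem exists_conj (h : IsSextic s y) : ∃ σ : K ≃ₐ[RatFunc k] K, σ y = -y := by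
  obtain ⟨g, hg, hgy⟩ := exists_ringHom_of_pow_eq two_pos h.sq_eq h.adjoin_eq_top h.irreducible
    (algebraMap (RatFunc k) K) (z' := -y) (by rw [neg_sq, h.sq_eq])
  have := h.finiteDimensional
  let g' : K →ₐ[RatFunc k] K := { g with commutes' := hg }
  exact ⟨AlgEquiv.ofBijective g' (Algebra.IsAlgebraic.algHom_bijective g'), hgy⟩

/-- The hyperelliptic involution. -/
def conj (h : IsSextic s y) : K ≃ₐ[RatFunc k] K := h.exists_conj.choose

theorem conj_y (h : IsSextic s y) : h.conj y = -y := h.exists_conj.choose_spec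

theorem conj_apply (h : IsSextic s y) (u v : RatFunc k) :
    h.conj (algebraMap (RatFunc k) K u + algebraMap (RatFunc k) K v * y) =
      algebraMap (RatFunc k) K u - algebraMap (RatFunc k) K v * y := by
  rw [map_add, map_mul, AlgEquiv.commutes, AlgEquiv.commutes, conj_y]; ring

theorem conj_conj (h : IsSextic s y) (f : K) : h.conj (h.conj f) = f := by
  obtain ⟨u, v, rfl⟩ := h.exists_eq f
  rw [conj_apply, map_sub, map_mul, AlgEquiv.commutes, AlgEquiv.commutes, conj_y]; ring

theorem mem_range_of_conj_eq [Algebra k K] (h : IsSextic s y) {f : K} (hf : h.conj f = f) :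
    ∃ u, algebraMap (RatFunc k) K u = f := by
  obtain ⟨u, v, rfl⟩ := h.exists_eq f
  refine ⟨u, ?_⟩
  rw [conj_apply] at hf
  have h1 : (2 : K) * (algebraMap (RatFunc k) K v * y) = 0 := by linear_combination -hf
  rw [(mul_eq_zero.1 h1).resolve_left h.two_ne_zero', add_zero]

theorem exists_norm [Algebra k K] (h : IsSextic s y) (f : K) :
    ∃ u, algebraMap (RatFunc k) K u = f * h.conj f :=
  h.mem_range_of_conj_eq (by rw [map_mul, conj_conj, mul_comm])

end IsSextic

namespace Place

theorem mem_of_pow_mem {k F : Type*} [Field k] [Field F] [Algebra k F] (P : Place k F) {f : F}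
    {n : ℕ} (hn : n ≠ 0) (h : f ^ n ∈ P.ring) : f ∈ P.ring := by
  rw [← val_le_one_iff, map_pow] at h
  rw [← val_le_one_iff]
  exact (pow_le_one_iff hn).1 h

theorem pow_mem_iff {k F : Type*} [Field k] [Field F] [Algebra k F] (P : Place k F) {f : F}
    {n : ℕ} (hn : n ≠ 0) : f ^ n ∈ P.ring ↔ f ∈ P.ring :=
  ⟨P.mem_of_pow_mem hn, fun h => pow_mem h n⟩

theorem two_mul_mem_iff {k F : Type*} [Field k] [Field F] [Algebra k F] (h2 : (2 : k) ≠ 0)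
    (P : Place k F) {f : F} : 2 * f ∈ P.ring ↔ f ∈ P.ring := by
  constructor
  · intro h
    have h3 := P.ring.mul_mem _ _ (P.algebraMap_mem 2⁻¹) h
    have h4 : algebraMap k F 2⁻¹ * (2 * f) = f := by
      rw [← mul_assoc, ← map_ofNat (algebraMap k F) 2, ← map_mul, inv_mul_cancel₀ h2, map_one,
        one_mul]
    rwa [h4] at h3
  · intro h
    rw [two_mul]
    exact P.ring.add_mem _ _ h h

theorem comapAut_mem_finitePlaces {k F : Type*} [Field k] [Field F] [Algebra k F]
    [Algebra (RatFunc k) F] [IsScalarTower k (RatFunc k) F] (σ : F ≃ₐ[RatFunc k] F)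
    (Q : Place k F) : Q.comapAut (σ.restrictScalars k) ∈ finitePlaces k F ↔
      Q ∈ finitePlaces k F := by
  change σ (algebraMap (RatFunc k) F RatFunc.X) ∈ Q.ring ↔ _
  rw [AlgEquiv.commutes]
  rfl

end Place

namespace IsSextic

open Place

variable {k K : Type*} [Field k] [Field K] [Algebra k K] [Algebra (RatFunc k) K]
  [IsScalarTower k (RatFunc k) K] {s : k[X]} {y : K}

/-- A function is regular on a set of places that is stable under the hyperelliptic involution
iff its even and odd parts are. -/
theorem forall_mem_iff (h : IsSextic s y) {S : Set (Place k K)} {S₀ : Set (Place k (RatFunc k))}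
    (hσ : ∀ Q, Q.comapAut (h.conj.restrictScalars k) ∈ S ↔ Q ∈ S)
    (hS : ∀ (Q : Place k K) P,
      Q.LiesOver (IsScalarTower.toAlgHom k (RatFunc k) K) P → (Q ∈ S ↔ P ∈ S₀))
    (u v : RatFunc k) :
    (∀ Q ∈ S, algebraMap (RatFunc k) K u + algebraMap (RatFunc k) K v * y ∈ Q.ring) ↔
      (∀ P ∈ S₀, u ∈ P.ring) ∧ (∀ P ∈ S₀, v ^ 2 * algebraMap k[X] (RatFunc k) s ∈ P.ring) := by
  have := h.finiteDimensional
  have := h.isSeparable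
  have hvy : algebraMap (RatFunc k) K (v ^ 2 * algebraMap k[X] (RatFunc k) s) =
      (algebraMap (RatFunc k) K v * y) ^ 2 := by
    rw [map_mul, map_pow, mul_pow, h.sq_eq]
  rw [← forall_mem_iff_of_tower (F := K) hS, ← forall_mem_iff_of_tower (F := K) hS, hvy,
    ← forall₂_and]
  constructor
  · intro H Q hQ
    have h1 := H Q hQ
    have h2 := H _ ((hσ Q).2 hQ)
    rw [mem_comapAut] at h2
    have h3 : h.conj _ ∈ Q.ring := h2
    rw [conj_apply] at h3
    have h4 : algebraMap (RatFunc k) K u ∈ Q.ring := by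
      rw [← two_mul_mem_iff h.two_ne]
      convert Q.ring.add_mem _ _ h1 h3 using 1
      ring
    refine ⟨h4, pow_mem ?_ 2⟩
    have := sub_mem h1 h4
    rwa [add_sub_cancel_left] at this
  · intro H Q hQ
    exact Q.ring.add_mem _ _ (H Q hQ).1 (Q.mem_of_pow_mem two_ne_zero (H Q hQ).2)

/-- The divisor `-3 ∞` on the projective line, which bounds the coefficient `v` of a function
`u + v y` that is regular at infinity. -/
def inftyDivisor (k : Type*) [Field k] : CurveDivisor k (RatFunc k) :=
  Finsupp.single (infty k) (-3)

/-- The functions regular at the finite places are `u + v y` with polynomials `u` and `v`. -/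
theorem mem_sectionsOn_finitePlaces (h : IsSextic s y) (u v : RatFunc k) :
    algebraMap (RatFunc k) K u + algebraMap (RatFunc k) K v * y ∈ sectionsOn (finitePlaces k K) 0 ↔
      u ∈ sectionsOn (finitePlaces k (RatFunc k)) 0 ∧
      v ∈ sectionsOn (finitePlaces k (RatFunc k)) (inftyDivisor k) := by
  have h0 : sectionsOn (finitePlaces k (RatFunc k)) (inftyDivisor k) =
      sectionsOn (finitePlaces k (RatFunc k)) 0 := by
    refine sectionsOn_congr fun P hP => ?_
    rw [inftyDivisor, Finsupp.single_eq_of_ne, Pi.zero_apply]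
    rintro rfl
    exact X_notMem_infty hP
  rw [h0, mem_sectionsOn_zero, h.forall_mem_iff (comapAut_mem_finitePlaces _)
    (S₀ := finitePlaces k (RatFunc k)) (fun Q P hQ => hQ.mem_finitePlaces_iff),
    ← mem_sectionsOn_zero, ← mem_sectionsOn_zero, mem_sectionsOn_finitePlaces_iff,
    mem_sectionsOn_finitePlaces_iff, mem_sectionsOn_finitePlaces_iff]
  refine and_congr_right fun _ => ⟨?_, ?_⟩
  · rintro ⟨p, hp⟩
    exact RatFunc.exists_polynomial_of_sq_mul h.separable.squarefree hp.symm
  · rintro ⟨q, rfl⟩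
    exact ⟨q ^ 2 * s, by rw [map_mul, map_pow]⟩

/-- A function `u + v y` is regular at infinity iff `u` is and `v` vanishes there to order at least
`3`, since `s` has degree `6`. -/
theorem mem_sectionsOn_finitePlaces_compl (h : IsSextic s y) (u v : RatFunc k) :
    algebraMap (RatFunc k) K u + algebraMap (RatFunc k) K v * y ∈
        sectionsOn (finitePlaces k K)ᶜ 0 ↔
      u ∈ sectionsOn (finitePlaces k (RatFunc k))ᶜ 0 ∧
      v ∈ sectionsOn (finitePlaces k (RatFunc k))ᶜ (inftyDivisor k) := by
  rw [mem_sectionsOn_zero, h.forall_mem_iff (S := (finitePlaces k K)ᶜ) (S₀ := (finitePlaces k (RatFunc k))ᶜ)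
    (fun Q => not_congr (comapAut_mem_finitePlaces _ Q))
    (fun Q P hQ => not_congr hQ.mem_finitePlaces_iff), ← mem_sectionsOn_zero]
  refine and_congr_right fun _ => ?_
  rw [mem_sectionsOn]
  refine forall₂_congr fun P hP => ?_
  obtain rfl := notMem_finitePlaces_ratFunc.1 hP
  rw [inftyDivisor, Finsupp.single_eq_same]
  by_cases hv : v = 0
  · simp [hv, zero_mem]
  · rw [mem_ring_iff _ (mul_ne_zero (pow_ne_zero 2 hv) h.algebraMap_ne_zero),
      ord_mul _ (pow_ne_zero 2 hv) h.algebraMap_ne_zero, ord_pow, ord_infty h.algebraMap_ne_zero,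
      RatFunc.intDegree_polynomial, h.natDegree_eq, val_eq_exp _ hv, WithZero.exp_le_exp]
    push_cast
    omega

/-- The cohomology of the structure sheaf: `h⁰ = 1`, `h¹ = 2`. -/
theorem isFredholmPair (h : IsSextic s y) :
    IsFredholmPair (sectionsOn (finitePlaces k K) 0) (sectionsOn (finitePlaces k K)ᶜ 0) (-1) ∧
    (∀ f ∈ sectionsOn (finitePlaces k K) 0 ⊓ sectionsOn (finitePlaces k K)ᶜ 0,
      ∃ c : k, algebraMap k K c = f) ∧
    finrank k (K ⧸ (sectionsOn (finitePlaces k K) 0 ⊔ sectionsOn (finitePlaces k K)ᶜ 0)) = 2 := by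
  obtain ⟨hE, htop⟩ := isFredholmPair_ratFunc (k := k)
  have hD := isFredholmPair_divisor isAffineSet_finitePlaces isAffineSet_finitePlaces_compl
    finite_residue hE (inftyDivisor k)
  have hcE : ∀ u ∈ sectionsOn (finitePlaces k (RatFunc k)) 0 ⊓
      sectionsOn (finitePlaces k (RatFunc k))ᶜ 0, ∃ c : k, algebraMap k (RatFunc k) c = u := by
    rintro u ⟨hu, hu'⟩
    obtain ⟨p, rfl⟩ := mem_sectionsOn_finitePlaces_iff.1 hu
    have h1 := mem_sectionsOn_zero.1 hu' (infty k) (notMem_finitePlaces_ratFunc.2 rfl)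
    by_cases hp : p = 0
    · exact ⟨0, by simp [hp]⟩
    · have hp' : algebraMap k[X] (RatFunc k) p ≠ 0 := by simpa using hp
      rw [mem_ring_iff _ hp', ord_infty hp', RatFunc.intDegree_polynomial] at h1
      obtain ⟨c, rfl⟩ := natDegree_eq_zero.1 (show p.natDegree = 0 by omega)
      exact ⟨c, by rw [IsScalarTower.algebraMap_apply k k[X] (RatFunc k)]; rfl⟩
  have hbot : sectionsOn (finitePlaces k (RatFunc k)) (inftyDivisor k) ⊓
      sectionsOn (finitePlaces k (RatFunc k))ᶜ (inftyDivisor k) = ⊥ := by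
    rw [eq_bot_iff]
    rintro v ⟨hv, hv'⟩
    have hv1 : v ∈ sectionsOn (finitePlaces k (RatFunc k))ᶜ 0 := by
      intro P hP
      refine (hv' P hP).trans (WithZero.exp_le_exp.2 ?_)
      rw [notMem_finitePlaces_ratFunc.1 hP, inftyDivisor, Finsupp.single_eq_same, Pi.zero_apply]
      omega
    have hv0 : v ∈ sectionsOn (finitePlaces k (RatFunc k)) 0 := by
      rw [← sectionsOn_congr (D := inftyDivisor k)]
      · exact hv
      · intro P hP
        rw [inftyDivisor, Finsupp.single_eq_of_ne, Pi.zero_apply]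
        rintro rfl
        exact X_notMem_infty hP
    obtain ⟨c, rfl⟩ := hcE v ⟨hv0, hv1⟩
    have h2 := hv' (infty k) (notMem_finitePlaces_ratFunc.2 rfl)
    rw [Submodule.mem_bot]
    by_contra hne
    rw [val_eq_exp _ hne, ord_algebraMap, WithZero.exp_le_exp, inftyDivisor,
      Finsupp.single_eq_same] at h2
    omega
  have hdeg : CurveDivisor.degree k (RatFunc k) (inftyDivisor k) = -3 := by
    rw [inftyDivisor, degree_single, deg_infty]; rfl
  rw [hdeg] at hD
  have hfin0 := hE.finite_quotient
  have hfin1 := hD.finite_quotient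
  have hq : finrank k (RatFunc k ⧸ (sectionsOn (finitePlaces k (RatFunc k)) (inftyDivisor k) ⊔
      sectionsOn (finitePlaces k (RatFunc k))ᶜ (inftyDivisor k))) = 2 := by
    have := hD.index_eq
    rw [hbot, finrank_bot] at this
    omega
  -- `K = k(x) ⊕ k(x) y`, compatibly with regularity: `h¹ = h¹(𝒪) + h¹(𝒪(-3)) = 0 + 2` on the line
  let Φ' : (RatFunc k × (Fin 1 → RatFunc k)) →ₗ[k] K :=
    { toFun := fun p => algebraMap (RatFunc k) K p.1 + algebraMap (RatFunc k) K (p.2 0) * y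
      map_add' := fun p q => by simp; ring
      map_smul' := fun c p => by
        rw [RingHom.id_apply, Algebra.smul_def c (_ : K), IsScalarTower.algebraMap_apply k (RatFunc k) K,
          Prod.smul_fst, Prod.smul_snd, Pi.smul_apply, Algebra.smul_def, Algebra.smul_def, map_mul,
          map_mul]
        ring }
  let Φ : (RatFunc k × (Fin 1 → RatFunc k)) ≃ₗ[k] K := LinearEquiv.ofBijective Φ' <| by
    constructor
    · rw [injective_iff_map_eq_zero]
      rintro ⟨u, v⟩ huv
      obtain ⟨h1, h2⟩ := h.eq_zero (u := u) (v := v 0) huv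
      exact Prod.ext h1 (funext fun i => by rw [Subsingleton.elim i 0]; exact h2)
    · intro f
      obtain ⟨u, v, rfl⟩ := h.exists_eq f
      exact ⟨(u, fun _ => v), rfl⟩
  have hsum := finrank_quotient_sup_of_prod Φ
    (sectionsOn (finitePlaces k (RatFunc k)) 0) (sectionsOn (finitePlaces k (RatFunc k))ᶜ 0)
    (fun _ => sectionsOn (finitePlaces k (RatFunc k)) (inftyDivisor k))
    (fun _ => sectionsOn (finitePlaces k (RatFunc k))ᶜ (inftyDivisor k))
    (sectionsOn (finitePlaces k K) 0) (sectionsOn (finitePlaces k K)ᶜ 0)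
    (fun u v => (h.mem_sectionsOn_finitePlaces u (v 0)).trans (by simp))
    (fun u v => (h.mem_sectionsOn_finitePlaces_compl u (v 0)).trans (by simp))
  have hq0 : finrank k (RatFunc k ⧸ (⊤ : Submodule k (RatFunc k))) = 0 :=
    finrank_zero_of_subsingleton
  rw [htop, hq0, zero_add, Finset.sum_const, Finset.card_univ, Fintype.card_fin, one_smul,
    hq] at hsum
  have hc : ∀ f ∈ sectionsOn (finitePlaces k K) 0 ⊓ sectionsOn (finitePlaces k K)ᶜ 0,
      ∃ c : k, algebraMap k K c = f := by
    rintro f ⟨hf, hf'⟩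
    obtain ⟨u, v, rfl⟩ := h.exists_eq f
    obtain ⟨hu, hv⟩ := (h.mem_sectionsOn_finitePlaces u v).1 hf
    obtain ⟨hu', hv'⟩ := (h.mem_sectionsOn_finitePlaces_compl u v).1 hf'
    obtain ⟨c, rfl⟩ := hcE u ⟨hu, hu'⟩
    have hv0 : v = 0 := by
      have : v ∈ (⊥ : Submodule k (RatFunc k)) := by rw [← hbot]; exact ⟨hv, hv'⟩
      exact this
    exact ⟨c, by rw [hv0, map_zero, zero_mul, add_zero, ← IsScalarTower.algebraMap_apply]⟩
  have hrange : sectionsOn (finitePlaces k K) 0 ⊓ sectionsOn (finitePlaces k K)ᶜ 0 =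
      LinearMap.range (Algebra.linearMap k K) := by
    ext f
    constructor
    · exact fun hf => hc f hf
    · rintro ⟨c, rfl⟩
      exact ⟨mem_sectionsOn_zero.2 fun P _ => P.algebraMap_mem c,
        mem_sectionsOn_zero.2 fun P _ => P.algebraMap_mem c⟩
  let e : k ≃ₗ[k] LinearMap.range (Algebra.linearMap k K) :=
    LinearEquiv.ofInjective (Algebra.linearMap k K) (algebraMap k K).injective
  refine ⟨⟨?_, hsum.1, ?_⟩, hc, hsum.2⟩
  · rw [hrange]
    exact Module.Finite.equiv e
  · rw [hsum.2, hrange, ← e.finrank_eq, finrank_self]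
    rfl

theorem curveGenus_eq (h : IsSextic s y) : curveGenus k K = 2 := by
  have := h.finiteDimensional
  have := h.isSeparable
  rw [curveGenus_eq_finrank]
  exact h.isFredholmPair.2.2

end IsSextic

end

section

open IsDedekindDomain Polynomial Module Place

/-! ### A function whose divisor is divisible by 7 -/

/-- A function `φ` on the curve `y ^ 2 = s(x)` whose divisor is divisible by `7` and whose norm to
`k(x)` is the seventh power of `n`. -/
structure IsRadicand {k K : Type*} [Field k] [Field K] [Algebra k K] [Algebra (RatFunc k) K]
    {s : k[X]} {y : K} (h : IsSextic s y) (φ : K) (n : RatFunc k) : Prop where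
  ne_zero : φ ≠ 0
  norm_eq : φ * h.conj φ = algebraMap (RatFunc k) K n ^ 7
  dvd_ord : ∀ P : Place k K, 7 ∣ P.ord φ

namespace IsRadicand

variable {k K : Type*} [Field k] [Field K] [Algebra k K] [Algebra (RatFunc k) K]
  [IsScalarTower k (RatFunc k) K] {s : k[X]} {y : K} {h : IsSextic s y} {φ : K} {n : RatFunc k}

theorem exists_divisor (hφ : IsRadicand h φ n) :
    ∃ m : CurveDivisor k K, ∀ P : Place k K, 7 * m P = P.ord φ := by
  have := h.finiteDimensional
  have := h.isSeparable
  obtain ⟨D, hD⟩ := Place.exists_divisor (k := k) hφ.ne_zero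
  refine ⟨D.mapRange (· / 7) (by simp), fun P => ?_⟩
  rw [Finsupp.mapRange_apply, hD]
  exact Int.mul_ediv_cancel' (hφ.dvd_ord P)

/-- A seventh of the divisor of `φ`. -/
def divisor (hφ : IsRadicand h φ n) : CurveDivisor k K := hφ.exists_divisor.choose

theorem divisor_apply (hφ : IsRadicand h φ n) (P : Place k K) : 7 * hφ.divisor P = P.ord φ :=
  hφ.exists_divisor.choose_spec P

/-- The degree is `0` because multiplication by `φ` changes the divisor by `div φ = 7 D` and keeps
the Euler characteristic. -/
theorem degree_divisor (hφ : IsRadicand h φ n) : CurveDivisor.degree k K hφ.divisor = 0 := by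
  have := h.finiteDimensional
  have := h.isSeparable
  have h1 := isFredholmPair_divisor isAffineSet_finitePlaces isAffineSet_finitePlaces_compl
    finite_residue h.isFredholmPair.1 ((7 : ℤ) • hφ.divisor)
  have h2 := isFredholmPair_mul (D' := ⇑((7 : ℤ) • hφ.divisor)) (inv_ne_zero hφ.ne_zero)
    (fun P => by rw [ord_inv, ← hφ.divisor_apply]; simp) h.isFredholmPair.1
  have h3 := h1.index_unique h2
  rw [map_zsmul, smul_eq_mul] at h3
  omega

theorem isFredholmPair (hφ : IsRadicand h φ n) (i : ℕ) :
    IsFredholmPair (sectionsOn (finitePlaces k K) ⇑(i • hφ.divisor))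
      (sectionsOn (finitePlaces k K)ᶜ ⇑(i • hφ.divisor)) (-1) := by
  have := h.finiteDimensional
  have := h.isSeparable
  have h1 := isFredholmPair_divisor isAffineSet_finitePlaces isAffineSet_finitePlaces_compl
    finite_residue h.isFredholmPair.1 (i • hφ.divisor)
  rwa [map_nsmul, hφ.degree_divisor, smul_zero, add_zero] at h1

/-- `f` is a section of `i D` iff `f wⁱ` is regular, where `w ^ 7 = φ`; this is expressed by
`(f wⁱ) ^ 7 = f ^ 7 φ ^ i`. -/
theorem mem_sectionsOn_iff (hφ : IsRadicand h φ n) {S : Set (Place k K)} {i : ℕ} {f : K} :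
    f ∈ sectionsOn S ⇑(i • hφ.divisor) ↔ ∀ P ∈ S, f ^ 7 * φ ^ i ∈ P.ring := by
  rw [mem_sectionsOn]
  refine forall₂_congr fun P _ => ?_
  by_cases hf : f = 0
  · simp [hf, zero_mem]
  · rw [mem_ring_iff _ (mul_ne_zero (pow_ne_zero _ hf) (pow_ne_zero _ hφ.ne_zero)),
      ord_mul _ (pow_ne_zero _ hf) (pow_ne_zero _ hφ.ne_zero), ord_pow, ord_pow,
      ← hφ.divisor_apply, val_eq_exp _ hf, WithZero.exp_le_exp, Finsupp.smul_apply, nsmul_eq_mul]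
    push_cast
    have : (i : ℤ) * (7 * hφ.divisor P) = 7 * (i * hφ.divisor P) := by ring
    rw [this]
    omega

/-- A power `φ ^ i` with `i` prime to `7` is a seventh power up to constants only if `φ` is a
seventh power: the constant is a seventh power because its square is a norm. -/
theorem exists_pow_eq (hφ : IsRadicand h φ n) {i : ℕ} (hi : Nat.Coprime i 7) {f : K} {c : k}
    (hc : c ≠ 0) (hf : f ^ 7 * φ ^ i = algebraMap k K c) : ∃ g : K, g ^ 7 = φ := by
  have hcK : algebraMap k K c ≠ 0 := by simpa using hc
  have hf0 : f ≠ 0 := by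
    rintro rfl
    rw [zero_pow (by omega), zero_mul] at hf
    exact hcK hf.symm
  obtain ⟨u, hu⟩ := h.exists_norm f
  set N := algebraMap (RatFunc k) K (u * n ^ i) with hN
  have hconj : h.conj (algebraMap k K c) = algebraMap k K c := by
    rw [IsScalarTower.algebraMap_apply k (RatFunc k) K, AlgEquiv.commutes]
  have h1 : N ^ 7 = algebraMap k K c ^ 2 := by
    have h2 := congrArg h.conj hf
    rw [hconj, map_mul, map_pow, map_pow] at h2
    rw [sq]
    nth_rewrite 1 [← hf]
    rw [← h2, hN, map_mul, map_pow, hu]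
    have := hφ.norm_eq
    calc _ = f ^ 7 * h.conj f ^ 7 * (algebraMap (RatFunc k) K n ^ 7) ^ i := by ring
      _ = _ := by rw [← this]; ring
  -- as `7 = 2 * 3 + 1`, the constant `c = c ^ 7 / (c ^ 2) ^ 3` is a seventh power
  have hN0 : N ≠ 0 := by
    intro h0
    rw [h0, zero_pow (by omega)] at h1
    exact pow_ne_zero 2 hcK h1.symm
  have h3 : (algebraMap k K c / N ^ 3) ^ 7 = algebraMap k K c := by
    rw [div_pow, ← pow_mul, mul_comm 3 7, pow_mul, h1, div_eq_iff (by positivity)]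
    ring
  set g := algebraMap k K c / N ^ 3 / f with hg
  have h4 : g ^ 7 = φ ^ i := by
    rw [hg, div_pow, h3, ← hf, mul_div_assoc, mul_comm, div_mul_cancel₀ _ (pow_ne_zero 7 hf0)]
  obtain ⟨a, b, hab⟩ : ∃ a b : ℤ, a * i + b * 7 = 1 := by
    exact Nat.isCoprime_iff_coprime.2 hi
  refine ⟨g ^ a * φ ^ b, ?_⟩
  have h5 : (g ^ a * φ ^ b) ^ (7 : ℤ) = φ ^ (a * i + b * 7) := by
    rw [mul_zpow, ← zpow_mul, mul_comm a 7, zpow_mul, zpow_add₀ hφ.ne_zero, zpow_mul φ b 7,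
      mul_comm a, zpow_mul φ, ← zpow_mul φ b 7]
    congr 2
    exact_mod_cast h4
  rw [hab, zpow_one] at h5
  exact_mod_cast h5

/-- A section `f` of `i D` would make `f ^ 7 φ ^ i` a constant, and `φ` a seventh power. -/
theorem inf_eq_bot (hφ : IsRadicand h φ n) (hne : ¬ ∃ g : K, g ^ 7 = φ) {i : ℕ}
    (hi : Nat.Coprime i 7) :
    sectionsOn (finitePlaces k K) ⇑(i • hφ.divisor) ⊓
      sectionsOn (finitePlaces k K)ᶜ ⇑(i • hφ.divisor) = ⊥ := by
  rw [eq_bot_iff]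
  rintro f ⟨hf, hf'⟩
  rw [Submodule.mem_bot]
  by_contra hf0
  obtain ⟨c, hc⟩ := h.isFredholmPair.2.1 (f ^ 7 * φ ^ i)
    ⟨mem_sectionsOn_zero.2 (hφ.mem_sectionsOn_iff.1 hf),
      mem_sectionsOn_zero.2 (hφ.mem_sectionsOn_iff.1 hf')⟩
  refine hne (hφ.exists_pow_eq hi ?_ hc.symm)
  rintro rfl
  rw [map_zero] at hc
  exact mul_ne_zero (pow_ne_zero 7 hf0) (pow_ne_zero i hφ.ne_zero) hc.symm

/-- A nontrivial class of degree `0` on a curve of genus `2` has `h¹ = 1`. -/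
theorem finrank_quotient (hφ : IsRadicand h φ n) (hne : ¬ ∃ g : K, g ^ 7 = φ) {i : ℕ}
    (hi : Nat.Coprime i 7) :
    finrank k (K ⧸ (sectionsOn (finitePlaces k K) ⇑(i • hφ.divisor) ⊔
      sectionsOn (finitePlaces k K)ᶜ ⇑(i • hφ.divisor))) = 1 := by
  have h1 := (hφ.isFredholmPair i).index_eq
  rw [hφ.inf_eq_bot hne hi, finrank_bot] at h1
  omega

/-- If `φ` is a seventh power, then the class of degree zero given by its divisor is trivial and
has `h¹ = 2`. -/
theorem two_le_finrank_quotient (hφ : IsRadicand h φ n) {g : K} (hg : g ^ 7 = φ) :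
    2 ≤ finrank k (K ⧸ (sectionsOn (finitePlaces k K) ⇑(1 • hφ.divisor) ⊔
      sectionsOn (finitePlaces k K)ᶜ ⇑(1 • hφ.divisor))) := by
  have h1 := (hφ.isFredholmPair 1).index_eq
  have := (hφ.isFredholmPair 1).finite_inf
  have hg0 : g ≠ 0 := by
    rintro rfl
    rw [zero_pow (by omega)] at hg
    exact hφ.ne_zero hg.symm
  have hmem : ∀ S : Set (Place k K), g⁻¹ ∈ sectionsOn S ⇑(1 • hφ.divisor) := fun S => by
    rw [hφ.mem_sectionsOn_iff]
    intro P _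
    rw [← hg, pow_one, inv_pow, inv_mul_cancel₀ (pow_ne_zero 7 hg0)]
    exact P.ring.one_mem
  have h2 : 0 < finrank k ↥(sectionsOn (finitePlaces k K) ⇑(1 • hφ.divisor) ⊓
      sectionsOn (finitePlaces k K)ᶜ ⇑(1 • hφ.divisor)) := by
    rw [finrank_pos_iff_exists_ne_zero]
    exact ⟨⟨g⁻¹, hmem _, hmem _⟩, fun h0 => inv_ne_zero hg0 (congrArg Subtype.val h0)⟩
  omega

end IsRadicand

section Eigen

variable {k K L : Type*} [Field k] [Field K] [Field L] [Algebra k K] [Algebra k L] [Algebra K L]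
  [IsScalarTower k K L] {ζ : k} {w : L}

theorem iterate_sum {ρ : L →+* L} (hρK : ∀ f : K, ρ (algebraMap K L f) = algebraMap K L f)
    (hρw : ρ w = algebraMap k L ζ * w) (c : ℕ → K) (j : ℕ) :
    ρ^[j] (∑ i ∈ Finset.range 7, algebraMap K L (c i) * w ^ i) =
      ∑ i ∈ Finset.range 7, algebraMap k L ζ ^ (j * i) * (algebraMap K L (c i) * w ^ i) := by
  have hζ : ρ (algebraMap k L ζ) = algebraMap k L ζ := by
    rw [IsScalarTower.algebraMap_apply k K L, hρK]
  induction j with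
  | zero => simp
  | succ j ih =>
    rw [Function.iterate_succ_apply', ih, map_sum]
    refine Finset.sum_congr rfl fun i _ => ?_
    rw [map_mul, map_pow, hζ, map_mul, hρK, map_pow, hρw]
    ring

/-- Projection to the eigenspaces of `ρ`. -/
theorem seven_mul_eq_sum (hζ7 : IsPrimitiveRoot ζ 7) {ρ : L →+* L}
    (hρK : ∀ f : K, ρ (algebraMap K L f) = algebraMap K L f)
    (hρw : ρ w = algebraMap k L ζ * w) (c : ℕ → K) {l : ℕ} (hl : l < 7) :
    7 * (algebraMap K L (c l) * w ^ l) = ∑ j ∈ Finset.range 7, algebraMap k L ζ ^ (j * (7 - l)) *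
      ρ^[j] (∑ i ∈ Finset.range 7, algebraMap K L (c i) * w ^ i) := by
  have hζL : IsPrimitiveRoot (algebraMap k L ζ) 7 := hζ7.map_of_injective (algebraMap k L).injective
  have h1 : ∀ i < 7, ∑ j ∈ Finset.range 7, algebraMap k L ζ ^ (j * (7 - l)) *
      algebraMap k L ζ ^ (j * i) = if i = l then 7 else 0 := by
    intro i hi
    have h2 : ∀ j, algebraMap k L ζ ^ (j * (7 - l)) * algebraMap k L ζ ^ (j * i) =
        (algebraMap k L ζ ^ (7 - l + i)) ^ j := fun j => by ring
    simp only [h2]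
    split_ifs with hil
    · rw [hil, Nat.sub_add_cancel hl.le, hζL.pow_eq_one]
      simp
    · have h3 : algebraMap k L ζ ^ (7 - l + i) - 1 ≠ 0 := by
        rw [sub_ne_zero]
        intro h4
        have := hζL.dvd_of_pow_eq_one _ h4
        omega
      have h5 := geom_sum_mul (algebraMap k L ζ ^ (7 - l + i)) 7
      rw [← pow_mul, mul_comm _ 7, pow_mul, hζL.pow_eq_one, one_pow, sub_self] at h5
      exact (mul_eq_zero.1 h5).resolve_right h3
  simp only [iterate_sum hρK hρw, Finset.mul_sum]
  rw [Finset.sum_comm]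
  have h6 : ∀ i ∈ Finset.range 7, ∑ j ∈ Finset.range 7, algebraMap k L ζ ^ (j * (7 - l)) *
      (algebraMap k L ζ ^ (j * i) * (algebraMap K L (c i) * w ^ i)) =
      if i = l then 7 * (algebraMap K L (c i) * w ^ i) else 0 := by
    intro i hi
    simp only [← mul_assoc]
    rw [← Finset.sum_mul, ← Finset.sum_mul, h1 i (Finset.mem_range.1 hi)]
    split_ifs <;> ring
  rw [Finset.sum_congr rfl h6, Finset.sum_ite_eq' (Finset.range 7) l,
    if_pos (Finset.mem_range.2 hl)]

theorem seven_ne_zero {F : Type*} [Field F] [Algebra k F] (hζ7 : IsPrimitiveRoot ζ 7) :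
    (7 : F) ≠ 0 := by
  have h1 := (hζ7.neZero').ne
  have h2 := (algebraMap k F).injective.ne h1
  rw [map_natCast, map_zero] at h2
  exact_mod_cast h2

/-- If all conjugates of `∑ cᵢ wⁱ` are regular at `Q`, then so is each term. -/
theorem term_mem (hζ7 : IsPrimitiveRoot ζ 7) {ρ : L →+* L}
    (hρK : ∀ f : K, ρ (algebraMap K L f) = algebraMap K L f)
    (hρw : ρ w = algebraMap k L ζ * w) (c : ℕ → K) (Q : Place k L)
    (h : ∀ j, ρ^[j] (∑ i ∈ Finset.range 7, algebraMap K L (c i) * w ^ i) ∈ Q.ring)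
    {l : ℕ} (hl : l < 7) : algebraMap K L (c l) * w ^ l ∈ Q.ring := by
  have h1 : 7 * (algebraMap K L (c l) * w ^ l) ∈ Q.ring := by
    rw [seven_mul_eq_sum hζ7 hρK hρw c hl]
    exact sum_mem fun j _ => Q.ring.mul_mem _ _ (pow_mem (Q.algebraMap_mem ζ) _) (h j)
  have h2 := Q.ring.mul_mem _ _ (Q.algebraMap_mem 7⁻¹) h1
  have h7 : (7 : k) ≠ 0 := seven_ne_zero hζ7
  have h3 : algebraMap k L 7⁻¹ * (7 * (algebraMap K L (c l) * w ^ l)) =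
      algebraMap K L (c l) * w ^ l := by
    rw [← mul_assoc, ← map_ofNat (algebraMap k L) 7, ← map_mul, inv_mul_cancel₀ h7, map_one,
      one_mul]
  rwa [h3] at h2

end Eigen

end

section

open IsDedekindDomain Polynomial Module Place

/-! ### The genus of the covering and of its quotient by an involution -/

/-- `L = K(w)` with `w ^ 7 = φ`, where `φ` is not a seventh power in `K`. -/
structure IsHeptic {K L : Type*} [Field K] [Field L] [Algebra K L] (φ : K) (w : L) : Prop where
  pow_eq : w ^ 7 = algebraMap K L φ
  adjoin_eq_top : IntermediateField.adjoin K {w} = ⊤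
  not_pow : ¬ ∃ g : K, g ^ 7 = φ

theorem Place.LiesOver.mem_finitePlaces_iff' {k K L : Type*} [Field k] [Field K] [Field L]
    [Algebra k K] [Algebra (RatFunc k) K] [Algebra k L] [Algebra (RatFunc k) L] [Algebra K L]
    [IsScalarTower k K L] [IsScalarTower (RatFunc k) K L] {Q : Place k L} {P : Place k K}
    (hQ : Q.LiesOver (IsScalarTower.toAlgHom k K L) P) :
    Q ∈ finitePlaces k L ↔ P ∈ finitePlaces k K := by
  change algebraMap (RatFunc k) L RatFunc.X ∈ Q.ring ↔ _
  rw [IsScalarTower.algebraMap_apply (RatFunc k) K L]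
  exact hQ.mem_iff _

namespace IsHeptic

section

variable {K L : Type*} [Field K] [Field L] [Algebra K L] {φ : K} {w : L}

theorem ne_zero (hw : IsHeptic φ w) : φ ≠ 0 := by
  rintro rfl
  exact hw.not_pow ⟨0, by simp⟩

theorem w_ne_zero (hw : IsHeptic φ w) : w ≠ 0 := by
  rintro rfl
  have := hw.pow_eq
  rw [zero_pow (by omega), eq_comm, map_eq_zero] at this
  exact hw.ne_zero this

theorem irreducible (hw : IsHeptic φ w) : Irreducible (X ^ 7 - C φ : K[X]) :=
  X_pow_sub_C_irreducible_of_prime (by norm_num) fun b hb => hw.not_pow ⟨b, hb⟩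

theorem finiteDimensional (hw : IsHeptic φ w) : FiniteDimensional K L :=
  finiteDimensional_of_pow_eq (n := 7) (by omega) hw.pow_eq hw.adjoin_eq_top

theorem isSeparable (hw : IsHeptic φ w) (h7 : (7 : K) ≠ 0) : Algebra.IsSeparable K L :=
  isSeparable_of_pow_eq (n := 7) (by exact_mod_cast h7) hw.ne_zero hw.pow_eq hw.adjoin_eq_top

theorem finrank_eq (hw : IsHeptic φ w) : finrank K L = 7 :=
  finrank_of_pow_eq (n := 7) (by omega) hw.pow_eq hw.adjoin_eq_top hw.irreducible

theorem exists_sum (hw : IsHeptic φ w) (z : L) :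
    ∃ c : ℕ → K, z = ∑ i ∈ Finset.range 7, algebraMap K L (c i) * w ^ i :=
  exists_sum_of_pow_eq (n := 7) (by omega) hw.pow_eq hw.adjoin_eq_top z

theorem coeff_unique (hw : IsHeptic φ w) {c d : ℕ → K}
    (hcd : ∑ i ∈ Finset.range 7, algebraMap K L (c i) * w ^ i =
      ∑ i ∈ Finset.range 7, algebraMap K L (d i) * w ^ i) : ∀ i < 7, c i = d i := by
  have := eq_zero_of_sum_eq_zero (n := 7) (by omega) hw.pow_eq hw.irreducible
    (fun i => c i - d i) (by
      simp only [map_sub, sub_mul, Finset.sum_sub_distrib]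
      rw [hcd, sub_self])
  exact fun i hi => sub_eq_zero.1 (this i hi)

/-- The automorphism of `L / K` that multiplies `w` by `ζ`. -/
theorem exists_rho {k : Type*} [Field k] [Algebra k L] {ζ : k} (hw : IsHeptic φ w)
    (hζ7 : IsPrimitiveRoot ζ 7) : ∃ ρ : L ≃ₐ[K] L, ρ w = algebraMap k L ζ * w := by
  obtain ⟨g, hg, hgw⟩ := exists_ringHom_of_pow_eq (n := 7) (by omega) hw.pow_eq hw.adjoin_eq_top
    hw.irreducible (algebraMap K L) (z' := algebraMap k L ζ * w)
    (by rw [mul_pow, ← map_pow, hζ7.pow_eq_one, map_one, one_mul, hw.pow_eq])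
  have := hw.finiteDimensional
  let g' : L →ₐ[K] L := { g with commutes' := hg }
  exact ⟨AlgEquiv.ofBijective g' (Algebra.IsAlgebraic.algHom_bijective g'), hgw⟩

/-- The fixed field of `ρ` is `K`. -/
theorem mem_range_of_eq {k : Type*} [Field k] [Algebra k K] [Algebra k L] [IsScalarTower k K L]
    {ζ : k} (hw : IsHeptic φ w) (hζ7 : IsPrimitiveRoot ζ 7) {ρ : L →+* L}
    (hρK : ∀ f : K, ρ (algebraMap K L f) = algebraMap K L f)
    (hρw : ρ w = algebraMap k L ζ * w) {z : L} (hz : ρ z = z) : ∃ f, algebraMap K L f = z := by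
  obtain ⟨c, hc⟩ := hw.exists_sum z
  have h1 := seven_mul_eq_sum hζ7 hρK hρw c (l := 0) (by omega)
  have h2 : ∀ j, ρ^[j] z = z := fun j => Function.iterate_fixed hz j
  rw [← hc] at h1
  have hζL : algebraMap k L ζ ^ 7 = 1 := by rw [← map_pow, hζ7.pow_eq_one, map_one]
  have h3 : ∑ j ∈ Finset.range 7, algebraMap k L ζ ^ (j * (7 - 0)) * ρ^[j] z = 7 * z := by
    rw [Finset.sum_congr rfl fun j _ => by
      rw [h2, tsub_zero, mul_comm j, pow_mul, hζL, one_pow, one_mul]]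
    simp
  rw [h3] at h1
  refine ⟨c 0, ?_⟩
  have := mul_left_cancel₀ (seven_ne_zero (F := L) hζ7) h1
  rwa [pow_zero, mul_one] at this

end

variable {k K L : Type*} [Field k] [Field K] [Field L] [Algebra k K] [Algebra (RatFunc k) K]
  [IsScalarTower k (RatFunc k) K] [Algebra k L] [Algebra (RatFunc k) L] [Algebra K L]
  [IsScalarTower k (RatFunc k) L] [IsScalarTower k K L] [IsScalarTower (RatFunc k) K L]
  {s : k[X]} {y : K} {h : IsSextic s y} {φ : K} {n : RatFunc k} {w : L} {ζ : k}

/-- A function `∑ cᵢ wⁱ` is regular on the preimage of `S` iff the coefficients `cᵢ` are sections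
over `S` of the multiples of the divisor `div φ / 7`. -/
theorem forall_mem_iff (hφ : IsRadicand h φ n) (hw : IsHeptic φ w) (hζ7 : IsPrimitiveRoot ζ 7)
    {S : Set (Place k K)} {S' : Set (Place k L)}
    (hS : ∀ Q P, Q.LiesOver (IsScalarTower.toAlgHom k K L) P → (Q ∈ S' ↔ P ∈ S)) (c : ℕ → K) :
    (∀ Q ∈ S', ∑ i ∈ Finset.range 7, algebraMap K L (c i) * w ^ i ∈ Q.ring) ↔
      ∀ i < 7, c i ∈ sectionsOn S ⇑(i • hφ.divisor) := by
  have := hw.finiteDimensional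
  have := hw.isSeparable (seven_ne_zero hζ7)
  have hterm : ∀ i (Q : Place k L), algebraMap K L (c i) * w ^ i ∈ Q.ring ↔
      algebraMap K L (c i ^ 7 * φ ^ i) ∈ Q.ring := by
    intro i Q
    rw [← Q.pow_mem_iff (n := 7) (by omega), mul_pow, ← pow_mul, mul_comm i 7, pow_mul, hw.pow_eq,
      map_mul, map_pow, map_pow]
  have hsec : ∀ i, c i ∈ sectionsOn S ⇑(i • hφ.divisor) ↔
      ∀ Q ∈ S', algebraMap K L (c i) * w ^ i ∈ Q.ring := by
    intro i
    rw [hφ.mem_sectionsOn_iff, ← forall_mem_iff_of_tower hS]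
    exact forall₂_congr fun Q _ => (hterm i Q).symm
  constructor
  · intro H i hi
    rw [hsec]
    intro Q hQ
    obtain ⟨ρ, hρ⟩ := hw.exists_rho hζ7
    refine term_mem hζ7 (ρ := (ρ : L →+* L)) ρ.commutes hρ c Q (fun j => ?_) hi
    -- the conjugates of `Q` under the powers of `ρ` lie over the same place
    have h1 : ∀ j : ℕ, ∀ z : L, ((ρ : L →+* L) : L → L)^[j] z = (ρ ^ j) z := by
      intro j
      induction j with
      | zero => intro z; rfl
      | succ j ih => intro z; rw [Function.iterate_succ_apply', ih, pow_succ']; rfl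
    rw [h1]
    have h2 := Q.liesOver_below (IsScalarTower.toAlgHom k K L) isIntegral_toAlgHom
    exact H (Q.comapAut ((ρ ^ j).restrictScalars k)) ((hS _ _ (h2.comapAut _)).2 ((hS _ _ h2).1 hQ))
  · intro H Q hQ
    exact sum_mem fun i hi => (hsec i).1 (H i (Finset.mem_range.1 hi)) Q hQ

theorem finiteDimensional_ratFunc (h : IsSextic s y) (hw : IsHeptic φ w) :
    FiniteDimensional (RatFunc k) L := by
  have := h.finiteDimensional
  have := hw.finiteDimensional
  exact FiniteDimensional.trans (RatFunc k) K L

theorem isSeparable_ratFunc (h : IsSextic s y) (hw : IsHeptic φ w) (hζ7 : IsPrimitiveRoot ζ 7) :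
    Algebra.IsSeparable (RatFunc k) L := by
  have := h.isSeparable
  have := hw.isSeparable (seven_ne_zero hζ7)
  exact Algebra.IsSeparable.trans (RatFunc k) K L

theorem coprime_seven (i : Fin 6) : Nat.Coprime (i + 1 : ℕ) 7 := by
  fin_cases i <;> decide

/-- The genus of the covering: `L` is the direct sum of the `K wⁱ`, which contribute `2` for `i = 0`
and `1` for each of `i = 1, …, 6`. -/
theorem curveGenus_eq (hφ : IsRadicand h φ n) (hw : IsHeptic φ w) (hζ7 : IsPrimitiveRoot ζ 7) :
    curveGenus k L = 8 := by
  have := finiteDimensional_ratFunc h hw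
  have := isSeparable_ratFunc (L := L) h hw hζ7
  have hsum : ∀ c : ℕ → K, ∑ i ∈ Finset.range 7, algebraMap K L (c i) * w ^ i =
      algebraMap K L (c 0) + ∑ i : Fin 6, algebraMap K L (c (i + 1)) * w ^ (i + 1 : ℕ) := by
    intro c
    rw [Finset.sum_range_succ', Finset.sum_range, pow_zero, mul_one, add_comm]
  have hext : ∀ (f : K) (g : Fin 6 → K), ∃ c : ℕ → K, c 0 = f ∧ ∀ i : Fin 6, c (i + 1) = g i := by
    intro f g
    exact ⟨fun i => Nat.casesOn i f fun j => if hj : j < 6 then g ⟨j, hj⟩ else 0, rfl,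
      fun i => dif_pos i.2⟩
  let Φ' : (K × (Fin 6 → K)) →ₗ[k] L :=
    { toFun := fun p => algebraMap K L p.1 + ∑ i : Fin 6, algebraMap K L (p.2 i) * w ^ (i + 1 : ℕ)
      map_add' := fun p q => by
        simp only [Prod.fst_add, Prod.snd_add, Pi.add_apply, map_add, add_mul,
          Finset.sum_add_distrib]
        ring
      map_smul' := fun c p => by
        simp only [RingHom.id_apply, Prod.smul_fst, Prod.smul_snd, Pi.smul_apply]
        simp only [Algebra.smul_def, map_mul, ← IsScalarTower.algebraMap_apply, mul_add,
          Finset.mul_sum, mul_assoc] }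
  have hΦ : ∀ c : ℕ → K, Φ' (c 0, fun i => c (i + 1)) =
      ∑ i ∈ Finset.range 7, algebraMap K L (c i) * w ^ i := fun c => (hsum c).symm
  let Φ : (K × (Fin 6 → K)) ≃ₗ[k] L := LinearEquiv.ofBijective Φ' <| by
    constructor
    · rw [injective_iff_map_eq_zero]
      rintro ⟨f, g⟩ hfg
      obtain ⟨c, rfl, hc⟩ := hext f g
      obtain rfl : (fun i : Fin 6 => c (i + 1)) = g := funext hc
      rw [hΦ] at hfg
      have h1 := hw.coeff_unique (c := c) (d := fun _ => 0) (by rw [hfg]; simp)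
      exact Prod.ext (h1 0 (by omega)) (funext fun i => h1 (i + 1) (by omega))
    · intro z
      obtain ⟨c, rfl⟩ := hw.exists_sum z
      exact ⟨_, hΦ c⟩
  have hreg : ∀ {S : Set (Place k K)} {S' : Set (Place k L)},
      (∀ Q P, Q.LiesOver (IsScalarTower.toAlgHom k K L) P → (Q ∈ S' ↔ P ∈ S)) →
      ∀ f g, Φ (f, g) ∈ sectionsOn S' 0 ↔ f ∈ sectionsOn S 0 ∧
        ∀ i : Fin 6, g i ∈ sectionsOn S ⇑((i + 1 : ℕ) • hφ.divisor) := by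
    intro S S' hS f g
    obtain ⟨c, rfl, hc⟩ := hext f g
    obtain rfl : (fun i : Fin 6 => c (i + 1)) = g := funext hc
    rw [mem_sectionsOn_zero]
    change (∀ Q ∈ S', Φ' (c 0, fun i => c (i + 1)) ∈ Q.ring) ↔ _
    rw [hΦ, forall_mem_iff hφ hw hζ7 hS]
    constructor
    · intro H
      refine ⟨?_, fun i => H _ (by omega)⟩
      have := H 0 (by omega)
      rwa [zero_smul] at this
    · rintro ⟨H0, H⟩ i hi
      cases i with
      | zero => rw [zero_smul]; exact H0
      | succ i => exact H ⟨i, by omega⟩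
  have hfin := h.isFredholmPair.1.finite_quotient
  have hfin' := fun i : Fin 6 => (hφ.isFredholmPair (i + 1)).finite_quotient
  have := finrank_quotient_sup_of_prod Φ (sectionsOn (finitePlaces k K) 0)
    (sectionsOn (finitePlaces k K)ᶜ 0)
    (fun i => sectionsOn (finitePlaces k K) ⇑((i + 1 : ℕ) • hφ.divisor))
    (fun i => sectionsOn (finitePlaces k K)ᶜ ⇑((i + 1 : ℕ) • hφ.divisor))
    (sectionsOn (finitePlaces k L) 0) (sectionsOn (finitePlaces k L)ᶜ 0)
    (hreg fun Q P hQ => hQ.mem_finitePlaces_iff')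
    (hreg fun Q P hQ => not_congr hQ.mem_finitePlaces_iff')
  rw [curveGenus_eq_finrank, this.2, h.isFredholmPair.2.2,
    Finset.sum_congr rfl fun i _ => hφ.finrank_quotient hw.not_pow (coprime_seven i)]
  simp

section Involution

variable {τ : L ≃ₐ[RatFunc k] L}

theorem tau_algebraMap (h : IsSextic s y) (hτy : τ (algebraMap K L y) = -algebraMap K L y)
    (f : K) : τ (algebraMap K L f) = algebraMap K L (h.conj f) := by
  obtain ⟨u, v, rfl⟩ := h.exists_eq f
  rw [h.conj_apply]
  simp only [map_add, map_sub, map_mul, ← IsScalarTower.algebraMap_apply, AlgEquiv.commutes, hτy]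
  ring

/-- The action of the involution on the expansion in powers of `w`: as `τ w = n / w`, it
interchanges the coefficients of `w ^ i` and `w ^ (7 - i)`. -/
theorem tau_term (h : IsSextic s y) (hw : IsHeptic φ w)
    (hτy : τ (algebraMap K L y) = -algebraMap K L y)
    (hτw : τ w * w = algebraMap (RatFunc k) L n) (f : K) {i : ℕ} (hi : i ≤ 7) :
    τ (algebraMap K L f * w ^ i) =
      algebraMap K L (h.conj f * algebraMap (RatFunc k) K n ^ i * φ⁻¹) * w ^ (7 - i) := by
  have hw0 := hw.w_ne_zero
  have hφ0 : algebraMap K L φ ≠ 0 := by simpa using hw.ne_zero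
  have h1 : τ w = algebraMap (RatFunc k) L n / w := by rw [eq_div_iff hw0, hτw]
  have h2 : w ^ (7 - i) * w ^ i = algebraMap K L φ := by
    rw [← pow_add, Nat.sub_add_cancel hi, hw.pow_eq]
  rw [map_mul, tau_algebraMap h hτy, map_pow, h1, div_pow, map_mul, map_mul, map_pow,
    ← IsScalarTower.algebraMap_apply, map_inv₀, ← h2]
  field_simp

/-- The expansion in powers of `w` of an element fixed by `τ`: its constant coefficient is in
`k(x)`, and the terms with exponents `i` and `7 - i` are interchanged by `τ`. -/
theorem coeff_eq_of_fixed (h : IsSextic s y) (hw : IsHeptic φ w)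
    (hτy : τ (algebraMap K L y) = -algebraMap K L y)
    (hτw : τ w * w = algebraMap (RatFunc k) L n) (c : ℕ → K)
    (hc : τ (∑ i ∈ Finset.range 7, algebraMap K L (c i) * w ^ i) =
      ∑ i ∈ Finset.range 7, algebraMap K L (c i) * w ^ i) :
    h.conj (c 0) = c 0 ∧ ∀ i < 7, i ≠ 0 → algebraMap K L (c (7 - i)) * w ^ (7 - i) =
      τ (algebraMap K L (c i) * w ^ i) := by
  let d : ℕ → K := fun j => if j = 0 then h.conj (c 0) else
    h.conj (c (7 - j)) * algebraMap (RatFunc k) K n ^ (7 - j) * φ⁻¹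
  have h0 : τ (algebraMap K L (c 0) * w ^ 0) = algebraMap K L (d 0) * w ^ 0 := by
    rw [pow_zero, mul_one, mul_one, tau_algebraMap h hτy]
    rfl
  have h1 : ∀ i < 7, i ≠ 0 → τ (algebraMap K L (c i) * w ^ i) =
      algebraMap K L (d (7 - i)) * w ^ (7 - i) := by
    intro i hi hi0
    rw [tau_term h hw hτy hτw _ hi.le]
    simp only [d]
    rw [if_neg (by omega), Nat.sub_sub_self hi.le]
  have h2 : τ (∑ i ∈ Finset.range 7, algebraMap K L (c i) * w ^ i) =
      ∑ i ∈ Finset.range 7, algebraMap K L (d i) * w ^ i := by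
    rw [map_sum]
    simp only [Finset.sum_range_succ, Finset.sum_range_zero, h0, h1 1 (by omega) (by omega),
      h1 2 (by omega) (by omega), h1 3 (by omega) (by omega), h1 4 (by omega) (by omega),
      h1 5 (by omega) (by omega), h1 6 (by omega) (by omega)]
    norm_num
    ring
  have h3 := hw.coeff_unique (h2.symm.trans hc)
  refine ⟨h3 0 (by omega), fun i hi hi0 => ?_⟩
  rw [h1 i hi hi0, h3 (7 - i) (by omega)]

/-- The genus of the quotient by an involution: `k(x) ⊕ K³` is identified with the fixed field by
`(e, f) ↦ e + ∑ (fᵢ wⁱ + τ (fᵢ wⁱ))`, `i = 1, 2, 3`, and the summands contribute `0 + 1 + 1 + 1`. -/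
theorem curveGenus_fixed_eq (hφ : IsRadicand h φ n) (hw : IsHeptic φ w)
    (hζ7 : IsPrimitiveRoot ζ 7) (hτy : τ (algebraMap K L y) = -algebraMap K L y)
    (hτw : τ w * w = algebraMap (RatFunc k) L n) (hττ : ∀ z, τ (τ z) = z)
    {Y : Type*} [Field Y] [Algebra k Y] [Algebra (RatFunc k) Y] [Algebra Y L]
    [IsScalarTower k (RatFunc k) Y] [IsScalarTower k Y L] [IsScalarTower (RatFunc k) Y L]
    (hY : ∀ z : L, τ z = z ↔ ∃ f : Y, algebraMap Y L f = z) : curveGenus k Y = 3 := by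
  have := finiteDimensional_ratFunc h hw
  have := isSeparable_ratFunc (L := L) h hw hζ7
  have : FiniteDimensional (RatFunc k) Y := FiniteDimensional.left (RatFunc k) Y L
  have : FiniteDimensional Y L := FiniteDimensional.right (RatFunc k) Y L
  have : Algebra.IsSeparable (RatFunc k) Y := Algebra.isSeparable_tower_bot_of_isSeparable _ Y L
  have : Algebra.IsSeparable Y L := Algebra.isSeparable_tower_top_of_isSeparable (RatFunc k) Y L
  have := h.finiteDimensional
  have := h.isSeparable
  have := hw.finiteDimensional
  let Ψ : (RatFunc k × (Fin 3 → K)) →ₗ[k] L :=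
    { toFun := fun p => algebraMap (RatFunc k) L p.1 + ∑ i : Fin 3,
        (algebraMap K L (p.2 i) * w ^ (i + 1 : ℕ) + τ (algebraMap K L (p.2 i) * w ^ (i + 1 : ℕ)))
      map_add' := fun p q => by
        simp only [Prod.fst_add, Prod.snd_add, Pi.add_apply, map_add, add_mul,
          Finset.sum_add_distrib]
        ring
      map_smul' := fun c p => by
        have hc : τ (algebraMap k L c) = algebraMap k L c := by
          rw [IsScalarTower.algebraMap_apply k (RatFunc k) L, AlgEquiv.commutes]
        simp only [RingHom.id_apply, Prod.smul_fst, Prod.smul_snd, Pi.smul_apply]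
        simp only [Algebra.smul_def, map_mul, ← IsScalarTower.algebraMap_apply, mul_add,
          Finset.mul_sum, mul_assoc, hc] }
  -- the expansion in powers of `w` of an element of the image
  have hΨ : ∀ e f, ∃ c : ℕ → K, Ψ (e, f) = ∑ i ∈ Finset.range 7, algebraMap K L (c i) * w ^ i ∧
      c 0 = algebraMap (RatFunc k) K e ∧ ∀ i : Fin 3, c (i + 1) = f i := by
    intro e f
    let g : ℕ → K → K := fun i a => h.conj a * algebraMap (RatFunc k) K n ^ i * φ⁻¹
    refine ⟨fun i => match i with
      | 0 => algebraMap (RatFunc k) K e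
      | 1 => f 0 | 2 => f 1 | 3 => f 2 | 4 => g 3 (f 2) | 5 => g 2 (f 1) | 6 => g 1 (f 0)
      | _ => 0, ?_, rfl, fun i => by fin_cases i <;> rfl⟩
    change algebraMap (RatFunc k) L e + ∑ i : Fin 3,
        (algebraMap K L (f i) * w ^ (i + 1 : ℕ) + τ (algebraMap K L (f i) * w ^ (i + 1 : ℕ))) = _
    have h1 : ∀ i : Fin 3, τ (algebraMap K L (f i) * w ^ (i + 1 : ℕ)) =
        algebraMap K L (g (i + 1) (f i)) * w ^ (7 - (i + 1) : ℕ) :=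
      fun i => tau_term h hw hτy hτw _ (by omega)
    simp only [h1, Fin.sum_univ_three, Finset.sum_range_succ, Finset.sum_range_zero,
      ← IsScalarTower.algebraMap_apply]
    norm_num
    ring
  have hinj : Function.Injective Ψ := by
    rw [injective_iff_map_eq_zero]
    rintro ⟨e, f⟩ hef
    obtain ⟨c, hc, hc0, hc1⟩ := hΨ e f
    have h1 := hw.coeff_unique (c := c) (d := fun _ => 0) (by rw [← hc, hef]; simp)
    refine Prod.ext ?_ (funext fun i => ?_)
    · have := h1 0 (by omega)
      rw [hc0] at this
      exact (map_eq_zero _).1 this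
    · change f i = 0
      rw [← hc1]
      exact h1 _ (by omega)
  have hrange : LinearMap.range Ψ = LinearMap.range (IsScalarTower.toAlgHom k Y L).toLinearMap := by
    ext z
    have h1 : z ∈ LinearMap.range (IsScalarTower.toAlgHom k Y L).toLinearMap ↔ τ z = z :=
      (hY z).symm
    rw [h1]
    constructor
    · rintro ⟨⟨e, f⟩, rfl⟩
      change τ (algebraMap (RatFunc k) L e + ∑ i : Fin 3, (algebraMap K L (f i) * w ^ (i + 1 : ℕ) +
        τ (algebraMap K L (f i) * w ^ (i + 1 : ℕ)))) = algebraMap (RatFunc k) L e + ∑ i : Fin 3,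
        (algebraMap K L (f i) * w ^ (i + 1 : ℕ) + τ (algebraMap K L (f i) * w ^ (i + 1 : ℕ)))
      rw [map_add, AlgEquiv.commutes, map_sum]
      congr 1
      refine Finset.sum_congr rfl fun i _ => ?_
      rw [map_add, hττ, add_comm]
    · intro hz
      obtain ⟨c, rfl⟩ := hw.exists_sum z
      obtain ⟨h2, h3⟩ := coeff_eq_of_fixed h hw hτy hτw c hz
      obtain ⟨e, he⟩ := h.mem_range_of_conj_eq h2
      refine ⟨(e, fun i => c (i + 1)), ?_⟩
      change algebraMap (RatFunc k) L e + ∑ i : Fin 3, (algebraMap K L (c (i + 1)) * w ^ (i + 1 : ℕ) +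
        τ (algebraMap K L (c (i + 1)) * w ^ (i + 1 : ℕ))) = _
      rw [Fin.sum_univ_three, IsScalarTower.algebraMap_apply (RatFunc k) K L, he]
      have h4 := h3 1 (by omega) (by omega)
      have h5 := h3 2 (by omega) (by omega)
      have h6 := h3 3 (by omega) (by omega)
      simp only [Finset.sum_range_succ, Finset.sum_range_zero]
      norm_num at h4 h5 h6 ⊢
      rw [← h4, ← h5, ← h6]
      ring
  let Φ : (RatFunc k × (Fin 3 → K)) ≃ₗ[k] Y :=
    (LinearEquiv.ofInjective Ψ hinj).trans ((LinearEquiv.ofEq _ _ hrange).trans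
      (LinearEquiv.ofInjective (IsScalarTower.toAlgHom k Y L).toLinearMap
        (algebraMap Y L).injective).symm)
  have hΦ : ∀ p, algebraMap Y L (Φ p) = Ψ p := by
    intro p
    have := LinearEquiv.apply_symm_apply (LinearEquiv.ofInjective
      (IsScalarTower.toAlgHom k Y L).toLinearMap (algebraMap Y L).injective)
      (LinearEquiv.ofEq _ _ hrange (LinearEquiv.ofInjective Ψ hinj p))
    exact congrArg Subtype.val this
  -- regularity of `Φ (e, f)` is regularity of each of its terms
  have hreg : ∀ {S₀ : Set (Place k (RatFunc k))} {S : Set (Place k K)} {T : Set (Place k Y)}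
      {S' : Set (Place k L)},
      (∀ Q P, Q.LiesOver (IsScalarTower.toAlgHom k (RatFunc k) K) P → (Q ∈ S ↔ P ∈ S₀)) →
      (∀ Q P, Q.LiesOver (IsScalarTower.toAlgHom k K L) P → (Q ∈ S' ↔ P ∈ S)) →
      (∀ Q P, Q.LiesOver (IsScalarTower.toAlgHom k Y L) P → (Q ∈ S' ↔ P ∈ T)) →
      (∀ Q, Q.comapAut (τ.restrictScalars k) ∈ S' ↔ Q ∈ S') →
      ∀ e f, Φ (e, f) ∈ sectionsOn T 0 ↔ e ∈ sectionsOn S₀ 0 ∧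
        ∀ i : Fin 3, f i ∈ sectionsOn S ⇑((i + 1 : ℕ) • hφ.divisor) := by
    intro S₀ S T S' hS hS' hT hτS e f
    rw [mem_sectionsOn_zero, ← forall_mem_iff_of_tower hT, hΦ, mem_sectionsOn_zero,
      ← forall_mem_iff_of_tower (F := K) hS]
    constructor
    · intro H
      obtain ⟨c, hc, hc0, hc1⟩ := hΨ e f
      rw [hc, forall_mem_iff hφ hw hζ7 hS'] at H
      refine ⟨?_, fun i => hc1 i ▸ H _ (by omega)⟩
      have := H 0 (by omega)
      rw [zero_smul, hc0] at this
      exact mem_sectionsOn_zero.1 this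
    · rintro ⟨He, Hf⟩ Q hQ
      have h1 : ∀ i : Fin 3, ∀ Q ∈ S', algebraMap K L (f i) * w ^ (i + 1 : ℕ) ∈ Q.ring := by
        intro i Q hQ
        have h2 := (forall_mem_iff hφ hw hζ7 hS' (fun j => if j = i + 1 then f i else 0)).2
          (fun j hj => by
            split_ifs with hji
            · rw [hji]; exact Hf i
            · exact zero_mem _) Q hQ
        have h3 : ∑ j ∈ Finset.range 7,
            algebraMap K L (if j = (i : ℕ) + 1 then f i else 0) * w ^ j =
            algebraMap K L (f i) * w ^ (i + 1 : ℕ) := by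
          rw [Finset.sum_eq_single (i + 1 : ℕ)]
          · rw [if_pos rfl]
          · intro j _ hj
            rw [if_neg hj, map_zero, zero_mul]
          · intro hi
            exact absurd (Finset.mem_range.2 (by omega)) hi
        rwa [h3] at h2
      refine Q.ring.add_mem _ _ ?_ (sum_mem fun i _ => Q.ring.add_mem _ _ (h1 i Q hQ) ?_)
      · have h2 := Q.liesOver_below (IsScalarTower.toAlgHom k K L) isIntegral_toAlgHom
        have h3 := He _ ((hS' _ _ h2).1 hQ)
        change algebraMap (RatFunc k) L e ∈ Q.ring
        rw [IsScalarTower.algebraMap_apply (RatFunc k) K L]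
        exact (h2.mem_iff _).2 h3
      · exact h1 i (Q.comapAut (τ.restrictScalars k)) ((hτS Q).2 hQ)
  obtain ⟨hE, htop⟩ := isFredholmPair_ratFunc (k := k)
  have hfin := hE.finite_quotient
  have hfin' := fun i : Fin 3 => (hφ.isFredholmPair (i + 1)).finite_quotient
  have := finrank_quotient_sup_of_prod Φ (sectionsOn (finitePlaces k (RatFunc k)) 0)
    (sectionsOn (finitePlaces k (RatFunc k))ᶜ 0)
    (fun i => sectionsOn (finitePlaces k K) ⇑((i + 1 : ℕ) • hφ.divisor))
    (fun i => sectionsOn (finitePlaces k K)ᶜ ⇑((i + 1 : ℕ) • hφ.divisor))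
    (sectionsOn (finitePlaces k Y) 0) (sectionsOn (finitePlaces k Y)ᶜ 0)
    (hreg (fun Q P hQ => hQ.mem_finitePlaces_iff) (fun Q P hQ => hQ.mem_finitePlaces_iff')
      (fun Q P hQ => hQ.mem_finitePlaces_iff') (comapAut_mem_finitePlaces _))
    (hreg (fun Q P hQ => not_congr hQ.mem_finitePlaces_iff)
      (fun Q P hQ => not_congr hQ.mem_finitePlaces_iff')
      (fun Q P hQ => not_congr hQ.mem_finitePlaces_iff')
      fun Q => not_congr (comapAut_mem_finitePlaces _ Q))
  have hq0 : finrank k (RatFunc k ⧸ (⊤ : Submodule k (RatFunc k))) = 0 :=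
    finrank_zero_of_subsingleton
  rw [curveGenus_eq_finrank, this.2, htop, hq0,
    Finset.sum_congr rfl fun i _ => hφ.finrank_quotient hw.not_pow
      (coprime_seven (Fin.castLE (by omega) i))]
  simp

end Involution

end IsHeptic

end

section

open IsDedekindDomain Polynomial Module Place

/-! ### Unramifiedness -/

namespace Place

variable {k E F : Type*} [Field k] [Field E] [Field F] [Algebra k E] [Algebra k F]

theorem val_comapAut (σ : F ≃ₐ[k] F) (Q : Place k F) (f : F) :
    (Q.comapAut σ).val f = Q.val (σ f) := by
  by_cases hf : f = 0
  · simp [hf]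
  · rw [val_eq_exp _ hf, val_eq_exp _ (by simpa using hf), ord_comapAut]

/-- An automorphism that fixes `Q` acts trivially on the residue classes of the functions that it
fixes. -/
theorem val_aut_sub_lt {σ : F ≃ₐ[k] F} {Q : Place k F} (hQ : Q.comapAut σ = Q) {z c : F}
    (hc : σ c = c) (hz : Q.val (z - c) < 1) : Q.val (σ z - z) < 1 := by
  have h1 : Q.val (σ (z - c)) < 1 := by
    rw [← val_comapAut, hQ]; exact hz
  have h2 : σ z - z = σ (z - c) - (z - c) := by rw [map_sub, hc]; ring
  rw [h2]
  exact (Q.val.map_sub _ _).trans_lt (max_lt h1 hz)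

/-- At a point of residue degree `1`, a regular function has the same value as a function on the
curve below. -/
theorem LiesOver.exists_val_sub_lt_of_inertiaDeg_eq_one {i : E →ₐ[k] F} {Q : Place k F}
    {P : Place k E} (h : Q.LiesOver i P) (hf : Q.inertiaDeg i P = 1) {z : F} (hz : z ∈ Q.ring) :
    ∃ c, Q.val (z - i c) < 1 := by
  rw [inertiaDeg, dif_pos h] at hf
  let _ := h.residueMap.toAlgebra
  have h1 := Subalgebra.bot_eq_top_of_finrank_eq_one hf
  have h2 : IsLocalRing.residue Q.ring ⟨z, hz⟩ ∈ (⊥ : Subalgebra P.Residue Q.Residue) := by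
    rw [h1]; trivial
  obtain ⟨c, hc⟩ := Algebra.mem_bot.1 h2
  obtain ⟨c, rfl⟩ := IsLocalRing.residue_surjective c
  refine ⟨c, ?_⟩
  have h3 : IsLocalRing.residue Q.ring (⟨z, hz⟩ - h.ringHom c) = 0 := by
    rw [map_sub, sub_eq_zero]; exact hc.symm
  rw [IsLocalRing.residue_eq_zero_iff, ← val_lt_one_iff] at h3
  exact h3

end Place

/-- A finite extension whose degree is invertible and prime is separable. -/
theorem isSeparable_of_finrank_dvd_prime {E F : Type*} [Field E] [Field F] [Algebra E F] {p : ℕ}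
    (hp : p.Prime) (hpE : (p : E) ≠ 0) (h : finrank E F ∣ p) : Algebra.IsSeparable E F := by
  have : FiniteDimensional E F :=
    FiniteDimensional.of_finrank_pos (Nat.pos_of_dvd_of_pos h hp.pos)
  refine ⟨fun z => ?_⟩
  have hz : IsIntegral E z := Algebra.IsIntegral.isIntegral z
  have hirr := minpoly.irreducible hz
  have hdvd : (minpoly E z).natDegree ∣ p := (minpoly.degree_dvd hz).trans h
  have hd0 : ((minpoly E z).natDegree : E) ≠ 0 := by
    rcases (Nat.dvd_prime hp).1 hdvd with h1 | h1
    · rw [h1, Nat.cast_one]; exact one_ne_zero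
    · rw [h1]; exact hpE
  rw [IsSeparable, separable_iff_derivative_ne_zero hirr]
  intro h0
  have h1 := congrArg (fun q => coeff q ((minpoly E z).natDegree - 1)) h0
  have hpos := minpoly.natDegree_pos hz
  simp only [coeff_derivative, coeff_zero] at h1
  rw [Nat.sub_add_cancel hpos, (minpoly.monic hz).coeff_natDegree, one_mul] at h1
  apply hd0
  have h2 : (((minpoly E z).natDegree - 1 + 1 : ℕ) : E) = 0 := by push_cast; exact h1
  rwa [Nat.sub_add_cancel hpos] at h2

namespace IsHeptic

variable {k K L : Type*} [Field k] [Field K] [Field L] [Algebra k K] [Algebra k L] [Algebra K L]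
  [IsScalarTower k K L] {φ : K} {w : L} {ζ : k}

/-- A Kummer extension is Galois. -/
theorem isGalois (hw : IsHeptic φ w) (hζ7 : IsPrimitiveRoot ζ 7) : IsGalois K L := by
  have := hw.finiteDimensional
  obtain ⟨ρ, hρ⟩ := hw.exists_rho hζ7
  refine IsGalois.of_fixedField_eq_bot K L (eq_bot_iff.2 fun z hz => ?_)
  exact hw.mem_range_of_eq hζ7 (ρ := (ρ : L →+* L)) ρ.commutes hρ (hz ⟨ρ, trivial⟩)

/-- `w` differs from a unit at `Q` by a function on `K`. -/
theorem exists_unit (hw : IsHeptic φ w) (hord : ∀ P : Place k K, 7 ∣ P.ord φ)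
    {Q : Place k L} {P : Place k K} (hQ : Q.LiesOver (IsScalarTower.toAlgHom k K L) P) :
    ∃ f : K, f ≠ 0 ∧ Q.ord (algebraMap K L f * w) = 0 := by
  obtain ⟨m, hm⟩ := hord P
  refine ⟨P.uniformizer ^ (-m), zpow_ne_zero _ P.uniformizer_ne_zero, ?_⟩
  have h1 := hQ.ord_eq φ
  have h2 := hQ.ord_eq (P.uniformizer ^ (-m))
  rw [ord_zpow, ord_uniformizer] at h2
  change Q.ord (algebraMap K L φ) = _ at h1
  change Q.ord (algebraMap K L (P.uniformizer ^ (-m))) = _ at h2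
  rw [← hw.pow_eq, ord_pow, hm] at h1
  have h0 : algebraMap K L (P.uniformizer ^ (-m)) ≠ 0 :=
    (_root_.map_ne_zero _).2 (zpow_ne_zero _ P.uniformizer_ne_zero)
  rw [ord_mul _ h0 hw.w_ne_zero, h2]
  have h3 : 7 * Q.ord w = 7 * ((Q.ramificationIdx (IsScalarTower.toAlgHom k K L) P : ℤ) * m) := by
    push_cast at h1
    rw [h1]
    ring
  have h4 : Q.ord w = (Q.ramificationIdx (IsScalarTower.toAlgHom k K L) P : ℤ) * m := by omega
  rw [h4]
  ring

/-- The stabilizer of `Q` has order `e f` and is a subgroup of a group of order `7`. -/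
theorem ramificationIdx_mul_inertiaDeg (hw : IsHeptic φ w) (hζ7 : IsPrimitiveRoot ζ 7)
    {Q : Place k L} {P : Place k K} (hQ : Q.LiesOver (IsScalarTower.toAlgHom k K L) P) :
    Q.ramificationIdx (IsScalarTower.toAlgHom k K L) P *
        Q.inertiaDeg (IsScalarTower.toAlgHom k K L) P = 1 ∨
      Q.ramificationIdx (IsScalarTower.toAlgHom k K L) P *
        Q.inertiaDeg (IsScalarTower.toAlgHom k K L) P = 7 ∧
      ∀ σ : L ≃ₐ[K] L, Q.comapAut (σ.restrictScalars k) = Q := by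
  classical
  have := hw.finiteDimensional
  have := hw.isGalois hζ7
  have h1 := card_comapAut_eq hQ hQ
  let H : Subgroup (L ≃ₐ[K] L) :=
    { carrier := {σ | Q.comapAut (σ.restrictScalars k) = Q}
      mul_mem' := fun {σ σ'} hσ hσ' => by
        change Q.comapAut ((σ * σ').restrictScalars k) = Q
        rw [restrictScalars_mul, comapAut_mul]
        rw [show Q.comapAut (σ.restrictScalars k) = Q from hσ]
        exact hσ'
      one_mem' := Q.comapAut_one
      inv_mem' := fun {σ} hσ => by
        have h2 := Q.comapAut_mul (σ.restrictScalars k) (σ⁻¹.restrictScalars k)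
        rw [show Q.comapAut (σ.restrictScalars k) = Q from hσ, ← restrictScalars_mul,
          mul_inv_cancel] at h2
        exact h2.symm.trans Q.comapAut_one }
  have hcard : Nat.card (L ≃ₐ[K] L) = 7 := by
    rw [IsGalois.card_aut_eq_finrank, hw.finrank_eq]
  have hH : Nat.card H = Q.ramificationIdx (IsScalarTower.toAlgHom k K L) P *
      Q.inertiaDeg (IsScalarTower.toAlgHom k K L) P := by
    rw [← h1]
    exact Nat.subtype_card _ fun σ => by
      rw [Finset.mem_filter]
      exact ⟨fun hσ => hσ.2, fun hσ => ⟨Finset.mem_univ _, hσ⟩⟩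
  have h2 := H.card_subgroup_dvd_card
  rw [hcard, Nat.dvd_prime (by norm_num)] at h2
  rw [← hH]
  refine h2.imp id fun h3 => ⟨h3, fun σ => ?_⟩
  have h4 : H = ⊤ := Subgroup.eq_top_of_card_eq H (by rw [h3, hcard])
  have : σ ∈ H := by rw [h4]; trivial
  exact this

theorem ramificationIdx_eq_one (hw : IsHeptic φ w) (hζ7 : IsPrimitiveRoot ζ 7)
    (hord : ∀ P : Place k K, 7 ∣ P.ord φ)
    {Q : Place k L} {P : Place k K} (hQ : Q.LiesOver (IsScalarTower.toAlgHom k K L) P) :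
    Q.ramificationIdx (IsScalarTower.toAlgHom k K L) P = 1 := by
  rcases hw.ramificationIdx_mul_inertiaDeg hζ7 hQ with h1 | ⟨h1, h2⟩
  · exact Nat.eq_one_of_mul_eq_one_right h1
  · rcases (Nat.dvd_prime (by norm_num)).1 (Dvd.intro _ h1) with h3 | h3
    · exact h3
    · -- otherwise `ρ` would act trivially on the residue field, but it multiplies the unit by `ζ`
      exfalso
      obtain ⟨ρ, hρ⟩ := hw.exists_rho hζ7
      obtain ⟨f, hf0, hf⟩ := hw.exists_unit hord hQ
      have hf0' : algebraMap K L f * w ≠ 0 := mul_ne_zero (by simpa using hf0) hw.w_ne_zero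
      obtain ⟨c, hc⟩ := hQ.exists_val_sub_lt_of_inertiaDeg_eq_one (by rw [h3] at h1; omega)
        ((Q.mem_ring_iff hf0').2 hf.ge)
      have h4 := val_aut_sub_lt (h2 ρ) (c := algebraMap K L c) (ρ.commutes c) hc
      have h5 : ρ.restrictScalars k (algebraMap K L f * w) - algebraMap K L f * w =
          algebraMap k L (ζ - 1) * (algebraMap K L f * w) := by
        change ρ (algebraMap K L f * w) - algebraMap K L f * w = _
        rw [map_mul, ρ.commutes, hρ, map_sub, map_one]
        ring
      have h6 : algebraMap k L (ζ - 1) ≠ 0 := by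
        simpa [sub_eq_zero] using hζ7.ne_one (by norm_num)
      rw [h5, val_eq_exp _ (mul_ne_zero h6 hf0'), ord_mul _ h6 hf0', ord_algebraMap, hf] at h4
      simp at h4

/-- The residue extension is separable as its degree divides `7`, which is invertible in `k`. -/
theorem isUnramifiedExt (hw : IsHeptic φ w) (hζ7 : IsPrimitiveRoot ζ 7)
    (hord : ∀ P : Place k K, 7 ∣ P.ord φ) : IsUnramifiedExt (IsScalarTower.toAlgHom k K L) := by
  intro Q P h
  refine ⟨hw.ramificationIdx_eq_one hζ7 hord h, ?_⟩
  have h1 : Q.inertiaDeg (IsScalarTower.toAlgHom k K L) P ∣ 7 := by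
    rcases hw.ramificationIdx_mul_inertiaDeg hζ7 h with h2 | h2
    · exact (Dvd.intro_left _ h2).trans (one_dvd 7)
    · exact Dvd.intro_left _ h2.1
  rw [inertiaDeg, dif_pos h] at h1
  let _ := h.residueMap.toAlgebra
  have h7 : (7 : P.Residue) ≠ 0 := seven_ne_zero hζ7
  exact isSeparable_of_finrank_dvd_prime (p := 7) (by norm_num) (by exact_mod_cast h7) h1

end IsHeptic

/-- An isomorphism is unramified. -/
theorem isUnramifiedExt_of_bijective {k E F : Type*} [Field k] [Field E] [Field F] [Algebra k E]
    [Algebra k F] {i : E →ₐ[k] F} (hi : Function.Surjective i) : IsUnramifiedExt i := by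
  intro Q P h
  constructor
  · obtain ⟨f, hf⟩ := hi Q.uniformizer
    have h1 := h.ord_eq f
    rw [hf, ord_uniformizer] at h1
    have : (Q.ramificationIdx i P : ℤ) ∣ 1 := ⟨_, h1⟩
    exact_mod_cast Int.eq_one_of_dvd_one (by positivity) this
  · let _ := h.residueMap.toAlgebra
    refine ⟨fun z => ?_⟩
    obtain ⟨z, rfl⟩ := IsLocalRing.residue_surjective z
    obtain ⟨f, hf⟩ := hi z
    have hfP : f ∈ P.ring := (h.mem_iff f).1 (by rw [hf]; exact z.2)
    have hz : IsLocalRing.residue Q.ring z =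
        algebraMap P.Residue Q.Residue (IsLocalRing.residue P.ring ⟨f, hfP⟩) := by
      have : z = h.ringHom ⟨f, hfP⟩ := Subtype.ext hf.symm
      rw [this]
      rfl
    rw [hz]
    exact isSeparable_algebraMap _

end

section

open IsDedekindDomain Polynomial Module Place

/-! ### The dihedral Galois group -/

/-- The data of the dihedral covering: `ρ` multiplies `w` by the root of unity `ζ` and fixes `y`,
and `τ` maps `y` to `-y` and `w` to `n / w`. -/
structure IsDihedralData {k K L : Type*} [Field k] [Field K] [Field L] [Algebra k K]
    [Algebra (RatFunc k) K] [Algebra k L] [Algebra (RatFunc k) L] [Algebra K L]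
    (s : k[X]) (y φ : K) (n : RatFunc k) (w : L) (ζ : k) (ρ τ : L ≃ₐ[RatFunc k] L) : Prop where
  sextic : IsSextic s y
  norm_eq : φ * sextic.conj φ = algebraMap (RatFunc k) K n ^ 7
  heptic : IsHeptic φ w
  zeta : IsPrimitiveRoot ζ 7
  rho_y : ρ (algebraMap K L y) = algebraMap K L y
  rho_w : ρ w = algebraMap k L ζ * w
  tau_y : τ (algebraMap K L y) = -algebraMap K L y
  tau_w : τ w * w = algebraMap (RatFunc k) L n

section

variable {k K L : Type*} [Field k] [Field K] [Field L] [Algebra k K] [Algebra (RatFunc k) K]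
  [IsScalarTower k (RatFunc k) K] [Algebra k L] [Algebra (RatFunc k) L] [Algebra K L]
  [IsScalarTower k (RatFunc k) L] [IsScalarTower k K L] [IsScalarTower (RatFunc k) K L]
  {s : k[X]} {y : K} {h : IsSextic s y} {φ : K} {n : RatFunc k} {w : L} {ζ : k}
  {ρ τ : L ≃ₐ[RatFunc k] L}

namespace IsHeptic

theorem apply_algebraMap (h : IsSextic s y) {σ : L ≃ₐ[RatFunc k] L}
    (hσ : σ (algebraMap K L y) = algebraMap K L y) (f : K) :
    σ (algebraMap K L f) = algebraMap K L f := by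
  obtain ⟨u, v, rfl⟩ := h.exists_eq f
  simp only [map_add, map_mul, ← IsScalarTower.algebraMap_apply, AlgEquiv.commutes, hσ]

theorem algEquiv_ext (h : IsSextic s y) (hw : IsHeptic φ w) {σ σ' : L ≃ₐ[RatFunc k] L}
    (hy : σ (algebraMap K L y) = σ' (algebraMap K L y)) (hσw : σ w = σ' w) : σ = σ' := by
  ext z
  obtain ⟨c, rfl⟩ := hw.exists_sum z
  have h1 : ∀ f : K, σ (algebraMap K L f) = σ' (algebraMap K L f) := by
    intro f
    obtain ⟨u, v, rfl⟩ := h.exists_eq f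
    simp only [map_add, map_mul, ← IsScalarTower.algebraMap_apply, AlgEquiv.commutes, hy]
  simp only [map_sum, map_mul, map_pow, h1, hσw]

theorem n_ne_zero (hφ : φ * h.conj φ = algebraMap (RatFunc k) K n ^ 7) (hw : IsHeptic φ w) :
    n ≠ 0 := by
  rintro rfl
  rw [map_zero, zero_pow (by omega)] at hφ
  rcases mul_eq_zero.1 hφ with h0 | h0
  · exact hw.ne_zero h0
  · exact hw.ne_zero ((map_eq_zero _).1 h0)

/-- The elements of the Galois group of `L / k(x)`. -/
theorem classification (hφ : φ * h.conj φ = algebraMap (RatFunc k) K n ^ 7)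
    (hw : IsHeptic φ w) (hζ7 : IsPrimitiveRoot ζ 7)
    (σ : L ≃ₐ[RatFunc k] L) :
    (σ (algebraMap K L y) = algebraMap K L y ∧ ∃ i < 7, σ w = algebraMap k L ζ ^ i * w) ∨
    (σ (algebraMap K L y) = -algebraMap K L y ∧
      ∃ i < 7, σ w * w = algebraMap k L ζ ^ i * algebraMap (RatFunc k) L n) := by
  have hζL : IsPrimitiveRoot (algebraMap k L ζ) 7 := hζ7.map_of_injective (algebraMap k L).injective
  have h1 : σ (algebraMap K L y) ^ 2 = algebraMap K L y ^ 2 := by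
    rw [← map_pow, ← map_pow, h.sq_eq, ← IsScalarTower.algebraMap_apply, AlgEquiv.commutes]
  rcases sq_eq_sq_iff_eq_or_eq_neg.1 h1 with h2 | h2
  · refine Or.inl ⟨h2, ?_⟩
    have h3 : (σ w / w) ^ 7 = 1 := by
      rw [div_pow, ← map_pow, hw.pow_eq, apply_algebraMap h h2, div_self]
      simpa using hw.ne_zero
    obtain ⟨i, hi, h4⟩ := hζL.eq_pow_of_pow_eq_one h3
    exact ⟨i, hi, by rw [h4, div_mul_cancel₀ _ hw.w_ne_zero]⟩
  · refine Or.inr ⟨h2, ?_⟩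
    have hn : algebraMap (RatFunc k) L n ≠ 0 := by simpa using n_ne_zero hφ hw
    have h3 : (σ w * w / algebraMap (RatFunc k) L n) ^ 7 = 1 := by
      rw [div_pow, mul_pow, ← map_pow σ, hw.pow_eq, tau_algebraMap h h2, ← map_mul, mul_comm,
        hφ, map_pow, ← IsScalarTower.algebraMap_apply, div_self (pow_ne_zero 7 hn)]
    obtain ⟨i, hi, h4⟩ := hζL.eq_pow_of_pow_eq_one h3
    exact ⟨i, hi, by rw [h4, div_mul_cancel₀ _ hn]⟩

/-- The automorphisms `ρ` and `τ` exist: `τ` extends the hyperelliptic involution, and `n / w` is a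
seventh root of the conjugate of `φ`, as `φ` times its conjugate is `n ^ 7`. -/
theorem exists_dihedralData (hφ : φ * h.conj φ = algebraMap (RatFunc k) K n ^ 7) (hw : IsHeptic φ w)
    (hζ7 : IsPrimitiveRoot ζ 7) :
    ∃ ρ τ : L ≃ₐ[RatFunc k] L, IsDihedralData s y φ n w ζ ρ τ := by
  obtain ⟨ρ, hρ⟩ := hw.exists_rho hζ7
  have hn : algebraMap (RatFunc k) L n ≠ 0 := by simpa using n_ne_zero hφ hw
  obtain ⟨g, hg, hgw⟩ := exists_ringHom_of_pow_eq (n := 7) (by omega) hw.pow_eq hw.adjoin_eq_top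
    hw.irreducible ((algebraMap K L).comp (h.conj : K →+* K))
    (z' := algebraMap (RatFunc k) L n / w) (by
      rw [div_pow, hw.pow_eq, div_eq_iff (by simpa using hw.ne_zero)]
      change _ = algebraMap K L (h.conj φ) * algebraMap K L φ
      rw [← map_mul, mul_comm, hφ, map_pow, ← IsScalarTower.algebraMap_apply])
  have := finiteDimensional_ratFunc (L := L) h hw
  have hcomm : ∀ e, g (algebraMap (RatFunc k) L e) = algebraMap (RatFunc k) L e := by
    intro e
    rw [IsScalarTower.algebraMap_apply (RatFunc k) K L, hg]
    change algebraMap K L (h.conj _) = _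
    rw [AlgEquiv.commutes]
  let g' : L →ₐ[RatFunc k] L := { g with commutes' := hcomm }
  refine ⟨ρ.restrictScalars (RatFunc k),
    AlgEquiv.ofBijective g' (Algebra.IsAlgebraic.algHom_bijective g'), h, hφ, hw, hζ7,
    ρ.commutes y, hρ, ?_, ?_⟩
  · change g (algebraMap K L y) = _
    rw [hg]
    change algebraMap K L (h.conj y) = _
    rw [h.conj_y, map_neg]
  · change g w * w = _
    rw [hgw, div_mul_cancel₀ _ hw.w_ne_zero]

end IsHeptic

namespace IsDihedralData

theorem rho_algebraMap (H : IsDihedralData s y φ n w ζ ρ τ) (f : K) :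
    ρ (algebraMap K L f) = algebraMap K L f :=
  IsHeptic.apply_algebraMap H.sextic H.rho_y f

theorem apply_zeta (σ : L ≃ₐ[RatFunc k] L) (c : k) : σ (algebraMap k L c) = algebraMap k L c := by
  rw [IsScalarTower.algebraMap_apply k (RatFunc k) L, AlgEquiv.commutes]

theorem rho_pow_y (H : IsDihedralData s y φ n w ζ ρ τ) (j : ℕ) :
    (ρ ^ j) (algebraMap K L y) = algebraMap K L y := by
  induction j with
  | zero => rfl
  | succ j ih => rw [pow_succ', AlgEquiv.mul_apply, ih, H.rho_y]

theorem rho_pow_w (H : IsDihedralData s y φ n w ζ ρ τ) (j : ℕ) :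
    (ρ ^ j) w = algebraMap k L ζ ^ j * w := by
  induction j with
  | zero => simp
  | succ j ih => rw [pow_succ', AlgEquiv.mul_apply, ih, map_mul, map_pow, apply_zeta, H.rho_w]; ring

theorem tau_w_eq (H : IsDihedralData s y φ n w ζ ρ τ) : τ w = algebraMap (RatFunc k) L n / w := by
  rw [eq_div_iff H.heptic.w_ne_zero, H.tau_w]

theorem rho_pow_seven (H : IsDihedralData s y φ n w ζ ρ τ) : ρ ^ 7 = 1 := by
  refine H.heptic.algEquiv_ext H.sextic ?_ ?_
  · rw [H.rho_pow_y]; rfl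
  · rw [H.rho_pow_w, ← map_pow, H.zeta.pow_eq_one, map_one, one_mul]; rfl

theorem tau_mul_self (H : IsDihedralData s y φ n w ζ ρ τ) : τ * τ = 1 := by
  refine H.heptic.algEquiv_ext H.sextic ?_ ?_
  · rw [AlgEquiv.mul_apply, H.tau_y, map_neg, H.tau_y, neg_neg]; rfl
  · have hn : algebraMap (RatFunc k) L n ≠ 0 := by simpa using IsHeptic.n_ne_zero H.norm_eq H.heptic
    rw [AlgEquiv.mul_apply, H.tau_w_eq, map_div₀, AlgEquiv.commutes, H.tau_w_eq]
    have := H.heptic.w_ne_zero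
    rw [AlgEquiv.one_apply]
    field_simp

theorem tau_tau (H : IsDihedralData s y φ n w ζ ρ τ) (z : L) : τ (τ z) = z :=
  AlgEquiv.congr_fun H.tau_mul_self z

theorem rho_mul_tau_mul_rho (H : IsDihedralData s y φ n w ζ ρ τ) : ρ * τ * ρ = τ := by
  have hζ0 : algebraMap k L ζ ≠ 0 := by simpa using H.zeta.ne_zero (by norm_num)
  have := H.heptic.w_ne_zero
  refine H.heptic.algEquiv_ext H.sextic ?_ ?_
  · rw [AlgEquiv.mul_apply, AlgEquiv.mul_apply, H.rho_y, H.tau_y, map_neg, H.rho_y]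
  · rw [AlgEquiv.mul_apply, AlgEquiv.mul_apply, H.rho_w, map_mul, apply_zeta, H.tau_w_eq, map_mul,
      apply_zeta, map_div₀, AlgEquiv.commutes, H.rho_w]
    field_simp

theorem rho_pow_mul_tau_mul (H : IsDihedralData s y φ n w ζ ρ τ) (j : ℕ) :
    ρ ^ j * τ * ρ ^ j = τ := by
  induction j with
  | zero => simp
  | succ j ih =>
    calc ρ ^ (j + 1) * τ * ρ ^ (j + 1) = ρ ^ j * ρ * τ * (ρ * ρ ^ j) := by
          rw [← pow_succ, ← pow_succ']
      _ = ρ ^ j * (ρ * τ * ρ) * ρ ^ j := by simp only [mul_assoc]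
      _ = τ := by rw [H.rho_mul_tau_mul_rho, ih]

/-- The involutions are conjugate: `3 j` is congruent to `-j / 2` modulo `7`. -/
theorem rho_pow_mul_tau (H : IsDihedralData s y φ n w ζ ρ τ) (j : ℕ) :
    ρ ^ (3 * j) * τ = τ * ρ ^ j * ρ ^ (3 * j) := by
  have h2 : ρ ^ (3 * j) * τ * ρ ^ (3 * j) = τ * ρ ^ j * ρ ^ (3 * j) * ρ ^ (3 * j) := by
    rw [H.rho_pow_mul_tau_mul, mul_assoc, mul_assoc, ← pow_add, ← pow_add,
      show j + (3 * j + 3 * j) = 7 * j by ring, pow_mul, H.rho_pow_seven, one_pow, mul_one]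
  exact mul_right_cancel h2

theorem y_ne_neg (H : IsDihedralData s y φ n w ζ ρ τ) : algebraMap K L y ≠ -algebraMap K L y := by
  intro h
  have h1 : (2 : L) * algebraMap K L y = 0 := by linear_combination h
  rcases mul_eq_zero.1 h1 with h2 | h2
  · exact H.sextic.two_ne_zero' h2
  · exact H.sextic.y_ne_zero ((map_eq_zero _).1 h2)

theorem rho_pow_ne_one (H : IsDihedralData s y φ n w ζ ρ τ) {j : ℕ} (hj : ¬ 7 ∣ j) : ρ ^ j ≠ 1 := by
  intro h
  have h1 := H.rho_pow_w j
  rw [h, AlgEquiv.one_apply] at h1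
  have h2 : algebraMap k L (ζ ^ j) = algebraMap k L 1 := by
    rw [map_pow, map_one]
    exact (mul_right_cancel₀ H.heptic.w_ne_zero ((one_mul w).trans h1)).symm
  exact hj (H.zeta.dvd_of_pow_eq_one j ((algebraMap k L).injective h2))

theorem exists_eq (H : IsDihedralData s y φ n w ζ ρ τ) (σ : L ≃ₐ[RatFunc k] L) :
    ∃ j < 7, σ = ρ ^ j ∨ σ = τ * ρ ^ j := by
  rcases IsHeptic.classification H.norm_eq H.heptic H.zeta σ with ⟨h1, i, hi, h2⟩ | ⟨h1, i, hi, h2⟩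
  · exact ⟨i, hi, Or.inl (H.heptic.algEquiv_ext H.sextic (by rw [h1, H.rho_pow_y])
      (by rw [h2, H.rho_pow_w]))⟩
  · refine ⟨i, hi, Or.inr (H.heptic.algEquiv_ext H.sextic
      (by rw [h1, AlgEquiv.mul_apply, H.rho_pow_y, H.tau_y]) ?_)⟩
    rw [AlgEquiv.mul_apply, H.rho_pow_w, map_mul, map_pow, apply_zeta, H.tau_w_eq, ← mul_div_assoc,
      eq_div_iff H.heptic.w_ne_zero, h2]

theorem isGalois (H : IsDihedralData s y φ n w ζ ρ τ) : IsGalois (RatFunc k) L := by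
  have := IsHeptic.finiteDimensional_ratFunc (L := L) H.sextic H.heptic
  refine IsGalois.of_fixedField_eq_bot (RatFunc k) L (eq_bot_iff.2 fun z hz => ?_)
  have h1 : ∀ σ : L ≃ₐ[RatFunc k] L, σ z = z := fun σ => hz ⟨σ, trivial⟩
  obtain ⟨f, rfl⟩ := H.heptic.mem_range_of_eq H.zeta (ρ := (ρ : L →+* L)) H.rho_algebraMap H.rho_w
    (h1 ρ)
  have h2 := h1 τ
  rw [IsHeptic.tau_algebraMap H.sextic H.tau_y] at h2
  obtain ⟨u, rfl⟩ := H.sextic.mem_range_of_conj_eq ((algebraMap K L).injective h2)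
  exact ⟨u, IsScalarTower.algebraMap_apply (RatFunc k) K L u⟩

theorem tau_ne (H : IsDihedralData s y φ n w ζ ρ τ) (i j : ℕ) : τ * ρ ^ i ≠ ρ ^ j := by
  intro h
  have h1 := AlgEquiv.congr_fun h (algebraMap K L y)
  rw [AlgEquiv.mul_apply, H.rho_pow_y, H.rho_pow_y, H.tau_y] at h1
  exact H.y_ne_neg h1.symm

theorem rho_pow_inj (H : IsDihedralData s y φ n w ζ ρ τ) {i j : ℕ} (hi : i < 7) (hj : j < 7)
    (hij : ρ ^ i = ρ ^ j) : i = j := by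
  wlog hle : i ≤ j generalizing i j
  · exact (this hj hi hij.symm (by omega)).symm
  by_contra hne
  refine H.rho_pow_ne_one (j := j - i) (fun hd => ?_) ?_
  · have := Nat.le_of_dvd (by omega) hd
    omega
  · have : ρ ^ j = ρ ^ (j - i) * ρ ^ i := by rw [← pow_add, Nat.sub_add_cancel hle]
    rw [this] at hij
    exact (mul_eq_right.1 hij.symm)

/-- The elements of the Galois group are `ρʲ` and `τ ρʲ`, `j = 0, …, 6`. -/
theorem sum_eq (H : IsDihedralData s y φ n w ζ ρ τ) [Fintype (L ≃ₐ[RatFunc k] L)] {M : Type*}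
    [AddCommMonoid M] (g : (L ≃ₐ[RatFunc k] L) → M) :
    ∑ σ, g σ = ∑ j ∈ Finset.range 7, (g (ρ ^ j) + g (τ * ρ ^ j)) := by
  let e : Fin 7 ⊕ Fin 7 → (L ≃ₐ[RatFunc k] L) := Sum.elim (fun j => ρ ^ (j : ℕ))
    (fun j => τ * ρ ^ (j : ℕ))
  have he : Function.Bijective e := by
    constructor
    · rintro (i | i) (j | j) hij
      · exact congrArg Sum.inl (Fin.ext (H.rho_pow_inj i.2 j.2 hij))
      · exact absurd hij.symm (H.tau_ne _ _)
      · exact absurd hij (H.tau_ne _ _)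
      · exact congrArg Sum.inr (Fin.ext (H.rho_pow_inj i.2 j.2 (mul_left_cancel hij)))
    · intro σ
      obtain ⟨j, hj, h1 | h1⟩ := H.exists_eq σ
      · exact ⟨Sum.inl ⟨j, hj⟩, h1.symm⟩
      · exact ⟨Sum.inr ⟨j, hj⟩, h1.symm⟩
  rw [← he.sum_comp, Fintype.sum_sum_type, Finset.sum_add_distrib, Finset.sum_range,
    Finset.sum_range]
  rfl

/-- The Galois group is the dihedral group of order `14`. -/
theorem nonempty_mulEquiv (H : IsDihedralData s y φ n w ζ ρ τ) :
    Nonempty ((L ≃ₐ[RatFunc k] L) ≃* DihedralGroup 7) := by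
  have hadd : ∀ i j : ZMod 7, ρ ^ (i + j).val = ρ ^ i.val * ρ ^ j.val := by
    intro i j
    rw [← pow_add, ZMod.val_add]
    conv_rhs => rw [← Nat.mod_add_div (i.val + j.val) 7, pow_add, pow_mul, H.rho_pow_seven,
      one_pow, mul_one]
  have hsub : ∀ i j : ZMod 7, ρ ^ i.val * (τ * ρ ^ j.val) = τ * ρ ^ (j - i).val := by
    intro i j
    have h1 : ρ ^ j.val = ρ ^ i.val * ρ ^ (j - i).val := by rw [← hadd]; congr 2; ring
    rw [h1, ← mul_assoc, ← mul_assoc, H.rho_pow_mul_tau_mul]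
  let f : DihedralGroup 7 → (L ≃ₐ[RatFunc k] L)
    | .r i => ρ ^ i.val
    | .sr i => τ * ρ ^ i.val
  let g : DihedralGroup 7 →* (L ≃ₐ[RatFunc k] L) :=
    { toFun := f
      map_one' := rfl
      map_mul' := by
        rintro (i | i) (j | j)
        · exact hadd i j
        · exact (hsub i j).symm
        · change τ * ρ ^ (i + j).val = τ * ρ ^ i.val * ρ ^ j.val
          rw [hadd, mul_assoc]
        · change ρ ^ (j - i).val = τ * ρ ^ i.val * (τ * ρ ^ j.val)
          rw [mul_assoc, hsub, ← mul_assoc, H.tau_mul_self, one_mul] }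
  have hg : Function.Bijective g := by
    constructor
    · rintro (i | i) (j | j) hij
      · exact congrArg _ (ZMod.val_injective 7 (H.rho_pow_inj (ZMod.val_lt i) (ZMod.val_lt j) hij))
      · exact absurd (show ρ ^ i.val = τ * ρ ^ j.val from hij).symm (H.tau_ne _ _)
      · exact absurd (show τ * ρ ^ i.val = ρ ^ j.val from hij) (H.tau_ne _ _)
      · exact congrArg _ (ZMod.val_injective 7 (H.rho_pow_inj (ZMod.val_lt i) (ZMod.val_lt j)
          (mul_left_cancel (show τ * ρ ^ i.val = τ * ρ ^ j.val from hij))))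
    · intro σ
      obtain ⟨j, hj, h1 | h1⟩ := H.exists_eq σ
      · refine ⟨.r j, ?_⟩
        change ρ ^ (j : ZMod 7).val = σ
        rw [ZMod.val_natCast, Nat.mod_eq_of_lt hj, h1]
      · refine ⟨.sr j, ?_⟩
        change τ * ρ ^ (j : ZMod 7).val = σ
        rw [ZMod.val_natCast, Nat.mod_eq_of_lt hj, h1]
  exact ⟨(MulEquiv.ofBijective g hg).symm⟩

end IsDihedralData

namespace IsHeptic

/-- An element of order `7` fixes `y` and multiplies `w` by a primitive seventh root of unity. -/
theorem rho_of_orderOf (hφ : φ * h.conj φ = algebraMap (RatFunc k) K n ^ 7)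
    (hw : IsHeptic φ w) (hζ7 : IsPrimitiveRoot ζ 7)
    {σ : L ≃ₐ[RatFunc k] L} (hσ : orderOf σ = 7) :
    ∃ ζ' : k, IsPrimitiveRoot ζ' 7 ∧ σ (algebraMap K L y) = algebraMap K L y ∧
      σ w = algebraMap k L ζ' * w := by
  obtain ⟨ρ, τ, H⟩ := exists_dihedralData hφ hw hζ7
  obtain ⟨j, hj, rfl | rfl⟩ := H.exists_eq σ
  · refine ⟨ζ ^ j, hζ7.pow_of_coprime j ?_, H.rho_pow_y j, by rw [H.rho_pow_w, map_pow]⟩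
    have hj0 : j ≠ 0 := by
      rintro rfl
      rw [pow_zero, orderOf_one] at hσ
      omega
    interval_cases j <;> first | omega | decide
  · have h1 : (τ * ρ ^ j) ^ 2 = 1 := by
      rw [sq, mul_assoc, ← mul_assoc (ρ ^ j), H.rho_pow_mul_tau_mul, H.tau_mul_self]
    have h2 := orderOf_dvd_of_pow_eq_one h1
    rw [hσ] at h2
    omega

theorem tau_of_orderOf (hφ : φ * h.conj φ = algebraMap (RatFunc k) K n ^ 7)
    (hw : IsHeptic φ w) (hζ7 : IsPrimitiveRoot ζ 7)
    {σ : L ≃ₐ[RatFunc k] L} (hσ : orderOf σ = 2) :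
    ∃ n' : RatFunc k, φ * h.conj φ = algebraMap (RatFunc k) K n' ^ 7 ∧
      σ (algebraMap K L y) = -algebraMap K L y ∧
      σ w * w = algebraMap (RatFunc k) L n' := by
  rcases classification hφ hw hζ7 σ with ⟨h1, i, hi, h2⟩ | ⟨h1, i, hi, h2⟩
  · exfalso
    obtain ⟨ρ, τ, H⟩ := exists_dihedralData hφ hw hζ7
    have h3 : σ = ρ ^ i := hw.algEquiv_ext h (by rw [h1, H.rho_pow_y]) (by rw [h2, H.rho_pow_w])
    have h4 : σ ^ 7 = 1 := by rw [h3, ← pow_mul, mul_comm, pow_mul, H.rho_pow_seven, one_pow]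
    have h5 := orderOf_dvd_of_pow_eq_one h4
    rw [hσ] at h5
    omega
  · refine ⟨algebraMap k (RatFunc k) (ζ ^ i) * n, ?_, h1, ?_⟩
    · have h3 : algebraMap k (RatFunc k) (ζ ^ i) ^ 7 = 1 := by
        rw [← map_pow, ← pow_mul, mul_comm i, pow_mul, hζ7.pow_eq_one, one_pow, map_one]
      rw [hφ, map_mul, mul_pow, ← map_pow _ (algebraMap k (RatFunc k) (ζ ^ i)), h3, map_one,
        one_mul]
    · rw [h2, map_mul, ← IsScalarTower.algebraMap_apply, map_pow]

end IsHeptic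

end

end

section

open IsDedekindDomain Polynomial Module Place

/-! ### Fixed points -/

namespace Place

section

variable {k F : Type*} [Field k] [Field F] [Algebra k F]

theorem val_lt_one_iff_ord_pos (Q : Place k F) {f : F} (hf : f ≠ 0) :
    Q.val f < 1 ↔ 0 < Q.ord f := by
  rw [val_eq_exp _ hf, ← WithZero.exp_zero, WithZero.exp_lt_exp]
  omega

theorem val_eq_one_iff_ord_eq_zero (Q : Place k F) {f : F} (hf : f ≠ 0) :
    Q.val f = 1 ↔ Q.ord f = 0 := by
  rw [val_eq_exp _ hf, ← WithZero.exp_zero, WithZero.exp_inj]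
  omega

theorem val_algebraMap (Q : Place k F) {c : k} (hc : c ≠ 0) : Q.val (algebraMap k F c) = 1 := by
  rw [val_eq_one_iff_ord_eq_zero _ (by simpa using hc), ord_algebraMap]

theorem eq_of_val_sub_lt (Q : Place k F) {z : F} {c c' : k} (h : Q.val (z - algebraMap k F c) < 1)
    (h' : Q.val (z - algebraMap k F c') < 1) : c = c' := by
  by_contra hne
  have h1 : Q.val (algebraMap k F (c - c')) < 1 := by
    rw [show algebraMap k F (c - c') = (z - algebraMap k F c') - (z - algebraMap k F c) by
      rw [map_sub]; ring]
    exact (Q.val.map_sub _ _).trans_lt (max_lt h' h)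
  rw [val_algebraMap _ (sub_ne_zero.2 hne)] at h1
  exact lt_irrefl _ h1

theorem exists_val_sub_lt [IsAlgClosed k] (Q : Place k F) [Module.Finite k Q.Residue] {z : F}
    (hz : z ∈ Q.ring) : ∃ c : k, Q.val (z - algebraMap k F c) < 1 := by
  obtain ⟨c, hc⟩ := (IsAlgClosed.algebraMap_bijective_of_isIntegral (k := k)
    (K := Q.Residue)).2 (IsLocalRing.residue Q.ring ⟨z, hz⟩)
  rw [algebraMap_residue] at hc
  refine ⟨c, ?_⟩
  have h1 : (⟨z, hz⟩ : Q.ring) - algebraMap k Q.ring c ∈ IsLocalRing.maximalIdeal Q.ring := by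
    rw [← IsLocalRing.residue_eq_zero_iff, map_sub, hc, sub_self]
  exact (val_lt_one_iff Q _).2 h1

end

section

variable {k : Type*} [Field k]

/-- The point `x = r` of the projective line. -/
theorem exists_ratFunc_place (r : k) : ∃ P : Place k (RatFunc k),
    P.ord (algebraMap k[X] (RatFunc k) (X - C r)) = 1 ∧ ∀ P' : Place k (RatFunc k),
      P'.val (algebraMap k[X] (RatFunc k) (X - C r)) < 1 → P' = P := by
  have hX0 : algebraMap k[X] (RatFunc k) (X - C r) ≠ 0 :=
    RatFunc.algebraMap_ne_zero (X_sub_C_ne_zero r)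
  let v : HeightOneSpectrum k[X] := ⟨Ideal.span {X - C r},
    (Ideal.span_singleton_prime (X_sub_C_ne_zero r)).2 (prime_X_sub_C r),
    by simpa using X_sub_C_ne_zero r⟩
  refine ⟨ofPrime v (valuation_algebraMap_le v), ?_, fun P' hP' => ?_⟩
  · rw [ord_def, val_ofPrime, HeightOneSpectrum.valuation_of_algebraMap,
      HeightOneSpectrum.intValuation_singleton v (X_sub_C_ne_zero r) rfl, WithZero.log_exp]
    rfl
  · have hX : (RatFunc.X : RatFunc k) ∈ P'.ring := by
      have h1 := P'.ring.add_mem _ _ ((val_le_one_iff _ _).1 hP'.le) (P'.algebraMap_mem r)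
      rwa [map_sub, RatFunc.algebraMap_X, RatFunc.algebraMap_C, ← RatFunc.algebraMap_eq_C,
        sub_add_cancel] at h1
    obtain ⟨v', rfl⟩ := exists_ofPrime hX
    rw [val_ofPrime, HeightOneSpectrum.valuation_lt_one_iff_mem] at hP'
    have h2 : v.asIdeal = v'.asIdeal := by
      refine (v.isPrime.isMaximal v.ne_bot).eq_of_le v'.isPrime.ne_top ?_
      exact (Ideal.span_singleton_le_iff_mem _).2 hP'
    have h3 : v = v' := HeightOneSpectrum.ext h2
    subst h3
    rfl

end

end Place

namespace IsDihedralData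

section

variable {k K L : Type*} [Field k] [Field K] [Field L] [Algebra k K] [Algebra (RatFunc k) K]
  [IsScalarTower k (RatFunc k) K] [Algebra k L] [Algebra (RatFunc k) L] [Algebra K L]
  [IsScalarTower k (RatFunc k) L] [IsScalarTower k K L] [IsScalarTower (RatFunc k) K L]
  {s : k[X]} {y : K} {φ : K} {n : RatFunc k} {w : L} {ζ : k}
  {ρ τ : L ≃ₐ[RatFunc k] L}

theorem finite_residue_top (H : IsDihedralData s y φ n w ζ ρ τ) (Q : Place k L) :
    Module.Finite k Q.Residue := by
  have := IsHeptic.finiteDimensional_ratFunc (L := L) H.sextic H.heptic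
  have := IsHeptic.isSeparable_ratFunc (L := L) H.sextic H.heptic H.zeta
  exact finite_residue Q

theorem comapAut_mul' (σ σ' : L ≃ₐ[RatFunc k] L) (Q : Place k L) :
    Q.comapAut ((σ * σ').restrictScalars k) =
      (Q.comapAut (σ.restrictScalars k)).comapAut (σ'.restrictScalars k) :=
   comapAut_mul (σ.restrictScalars k) (σ'.restrictScalars k) Q

theorem algebraMap_X_sub_C (r : k) : algebraMap (RatFunc k) L RatFunc.X - algebraMap k L r =
    algebraMap (RatFunc k) L (algebraMap k[X] (RatFunc k) (X - C r)) := by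
  rw [map_sub, map_sub, RatFunc.algebraMap_X, RatFunc.algebraMap_C, ← RatFunc.algebraMap_eq_C,
    ← IsScalarTower.algebraMap_apply]

theorem algebraMap_X_sub_ne_zero (r : k) :
    algebraMap (RatFunc k) L RatFunc.X - algebraMap k L r ≠ 0 := by
  rw [algebraMap_X_sub_C, Ne, map_eq_zero]
  exact RatFunc.algebraMap_ne_zero (X_sub_C_ne_zero r)

theorem sq_y (H : IsDihedralData s y φ n w ζ ρ τ) : algebraMap K L y ^ 2 =
    algebraMap (RatFunc k) L (algebraMap k[X] (RatFunc k) s) := by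
  rw [← map_pow, H.sextic.sq_eq, ← IsScalarTower.algebraMap_apply]

theorem val_two (H : IsDihedralData s y φ n w ζ ρ τ) (Q : Place k L) : Q.val (2 : L) = 1 := by
  have := Q.val_algebraMap H.sextic.two_ne
  rwa [map_ofNat] at this

variable [IsAlgClosed k]

/-- A nontrivial automorphism of `L / K` has no fixed point: otherwise it would fix the value of a
unit `f w`, but multiplies it by a nontrivial root of unity. -/
theorem comapAut_ne (H : IsDihedralData s y φ n w ζ ρ τ)
    (hord : ∀ P : Place k K, 7 ∣ P.ord φ) {σ : L ≃ₐ[RatFunc k] L}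
    (hσy : σ (algebraMap K L y) = algebraMap K L y) {ξ : k} (hξ : ξ ≠ 1)
    (hσw : σ w = algebraMap k L ξ * w) (Q : Place k L) :
    Q.comapAut (σ.restrictScalars k) ≠ Q := by
  intro hQ
  have := H.finite_residue_top Q
  have hfin := H.heptic.finiteDimensional
  have h1 := Q.liesOver_below (IsScalarTower.toAlgHom k K L) isIntegral_toAlgHom
  obtain ⟨f, hf, h2⟩ := H.heptic.exists_unit hord h1
  have h0 : algebraMap K L f * w ≠ 0 :=
    mul_ne_zero (by simpa using hf) H.heptic.w_ne_zero
  obtain ⟨c, hc⟩ := Q.exists_val_sub_lt ((Q.mem_ring_iff h0).2 h2.ge)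
  have h3 := val_aut_sub_lt hQ (AlgEquiv.commutes _ c) hc
  have h4 : σ (algebraMap K L f * w) - algebraMap K L f * w =
      algebraMap k L (ξ - 1) * (algebraMap K L f * w) := by
    rw [map_mul, IsHeptic.apply_algebraMap H.sextic hσy, hσw, map_sub, map_one]
    ring
  change Q.val (σ (algebraMap K L f * w) - algebraMap K L f * w) < 1 at h3
  rw [h4, map_mul, val_algebraMap _ (sub_ne_zero.2 hξ), one_mul,
    (val_eq_one_iff_ord_eq_zero _ h0).2 h2] at h3
  exact lt_irrefl _ h3

theorem comapAut_rho_pow_ne (H : IsDihedralData s y φ n w ζ ρ τ)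
    (hord : ∀ P : Place k K, 7 ∣ P.ord φ) {j : ℕ} (hj : ¬ 7 ∣ j) (Q : Place k L) :
    Q.comapAut ((ρ ^ j).restrictScalars k) ≠ Q :=
  H.comapAut_ne hord (H.rho_pow_y j) (fun h1 => hj (H.zeta.dvd_of_pow_eq_one j h1))
    (by rw [H.rho_pow_w, map_pow]) Q

/-- A function that `τ` changes by a sign vanishes at the fixed points of `τ`, unless it has a
pole there. -/
theorem val_lt_one_of_fixed (H : IsDihedralData s y φ n w ζ ρ τ) {Q : Place k L}
    (hQ : Q.comapAut (τ.restrictScalars k) = Q) {z : L} (hz : z ∈ Q.ring) (hτ : τ z = -z) :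
    Q.val z < 1 := by
  have := H.finite_residue_top Q
  obtain ⟨c, hc⟩ := Q.exists_val_sub_lt hz
  have h3 := val_aut_sub_lt hQ (AlgEquiv.commutes _ c) hc
  change Q.val (τ z - z) < 1 at h3
  rwa [hτ, show -z - z = -(2 * z) by ring, Valuation.map_neg, map_mul, H.val_two, one_mul] at h3

/-- The fixed points of `τ` lie above the roots of `s`. -/
theorem exists_root_of_fixed (H : IsDihedralData s y φ n w ζ ρ τ) {Q : Place k L}
    (hQ : Q.comapAut (τ.restrictScalars k) = Q) : ∃ r : k, s.eval r = 0 ∧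
      0 < Q.ord (algebraMap (RatFunc k) L RatFunc.X - algebraMap k L r) := by
  have := H.finite_residue_top Q
  have := IsHeptic.finiteDimensional_ratFunc (L := L) H.sextic H.heptic
  by_cases hx : Q ∈ finitePlaces k L
  · have hy : algebraMap K L y ∈ Q.ring := by
      refine Q.mem_of_pow_mem two_ne_zero ?_
      rw [H.sq_y]
      exact polynomial_mem_of_mem_finitePlaces hx s
    have h1 := H.val_lt_one_of_fixed hQ hy H.tau_y
    have h2 : Q.val (algebraMap (RatFunc k) L (algebraMap k[X] (RatFunc k) s)) < 1 := by
      rw [← H.sq_y, map_pow]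
      exact pow_lt_one₀ zero_le h1 two_ne_zero
    obtain ⟨r, hr⟩ := Q.exists_val_sub_lt (show algebraMap (RatFunc k) L RatFunc.X ∈ Q.ring from hx)
    refine ⟨r, ?_, (Q.val_lt_one_iff_ord_pos (algebraMap_X_sub_ne_zero r)).1 hr⟩
    obtain ⟨g, hg⟩ := X_sub_C_dvd_sub_C_eval (a := r) (p := s)
    by_contra hne
    have h3 : algebraMap k L (s.eval r) =
        algebraMap (RatFunc k) L (algebraMap k[X] (RatFunc k) s) -
        (algebraMap (RatFunc k) L RatFunc.X - algebraMap k L r) *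
          algebraMap (RatFunc k) L (algebraMap k[X] (RatFunc k) g) := by
      rw [algebraMap_X_sub_C, ← map_mul, ← map_mul, ← hg, map_sub, map_sub, sub_sub_cancel,
        RatFunc.algebraMap_C, ← RatFunc.algebraMap_eq_C, ← IsScalarTower.algebraMap_apply]
    have h4 : Q.val (algebraMap k L (s.eval r)) < 1 := by
      rw [h3]
      refine (Q.val.map_sub _ _).trans_lt (max_lt h2 ?_)
      rw [map_mul]
      exact mul_lt_one_of_lt_of_le hr
        ((Q.val_le_one_iff _).2 (polynomial_mem_of_mem_finitePlaces hx g))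
    rw [val_algebraMap _ hne] at h4
    exact lt_irrefl _ h4
  · exfalso
    have hl := notMem_finitePlaces_iff.1 hx
    have hs0 := H.sextic.algebraMap_ne_zero
    have hX0 : (RatFunc.X : RatFunc k) ^ 6 ≠ 0 := pow_ne_zero 6 RatFunc.X_ne_zero
    set z : L := algebraMap K L y / algebraMap (RatFunc k) L (RatFunc.X ^ 3) with hz
    have hz2 : z ^ 2 =
        algebraMap (RatFunc k) L (algebraMap k[X] (RatFunc k) s / RatFunc.X ^ 6) := by
      rw [hz, div_pow, H.sq_y, ← map_pow, ← pow_mul, map_div₀]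
    have hz0 : z ≠ 0 := div_ne_zero (by simpa using H.sextic.y_ne_zero)
      (by simpa using RatFunc.X_ne_zero)
    have h1 : (infty k).ord (algebraMap k[X] (RatFunc k) s / RatFunc.X ^ 6) = 0 := by
      rw [ord_div _ hs0 hX0, ord_pow, ord_infty hs0, ord_infty RatFunc.X_ne_zero,
        RatFunc.intDegree_X, RatFunc.intDegree_polynomial, H.sextic.natDegree_eq]
      norm_num
    have h2 : Q.ord z = 0 := by
      have h3 := hl.ord_eq (algebraMap k[X] (RatFunc k) s / RatFunc.X ^ 6)
      rw [h1, mul_zero] at h3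
      change Q.ord (algebraMap (RatFunc k) L _) = 0 at h3
      rw [← hz2, ord_pow] at h3
      push_cast at h3
      omega
    have h3 := H.val_lt_one_of_fixed hQ ((Q.mem_ring_iff hz0).2 h2.ge)
      (by rw [hz, map_div₀, H.tau_y, AlgEquiv.commutes, neg_div])
    rw [(val_eq_one_iff_ord_eq_zero _ hz0).2 h2] at h3
    exact lt_irrefl _ h3

/-- A point above a root of `s` is fixed by a nontrivial automorphism, since its ramification index
over `k(x)` is even: the square of `y` is `s`, which has a simple zero. -/
theorem exists_stabilizer_ne_one (H : IsDihedralData s y φ n w ζ ρ τ) {r : k} (hr : s.eval r = 0)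
    {Q : Place k L} {P : Place k (RatFunc k)}
    (hQ : Q.LiesOver (IsScalarTower.toAlgHom k (RatFunc k) L) P)
    (hP : P.ord (algebraMap k[X] (RatFunc k) (X - C r)) = 1) :
    ∃ σ : L ≃ₐ[RatFunc k] L, σ ≠ 1 ∧ Q.comapAut (σ.restrictScalars k) = Q := by
  classical
  have := IsHeptic.finiteDimensional_ratFunc (L := L) H.sextic H.heptic
  have := H.isGalois
  have hX0 : algebraMap k[X] (RatFunc k) (X - C r) ≠ 0 :=
    RatFunc.algebraMap_ne_zero (X_sub_C_ne_zero r)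
  obtain ⟨g, hg⟩ := dvd_iff_isRoot.2 hr
  have hg0 : g ≠ 0 := by
    rintro rfl
    exact H.sextic.ne_zero (by rw [hg, mul_zero])
  have hgr : g.eval r ≠ 0 := by
    have h1 := H.sextic.separable.eval₂_derivative_ne_zero (RingHom.id k) (x := r)
      (by simpa [eval₂_id] using hr)
    rw [hg] at h1
    simpa using h1
  have hXm : (RatFunc.X : RatFunc k) ∈ P.ring := by
    have h1 := P.ring.add_mem _ _ ((P.mem_ring_iff hX0).2 (by omega)) (P.algebraMap_mem r)
    rwa [map_sub, RatFunc.algebraMap_X, RatFunc.algebraMap_C, ← RatFunc.algebraMap_eq_C,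
      sub_add_cancel] at h1
  have hgP : P.ord (algebraMap k[X] (RatFunc k) g) = 0 := by
    have hg0' : algebraMap k[X] (RatFunc k) g ≠ 0 := by simpa using hg0
    refine le_antisymm ?_ ((P.mem_ring_iff hg0').1 (polynomial_mem hXm g))
    by_contra! hlt
    obtain ⟨q, hq⟩ := X_sub_C_dvd_sub_C_eval (a := r) (p := g)
    have h3 : algebraMap k (RatFunc k) (g.eval r) = algebraMap k[X] (RatFunc k) g -
        algebraMap k[X] (RatFunc k) (X - C r) * algebraMap k[X] (RatFunc k) q := by
      rw [← map_mul, ← hq, map_sub, sub_sub_cancel, RatFunc.algebraMap_C, ← RatFunc.algebraMap_eq_C]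
    have h4 : P.val (algebraMap k (RatFunc k) (g.eval r)) < 1 := by
      rw [h3]
      refine (P.val.map_sub _ _).trans_lt (max_lt ((P.val_lt_one_iff_ord_pos hg0').2 hlt) ?_)
      rw [map_mul]
      exact mul_lt_one_of_lt_of_le ((P.val_lt_one_iff_ord_pos hX0).2 (by omega))
        ((P.val_le_one_iff _).2 (polynomial_mem hXm q))
    rw [val_algebraMap _ hgr] at h4
    exact lt_irrefl _ h4
  have hsP : P.ord (algebraMap k[X] (RatFunc k) s) = 1 := by
    rw [hg, map_mul, ord_mul _ hX0 (by simpa using hg0), hP, hgP, add_zero]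
  have h1 := hQ.ord_eq (algebraMap k[X] (RatFunc k) s)
  change Q.ord (algebraMap (RatFunc k) L _) = _ at h1
  rw [← H.sq_y, ord_pow, hsP, mul_one] at h1
  have h2 := card_comapAut_eq hQ hQ
  by_contra! hne
  have h3 : (Finset.univ.filter fun σ : L ≃ₐ[RatFunc k] L =>
      Q.comapAut (σ.restrictScalars k) = Q).card = 1 := by
    rw [Finset.card_eq_one]
    refine ⟨1, Finset.ext fun σ => ?_⟩
    rw [Finset.mem_filter, Finset.mem_singleton]
    refine ⟨fun h => by_contra fun h' => hne σ h' h.2, fun h => ⟨Finset.mem_univ _, ?_⟩⟩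
    rw [h]
    exact comapAut_one Q
  rw [h3] at h2
  have h4 := Nat.eq_one_of_mul_eq_one_right h2.symm
  rw [h4] at h1
  push_cast at h1
  omega

/-- Above each root of `s` there is exactly one fixed point of `τ`. -/
theorem existsUnique_fixed (H : IsDihedralData s y φ n w ζ ρ τ)
    (hord : ∀ P : Place k K, 7 ∣ P.ord φ) {r : k} (hr : s.eval r = 0) :
    ∃! Q : Place k L, Q.comapAut (τ.restrictScalars k) = Q ∧
      0 < Q.ord (algebraMap (RatFunc k) L RatFunc.X - algebraMap k L r) := by
  have := IsHeptic.finiteDimensional_ratFunc (L := L) H.sextic H.heptic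
  have := H.isGalois
  have hX0 : algebraMap k[X] (RatFunc k) (X - C r) ≠ 0 :=
    RatFunc.algebraMap_ne_zero (X_sub_C_ne_zero r)
  obtain ⟨P, hP, hPu⟩ := exists_ratFunc_place r
  have hover : ∀ Q : Place k L,
      0 < Q.ord (algebraMap (RatFunc k) L RatFunc.X - algebraMap k L r) ↔
        Q.LiesOver (IsScalarTower.toAlgHom k (RatFunc k) L) P := by
    intro Q
    rw [algebraMap_X_sub_C]
    constructor
    · intro h
      have h1 := Q.liesOver_below (IsScalarTower.toAlgHom k (RatFunc k) L) isIntegral_toAlgHom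
      have h2 := h1.ord_eq (algebraMap k[X] (RatFunc k) (X - C r))
      change Q.ord (algebraMap (RatFunc k) L _) = _ at h2
      rw [h2] at h
      rwa [hPu _ ((val_lt_one_iff_ord_pos _ hX0).2 (pos_of_mul_pos_right h (Int.natCast_nonneg _)))]
        at h1
    · intro h
      have h2 := h.ord_eq (algebraMap k[X] (RatFunc k) (X - C r))
      change Q.ord (algebraMap (RatFunc k) L _) = _ at h2
      rw [h2, hP, mul_one]
      exact_mod_cast h.ramificationIdx_pos
  refine existsUnique_of_exists_of_unique ?_ ?_
  · obtain ⟨Q, hQ⟩ := exists_liesOver (F := L) P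
    obtain ⟨σ, hσ, hσQ⟩ := H.exists_stabilizer_ne_one hr hQ hP
    obtain ⟨j, hj, rfl | rfl⟩ := H.exists_eq σ
    · exact absurd hσQ (H.comapAut_rho_pow_ne hord (fun hd => hσ (by
        rw [Nat.eq_zero_of_dvd_of_lt hd hj, pow_zero])) Q)
    · refine ⟨Q.comapAut ((ρ ^ (3 * j)).restrictScalars k), ?_, (hover _).2 (hQ.comapAut _)⟩
      rw [← comapAut_mul', H.rho_pow_mul_tau, comapAut_mul', hσQ]
  · rintro Q Q' ⟨hτ, hQ⟩ ⟨hτ', hQ'⟩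
    obtain ⟨σ, hσ⟩ := exists_comapAut_eq ((hover Q).1 hQ) ((hover Q').1 hQ')
    have key : ∃ j < 7, Q.comapAut ((ρ ^ j).restrictScalars k) = Q' := by
      obtain ⟨j, hj, rfl | rfl⟩ := H.exists_eq σ
      · exact ⟨j, hj, hσ⟩
      · exact ⟨j, hj, by rwa [comapAut_mul', hτ] at hσ⟩
    obtain ⟨j, hj, hjQ⟩ := key
    have h1 : Q.comapAut ((ρ ^ (2 * j)).restrictScalars k) = Q := by
      have h2 := congrArg (fun σ : L ≃ₐ[RatFunc k] L => Q.comapAut (σ.restrictScalars k))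
        (H.rho_pow_mul_tau_mul j)
      simp only [comapAut_mul', hjQ, hτ'] at h2
      rw [hτ] at h2
      rw [two_mul, pow_add, comapAut_mul', hjQ, h2]
    by_contra hne
    refine H.comapAut_rho_pow_ne hord (j := 2 * j) (fun hd => hne ?_) Q h1
    have : j = 0 := by omega
    subst this
    rw [← hjQ, pow_zero]
    exact (comapAut_one Q).symm

theorem ncard_fixed (H : IsDihedralData s y φ n w ζ ρ τ)
    (hord : ∀ P : Place k K, 7 ∣ P.ord φ) :
    {Q : Place k L | Q.comapAut (τ.restrictScalars k) = Q}.ncard = 6 := by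
  classical
  have h1 : ∀ r : {r : k // s.eval r = 0}, ∃ Q : Place k L,
      Q.comapAut (τ.restrictScalars k) = Q ∧
        0 < Q.ord (algebraMap (RatFunc k) L RatFunc.X - algebraMap k L r.1) :=
    fun r => (H.existsUnique_fixed hord r.2).exists
  choose g hg hg' using h1
  have h2 : {Q : Place k L | Q.comapAut (τ.restrictScalars k) = Q} = Set.range g := by
    ext Q
    constructor
    · intro hQ
      obtain ⟨r, hr, hQr⟩ := H.exists_root_of_fixed hQ
      exact ⟨⟨r, hr⟩, (H.existsUnique_fixed hord hr).unique ⟨hg _, hg' ⟨r, hr⟩⟩ ⟨hQ, hQr⟩⟩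
    · rintro ⟨r, rfl⟩
      exact hg r
  have h3 : Function.Injective g := by
    intro r r' hrr
    refine Subtype.ext ((g r).eq_of_val_sub_lt (z := algebraMap (RatFunc k) L RatFunc.X) ?_ ?_)
    · exact (val_lt_one_iff_ord_pos _ (algebraMap_X_sub_ne_zero _)).2 (hg' r)
    · rw [hrr]
      exact (val_lt_one_iff_ord_pos _ (algebraMap_X_sub_ne_zero _)).2 (hg' r')
  rw [h2, ← Set.image_univ, Set.ncard_image_of_injective _ h3, Set.ncard_univ]
  have h4 : Nat.card {r : k // s.eval r = 0} = Fintype.card (s.rootSet k) := by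
    rw [← Nat.card_eq_fintype_card]
    refine Nat.card_congr (Equiv.subtypeEquivRight fun r => ?_)
    rw [mem_rootSet_of_ne H.sextic.ne_zero, coe_aeval_eq_eval]
  rw [h4, card_rootSet_eq_natDegree H.sextic.separable (by
    simpa using IsAlgClosed.splits s), H.sextic.natDegree_eq]

end

end IsDihedralData

end

section

open IsDedekindDomain Polynomial Module Place

/-! ### The quotient curves -/

theorem mem_quotientField_iff {k F : Type*} [Field k] [Field F] [Algebra k F] (σ : F ≃ₐ[k] F)
    (z : F) : z ∈ quotientField σ ↔ σ z = z := by
  rw [IntermediateField.mem_fixedField_iff]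
  refine ⟨fun h => h σ (Subgroup.mem_zpowers σ), fun h g hg => ?_⟩
  have h1 : σ ∈ MulAction.stabilizer (F ≃ₐ[k] F) z := h
  exact Subgroup.zpowers_le.2 h1 hg

section

variable {k L : Type*} [Field k] [Field L] [Algebra k L] [Algebra (RatFunc k) L]
  [IsScalarTower k (RatFunc k) L]

/-- The quotient field by an automorphism over `k(x)` contains `k(x)`. -/
@[reducible]
def quotientFieldAlgebra (σ : L ≃ₐ[RatFunc k] L) :
    Algebra (RatFunc k) (quotientField (σ.restrictScalars k)) :=
  ((algebraMap (RatFunc k) L).codRestrict (quotientField (σ.restrictScalars k)).toSubring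
    fun f => (mem_quotientField_iff _ _).2 (σ.commutes f)).toAlgebra

theorem isScalarTower_quotientField_top (σ : L ≃ₐ[RatFunc k] L) :
    let _ := quotientFieldAlgebra σ
    IsScalarTower (RatFunc k) (quotientField (σ.restrictScalars k)) L :=
  let _ := quotientFieldAlgebra σ
  .of_algebraMap_eq fun _ => rfl

theorem isScalarTower_quotientField (σ : L ≃ₐ[RatFunc k] L) :
    let _ := quotientFieldAlgebra σ
    IsScalarTower k (RatFunc k) (quotientField (σ.restrictScalars k)) :=
  let _ := quotientFieldAlgebra σ
  .of_algebraMap_eq fun c => Subtype.ext (IsScalarTower.algebraMap_apply k (RatFunc k) L c)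

end

namespace IsDihedralData

section

variable {k K L : Type*} [Field k] [Field K] [Field L] [Algebra k K] [Algebra (RatFunc k) K]
  [IsScalarTower k (RatFunc k) K] [Algebra k L] [Algebra (RatFunc k) L] [Algebra K L]
  [IsScalarTower k (RatFunc k) L] [IsScalarTower k K L] [IsScalarTower (RatFunc k) K L]
  {s : k[X]} {y : K} {φ : K} {n : RatFunc k} {w : L} {ζ : k}
  {ρ τ : L ≃ₐ[RatFunc k] L}

/-- Any element of order `7` and any involution of the Galois group can play the roles of `ρ`
and `τ`. -/
theorem of_orderOf {h : IsSextic s y} (hφ : φ * h.conj φ = algebraMap (RatFunc k) K n ^ 7)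
    (hw : IsHeptic φ w) (hζ7 : IsPrimitiveRoot ζ 7) (hρ : orderOf ρ = 7) (hτ : orderOf τ = 2) :
    ∃ n' ζ', IsDihedralData s y φ n' w ζ' ρ τ := by
  obtain ⟨ζ', h1, h2, h3⟩ := hw.rho_of_orderOf hφ hζ7 hρ
  obtain ⟨n', h4, h5, h6⟩ := hw.tau_of_orderOf hφ hζ7 hτ
  exact ⟨n', ζ', h, h4, hw, h1, h2, h3, h5, h6⟩

/-- The quotient by `ρ` is the curve `C`. -/
theorem mem_quotientField_rho_iff (H : IsDihedralData s y φ n w ζ ρ τ) (z : L) :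
    z ∈ quotientField (ρ.restrictScalars k) ↔ ∃ f : K, algebraMap K L f = z := by
  rw [mem_quotientField_iff]
  constructor
  · exact fun h => H.heptic.mem_range_of_eq H.zeta (ρ := (ρ : L →+* L)) H.rho_algebraMap H.rho_w h
  · rintro ⟨f, rfl⟩
    exact H.rho_algebraMap f

theorem curveGenus_quotientField_tau (H : IsDihedralData s y φ n w ζ ρ τ)
    (hord : ∀ P : Place k K, 7 ∣ P.ord φ) :
    curveGenus k (quotientField (τ.restrictScalars k)) = 3 := by
  let _ := quotientFieldAlgebra τ
  have := isScalarTower_quotientField τ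
  have := isScalarTower_quotientField_top τ
  refine IsHeptic.curveGenus_fixed_eq (τ := τ) ⟨H.heptic.ne_zero, H.norm_eq, hord⟩ H.heptic H.zeta
    H.tau_y H.tau_w H.tau_tau fun z => ?_
  have h1 := mem_quotientField_iff (τ.restrictScalars k) z
  exact ⟨fun h => ⟨⟨z, h1.2 h⟩, rfl⟩, fun ⟨f, hf⟩ => hf ▸ (mem_quotientField_iff (τ.restrictScalars k) _).1 f.2⟩

/-- The quotient by `ρ` is isomorphic to `C`, so it is defined by the same equation. -/
theorem curveGenus_quotientField_rho (H : IsDihedralData s y φ n w ζ ρ τ)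
    (hord : ∀ P : Place k K, 7 ∣ P.ord φ) :
    curveGenus k (quotientField (ρ.restrictScalars k)) = 2 ∧
      IsUnramifiedExt (quotientField (ρ.restrictScalars k)).val := by
  let _ := quotientFieldAlgebra ρ
  have := isScalarTower_quotientField ρ
  have := isScalarTower_quotientField_top ρ
  let j : K →ₐ[k] quotientField (ρ.restrictScalars k) :=
    { toFun := fun f => ⟨algebraMap K L f, (H.mem_quotientField_rho_iff _).2 ⟨f, rfl⟩⟩
      map_one' := Subtype.ext (map_one _)
      map_mul' := fun f g => Subtype.ext (map_mul _ f g)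
      map_zero' := Subtype.ext (map_zero _)
      map_add' := fun f g => Subtype.ext (map_add _ f g)
      commutes' := fun c => Subtype.ext (IsScalarTower.algebraMap_apply k K L c).symm }
  have hj : Function.Surjective j := by
    rintro ⟨z, hz⟩
    obtain ⟨f, hf⟩ := (H.mem_quotientField_rho_iff z).1 hz
    exact ⟨f, Subtype.ext hf⟩
  have hjE : ∀ e : RatFunc k, j (algebraMap (RatFunc k) K e) =
      algebraMap (RatFunc k) (quotientField (ρ.restrictScalars k)) e := fun e =>
    Subtype.ext (IsScalarTower.algebraMap_apply (RatFunc k) K L e).symm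
  have hS : IsSextic s (j y) := by
    refine ⟨H.sextic.two_ne, H.sextic.natDegree_eq, H.sextic.separable, ?_, ?_⟩
    · rw [← map_pow, H.sextic.sq_eq, hjE]
    · refine eq_top_iff.2 fun z _ => ?_
      obtain ⟨f, rfl⟩ := hj z
      obtain ⟨u, v, rfl⟩ := H.sextic.exists_eq f
      rw [map_add, map_mul, hjE, hjE]
      exact add_mem (IntermediateField.algebraMap_mem _ u)
        (mul_mem (IntermediateField.algebraMap_mem _ v)
          (IntermediateField.mem_adjoin_simple_self _ _))
  refine ⟨hS.curveGenus_eq, ?_⟩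
  have hW : IsHeptic (j φ) w := by
    refine ⟨H.heptic.pow_eq, eq_top_iff.2 fun z _ => ?_, ?_⟩
    · obtain ⟨c, rfl⟩ := H.heptic.exists_sum z
      refine sum_mem fun i _ => mul_mem ?_
        (pow_mem (IntermediateField.mem_adjoin_simple_self _ _) _)
      exact IntermediateField.algebraMap_mem
        (IntermediateField.adjoin (quotientField (ρ.restrictScalars k)) {w}) (j (c i))
    · rintro ⟨g, hg⟩
      obtain ⟨g, rfl⟩ := hj g
      rw [← map_pow] at hg
      exact H.heptic.not_pow ⟨g, j.toRingHom.injective hg⟩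
  refine hW.isUnramifiedExt H.zeta fun P => ?_
  have hint : (j : K →+* quotientField (ρ.restrictScalars k)).IsIntegral :=
    RingHom.isIntegral_of_surjective _ hj
  rw [(P.liesOver_below j hint).ord_eq]
  exact Dvd.dvd.mul_left (hord _) _

/-- The equation of the correspondence on `Y = X / ⟨τ⟩`, as `X / D₇` is the projective line. -/
theorem exists_endomorphism (H : IsDihedralData s y φ n w ζ ρ τ) :
    ∃ T : AddMonoid.End (CurvePicZero k (quotientField (τ.restrictScalars k))),
      IsInducedByCorrespondence (quotientField (τ.restrictScalars k)).val
        ((ρ.restrictScalars k).toAlgHom.comp (quotientField (τ.restrictScalars k)).val) T ∧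
      T ^ 3 + T ^ 2 - 2 * T - 1 = 0 := by
  classical
  set F := quotientField (τ.restrictScalars k) with hFdef
  let _ : Algebra (RatFunc k) F := quotientFieldAlgebra τ
  have : IsScalarTower k (RatFunc k) F := isScalarTower_quotientField τ
  have : IsScalarTower (RatFunc k) F L := isScalarTower_quotientField_top τ
  have := IsHeptic.finiteDimensional_ratFunc (L := L) H.sextic H.heptic
  have hGal := H.isGalois
  have : FiniteDimensional F L := FiniteDimensional.right (RatFunc k) F L
  have hτF : ∀ f : F, τ (algebraMap F L f) = algebraMap F L f := fun f =>
    (mem_quotientField_iff (τ.restrictScalars k) _).1 f.2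
  let τ' : L ≃ₐ[F] L := AlgEquiv.ofRingEquiv (f := (τ : L ≃+* L)) hτF
  have hτ' : ∀ z, τ' z = τ z := fun _ => rfl
  have hFL : IsGalois F L := by
    refine IsGalois.of_fixedField_eq_bot F L (eq_bot_iff.2 fun z hz => ?_)
    have h1 : τ z = z := hz ⟨τ', trivial⟩
    exact ⟨⟨z, (mem_quotientField_iff _ _).2 h1⟩, rfl⟩
  have h2L : (2 : L) ≠ 0 := H.sextic.two_ne_zero'
  have hyL : algebraMap K L y ≠ 0 := by simpa using H.sextic.y_ne_zero
  -- `L = F(y)`: an element is the sum of an even part, and an odd part that is `y` times an even one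
  have hext : ∀ σ : L ≃ₐ[F] L, ∀ σ' : L ≃ₐ[F] L,
      σ (algebraMap K L y) = σ' (algebraMap K L y) → σ = σ' := by
    intro σ σ' hσ
    ext z
    have h1 : ∃ f : F, algebraMap F L f = (z + τ z) / 2 :=
      ⟨⟨_, (mem_quotientField_iff _ _).2 (show τ ((z + τ z) / 2) = _ by
        rw [map_div₀, map_add, H.tau_tau, map_ofNat, add_comm])⟩, rfl⟩
    have h2 : ∃ f : F, algebraMap F L f = (z - τ z) / (2 * algebraMap K L y) :=
      ⟨⟨_, (mem_quotientField_iff _ _).2 (show τ ((z - τ z) / (2 * algebraMap K L y)) = _ by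
        rw [map_div₀, map_sub, H.tau_tau, map_mul, map_ofNat, H.tau_y]
        field_simp
        ring)⟩, rfl⟩
    obtain ⟨f, hf⟩ := h1
    obtain ⟨g, hg⟩ := h2
    have h3 : z = algebraMap F L f + algebraMap F L g * algebraMap K L y := by
      rw [hf, hg]
      field_simp
      ring
    rw [h3]
    simp only [map_add, map_mul, AlgEquiv.commutes, hσ]
  have hex : ∀ σ : L ≃ₐ[F] L, σ = 1 ∨ σ = τ' := by
    intro σ
    have h1 : σ (algebraMap K L y) ^ 2 = algebraMap K L y ^ 2 := by
      rw [← map_pow, H.sq_y, IsScalarTower.algebraMap_apply (RatFunc k) F L, AlgEquiv.commutes]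
    rcases sq_eq_sq_iff_eq_or_eq_neg.1 h1 with h2 | h2
    · exact Or.inl (hext _ _ h2)
    · exact Or.inr (hext _ _ (by rw [h2, hτ', H.tau_y]))
  have hne : (1 : L ≃ₐ[F] L) ≠ τ' := by
    intro h
    have h1 := AlgEquiv.congr_fun h (algebraMap K L y)
    rw [hτ', H.tau_y] at h1
    exact H.y_ne_neg h1
  have huniv : (Finset.univ : Finset (L ≃ₐ[F] L)) = {1, τ'} := by
    ext σ
    simpa using hex σ
  refine exists_endomorphism_of_dihedral (E := RatFunc k) (F := F) ρ τ ?_ hτF H.rho_pow_seven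
    H.rho_mul_tau_mul_rho (fun g => H.sum_eq g) (fun g => ⟨τ', hτ', ?_⟩)
    RatFunc.mem_principalDivisors
  · rw [← IsGalois.card_aut_eq_finrank, Nat.card_eq_fintype_card, ← Finset.card_univ, huniv,
      Finset.card_pair hne]
  · convert Finset.sum_pair hne using 2

end

end IsDihedralData

end

section

open IsDedekindDomain Polynomial Module Place

/-! ### Extension of the field of constants -/

/-- `j` embeds the function field `K = k(x, y)` into the function field `K₁ = k₁(x, y)` of the same
curve over the larger field of constants `k₁`, and `m` is the embedding of `k(x)` into `k₁(x)`. -/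
structure IsConstantExtension {k k₁ K K₁ : Type*} [Field k] [Field k₁] [Algebra k k₁] [Field K]
    [Field K₁] [Algebra k K] [Algebra k₁ K₁] [Algebra (RatFunc k) K] [Algebra (RatFunc k₁) K₁]
    (y : K) (y₁ : K₁) (m : RatFunc k →+* RatFunc k₁) (j : K →+* K₁) : Prop where
  m_algebraMap : ∀ c : k, m (algebraMap k (RatFunc k) c) =
    algebraMap k₁ (RatFunc k₁) (algebraMap k k₁ c)
  m_X : m RatFunc.X = RatFunc.X
  j_algebraMap : ∀ f, j (algebraMap (RatFunc k) K f) = algebraMap (RatFunc k₁) K₁ (m f)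
  j_y : j y = y₁

namespace IsConstantExtension

variable {k k₁ K K₁ : Type*} [Field k] [Field k₁] [Algebra k k₁] [Field K]
  [Field K₁] [Algebra k K] [Algebra k₁ K₁] [Algebra (RatFunc k) K] [Algebra (RatFunc k₁) K₁]
  [IsScalarTower k (RatFunc k) K] [IsScalarTower k₁ (RatFunc k₁) K₁]
  {y : K} {y₁ : K₁} {m : RatFunc k →+* RatFunc k₁} {j : K →+* K₁}
  {s : k[X]} {s₁ : k₁[X]} {h : IsSextic s y} {h₁ : IsSextic s₁ y₁} {φ : K} {n : RatFunc k}

theorem j_constant (hj : IsConstantExtension y y₁ m j) (c : k) :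
    j (algebraMap k K c) = algebraMap k₁ K₁ (algebraMap k k₁ c) := by
  rw [IsScalarTower.algebraMap_apply k (RatFunc k) K, hj.j_algebraMap, hj.m_algebraMap,
    ← IsScalarTower.algebraMap_apply]

/-- A place of `K₁` is trivial on `K` or restricts to a place of `K`. -/
theorem comap_cases (hj : IsConstantExtension y y₁ m j) (P₁ : Place k₁ K₁) :
    (∀ f, j f ∈ P₁.ring) ∨ ∃ P : Place k K, (∀ f, j f ∈ P₁.ring ↔ f ∈ P.ring) ∧
      ∃ e : ℤ, ∀ f, P₁.ord (j f) = e * P.ord f := by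
  by_cases htop : P₁.ring.comap j = ⊤
  · left
    intro f
    have : f ∈ P₁.ring.comap j := by rw [htop]; trivial
    exact this
  · right
    let P : Place k K :=
      { ring := P₁.ring.comap j
        algebraMap_mem := fun c => by
          change j _ ∈ P₁.ring
          rw [hj.j_constant]
          exact P₁.algebraMap_mem _
        isDVR := ValuationSubring.isDiscreteValuationRing_comap P₁ j htop }
    let _ : Algebra k K₁ := ((algebraMap k₁ K₁).comp (algebraMap k k₁)).toAlgebra
    let i : K →ₐ[k] K₁ := { j with commutes' := hj.j_constant }
    let P₁' : Place k K₁ :=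
      { ring := P₁.ring
        algebraMap_mem := fun c => P₁.algebraMap_mem _
        isDVR := P₁.isDVR }
    have hl : P₁'.LiesOver i P := rfl
    exact ⟨P, fun _ => Iff.rfl, P₁'.ramificationIdx i P, fun f => hl.ord_eq f⟩

theorem conj_apply (hj : IsConstantExtension y y₁ m j) (f : K) :
    h₁.conj (j f) = j (h.conj f) := by
  obtain ⟨u, v, rfl⟩ := h.exists_eq f
  rw [map_add, map_mul, map_add, map_mul, hj.j_algebraMap, hj.j_algebraMap, hj.j_y, map_add,
    map_mul, map_add, map_mul, AlgEquiv.commutes, AlgEquiv.commutes, AlgEquiv.commutes,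
    AlgEquiv.commutes, h.conj_y, h₁.conj_y, map_neg, hj.j_algebraMap, hj.j_algebraMap, hj.j_y]

theorem dvd_ord (hj : IsConstantExtension y y₁ m j) (hφ0 : φ ≠ 0)
    (hord : ∀ P : Place k K, 7 ∣ P.ord φ) (P₁ : Place k₁ K₁) : 7 ∣ P₁.ord (j φ) := by
  rcases hj.comap_cases P₁ with h1 | ⟨P, -, e, he⟩
  · have h0 : j φ ≠ 0 := by simpa using hφ0
    have h2 := (P₁.mem_ring_iff h0).1 (h1 φ)
    have h3 := (P₁.mem_ring_iff (inv_ne_zero h0)).1 (by rw [← map_inv₀]; exact h1 _)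
    rw [ord_inv] at h3
    rw [show P₁.ord (j φ) = 0 by omega]
    exact dvd_zero 7
  · rw [he]
    exact Dvd.dvd.mul_left (hord P) e

theorem isRadicand (hj : IsConstantExtension y y₁ m j) (hφ : IsRadicand h φ n) :
    IsRadicand h₁ (j φ) (m n) := by
  refine ⟨by simpa using hφ.ne_zero, ?_, hj.dvd_ord hφ.ne_zero hφ.dvd_ord⟩
  rw [hj.conj_apply (h := h), ← map_mul, hφ.norm_eq, map_pow, hj.j_algebraMap]

theorem mem_finitePlaces_iff (hj : IsConstantExtension y y₁ m j) {P₁ : Place k₁ K₁} {P : Place k K}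
    (hP : ∀ f, j f ∈ P₁.ring ↔ f ∈ P.ring) : P₁ ∈ finitePlaces k₁ K₁ ↔ P ∈ finitePlaces k K := by
  change algebraMap (RatFunc k₁) K₁ RatFunc.X ∈ P₁.ring ↔ _
  rw [← hj.m_X, ← hj.j_algebraMap, hP]
  rfl

/-- Sections remain sections after extension of constants. -/
theorem mem_sectionsOn (hj : IsConstantExtension y y₁ m j) (hφ : IsRadicand h φ n)
    {S : Set (Place k K)} {S₁ : Set (Place k₁ K₁)}
    (hS : ∀ P₁ ∈ S₁, ∀ P : Place k K, (∀ f, j f ∈ P₁.ring ↔ f ∈ P.ring) → P ∈ S) {i : ℕ} {f : K}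
    (hf : f ∈ sectionsOn S ⇑(i • hφ.divisor)) :
    j f ∈ sectionsOn S₁ ⇑(i • (hj.isRadicand (h₁ := h₁) hφ).divisor) := by
  rw [IsRadicand.mem_sectionsOn_iff] at hf ⊢
  intro P₁ hP₁
  rw [← map_pow, ← map_pow, ← map_mul]
  rcases hj.comap_cases P₁ with h1 | ⟨P, hP, -⟩
  · exact h1 _
  · exact (hP _).2 (hf P (hS P₁ hP₁ P hP))

/-- Multiplication by a negative power of `x` makes a function vanish at infinity. -/
theorem exists_X_pow_inv_mul_mem (hφ : IsRadicand h φ n) (g : K) : ∃ N : ℕ,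
    (algebraMap (RatFunc k) K RatFunc.X ^ N)⁻¹ * g ∈
      sectionsOn (finitePlaces k K)ᶜ ⇑(1 • hφ.divisor) := by
  have := h.finiteDimensional
  have := h.isSeparable
  by_cases hg : g = 0
  · exact ⟨0, by rw [hg, mul_zero]; exact zero_mem _⟩
  have hx0 : algebraMap (RatFunc k) K RatFunc.X ≠ 0 := by simpa using RatFunc.X_ne_zero
  have h0 : g ^ 7 * φ ≠ 0 := mul_ne_zero (pow_ne_zero 7 hg) hφ.ne_zero
  obtain ⟨D, hD⟩ := exists_divisor (k := k) h0
  obtain ⟨N, hN⟩ := exists_finsupp_bound D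
  refine ⟨N, hφ.mem_sectionsOn_iff.2 fun P hP => ?_⟩
  have hx : P.ord (algebraMap (RatFunc k) K RatFunc.X) < 0 :=
    not_le.1 fun hle => hP ((P.mem_ring_iff hx0).2 hle)
  have h1 := hN P
  rw [hD] at h1
  rw [pow_one, mul_pow, mul_assoc, ← inv_pow, ← pow_mul, P.mem_ring_iff
    (mul_ne_zero (pow_ne_zero _ (inv_ne_zero hx0)) h0), ord_mul _ (pow_ne_zero _ (inv_ne_zero hx0))
    h0, ord_pow, ord_inv]
  push_cast
  nlinarith

/-- A function that is not a seventh power remains so after an extension of the field of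
constants, because the dimension of `H¹` of the associated divisor class of degree zero does not
grow. -/
theorem not_pow (hj : IsConstantExtension y y₁ m j) (h₁ : IsSextic s₁ y₁)
    (hφ : IsRadicand h φ n) (hne : ¬ ∃ g : K, g ^ 7 = φ) : ¬ ∃ g : K₁, g ^ 7 = j φ := by
  rintro ⟨g₁, hg₁⟩
  have hφ₁ := hj.isRadicand (h₁ := h₁) hφ
  have h2 := hφ₁.two_le_finrank_quotient hg₁
  set I₁ := sectionsOn (finitePlaces k₁ K₁) ⇑(1 • hφ₁.divisor) with hI₁
  set J₁ := sectionsOn (finitePlaces k₁ K₁)ᶜ ⇑(1 • hφ₁.divisor) with hJ₁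
  have hI : ∀ f ∈ sectionsOn (finitePlaces k K) ⇑(1 • hφ.divisor), j f ∈ I₁ := fun f hf =>
    hj.mem_sectionsOn hφ (fun P₁ hP₁ P hP => (hj.mem_finitePlaces_iff hP).1 hP₁) hf
  have hJ : ∀ f ∈ sectionsOn (finitePlaces k K)ᶜ ⇑(1 • hφ.divisor), j f ∈ J₁ := fun f hf =>
    hj.mem_sectionsOn hφ (S := (finitePlaces k K)ᶜ)
      (S₁ := (finitePlaces k₁ K₁)ᶜ) (fun P₁ hP₁ P hP => fun h' => hP₁ ((hj.mem_finitePlaces_iff hP).2 h')) hf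
  obtain ⟨e, -, he⟩ := finrank_eq_one_iff'.1 (hφ.finrank_quotient hne (i := 1) (by norm_num))
  obtain ⟨e, rfl⟩ := Submodule.mkQ_surjective _ e
  have hsmul : ∀ (c : k₁) (z : K₁), c • z = algebraMap (RatFunc k₁) K₁ (algebraMap k₁ _ c) * z :=
    fun c z => by rw [Algebra.smul_def, ← IsScalarTower.algebraMap_apply]
  -- `K₁` is spanned over `k₁` by one element `j e` modulo `I₁ + J₁`, so `h¹ ≤ 1`
  let V : Submodule k₁ K₁ := Submodule.span k₁ {j e} ⊔ (I₁ ⊔ J₁)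
  have hK : ∀ f : K, j f ∈ V := by
    intro f
    obtain ⟨c, hc⟩ := he (Submodule.mkQ _ f)
    rw [← map_smul, ← sub_eq_zero, ← map_sub, Submodule.mkQ_apply,
      Submodule.Quotient.mk_eq_zero, Submodule.mem_sup] at hc
    obtain ⟨a, ha, b, hb, hab⟩ := hc
    have h3 : j f = algebraMap k k₁ c • j e - (j a + j b) := by
      rw [← map_add, hab, map_sub, Algebra.smul_def c e, map_mul, hj.j_constant, Algebra.smul_def]
      ring
    rw [h3]
    exact sub_mem (Submodule.mem_sup_left (Submodule.smul_mem _ _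
      (Submodule.mem_span_singleton_self _)))
      (Submodule.mem_sup_right (add_mem (Submodule.mem_sup_left (hI a ha))
        (Submodule.mem_sup_right (hJ b hb))))
  have hpoly : ∀ (p : k₁[X]) (f : K),
      algebraMap (RatFunc k₁) K₁ (algebraMap k₁[X] (RatFunc k₁) p) * j f ∈ V := by
    intro p f
    induction p using Polynomial.induction_on' with
    | add p q hp hq => rw [map_add, map_add, add_mul]; exact add_mem hp hq
    | monomial i c =>
      have h3 : algebraMap (RatFunc k₁) K₁ (algebraMap k₁[X] (RatFunc k₁) (monomial i c)) * j f =
          c • j (algebraMap (RatFunc k) K RatFunc.X ^ i * f) := by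
        rw [hsmul, map_mul j, map_pow, hj.j_algebraMap, hj.m_X, ← C_mul_X_pow_eq_monomial, map_mul,
          map_pow, RatFunc.algebraMap_X, RatFunc.algebraMap_C, map_mul, map_pow,
          RatFunc.algebraMap_eq_C, mul_assoc]
      rw [h3]
      exact V.smul_mem c (hK _)
  -- write `u xᴺ` as a polynomial plus a function regular at infinity, where `g / xᴺ` is a section at
  -- infinity
  have hmul : ∀ (u : RatFunc k₁) (g : K), algebraMap (RatFunc k₁) K₁ u * j g ∈ V := by
    intro u g
    obtain ⟨N, hN⟩ := exists_X_pow_inv_mul_mem hφ g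
    have h3 : u * RatFunc.X ^ N ∈ (⊤ : Submodule k₁ (RatFunc k₁)) := trivial
    rw [← isFredholmPair_ratFunc.2, Submodule.mem_sup] at h3
    obtain ⟨p, hp, q, hq, hpq⟩ := h3
    obtain ⟨p, rfl⟩ := mem_sectionsOn_finitePlaces_iff.1 hp
    have hx0 : algebraMap (RatFunc k) K RatFunc.X ≠ 0 := by simpa using RatFunc.X_ne_zero
    have h4 : algebraMap (RatFunc k₁) K₁ u * j g =
        algebraMap (RatFunc k₁) K₁ (u * RatFunc.X ^ N) *
          j ((algebraMap (RatFunc k) K RatFunc.X ^ N)⁻¹ * g) := by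
      have h5 : j g = j (algebraMap (RatFunc k) K RatFunc.X ^ N) *
          j ((algebraMap (RatFunc k) K RatFunc.X ^ N)⁻¹ * g) := by
        rw [← map_mul, mul_inv_cancel_left₀ (pow_ne_zero N hx0)]
      rw [h5, map_pow j, hj.j_algebraMap, hj.m_X, map_mul (algebraMap (RatFunc k₁) K₁), map_pow]
      ring
    rw [h4, ← hpq, map_add, add_mul]
    refine add_mem (hpoly _ _) (Submodule.mem_sup_right (Submodule.mem_sup_right ?_))
    have h6 := hJ _ hN
    rw [hJ₁, hφ₁.mem_sectionsOn_iff] at h6 ⊢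
    intro P₁ hP₁
    rw [mul_pow, mul_assoc]
    refine P₁.ring.mul_mem _ _ (pow_mem ?_ 7) (h6 P₁ hP₁)
    have := h₁.finiteDimensional
    have h7 := notMem_finitePlaces_iff.1 hP₁
    exact (h7.mem_iff q).2 (mem_sectionsOn_zero.1 hq _ (notMem_finitePlaces_ratFunc.2 rfl))
  have htop : ∀ f : K₁, f ∈ V := by
    intro f
    obtain ⟨u, v, rfl⟩ := h₁.exists_eq f
    have h3 := add_mem (hmul u 1) (hmul v y)
    rwa [map_one, mul_one, hj.j_y] at h3
  have h3 : finrank k₁ (K₁ ⧸ (I₁ ⊔ J₁)) ≤ 1 := by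
    refine finrank_le_one ((I₁ ⊔ J₁).mkQ (j e)) fun z => ?_
    obtain ⟨z, rfl⟩ := Submodule.mkQ_surjective _ z
    obtain ⟨a, ha, b, hb, hab⟩ := Submodule.mem_sup.1 (htop z)
    obtain ⟨c, rfl⟩ := Submodule.mem_span_singleton.1 ha
    refine ⟨c, ?_⟩
    have h4 : (I₁ ⊔ J₁).mkQ b = 0 := (Submodule.Quotient.mk_eq_zero _).2 hb
    rw [← hab, map_add, map_smul, h4, add_zero]
  omega

end IsConstantExtension

end

section

open IsDedekindDomain Polynomial Module Place

/-! ### The same equations over a larger field of constants -/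

section

variable (k k₁ : Type*) [Field k] [Field k₁] [Algebra k k₁]

/-- The embedding of `k(x)` into `k₁(x)`. -/
def RatFunc.mapConstants : RatFunc k →+* RatFunc k₁ :=
  RatFunc.mapRingHom (Polynomial.mapRingHom (algebraMap k k₁))
    (nonZeroDivisors_le_comap_nonZeroDivisors_of_injective _
      (Polynomial.map_injective _ (algebraMap k k₁).injective))

variable {k k₁}

theorem RatFunc.mapConstants_algebraMap (p : k[X]) :
    RatFunc.mapConstants k k₁ (algebraMap k[X] (RatFunc k) p) =
      algebraMap k₁[X] (RatFunc k₁) (p.map (algebraMap k k₁)) := by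
  have h1 := RatFunc.map_apply_div (φ := Polynomial.mapRingHom (algebraMap k k₁))
    (nonZeroDivisors_le_comap_nonZeroDivisors_of_injective _
      (Polynomial.map_injective _ (algebraMap k k₁).injective)) p 1
  rwa [map_one, map_one, div_one, map_one, div_one] at h1

theorem RatFunc.mapConstants_X : RatFunc.mapConstants k k₁ RatFunc.X = RatFunc.X := by
  rw [← RatFunc.algebraMap_X, RatFunc.mapConstants_algebraMap, map_X, RatFunc.algebraMap_X]

theorem RatFunc.mapConstants_constant (c : k) :
    RatFunc.mapConstants k k₁ (algebraMap k (RatFunc k) c) =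
      algebraMap k₁ (RatFunc k₁) (algebraMap k k₁ c) := by
  rw [RatFunc.algebraMap_eq_C, ← RatFunc.algebraMap_C, RatFunc.mapConstants_algebraMap, map_C,
    RatFunc.algebraMap_C, RatFunc.algebraMap_eq_C]

/-- `k₁` and `k(x)` are linearly disjoint over `k` in `k₁(x)`. -/
theorem RatFunc.eq_zero_of_linearIndependent {ι : Type*} {c : ι → k₁} (hc : LinearIndependent k c)
    (S : Finset ι) (e : ι → RatFunc k)
    (h : ∑ i ∈ S, algebraMap k₁ (RatFunc k₁) (c i) * RatFunc.mapConstants k k₁ (e i) = 0) :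
    ∀ i ∈ S, e i = 0 := by
  obtain ⟨b, hb⟩ := IsLocalization.exist_integer_multiples (nonZeroDivisors k[X]) S e
  have hp : ∀ i : ι, ∃ p : k[X], i ∈ S →
      algebraMap k[X] (RatFunc k) p = algebraMap k[X] (RatFunc k) b * e i := by
    intro i
    by_cases hi : i ∈ S
    · obtain ⟨p, hp⟩ := hb i hi
      exact ⟨p, fun _ => by rw [hp, Algebra.smul_def]⟩
    · exact ⟨0, fun h => absurd h hi⟩
  choose p hp using hp
  have h1 : ∑ i ∈ S, Polynomial.C (c i) * (p i).map (algebraMap k k₁) = 0 := by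
    apply IsFractionRing.injective k₁[X] (RatFunc k₁)
    rw [map_sum, map_zero, ← mul_zero (RatFunc.mapConstants k k₁ (algebraMap k[X] (RatFunc k) b)),
      ← h, Finset.mul_sum]
    refine Finset.sum_congr rfl fun i hi => ?_
    rw [map_mul, ← RatFunc.mapConstants_algebraMap, hp i hi, RatFunc.algebraMap_C, map_mul,
      RatFunc.algebraMap_eq_C]
    ring
  intro i hi
  have h2 : p i = 0 := by
    ext n
    have h3 := congrArg (fun q => coeff q n) h1
    simp only [finsetSum_coeff, coeff_C_mul, coeff_map, coeff_zero] at h3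
    refine linearIndependent_iff'.1 hc S (fun i => (p i).coeff n) ?_ i hi
    rw [← h3]
    exact Finset.sum_congr rfl fun i _ => by rw [Algebra.smul_def, mul_comm]
  have h4 := hp i hi
  rw [h2, map_zero, eq_comm, mul_eq_zero] at h4
  exact h4.resolve_left (by simp)

end

section

universe u v

variable {k K : Type*} {k₁ : Type u} [Field k] [Field k₁] [Algebra k k₁] [Field K] [Algebra k K]
  [Algebra (RatFunc k) K] [IsScalarTower k (RatFunc k) K] {s : k[X]} {y : K} {φ : K}

theorem adjoinRoot_intermediateField_eq_top {E : Type*} [Field E] (f : E[X])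
    [Fact (Irreducible f)] : IntermediateField.adjoin E {AdjoinRoot.root f} = ⊤ := by
  refine eq_top_iff.2 fun z _ => IntermediateField.algebra_adjoin_le_adjoin E _ ?_
  rw [AdjoinRoot.adjoinRoot_eq_top]
  trivial

/-- The curve `y ^ 2 = s(x)` over `k₁`. -/
theorem IsSextic.exists_constantExtension (h : IsSextic s y) :
    ∃ (K₁ : Type u) (_ : Field K₁) (_ : Algebra k₁ K₁) (_ : Algebra (RatFunc k₁) K₁)
      (_ : IsScalarTower k₁ (RatFunc k₁) K₁) (y₁ : K₁) (j : K →+* K₁),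
      IsSextic (s.map (algebraMap k k₁)) y₁ ∧
        IsConstantExtension y y₁ (RatFunc.mapConstants k k₁) j := by
  set f : (RatFunc k₁)[X] :=
    X ^ 2 - C (algebraMap k₁[X] (RatFunc k₁) (s.map (algebraMap k k₁))) with hf
  have hsep : (s.map (algebraMap k k₁)).Separable := h.separable.map
  have hdeg : (s.map (algebraMap k k₁)).natDegree = 6 := by rw [natDegree_map, h.natDegree_eq]
  have hirr : Fact (Irreducible f) := ⟨X_pow_sub_C_irreducible_of_prime Nat.prime_two
    (RatFunc.sq_ne_of_separable hsep (by omega))⟩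
  have hroot : AdjoinRoot.root f ^ 2 = algebraMap (RatFunc k₁) (AdjoinRoot f)
      (algebraMap k₁[X] (RatFunc k₁) (s.map (algebraMap k k₁))) := by
    have h1 := AdjoinRoot.eval₂_root f
    rwa [hf, eval₂_sub, eval₂_X_pow, eval₂_C, sub_eq_zero] at h1
  obtain ⟨j, hj, hjy⟩ := exists_ringHom_of_pow_eq (n := 2) (by omega) h.sq_eq h.adjoin_eq_top
    h.irreducible ((algebraMap (RatFunc k₁) (AdjoinRoot f)).comp (RatFunc.mapConstants k k₁))
    (z' := AdjoinRoot.root f) (by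
      rw [hroot, RingHom.comp_apply, RatFunc.mapConstants_algebraMap])
  refine ⟨AdjoinRoot f, inferInstance, inferInstance, inferInstance, inferInstance,
    AdjoinRoot.root f, j, ⟨?_, hdeg, hsep, hroot, ?_⟩,
    ⟨RatFunc.mapConstants_constant, RatFunc.mapConstants_X, hj, hjy⟩⟩
  · rw [← map_ofNat (algebraMap k k₁) 2]
    simpa using h.two_ne
  · exact adjoinRoot_intermediateField_eq_top f

/-- The covering `w ^ 7 = φ` over `k₁`. -/
theorem IsHeptic.exists_constantExtension {L : Type*} {K₁ : Type v} [Field L] [Algebra K L] {w : L}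
    (hw : IsHeptic φ w) [Field K₁] [Algebra k₁ K₁] [Algebra (RatFunc k₁) K₁]
    [IsScalarTower k₁ (RatFunc k₁) K₁] (j : K →+* K₁) (hne : ¬ ∃ g : K₁, g ^ 7 = j φ) :
    ∃ (L₁ : Type v) (_ : Field L₁) (_ : Algebra K₁ L₁) (_ : Algebra k₁ L₁)
      (_ : Algebra (RatFunc k₁) L₁) (_ : IsScalarTower k₁ K₁ L₁)
      (_ : IsScalarTower (RatFunc k₁) K₁ L₁) (w₁ : L₁) (J : L →+* L₁),
      IsHeptic (j φ) w₁ ∧ (∀ f, J (algebraMap K L f) = algebraMap K₁ L₁ (j f)) ∧ J w = w₁ := by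
  set f : K₁[X] := X ^ 7 - C (j φ) with hf
  have hirr : Fact (Irreducible f) := ⟨X_pow_sub_C_irreducible_of_prime (by norm_num)
    fun b hb => hne ⟨b, hb⟩⟩
  have hroot : AdjoinRoot.root f ^ 7 = algebraMap K₁ (AdjoinRoot f) (j φ) := by
    have h1 := AdjoinRoot.eval₂_root f
    rwa [hf, eval₂_sub, eval₂_X_pow, eval₂_C, sub_eq_zero] at h1
  obtain ⟨J, hJ, hJw⟩ := exists_ringHom_of_pow_eq (n := 7) (by omega) hw.pow_eq hw.adjoin_eq_top
    hw.irreducible ((algebraMap K₁ (AdjoinRoot f)).comp j) (z' := AdjoinRoot.root f) hroot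
  refine ⟨AdjoinRoot f, inferInstance, inferInstance, inferInstance, inferInstance, inferInstance,
    inferInstance, AdjoinRoot.root f, J, ⟨hroot, ?_, hne⟩, hJ, hJw⟩
  exact adjoinRoot_intermediateField_eq_top f

end

end

section

open IsDedekindDomain Polynomial Module Place

/-! ### Geometric integrality and the extended function field -/

section

universe u

variable {k K L : Type*} {k₁ : Type u} [Field k] [Field K] [Field L] [Field k₁] [Algebra k k₁]
  [Algebra k K] [Algebra (RatFunc k) K] [IsScalarTower k (RatFunc k) K] [Algebra k L]
  [Algebra K L] [IsScalarTower k K L] {s : k[X]} {y : K} {φ : K} {n : RatFunc k} {w : L}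

/-- `k₁` and `K` are linearly disjoint over `k` in `K₁`. -/
theorem IsConstantExtension.eq_zero_of_linearIndependent {K₁ : Type*} [Field K₁] [Algebra k₁ K₁]
    [Algebra (RatFunc k₁) K₁] [IsScalarTower k₁ (RatFunc k₁) K₁] {s₁ : k₁[X]} {y₁ : K₁}
    {j : K →+* K₁} (hj : IsConstantExtension y y₁ (RatFunc.mapConstants k k₁) j)
    (h : IsSextic s y) (h₁ : IsSextic s₁ y₁) {ι : Type*} {c : ι → k₁} (hc : LinearIndependent k c)
    (S : Finset ι) (f : ι → K) (hf : ∑ i ∈ S, algebraMap k₁ K₁ (c i) * j (f i) = 0) :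
    ∀ i ∈ S, f i = 0 := by
  choose u v huv using fun i => h.exists_eq (f i)
  have h2 : algebraMap (RatFunc k₁) K₁
        (∑ i ∈ S, algebraMap k₁ (RatFunc k₁) (c i) * RatFunc.mapConstants k k₁ (u i)) +
      algebraMap (RatFunc k₁) K₁
        (∑ i ∈ S, algebraMap k₁ (RatFunc k₁) (c i) * RatFunc.mapConstants k k₁ (v i)) * y₁ = 0 := by
    rw [← hf, map_sum, map_sum, Finset.sum_mul, ← Finset.sum_add_distrib]
    refine Finset.sum_congr rfl fun i _ => ?_
    rw [huv i, map_add j, map_mul j, hj.j_algebraMap, hj.j_algebraMap, hj.j_y, map_mul, map_mul,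
      ← IsScalarTower.algebraMap_apply]
    ring
  obtain ⟨h3, h4⟩ := h₁.eq_zero h2
  intro i hi
  rw [huv i, RatFunc.eq_zero_of_linearIndependent hc S u h3 i hi,
    RatFunc.eq_zero_of_linearIndependent hc S v h4 i hi, map_zero, zero_mul, add_zero]

/-- Linear disjointness from `K` implies linear disjointness from `L`. -/
theorem IsHeptic.eq_zero_of_linearIndependent {K₁ L₁ : Type*} [Field K₁] [Algebra k₁ K₁]
    [Field L₁] [Algebra K₁ L₁] [Algebra k₁ L₁] [IsScalarTower k₁ K₁ L₁]
    {j : K →+* K₁} {J : L →+* L₁} {w₁ : L₁} (hw : IsHeptic φ w) (hw₁ : IsHeptic (j φ) w₁)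
    (hJ : ∀ f, J (algebraMap K L f) = algebraMap K₁ L₁ (j f)) (hJw : J w = w₁)
    {ι : Type*} {c : ι → k₁} (S : Finset ι)
    (hc : ∀ f : ι → K, ∑ i ∈ S, algebraMap k₁ K₁ (c i) * j (f i) = 0 → ∀ i ∈ S, f i = 0)
    (f : ι → L) (hf : ∑ i ∈ S, algebraMap k₁ L₁ (c i) * J (f i) = 0) :
    ∀ i ∈ S, f i = 0 := by
  choose g hg using fun i => hw.exists_sum (f i)
  have h1 : ∑ m ∈ Finset.range 7, algebraMap K₁ L₁
      (∑ i ∈ S, algebraMap k₁ K₁ (c i) * j (g i m)) * w₁ ^ m = 0 := by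
    rw [← hf]
    simp only [map_sum, Finset.sum_mul]
    rw [Finset.sum_comm]
    refine Finset.sum_congr rfl fun i _ => ?_
    rw [hg i, map_sum, Finset.mul_sum]
    refine Finset.sum_congr rfl fun m _ => ?_
    rw [map_mul J, map_pow, hJ, hJw, map_mul, ← IsScalarTower.algebraMap_apply]
    ring
  have h2 := eq_zero_of_sum_eq_zero (n := 7) (by omega) hw₁.pow_eq hw₁.irreducible
    (fun m => ∑ i ∈ S, algebraMap k₁ K₁ (c i) * j (g i m)) h1
  intro i hi
  rw [hg i]
  refine Finset.sum_eq_zero fun m hm => ?_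
  rw [hc (fun i => g i m) (h2 m (Finset.mem_range.1 hm)) i hi, map_zero, zero_mul]

/-- `k₁ ⊗ L` embeds into the function field over `k₁` that is defined by the same equations as
`L`. -/
theorem IsHeptic.exists_tensorProduct_embedding {h : IsSextic s y} (hφ : IsRadicand h φ n)
    (hw : IsHeptic φ w) :
    ∃ (K₁ : Type u) (_ : Field K₁) (_ : Algebra k₁ K₁) (_ : Algebra (RatFunc k₁) K₁)
      (_ : IsScalarTower k₁ (RatFunc k₁) K₁) (L₁ : Type u) (_ : Field L₁) (_ : Algebra K₁ L₁)
      (_ : Algebra k₁ L₁) (_ : Algebra (RatFunc k₁) L₁) (_ : IsScalarTower k₁ K₁ L₁)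
      (_ : IsScalarTower (RatFunc k₁) K₁ L₁) (y₁ : K₁) (j : K →+* K₁) (w₁ : L₁)
      (Θ : k₁ ⊗[k] L →ₐ[k₁] L₁), IsSextic (s.map (algebraMap k k₁)) y₁ ∧
        IsConstantExtension y y₁ (RatFunc.mapConstants k k₁) j ∧ IsHeptic (j φ) w₁ ∧
        Function.Injective Θ ∧ (∀ f, Θ (1 ⊗ₜ algebraMap K L f) = algebraMap K₁ L₁ (j f)) ∧
        Θ (1 ⊗ₜ w) = w₁ := by
  obtain ⟨K₁, _, _, _, _, y₁, j, h₁, hj⟩ := h.exists_constantExtension (k₁ := k₁)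
  obtain ⟨L₁, _, _, _, _, _, _, w₁, J, hw₁, hJ, hJw⟩ := hw.exists_constantExtension (k₁ := k₁) j
    (hj.not_pow h₁ hφ hw.not_pow)
  let _ : Algebra k L₁ := ((algebraMap k₁ L₁).comp (algebraMap k k₁)).toAlgebra
  have : IsScalarTower k k₁ L₁ := .of_algebraMap_eq fun _ => rfl
  let J' : L →ₐ[k] L₁ := { J with
    commutes' := fun c => by
      change J (algebraMap k L c) = algebraMap k₁ L₁ (algebraMap k k₁ c)
      rw [IsScalarTower.algebraMap_apply k K L, hJ, hj.j_constant,
        ← IsScalarTower.algebraMap_apply] }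
  let Θ : k₁ ⊗[k] L →ₐ[k₁] L₁ := Algebra.TensorProduct.lift (Algebra.ofId k₁ L₁) J'
    fun _ _ => Commute.all _ _
  have hΘ : ∀ c l, Θ (c ⊗ₜ l) = algebraMap k₁ L₁ c * J l := fun c l =>
    Algebra.TensorProduct.lift_tmul _ _ _ c l
  refine ⟨K₁, inferInstance, inferInstance, inferInstance, inferInstance, L₁, inferInstance,
    inferInstance, inferInstance, inferInstance, inferInstance, inferInstance, y₁, j, w₁, Θ, h₁,
    hj, hw₁, ?_, fun f => by rw [hΘ, map_one, one_mul, hJ], by rw [hΘ, map_one, one_mul, hJw]⟩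
  classical
  rw [injective_iff_map_eq_zero]
  intro t ht
  let b := Basis.ofVectorSpace k k₁
  obtain ⟨f, rfl⟩ := (TensorProduct.equivFinsuppOfBasisLeft (N := L) b).symm.surjective t
  rw [TensorProduct.equivFinsuppOfBasisLeft_symm_apply] at ht
  simp only [Finsupp.sum, map_sum, hΘ] at ht
  have h2 := hw.eq_zero_of_linearIndependent hw₁ hJ hJw f.support
    (hj.eq_zero_of_linearIndependent h h₁ b.linearIndependent f.support) f ht
  have h3 : f = 0 := by
    ext i
    by_cases hi : i ∈ f.support
    · exact h2 i hi
    · exact Finsupp.notMem_support_iff.1 hi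
  rw [h3, map_zero]

/-- The covering is geometrically integral. -/
theorem IsHeptic.isDomain_tensorProduct {h : IsSextic s y} (hφ : IsRadicand h φ n)
    (hw : IsHeptic φ w) : IsDomain (k₁ ⊗[k] L) := by
  obtain ⟨K₁, _, _, _, _, L₁, _, _, _, _, _, _, y₁, j, w₁, Θ, -, -, -, hΘ, -⟩ :=
    hw.exists_tensorProduct_embedding (k₁ := k₁) hφ
  exact hΘ.isDomain (Θ : k₁ ⊗[k] L →+* L₁)

/-- The fraction field of `k₁ ⊗ L` is the function field over `k₁` that is defined by the same
equations as `L`. -/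
theorem IsHeptic.exists_isHeptic_baseChange {h : IsSextic s y} (hφ : IsRadicand h φ n)
    (hw : IsHeptic φ w) (L₁ : Type*) [Field L₁] [Algebra k₁ L₁] [Algebra (k₁ ⊗[k] L) L₁]
    [IsScalarTower k₁ (k₁ ⊗[k] L) L₁] [IsFractionRing (k₁ ⊗[k] L) L₁] :
    ∃ (K₁ : Type u) (_ : Field K₁) (_ : Algebra k₁ K₁) (_ : Algebra (RatFunc k₁) K₁)
      (_ : IsScalarTower k₁ (RatFunc k₁) K₁) (_ : Algebra K₁ L₁)
      (_ : Algebra (RatFunc k₁) L₁) (_ : IsScalarTower k₁ K₁ L₁)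
      (_ : IsScalarTower k₁ (RatFunc k₁) L₁)
      (_ : IsScalarTower (RatFunc k₁) K₁ L₁) (y₁ : K₁) (j : K →+* K₁),
      IsSextic (s.map (algebraMap k k₁)) y₁ ∧
        IsConstantExtension y y₁ (RatFunc.mapConstants k k₁) j ∧
        IsHeptic (j φ) (algebraMap (k₁ ⊗[k] L) L₁ (1 ⊗ₜ w)) ∧
        ∀ f, algebraMap K₁ L₁ (j f) = algebraMap (k₁ ⊗[k] L) L₁ (1 ⊗ₜ algebraMap K L f) := by
  obtain ⟨K₁, _, _, _, _, L', _, _, _, _, _, _, y₁, j, w₁, Θ, h₁, hj, hw₁, hΘ, hΘj, hΘw⟩ :=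
    hw.exists_tensorProduct_embedding (k₁ := k₁) hφ
  let g : L₁ →+* L' := IsFractionRing.lift (g := (Θ : k₁ ⊗[k] L →+* L')) hΘ
  have hg : ∀ t, g (algebraMap (k₁ ⊗[k] L) L₁ t) = Θ t := fun t =>
    IsFractionRing.lift_algebraMap hΘ t
  have hmem : ∀ t, Θ t ∈ g.fieldRange := fun t => ⟨_, hg t⟩
  have hpoly : ∀ p : k₁[X], algebraMap (RatFunc k₁) L' (algebraMap k₁[X] (RatFunc k₁) p) ∈
      g.fieldRange := by
    intro p
    induction p using Polynomial.induction_on' with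
    | add p q hp hq => rw [map_add, map_add]; exact add_mem hp hq
    | monomial i c =>
      rw [← C_mul_X_pow_eq_monomial, map_mul, map_pow, RatFunc.algebraMap_X, RatFunc.algebraMap_C,
        map_mul, map_pow, ← RatFunc.algebraMap_eq_C,
        IsScalarTower.algebraMap_apply (RatFunc k₁) K₁ L',
        IsScalarTower.algebraMap_apply (RatFunc k₁) K₁ L',
        ← IsScalarTower.algebraMap_apply k₁ (RatFunc k₁) K₁,
        ← IsScalarTower.algebraMap_apply k₁ K₁ L', ← hj.m_X, ← hj.j_algebraMap, ← hΘj,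
        ← Θ.commutes]
      exact mul_mem (hmem _) (pow_mem (hmem _) _)
  have hrat : ∀ f : RatFunc k₁, algebraMap (RatFunc k₁) L' f ∈ g.fieldRange := by
    intro f
    rw [← RatFunc.num_div_denom f, map_div₀]
    exact div_mem (hpoly _) (hpoly _)
  have hK : ∀ f : K₁, algebraMap K₁ L' f ∈ g.fieldRange := by
    intro f
    obtain ⟨u, v, rfl⟩ := h₁.exists_eq f
    rw [map_add, map_mul, ← IsScalarTower.algebraMap_apply, ← IsScalarTower.algebraMap_apply,
      ← hj.j_y, ← hΘj]
    exact add_mem (hrat u) (mul_mem (hrat v) (hmem _))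
  have hsurj : Function.Surjective g := by
    intro z
    obtain ⟨c, rfl⟩ := hw₁.exists_sum z
    change _ ∈ g.fieldRange
    refine sum_mem fun i _ => mul_mem (hK _) (pow_mem ?_ i)
    rw [← hΘw]
    exact hmem _
  -- carry the algebra structures of `L'` over to `L₁`
  let e : L₁ ≃+* L' := RingEquiv.ofBijective g ⟨g.injective, hsurj⟩
  have he : ∀ z, e z = g z := fun _ => rfl
  let _ : Algebra K₁ L₁ := ((e.symm : L' →+* L₁).comp (algebraMap K₁ L')).toAlgebra
  let _ : Algebra (RatFunc k₁) L₁ :=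
    ((e.symm : L' →+* L₁).comp (algebraMap (RatFunc k₁) L')).toAlgebra
  have hKL : ∀ f, algebraMap K₁ L₁ f = e.symm (algebraMap K₁ L' f) := fun _ => rfl
  have hRL : ∀ f, algebraMap (RatFunc k₁) L₁ f = e.symm (algebraMap (RatFunc k₁) L' f) :=
    fun _ => rfl
  have t1 : IsScalarTower k₁ K₁ L₁ := .of_algebraMap_eq fun c => by
    rw [hKL, ← IsScalarTower.algebraMap_apply, RingEquiv.eq_symm_apply, he,
      IsScalarTower.algebraMap_apply k₁ (k₁ ⊗[k] L) L₁, hg, Θ.commutes]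
  have t2 : IsScalarTower (RatFunc k₁) K₁ L₁ := .of_algebraMap_eq fun f => by
    rw [hKL, hRL, ← IsScalarTower.algebraMap_apply]
  have t3 : IsScalarTower k₁ (RatFunc k₁) L₁ := .of_algebraMap_eq fun c => by
    rw [IsScalarTower.algebraMap_apply (RatFunc k₁) K₁ L₁, ← IsScalarTower.algebraMap_apply k₁ _ K₁,
      ← IsScalarTower.algebraMap_apply]
  have hw' : algebraMap (k₁ ⊗[k] L) L₁ (1 ⊗ₜ w) = e.symm w₁ := by
    rw [RingEquiv.eq_symm_apply, he, hg, hΘw]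
  refine ⟨K₁, inferInstance, inferInstance, inferInstance, inferInstance, inferInstance,
    inferInstance, t1, t3, t2, y₁, j, h₁, hj, ⟨?_, ?_, hw₁.not_pow⟩, fun f => ?_⟩
  · rw [hw', hKL, ← map_pow, hw₁.pow_eq]
  · refine eq_top_iff.2 fun z _ => ?_
    obtain ⟨c, hc⟩ := hw₁.exists_sum (e z)
    have h2 : z = ∑ i ∈ Finset.range 7, algebraMap K₁ L₁ (c i) *
        algebraMap (k₁ ⊗[k] L) L₁ (1 ⊗ₜ w) ^ i := by
      rw [← e.symm_apply_apply z, hc, map_sum, hw']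
      simp only [map_mul, map_pow, hKL]
    rw [h2]
    exact sum_mem fun i _ => mul_mem (IntermediateField.algebraMap_mem _ _)
      (pow_mem (IntermediateField.mem_adjoin_simple_self _ _) _)
  · rw [hKL, RingEquiv.symm_apply_eq, he, hg, hΘj]

end

end

section

open IsDedekindDomain Polynomial Module Place

/-! ### Extension of the Galois action and conjugacy of the involutions -/

section

variable {k F : Type*} (k₁ F₁ : Type*) [Field k] [Field F] [Algebra k F] [Field k₁] [Algebra k k₁]
  [Field F₁] [Algebra k₁ F₁] [Algebra (k₁ ⊗[k] F) F₁] [IsScalarTower k₁ (k₁ ⊗[k] F) F₁]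
  [IsFractionRing (k₁ ⊗[k] F) F₁]

theorem baseChangeAut_algebraMap (σ : F ≃ₐ[k] F) (f : F) :
    baseChangeAut k₁ F₁ σ (algebraMap (k₁ ⊗[k] F) F₁ (1 ⊗ₜ f)) =
      algebraMap (k₁ ⊗[k] F) F₁ (1 ⊗ₜ σ f) := by
  rw [baseChangeAut, IsFractionRing.algEquivOfAlgEquiv_algebraMap]
  rfl

/-- An automorphism that fixes the constants and `x` fixes `k(x)`. -/
theorem exists_restrictScalars_eq {k F : Type*} [Field k] [Field F] [Algebra k F]
    [Algebra (RatFunc k) F] [IsScalarTower k (RatFunc k) F] (σ : F ≃ₐ[k] F)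
    (hσ : σ (algebraMap (RatFunc k) F RatFunc.X) = algebraMap (RatFunc k) F RatFunc.X) :
    ∃ σ' : F ≃ₐ[RatFunc k] F, σ'.restrictScalars k = σ := by
  have hpoly : ∀ p : k[X], σ (algebraMap (RatFunc k) F (algebraMap k[X] (RatFunc k) p)) =
      algebraMap (RatFunc k) F (algebraMap k[X] (RatFunc k) p) := by
    intro p
    induction p using Polynomial.induction_on' with
    | add p q hp hq => rw [map_add, map_add, map_add, hp, hq]
    | monomial i c =>
      rw [← C_mul_X_pow_eq_monomial, map_mul, map_pow, RatFunc.algebraMap_X, RatFunc.algebraMap_C,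
        map_mul, map_pow, ← RatFunc.algebraMap_eq_C, ← IsScalarTower.algebraMap_apply, map_mul,
        map_pow, hσ, σ.commutes]
  have hrat : ∀ f : RatFunc k, σ (algebraMap (RatFunc k) F f) = algebraMap (RatFunc k) F f := by
    intro f
    rw [← RatFunc.num_div_denom f, map_div₀, map_div₀, hpoly, hpoly]
  exact ⟨AlgEquiv.ofRingEquiv (f := (σ : F ≃+* F)) hrat, by ext; rfl⟩

end

namespace IsDihedralData

universe u

variable {k K L : Type*} [Field k] [Field K] [Field L] [Algebra k K] [Algebra (RatFunc k) K]
  [IsScalarTower k (RatFunc k) K] [Algebra k L] [Algebra (RatFunc k) L] [Algebra K L]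
  [IsScalarTower k (RatFunc k) L] [IsScalarTower k K L] [IsScalarTower (RatFunc k) K L]
  {s : k[X]} {y : K} {φ : K} {n : RatFunc k} {w : L} {ζ : k} {ρ τ : L ≃ₐ[RatFunc k] L}

/-- The dihedral data over `k` give dihedral data over every extension field `k₁`, with the extended
automorphisms; so what is proved over `k` holds over `k₁`. -/
theorem exists_baseChange (H : IsDihedralData s y φ n w ζ ρ τ)
    (hord : ∀ P : Place k K, 7 ∣ P.ord φ) (k₁ : Type u) [Field k₁] [Algebra k k₁]
    (L₁ : Type*) [Field L₁] [Algebra k₁ L₁] [Algebra (k₁ ⊗[k] L) L₁]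
    [IsScalarTower k₁ (k₁ ⊗[k] L) L₁] [IsFractionRing (k₁ ⊗[k] L) L₁] :
    ∃ (K₁ : Type u) (_ : Field K₁) (_ : Algebra k₁ K₁) (_ : Algebra (RatFunc k₁) K₁)
      (_ : IsScalarTower k₁ (RatFunc k₁) K₁) (_ : Algebra K₁ L₁)
      (_ : Algebra (RatFunc k₁) L₁) (_ : IsScalarTower k₁ K₁ L₁)
      (_ : IsScalarTower k₁ (RatFunc k₁) L₁)
      (_ : IsScalarTower (RatFunc k₁) K₁ L₁) (y₁ φ₁ : K₁) (n₁ : RatFunc k₁) (w₁ : L₁) (ζ₁ : k₁)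
      (ρ₁ τ₁ : L₁ ≃ₐ[RatFunc k₁] L₁),
      IsDihedralData (s.map (algebraMap k k₁)) y₁ φ₁ n₁ w₁ ζ₁ ρ₁ τ₁ ∧
        (∀ P : Place k₁ K₁, 7 ∣ P.ord φ₁) ∧
        ρ₁.restrictScalars k₁ = baseChangeAut k₁ L₁ (ρ.restrictScalars k) ∧
        τ₁.restrictScalars k₁ = baseChangeAut k₁ L₁ (τ.restrictScalars k) ∧
        algebraMap (RatFunc k₁) L₁ RatFunc.X =
          algebraMap (k₁ ⊗[k] L) L₁ (1 ⊗ₜ algebraMap (RatFunc k) L RatFunc.X) := by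
  have hφ : IsRadicand H.sextic φ n := ⟨H.heptic.ne_zero, H.norm_eq, hord⟩
  obtain ⟨K₁, _, _, _, _, _, _, t1, t3, t2, y₁, j, h₁, hj, hw₁, hjL⟩ :=
    H.heptic.exists_isHeptic_baseChange hφ (k₁ := k₁) L₁
  have hφ₁ := hj.isRadicand (h₁ := h₁) hφ
  have hrat : ∀ f : RatFunc k, algebraMap (RatFunc k₁) L₁ (RatFunc.mapConstants k k₁ f) =
      algebraMap (k₁ ⊗[k] L) L₁ (1 ⊗ₜ algebraMap (RatFunc k) L f) := fun f => by
    rw [IsScalarTower.algebraMap_apply (RatFunc k₁) K₁ L₁, ← hj.j_algebraMap, hjL,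
      ← IsScalarTower.algebraMap_apply]
  have hX := hrat RatFunc.X
  rw [RatFunc.mapConstants_X] at hX
  have hex : ∀ σ : L ≃ₐ[RatFunc k] L, ∃ σ₁ : L₁ ≃ₐ[RatFunc k₁] L₁,
      σ₁.restrictScalars k₁ = baseChangeAut k₁ L₁ (σ.restrictScalars k) := fun σ =>
    exists_restrictScalars_eq _ (by
      rw [hX, baseChangeAut_algebraMap, AlgEquiv.restrictScalars_apply, AlgEquiv.commutes])
  obtain ⟨ρ₁, hρ₁⟩ := hex ρ
  obtain ⟨τ₁, hτ₁⟩ := hex τ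
  have hρa : ∀ f : L, ρ₁ (algebraMap (k₁ ⊗[k] L) L₁ (1 ⊗ₜ f)) =
      algebraMap (k₁ ⊗[k] L) L₁ (1 ⊗ₜ ρ f) := fun f => by
    change ρ₁.restrictScalars k₁ _ = _
    rw [hρ₁, baseChangeAut_algebraMap]
    rfl
  have hτa : ∀ f : L, τ₁ (algebraMap (k₁ ⊗[k] L) L₁ (1 ⊗ₜ f)) =
      algebraMap (k₁ ⊗[k] L) L₁ (1 ⊗ₜ τ f) := fun f => by
    change τ₁.restrictScalars k₁ _ = _
    rw [hτ₁, baseChangeAut_algebraMap]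
    rfl
  let ι : L →+* L₁ := (algebraMap (k₁ ⊗[k] L) L₁).comp
    (Algebra.TensorProduct.includeRight : L →ₐ[k] k₁ ⊗[k] L).toRingHom
  have hι : ∀ f, algebraMap (k₁ ⊗[k] L) L₁ (1 ⊗ₜ f) = ι f := fun _ => rfl
  simp only [hι] at hw₁ hjL hrat hρa hτa
  have hyL : algebraMap K₁ L₁ y₁ = ι (algebraMap K L y) := by rw [← hj.j_y, hjL]
  have hζL : algebraMap k₁ L₁ (algebraMap k k₁ ζ) = ι (algebraMap k L ζ) := by
    rw [IsScalarTower.algebraMap_apply k₁ (RatFunc k₁) L₁, ← RatFunc.mapConstants_constant, hrat,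
      ← IsScalarTower.algebraMap_apply]
  refine ⟨K₁, inferInstance, inferInstance, inferInstance, inferInstance, inferInstance,
    inferInstance, t1, t3, t2, y₁, j φ, RatFunc.mapConstants k k₁ n, ι w, algebraMap k k₁ ζ,
    ρ₁, τ₁, ⟨h₁, hφ₁.norm_eq, hw₁, H.zeta.map_of_injective (algebraMap k k₁).injective, ?_, ?_, ?_,
    ?_⟩, hφ₁.dvd_ord, hρ₁, hτ₁, hX⟩
  · rw [hyL, hρa, H.rho_y]
  · rw [hρa, H.rho_w, map_mul, hζL]
  · rw [hyL, hτa, H.tau_y, map_neg]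
  · rw [hτa, ← map_mul, H.tau_w, hrat]

/-- The involutions are conjugate, hence their quotient fields are isomorphic. -/
theorem nonempty_quotientField_algEquiv (H : IsDihedralData s y φ n w ζ ρ τ)
    {τ₂ : L ≃ₐ[RatFunc k] L} (hτ₂ : orderOf τ₂ = 2) :
    Nonempty (quotientField τ ≃ₐ[RatFunc k] quotientField τ₂) := by
  obtain ⟨j, hj, rfl | rfl⟩ := H.exists_eq τ₂
  · have h1 : (ρ ^ j) ^ 7 = 1 := by rw [← pow_mul, mul_comm, pow_mul, H.rho_pow_seven, one_pow]
    have h2 := orderOf_dvd_of_pow_eq_one h1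
    rw [hτ₂] at h2
    omega
  · have h1 := H.rho_pow_mul_tau j
    have h2 : (quotientField τ).map (ρ ^ (3 * j)).toAlgHom = quotientField (τ * ρ ^ j) := by
      ext z
      rw [mem_quotientField_iff]
      constructor
      · rintro ⟨f, hf, rfl⟩
        have h3 := AlgEquiv.congr_fun h1 f
        rw [AlgEquiv.mul_apply, AlgEquiv.mul_apply, (mem_quotientField_iff τ f).1 hf] at h3
        exact h3.symm
      · intro hz
        refine ⟨(ρ ^ (3 * j)).symm z, (mem_quotientField_iff τ _).2 ?_,
          AlgEquiv.apply_symm_apply _ _⟩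
        apply (ρ ^ (3 * j)).injective
        have h3 := AlgEquiv.congr_fun h1 ((ρ ^ (3 * j)).symm z)
        rw [AlgEquiv.mul_apply, AlgEquiv.mul_apply, AlgEquiv.apply_symm_apply, hz] at h3
        rw [h3, AlgEquiv.apply_symm_apply]
    exact ⟨((quotientField τ).equivMap (ρ ^ (3 * j)).toAlgHom).trans
      (IntermediateField.equivOfEq h2)⟩

theorem orderOf_tau (H : IsDihedralData s y φ n w ζ ρ τ) : orderOf τ = 2 := by
  refine orderOf_eq_prime (by rw [sq, H.tau_mul_self]) fun h => ?_
  exact H.tau_ne 0 0 (by rw [pow_zero, mul_one, h])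

theorem orderOf_rho (H : IsDihedralData s y φ n w ζ ρ τ) : orderOf ρ = 7 := by
  have := Fact.mk (show Nat.Prime 7 by norm_num)
  refine orderOf_eq_prime H.rho_pow_seven ?_
  simpa using H.rho_pow_ne_one (j := 1) (by norm_num)

end IsDihedralData

end

section

open IsDedekindDomain Polynomial Module Place

/-! ### Divisibility by 7 and the case of a seventh power -/

section

variable {k K : Type*} [Field k] [Field K] [Algebra k K] [Algebra (RatFunc k) K]
  [IsScalarTower k (RatFunc k) K] {s : k[X]} {y : K} {h : IsSextic s y} {φ : K} {n : RatFunc k}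

/-- If the divisors of `φ` and its conjugate are relatively prime, then the divisor of `φ` is
divisible by `7`. -/
theorem dvd_ord_of_relativelyPrime (hφ0 : φ ≠ 0)
    (hφ : φ * h.conj φ = algebraMap (RatFunc k) K n ^ 7) (P : Place k K)
    (hP : P.ord φ = 0 ∨ P.ord (h.conj φ) = 0) : 7 ∣ P.ord φ := by
  rcases hP with h0 | h0
  · rw [h0]; exact dvd_zero 7
  · have h1 := P.ord_mul hφ0 (show h.conj φ ≠ 0 by simpa using hφ0)
    rw [hφ, h0, add_zero, ord_pow] at h1
    exact ⟨_, by rw [← h1]; rfl⟩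

/-- If `φ` is a seventh power in `K`, then `w` is in `K`, as the seventh roots of unity are in
`k`. -/
theorem surjective_algebraMap_of_pow_eq {L : Type*} [Field L] [Algebra K L] [Algebra k L]
    [IsScalarTower k K L] {w : L} {ζ : k} (hζ7 : IsPrimitiveRoot ζ 7)
    (hw : w ^ 7 = algebraMap K L φ) (hL : IntermediateField.adjoin K {w} = ⊤) {g : K}
    (hg : g ^ 7 = φ) : Function.Surjective (algebraMap K L) := by
  have hζL : IsPrimitiveRoot (algebraMap k L ζ) 7 := hζ7.map_of_injective (algebraMap k L).injective
  have hmem : w ∈ (⊥ : IntermediateField K L) := by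
    by_cases hg0 : g = 0
    · rw [← hg, hg0, zero_pow (by omega), map_zero] at hw
      rw [eq_zero_of_pow_eq_zero hw]
      exact zero_mem _
    · have h1 : (w / algebraMap K L g) ^ 7 = 1 := by
        rw [div_pow, hw, ← hg, map_pow, div_self]
        exact pow_ne_zero 7 (by simpa using hg0)
      obtain ⟨i, -, hi⟩ := hζL.eq_pow_of_pow_eq_one h1
      rw [eq_div_iff (by simpa using hg0), ← map_pow, IsScalarTower.algebraMap_apply k K L,
        ← map_mul] at hi
      exact ⟨_, hi⟩
  rw [IntermediateField.adjoin_simple_eq_bot_iff.2 hmem] at hL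
  intro z
  have h2 : z ∈ (⊥ : IntermediateField K L) := hL ▸ IntermediateField.mem_top
  exact h2

end

/-! ### The geometric statements over a larger field of constants -/

namespace IsDihedralData

variable {k K L : Type*} [Field k] [Field K] [Field L] [Algebra k K] [Algebra (RatFunc k) K]
  [IsScalarTower k (RatFunc k) K] [Algebra k L] [Algebra (RatFunc k) L] [Algebra K L]
  [IsScalarTower k (RatFunc k) L] [IsScalarTower k K L] [IsScalarTower (RatFunc k) K L]
  {s : k[X]} {y : K} {φ : K} {n : RatFunc k} {w : L} {ζ : k} {ρ τ : L ≃ₐ[RatFunc k] L}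
  (k₁ L₁ : Type*) [Field k₁] [Algebra k k₁] [Field L₁] [Algebra k₁ L₁] [Algebra (k₁ ⊗[k] L) L₁]
  [IsScalarTower k₁ (k₁ ⊗[k] L) L₁] [IsFractionRing (k₁ ⊗[k] L) L₁]

theorem curveGenus_baseChange (H : IsDihedralData s y φ n w ζ ρ τ)
    (hord : ∀ P : Place k K, 7 ∣ P.ord φ) : curveGenus k₁ L₁ = 8 := by
  obtain ⟨K₁, _, _, _, _, _, _, _, _, _, y₁, φ₁, n₁, w₁, ζ₁, ρ₁, τ₁, H₁, hord₁, -⟩ :=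
    H.exists_baseChange hord k₁ L₁
  exact H₁.heptic.curveGenus_eq ⟨H₁.heptic.ne_zero, H₁.norm_eq, hord₁⟩ H₁.zeta

theorem baseChange_rho (H : IsDihedralData s y φ n w ζ ρ τ)
    (hord : ∀ P : Place k K, 7 ∣ P.ord φ) :
    curveGenus k₁ (quotientField (baseChangeAut k₁ L₁ (ρ.restrictScalars k))) = 2 ∧
      IsUnramifiedExt (quotientField (baseChangeAut k₁ L₁ (ρ.restrictScalars k))).val ∧
      (IsAlgClosed k₁ →
        ∀ Q : Place k₁ L₁, ¬ Q.IsFixedBy (baseChangeAut k₁ L₁ (ρ.restrictScalars k))) := by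
  obtain ⟨K₁, _, _, _, _, _, _, _, _, _, y₁, φ₁, n₁, w₁, ζ₁, ρ₁, τ₁, H₁, hord₁, hρ₁, -⟩ :=
    H.exists_baseChange hord k₁ L₁
  rw [← hρ₁]
  refine ⟨(H₁.curveGenus_quotientField_rho hord₁).1, (H₁.curveGenus_quotientField_rho hord₁).2,
    fun _ Q hQ => ?_⟩
  rw [Place.isFixedBy_iff] at hQ
  refine H₁.comapAut_rho_pow_ne hord₁ (j := 1) (by norm_num) Q ?_
  rwa [pow_one]

theorem curveGenus_baseChange_tau (H : IsDihedralData s y φ n w ζ ρ τ)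
    (hord : ∀ P : Place k K, 7 ∣ P.ord φ) :
    curveGenus k₁ (quotientField (baseChangeAut k₁ L₁ (τ.restrictScalars k))) = 3 := by
  obtain ⟨K₁, _, _, _, _, _, _, _, _, _, y₁, φ₁, n₁, w₁, ζ₁, ρ₁, τ₁, H₁, hord₁, -, hτ₁, -⟩ :=
    H.exists_baseChange hord k₁ L₁
  rw [← hτ₁]
  exact H₁.curveGenus_quotientField_tau hord₁

theorem baseChange_fixed (H : IsDihedralData s y φ n w ζ ρ τ)
    (hord : ∀ P : Place k K, 7 ∣ P.ord φ) [IsAlgClosed k₁] :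
    {Q : Place k₁ L₁ | Q.IsFixedBy (baseChangeAut k₁ L₁ (τ.restrictScalars k))}.ncard = 6 ∧
      (∀ Q : Place k₁ L₁, Q.IsFixedBy (baseChangeAut k₁ L₁ (τ.restrictScalars k)) →
        ∃ r : k₁, aeval r s = 0 ∧ 0 < Q.ord (algebraMap (k₁ ⊗[k] L) L₁
          (1 ⊗ₜ algebraMap (RatFunc k) L RatFunc.X) - algebraMap k₁ L₁ r)) ∧
      (∀ r : k₁, aeval r s = 0 →
        ∃! Q : Place k₁ L₁, Q.IsFixedBy (baseChangeAut k₁ L₁ (τ.restrictScalars k)) ∧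
          0 < Q.ord (algebraMap (k₁ ⊗[k] L) L₁
            (1 ⊗ₜ algebraMap (RatFunc k) L RatFunc.X) - algebraMap k₁ L₁ r)) := by
  obtain ⟨K₁, _, _, _, _, _, _, _, _, _, y₁, φ₁, n₁, w₁, ζ₁, ρ₁, τ₁, H₁, hord₁, -, hτ₁, hX⟩ :=
    H.exists_baseChange hord k₁ L₁
  simp only [Place.isFixedBy_iff]
  rw [← hτ₁, ← hX]
  refine ⟨H₁.ncard_fixed hord₁, fun Q hQ => ?_, fun r hr =>
    H₁.existsUnique_fixed hord₁ (by rwa [eval_map_algebraMap])⟩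
  obtain ⟨r, hr, hQr⟩ := H₁.exists_root_of_fixed hQ
  exact ⟨r, by rwa [eval_map_algebraMap] at hr, hQr⟩

theorem exists_endomorphism_baseChange (H : IsDihedralData s y φ n w ζ ρ τ)
    (hord : ∀ P : Place k K, 7 ∣ P.ord φ) :
    ∃ T : AddMonoid.End (CurvePicZero k₁
        (quotientField (baseChangeAut k₁ L₁ (τ.restrictScalars k)))),
      IsInducedByCorrespondence (quotientField (baseChangeAut k₁ L₁ (τ.restrictScalars k))).val
        ((baseChangeAut k₁ L₁ (ρ.restrictScalars k)).toAlgHom.comp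
          (quotientField (baseChangeAut k₁ L₁ (τ.restrictScalars k))).val) T ∧
      T ^ 3 + T ^ 2 - 2 * T - 1 = 0 := by
  obtain ⟨K₁, _, _, _, _, _, _, _, _, _, y₁, φ₁, n₁, w₁, ζ₁, ρ₁, τ₁, H₁, hord₁, hρ₁, hτ₁, -⟩ :=
    H.exists_baseChange hord k₁ L₁
  rw [← hτ₁, ← hρ₁]
  exact H₁.exists_endomorphism

end IsDihedralData

end

end

theorem propositionP
    {k : Type*} [Field k] (h2 : (2 : k) ≠ 0)
    (a b c : RatFunc k) (s : Polynomial k) (lam : k)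
    (hdeg : s.natDegree = 6) (hsep : s.Separable)
    (heq : a ^ 2 - b ^ 2 * algebraMap (Polynomial k) (RatFunc k) s =
      algebraMap k (RatFunc k) lam * c ^ 7)
    (hzeta : ∃ ζ : k, IsPrimitiveRoot ζ 7)
    (hlam : ∃ μ : k, μ ^ 7 = lam)
    -- `K = k(x, y) = k(C)` with `y ^ 2 = s(x)`
    {K : Type*} [Field K] [Algebra k K] [Algebra (RatFunc k) K] [IsScalarTower k (RatFunc k) K]
    (y : K) (hy : y ^ 2 = algebraMap (RatFunc k) K (algebraMap (Polynomial k) (RatFunc k) s))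
    (hK : IntermediateField.adjoin (RatFunc k) {y} = ⊤)
    -- `φ = a + b y` and `ψ = a - b y`
    (φ ψ : K)
    (hφ : φ = algebraMap (RatFunc k) K a + algebraMap (RatFunc k) K b * y)
    (hψ : ψ = algebraMap (RatFunc k) K a - algebraMap (RatFunc k) K b * y)
    -- `L = k(x, y, w) = k(X)` with `w` any root of `Z ^ 7 - φ`
    {L : Type*} [Field L] [Algebra k L] [Algebra (RatFunc k) L] [Algebra K L]
    [IsScalarTower k (RatFunc k) L] [IsScalarTower k K L] [IsScalarTower (RatFunc k) K L]
    (w : L) (hw : w ^ 7 = algebraMap K L φ)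
    (hL : IntermediateField.adjoin K {w} = ⊤) :
    -- 1. the extension `k(x, y, w) / k(x)` is Galois with group `D₇`
    ((¬ ∃ g : K, g ^ 7 = φ) →
      IsGalois (RatFunc k) L ∧ Nonempty ((L ≃ₐ[RatFunc k] L) ≃* DihedralGroup 7)) ∧
    -- 2. if `div φ` and `div ψ` are relatively prime, then `k(x, y, w) / k(x, y)` is unramified
    (φ ≠ 0 → (∀ P : Place k K, P.ord φ = 0 ∨ P.ord ψ = 0) →
      IsUnramifiedExt (IsScalarTower.toAlgHom k K L) ∧
      ((¬ ∃ g : K, g ^ 7 = φ) →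
        -- `C = X / ⟨ρ⟩` for the elements `ρ` of order 7
        (∀ ρ : L ≃ₐ[RatFunc k] L, orderOf ρ = 7 →
          quotientField ρ = (IsScalarTower.toAlgHom (RatFunc k) K L).fieldRange) ∧
        -- the seven curves `Y = X / ⟨τ⟩` are isomorphic
        (∀ τ τ₂ : L ≃ₐ[RatFunc k] L, orderOf τ = 2 → orderOf τ₂ = 2 →
          Nonempty (quotientField τ ≃ₐ[RatFunc k] quotientField τ₂)) ∧
        -- the genera of `X`, `C`, `Y`
        curveGenus k L = 8 ∧ curveGenus k K = 2 ∧
        (∀ τ : L ≃ₐ[RatFunc k] L, orderOf τ = 2 →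
          curveGenus k (quotientField (τ.restrictScalars k)) = 3) ∧
        -- `X` is geometrically integral, and over every extension field `k₁` of `k`:
        (∀ (k₁ : Type*) [Field k₁] [Algebra k k₁], IsDomain (k₁ ⊗[k] L)) ∧
        (∀ (k₁ L₁ : Type*) [Field k₁] [Algebra k k₁] [Field L₁] [Algebra k₁ L₁]
          [Algebra (k₁ ⊗[k] L) L₁] [IsScalarTower k₁ (k₁ ⊗[k] L) L₁]
          [IsFractionRing (k₁ ⊗[k] L) L₁],
          curveGenus k₁ L₁ = 8 ∧
          -- `C = X / ⟨ρ⟩` has genus 2, `X → C` is unramified, `ρ` has no geometric fixed point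
          (∀ ρ : L ≃ₐ[RatFunc k] L, orderOf ρ = 7 →
            curveGenus k₁ (quotientField (baseChangeAut k₁ L₁ (ρ.restrictScalars k))) = 2 ∧
            IsUnramifiedExt (quotientField (baseChangeAut k₁ L₁ (ρ.restrictScalars k))).val ∧
            (IsAlgClosed k₁ →
              ∀ Q : Place k₁ L₁, ¬ Q.IsFixedBy (baseChangeAut k₁ L₁ (ρ.restrictScalars k)))) ∧
          (∀ τ : L ≃ₐ[RatFunc k] L, orderOf τ = 2 →
            -- `Y = X / ⟨τ⟩` has genus 3
            curveGenus k₁ (quotientField (baseChangeAut k₁ L₁ (τ.restrictScalars k))) = 3 ∧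
            -- `τ` has 6 geometric fixed points, one above each root of `s`
            (IsAlgClosed k₁ →
              {Q : Place k₁ L₁ |
                Q.IsFixedBy (baseChangeAut k₁ L₁ (τ.restrictScalars k))}.ncard = 6 ∧
              (∀ Q : Place k₁ L₁, Q.IsFixedBy (baseChangeAut k₁ L₁ (τ.restrictScalars k)) →
                ∃ r : k₁, Polynomial.aeval r s = 0 ∧
                  0 < Q.ord (algebraMap (k₁ ⊗[k] L) L₁
                    (1 ⊗ₜ algebraMap (RatFunc k) L RatFunc.X) - algebraMap k₁ L₁ r)) ∧
              (∀ r : k₁, Polynomial.aeval r s = 0 →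
                ∃! Q : Place k₁ L₁, Q.IsFixedBy (baseChangeAut k₁ L₁ (τ.restrictScalars k)) ∧
                  0 < Q.ord (algebraMap (k₁ ⊗[k] L) L₁
                    (1 ⊗ₜ algebraMap (RatFunc k) L RatFunc.X) - algebraMap k₁ L₁ r))) ∧
            -- the correspondence `X → Y × Y` given by the quotient map and its composite with an
            -- element of order 7 satisfies `T ^ 3 + T ^ 2 - 2 T - 1 = 0` on the Jacobian of `Y`
            (∀ ρ : L ≃ₐ[RatFunc k] L, orderOf ρ = 7 →
              ∃ T : AddMonoid.End (CurvePicZero k₁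
                  (quotientField (baseChangeAut k₁ L₁ (τ.restrictScalars k)))),
                IsInducedByCorrespondence
                  (quotientField (baseChangeAut k₁ L₁ (τ.restrictScalars k))).val
                  ((baseChangeAut k₁ L₁ (ρ.restrictScalars k)).toAlgHom.comp
                    (quotientField (baseChangeAut k₁ L₁ (τ.restrictScalars k))).val) T ∧
                T ^ 3 + T ^ 2 - 2 * T - 1 = 0))))) := by
  obtain ⟨ζ, hζ⟩ := hzeta
  obtain ⟨μ, hμ⟩ := hlam
  have h : IsSextic s y := ⟨h2, hdeg, hsep, hy, hK⟩
  have hconj : h.conj φ = ψ := by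
    rw [hφ, hψ, map_add, map_mul, AlgEquiv.commutes, AlgEquiv.commutes, h.conj_y]
    ring
  have hnorm : φ * h.conj φ = algebraMap (RatFunc k) K (algebraMap k (RatFunc k) μ * c) ^ 7 := by
    rw [← map_pow, mul_pow, ← map_pow, hμ, ← heq, hconj, hφ, hψ, map_sub, map_mul, map_pow,
      map_pow, ← hy]
    ring
  refine ⟨fun hne => ?_, fun hφ0 hcop => ?_⟩
  · have hW : IsHeptic φ w := ⟨hw, hL, hne⟩
    obtain ⟨ρ, τ, H⟩ := hW.exists_dihedralData hnorm hζ
    exact ⟨H.isGalois, H.nonempty_mulEquiv⟩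
  have hord : ∀ P : Place k K, 7 ∣ P.ord φ := fun P =>
    dvd_ord_of_relativelyPrime hφ0 hnorm P (by rw [hconj]; exact hcop P)
  by_cases hne : ∃ g : K, g ^ 7 = φ
  · obtain ⟨g, hg⟩ := hne
    exact ⟨isUnramifiedExt_of_bijective (surjective_algebraMap_of_pow_eq hζ hw hL hg),
      fun h => absurd ⟨g, hg⟩ h⟩
  have hW : IsHeptic φ w := ⟨hw, hL, hne⟩
  have hR : IsRadicand h φ (algebraMap k (RatFunc k) μ * c) := ⟨hφ0, hnorm, hord⟩
  obtain ⟨ρ₀, τ₀, H₀⟩ := hW.exists_dihedralData hnorm hζ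
  refine ⟨hW.isUnramifiedExt hζ hord, fun _ => ⟨fun ρ hρ => ?_, fun τ τ₂ hτ hτ₂ => ?_,
    hW.curveGenus_eq hR hζ, h.curveGenus_eq, fun τ hτ => ?_,
    fun k₁ _ _ => hW.isDomain_tensorProduct hR, fun k₁ L₁ _ _ _ _ _ _ _ =>
      ⟨H₀.curveGenus_baseChange k₁ L₁ hord, fun ρ hρ => ?_, fun τ hτ => ?_⟩⟩⟩
  · obtain ⟨n', ζ', H⟩ := IsDihedralData.of_orderOf hnorm hW hζ hρ H₀.orderOf_tau
    ext z
    rw [mem_quotientField_iff]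
    exact (mem_quotientField_iff (ρ.restrictScalars k) z).symm.trans
      (H.mem_quotientField_rho_iff z)
  · obtain ⟨n', ζ', H⟩ := IsDihedralData.of_orderOf hnorm hW hζ H₀.orderOf_rho hτ
    exact H.nonempty_quotientField_algEquiv hτ₂
  · obtain ⟨n', ζ', H⟩ := IsDihedralData.of_orderOf hnorm hW hζ H₀.orderOf_rho hτ
    exact H.curveGenus_quotientField_tau hord
  · obtain ⟨n', ζ', H⟩ := IsDihedralData.of_orderOf hnorm hW hζ hρ H₀.orderOf_tau
    exact H.baseChange_rho k₁ L₁ hord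
  · obtain ⟨n', ζ', H⟩ := IsDihedralData.of_orderOf hnorm hW hζ H₀.orderOf_rho hτ
    refine ⟨H.curveGenus_baseChange_tau k₁ L₁ hord, fun _ => H.baseChange_fixed k₁ L₁ hord,
      fun ρ hρ => ?_⟩
    obtain ⟨n'', ζ'', H'⟩ := IsDihedralData.of_orderOf hnorm hW hζ hρ hτ
    exact H'.exists_endomorphism_baseChange k₁ L₁ hord
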